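/- Let $n=2$, $l=1$. Let $V(x)=\sum_{p\in\mathbb Z^2}v_pe^{i\langle p,x\rangle}$ be a real trigonometric polynomial with $v_0=0$, let $\sigma\in\mathbb R$, $A\in\mathbb C$, $q\in\mathbb Z^2$. Put $P_m(t)=m+t$ and $p_m^2(t)=\sum_{i=1}^2(m_i+t_i)^2$ ($m\in\mathbb Z^2$, $t\in\mathbb C^2$), so that $p_m^2(t)=|P_m(t)|^2$ for real $t$. Identify operators with matrices in the basis $e^{i\langle P_m(t),x\rangle}$, $m\in\mathbb Z^2$; thus $H_0(t)=\mathrm{diag}(p_m^2(t))$ and a potential $W=\sum_b w_be^{i\langle b,x\rangle}$ has the matrix $(w_{m-n})_{m,n}$. Let $$\|W\|_*=\sum_b|w_b|,\qquad \|T\|_0=\tfrac12\sup_r\sum_p(|T_{pr}|+|T_{rp}|),$$ where for the gradient of a matrix $|\cdot|$ is the length of the entries in $\mathbb C^2$. *Resonant set.* For $0<\varepsilon<1$, $k>0$ let $\chi_q(k,\varepsilon)$ be the set of $t\in[0,1)^2$ for which there is a unique $j\in\mathbb Z^2$ with $|P_j(t)|=k$ and, for this $j$, $|p_{j-q}^2(t)-p_j^2(t)|<\varepsilon$,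 while $|p_j^2(t)-p_m^2(t)|>2\varepsilon^6$ and $|p_{j-q}^2(t)-p_m^2(t)|>2\varepsilon^6$ for all $m\ne j,j-q$. For $t_0\in\chi_q(k,\varepsilon)$ with this $j$, let $U(t_0)$ be the set of all $t\in\mathbb C^2$ at distance less than $\frac18k^{-1}\varepsilon^{10}$ from a point $s\in\mathbb R^2$ with $|s-t_0|<k^{-1}\varepsilon^7$. (So the sets $U(t_0)$ cover the real $(k^{-1}\varepsilon^7)$-neighbourhood of $\chi_q(k,\varepsilon)$ and its $(\frac18k^{-1}\varepsilon^{10})$-neighbourhood in $\mathbb C^2$.) *Model operator.* Let $P_q$ be the coordinate projection onto the indices $j,j-q$, and let $\hat H_q(t)=H_0(t)+P_qVP_q$. Its block $\begin{pmatrix}p_j^2&v_q\\v_{-q}&p_{j-q}^2\end{pmatrix}$ has the eigenvalues $\hat\lambda^\pm=a\pm b$, $2a=p_j^2+p_{j-q}^2$, $2b=(4|v_q|^2+(p_j^2-p_{j-q}^2)^2)^{1/2}$ (principal branch), and $\hat E^\pm(t)$ are the corresponding spectral projections. *Series.* For a potential $W$ and $r\ge1$, with the contour $C_1=\{z:|z-\hat\lambda^+(t)|=\frac14\varepsilon^{10}\}$,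 let $$g_{W,r}(t)=\frac{(-1)^r}{2\pi i r}\,\mathrm{Tr}\oint_{C_1}\big((\hat H_q(t)-z)^{-1}(W-P_qVP_q)\big)^rdz,$$ $$G_{W,r}(t)=\frac{(-1)^{r+1}}{2\pi i}\oint_{C_1}\big((\hat H_q(t)-z)^{-1}(W-P_qVP_q)\big)^r(\hat H_q(t)-z)^{-1}dz,$$ $$\lambda_W(t)=\hat\lambda^+(t)+\sum_{r\ge1}g_{W,r}(t),\qquad E_W(t)=\hat E^+(t)+\sum_{r\ge1}G_{W,r}(t).\tag{1}$$ *Successive approximations.* Let $W_0=V$ and $W_{m+1}=V+\sigma|\psi_{m}|^2$, where $\psi_{m}(x,t)=A\sum_{b}(E_{W_m}(t))_{j+b,j}\,e^{i\langle b,x\rangle}$; for complex $t$, $|\psi_m|^2$ is replaced by its holomorphic continuation $\psi_m(x,t)\overline{\psi_m(x,\bar t)}$. Thus the $W_m=W_m(x,t)$ depend on $t$. **Theorem.** There are absolute constants $\varepsilon_0,\hat c,C>0$ such that the following holds whenever $0<\varepsilon<\varepsilon_0$, $\|V\|_*<\varepsilon^9$ and $|v_q|>\varepsilon^{10}$. There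 is $k_1=k_1(V,q,\varepsilon)$ such that for all $k>k_1$, all $\sigma,A$ with $|\sigma||A|^2<\varepsilon^{11}$, and all $t_0\in\chi_q(k,\varepsilon)$, there is a family of potentials $W=W(\cdot,t)$ with $\|W_m-W\|_*\to0$ for every $t\in U(t_0)$, and for every $t\in U(t_0)$: 1. The traces and the series (1) for $\lambda=\lambda_W$ and $E=E_W$ converge (the second one in $\|\cdot\|_0$). For real $t$, $\lambda(t)$ is a real simple eigenvalue of $H_0(t)+W$ in $\ell^2(\mathbb Z^2)$, and $E(t)$ is the orthogonal projection onto its one-dimensional eigenspace. 2. All terms and sums in (1) are differentiable in $t$ (the matrices with respect to $\|\cdot\|_0$), and $$\nabla_t\lambda=\nabla_t\hat\lambda^++\sum_{r\ge1}\nabla_tg_{W,r},\qquad \nabla_tE=\nabla_t\hat E^++\sum_{r\ge1}\nabla_tG_{W,r},$$ the second series converging in $\|\cdot\|_0$. For all $r\ge1$, $$|\nabla_tg_{W,r}(t)|<(\hat c\varepsilon)^rk\varepsilon,\qquad \|\nabla_tG_{W,r}(t)\|_0<(\hat c\varepsilon)^rk\varepsilon^{-10}.$$ 3. Consequently $$|\nabla_t(\lambda-\hat\lambda^+)|<Ck\varepsilon^2,\qquad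 \|\nabla_t(E-\hat E^+)\|_0<Ck\varepsilon^{-9},\qquad \Big|\frac{|\nabla_t\lambda|}{2k}-1\Big|\le C\varepsilon^2,$$ the last being $|\nabla_t\lambda|=2k(1+O(\varepsilon^2))$. -/

import Mathlib

open scoped ENNReal Topology ComplexConjugate

noncomputable section

namespace ResonantGP

/-! Fourier side of the problem on `Q = [0, 2π]²`: in the basis `exp (i ⟨m + t, x⟩)`, `m ∈ ℤ²`,
a function is its family of coefficients, an operator is an infinite matrix. -/

/-- The lattice `ℤ²`. -/
abbrev Idx : Type := Fin 2 → ℤ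

/-- Real quasimomenta (Euclidean norm). -/
abbrev R2 : Type := EuclideanSpace ℝ (Fin 2)

/-- Complex quasimomenta (Hermitian norm). -/
abbrev C2 : Type := EuclideanSpace ℂ (Fin 2)

/-- Matrices indexed by `ℤ²` with entries in `F`. -/
abbrev Mat (F : Type) : Type := Idx → Idx → F

/-- The inclusion `ℝ² ⊆ ℂ²`. -/
def toC (s : R2) : C2 := WithLp.toLp 2 fun i => (s i : ℂ)

/-- Coordinatewise complex conjugation on `ℂ²`. -/
def conjC (t : C2) : C2 := WithLp.toLp 2 fun i => conj (t i)

/-- `P_m(t) = m + t` for real `t`. -/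
def momentum (m : Idx) (t : R2) : R2 := WithLp.toLp 2 fun i => (m i : ℝ) + t i

/-- `p_m²(t) = |P_m(t)|²`, continued holomorphically to `t ∈ ℂ²`. -/
def psq (m : Idx) (t : C2) : ℂ := ∑ i, ((m i : ℂ) + t i) ^ 2

/-- `t` is a point of the resonant set `χ_q(k, ε) ⊆ [0,1)²`, and `j` is the lattice point with
`|P_j(t)| = k`. The values `p_j²(t)` and `p_{j-q}²(t)` are `ε`-close to each other, and both are
further than `2 ε⁶` from all the other `p_m²(t)`. -/
structure IsResonantPoint (q : Idx) (k ε : ℝ) (t : R2) (j : Idx) : Prop where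
  mem_cell : ∀ i, 0 ≤ t i ∧ t i < 1
  norm_eq : ‖momentum j t‖ = k
  unique : ∀ m : Idx, ‖momentum m t‖ = k → m = j
  close : |‖momentum (j - q) t‖ ^ 2 - ‖momentum j t‖ ^ 2| < ε
  gap : ∀ m : Idx, m ≠ j → m ≠ j - q → 2 * ε ^ 6 < |‖momentum j t‖ ^ 2 - ‖momentum m t‖ ^ 2|
  gap' : ∀ m : Idx, m ≠ j → m ≠ j - q →
    2 * ε ^ 6 < |‖momentum (j - q) t‖ ^ 2 - ‖momentum m t‖ ^ 2|

/-- The complex `k⁻¹ ε¹⁰ / 8`-neighbourhood of the real `k⁻¹ ε⁷`-neighbourhood of `t₀`. -/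
def nbhd (k ε : ℝ) (t₀ : R2) : Set C2 :=
  {t | ∃ s : R2, ‖s - t₀‖ < k⁻¹ * ε ^ 7 ∧ ‖t - toC s‖ < 1 / 8 * k⁻¹ * ε ^ 10}

/-! ### Norms -/

/-- `‖w‖_* = ∑ |w_b|`, the sum of the moduli of the Fourier coefficients. -/
def starNorm (w : Idx → ℂ) : ℝ≥0∞ := ∑' b, ‖w b‖ₑ

/-- `‖T‖₀ = ½ sup_r ∑_p (|T_{pr}| + |T_{rp}|)`. For a gradient, the entries are vectors of `ℂ²`
and `|·|` is their length. -/
def norm0 {F : Type} [NormedAddCommGroup F] (T : Mat F) : ℝ≥0∞ :=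
  (⨆ r, ∑' p, (‖T p r‖ₑ + ‖T r p‖ₑ)) / 2

/-! ### Matrix algebra -/

/-- The product of two infinite matrices. -/
def mul (S T : Mat ℂ) : Mat ℂ := fun m n => ∑' p, S m p * T p n

/-- Powers of an infinite matrix. -/
def pow (T : Mat ℂ) : ℕ → Mat ℂ
  | 0 => fun m n => if m = n then 1 else 0
  | r + 1 => mul (pow T r) T

/-! ### The model operator `Ĥ_q(t) = H₀(t) + P_q V P_q` -/

/-- The two indices `j`, `j - q` onto which `P_q` projects. -/
def inBlock (q j m : Idx) : Prop := m = j ∨ m = j - q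

open Classical in
/-- The matrix of `P_q V P_q`, where `(V)_{mn} = v_{m-n}`. -/
def blockV (v : Idx → ℂ) (q j : Idx) : Mat ℂ := fun m n =>
  if inBlock q j m ∧ inBlock q j n then v (m - n) else 0

/-- The matrix of `H₀(t)`. -/
def freeOp (t : C2) : Mat ℂ := fun m n => if m = n then psq m t else 0

/-- `2b = (4 |v_q|² + (p_j² - p_{j-q}²)²)^{1/2}`, principal branch. -/
def twoB (v : Idx → ℂ) (q j : Idx) (t : C2) : ℂ :=
  (4 * (‖v q‖ : ℂ) ^ 2 + (psq j t - psq (j - q) t) ^ 2) ^ (1 / 2 : ℂ)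

/-- `λ̂⁺(t) = a + b`, where `2a = p_j² + p_{j-q}²`. -/
def lamPlus (v : Idx → ℂ) (q j : Idx) (t : C2) : ℂ :=
  (psq j t + psq (j - q) t) / 2 + twoB v q j t / 2

/-- `λ̂⁻(t) = a - b`. -/
def lamMinus (v : Idx → ℂ) (q j : Idx) (t : C2) : ℂ :=
  (psq j t + psq (j - q) t) / 2 - twoB v q j t / 2

open Classical in
/-- The spectral projection `Ê⁺(t)` of the model operator for `λ̂⁺(t)`: on the block it is
`(Ĥ_q - λ̂⁻) / (λ̂⁺ - λ̂⁻)`. -/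
def EPlus (v : Idx → ℂ) (q j : Idx) (t : C2) : Mat ℂ := fun m n =>
  if inBlock q j m ∧ inBlock q j n then
    (freeOp t m n + blockV v q j m n - (if m = n then lamMinus v q j t else 0)) /
      (lamPlus v q j t - lamMinus v q j t)
  else 0

open Classical in
/-- The spectral projection `Ê⁻(t)` of the model operator for `λ̂⁻(t)`. -/
def EMinus (v : Idx → ℂ) (q j : Idx) (t : C2) : Mat ℂ := fun m n =>
  if inBlock q j m ∧ inBlock q j n then
    ((if m = n then lamPlus v q j t else 0) - (freeOp t m n + blockV v q j m n)) /
      (lamPlus v q j t - lamMinus v q j t)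
  else 0

open Classical in
/-- The resolvent `(Ĥ_q(t) - z)⁻¹`, written through the spectral decomposition of `Ĥ_q(t)`,
whose eigenvalues are `λ̂⁺`, `λ̂⁻` and the `p_m²` with `m ≠ j, j - q`. -/
def modelResolvent (v : Idx → ℂ) (q j : Idx) (t : C2) (z : ℂ) : Mat ℂ := fun m n =>
  (lamPlus v q j t - z)⁻¹ * EPlus v q j t m n + (lamMinus v q j t - z)⁻¹ * EMinus v q j t m n +
    if m = n ∧ ¬ inBlock q j m then (psq m t - z)⁻¹ else 0

/-! ### Perturbation series for `H₀(t) + W`; the contour is `|z - λ̂⁺(t)| = ε¹⁰ / 4` -/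

/-- The matrix of `(Ĥ_q(t) - z)⁻¹ (W - P_q V P_q)`, `W` having the Fourier coefficients `w`. -/
def kernelMat (v : Idx → ℂ) (q j : Idx) (w : Idx → ℂ) (t : C2) (z : ℂ) : Mat ℂ :=
  mul (modelResolvent v q j t z) fun m n => w (m - n) - blockV v q j m n

/-- `∮ ((Ĥ_q(t) - z)⁻¹ (W - P_q V P_q))^r dz`. -/
def gMat (v : Idx → ℂ) (q j : Idx) (ε : ℝ) (w : Idx → ℂ) (r : ℕ) (t : C2) : Mat ℂ := fun m n =>
  ∮ z in C(lamPlus v q j t, ε ^ 10 / 4), pow (kernelMat v q j w t z) r m n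

/-- `ĝ_{W,r}(t)`, for `r ≥ 1`. -/
def gTerm (v : Idx → ℂ) (q j : Idx) (ε : ℝ) (w : Idx → ℂ) (r : ℕ) (t : C2) : ℂ :=
  (-1) ^ r / (2 * Real.pi * Complex.I * r) * ∑' m, gMat v q j ε w r t m m

/-- `Ĝ_{W,r}(t)`, for `r ≥ 1`. -/
def GTerm (v : Idx → ℂ) (q j : Idx) (ε : ℝ) (w : Idx → ℂ) (r : ℕ) (t : C2) : Mat ℂ :=
  fun m n => (-1) ^ (r + 1) / (2 * Real.pi * Complex.I) *
    ∮ z in C(lamPlus v q j t, ε ^ 10 / 4),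
      mul (pow (kernelMat v q j w t z) r) (modelResolvent v q j t z) m n

/-- `λ̂_W(t) = λ̂⁺(t) + ∑_{r ≥ 1} ĝ_{W,r}(t)`. -/
def lamW (v : Idx → ℂ) (q j : Idx) (ε : ℝ) (w : Idx → ℂ) (t : C2) : ℂ :=
  lamPlus v q j t + ∑' r : ℕ, gTerm v q j ε w (r + 1) t

/-- `Ê_W(t) = Ê⁺(t) + ∑_{r ≥ 1} Ĝ_{W,r}(t)`. -/
def EW (v : Idx → ℂ) (q j : Idx) (ε : ℝ) (w : Idx → ℂ) (t : C2) : Mat ℂ :=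
  fun m n => EPlus v q j t m n + ∑' r : ℕ, GTerm v q j ε w (r + 1) t m n

/-! ### Successive approximation -/

/-- The Fourier coefficients of `ψ_W`, where `u_W = ψ_W exp (i ⟨P_j(t), x⟩)` is the eigenfunction
of `H₀(t) + W` given by the `j`-th column of `A Ê_W(t)`. -/
def psi (v : Idx → ℂ) (q j : Idx) (ε : ℝ) (A : ℂ) (w : Idx → ℂ) (t : C2) (b : Idx) : ℂ :=
  A * EW v q j ε w t (j + b) j

/-- The Fourier coefficients of `W_m(t)`: `W_0 = V`, `W_{m+1} = V + σ |u_{W_m}|²`. For real `t` the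
sum over `c` is the `b`-th Fourier coefficient of `|u_{W_m}|² = ψ ψ̄`; for complex `t` it is its
holomorphic continuation, with `conj (ψ (t̄))` in the place of `conj (ψ (t))`. -/
def Wseq (v : Idx → ℂ) (q j : Idx) (ε σ : ℝ) (A : ℂ) : ℕ → C2 → Idx → ℂ
  | 0 => fun _ => v
  | m + 1 => fun t b => v b + σ * ∑' c : Idx,
      psi v q j ε A (Wseq v q j ε σ A m t) t (b + c) *
        conj (psi v q j ε A (Wseq v q j ε σ A m (conjC t)) (conjC t) c)

/-! ### Spectral projections and gradients -/

/-- The matrix of `H₀(t) + W`. -/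
def fullOp (w : Idx → ℂ) (t : C2) : Mat ℂ := fun m n => freeOp t m n + w (m - n)

/-- `L` is a simple eigenvalue of `H` in `ℓ²(ℤ²)`, and `E` is the orthogonal projection onto its
one-dimensional eigenspace. -/
def IsSimpleSpectralProjection (H E : Mat ℂ) (L : ℝ) : Prop :=
  ∃ f : Idx → ℂ, HasSum (fun m => ‖f m‖ ^ 2) 1 ∧ (∀ m n, E m n = f m * conj (f n)) ∧
    ∀ g : Idx → ℂ, Summable (fun m => ‖g m‖ ^ 2) →
      ((∀ m, HasSum (fun n => H m n * g n) (L * g m)) ↔ ∃ a : ℂ, ∀ m, g m = a * f m)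

/-- The gradient `(∂f/∂t₁, ∂f/∂t₂)` of a function on `ℂ²`. -/
def grad (f : C2 → ℂ) (t : C2) : C2 :=
  WithLp.toLp 2 fun i => fderiv ℂ f t (EuclideanSpace.single i 1)

/-- The (entrywise) gradient of a matrix-valued function; its entries are vectors of `ℂ²`. -/
def matGrad (T : C2 → Mat ℂ) (t : C2) : Mat C2 := fun m n => grad (fun s => T s m n) t

/-- `T` is (Fréchet) differentiable at `t` with respect to the norm `‖·‖₀`:
`‖T(t + h) - T(t) - ⟨∇T(t), h⟩‖₀ = o(|h|)`. -/
def DifferentiableAt0 (T : C2 → Mat ℂ) (t : C2) : Prop :=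
  (∀ m n, DifferentiableAt ℂ (fun s => T s m n) t) ∧
  Filter.Tendsto
    (fun h : C2 => norm0 (fun m n => T (t + h) m n - T t m n - ∑ i, h i * matGrad T t m n i) / ‖h‖ₑ)
    (𝓝[≠] 0) (𝓝 0)

end ResonantGP

end

noncomputable section

namespace ResonantGP

/-! ### Cauchy estimates in several variables -/

section Cauchy

variable {E : Type*} [NormedAddCommGroup E] [NormedSpace ℂ E]
  {F : Type*} [NormedAddCommGroup F] [NormedSpace ℂ F]

/-! Write z = λ̂⁺ + ζ, R(ζ) = (Ĥ_q - z)⁻¹ and X = W - P V P with P = P_q, so that H₀ + W = Ĥ_q + X.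
On the contour R is of order ε⁻¹⁰ on the two-dimensional block and at most ε⁻⁶ off it, while X is of
order ε⁹. So RX is not small: its corner from the complement into the block is only bounded by a
multiple of ε⁻¹. However, the block of X is the block of W - V, of order ε¹¹, and the opposite
corner of RX is of order ε³. Conjugation with ε² P + (1 - P) balances the corners and makes all four
O(ε) (`BlockBound.norm_wtKer_le`). Hence all series are geometric with ratio 260 ε. The estimates
take place in the Banach algebra `Schur` of matrices with bounded row and column sums; its norm
dominates ‖·‖₀, and for a multiplication operator it is at most ‖W‖_*.

Traces: the part of (RX)^r that never enters the block is holomorphic inside the contour and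
integrates to zero. The remaining part passes through the rank two projection P, so its diagonal is
absolutely summable (`sum_diag_pow_sub_le`, `ModelData.sum_diag_circleIntegral_le`).

Gradients: the differences p_m² - p_j² are affine in t, so the gap conditions survive in a complex
ball of radius 2k⁻¹ε⁷ around the resonant point (`modelBounds`). All quantities are holomorphic and
bounded there, and Cauchy's estimate costs a factor of order k ε⁻⁷, less than the theorem allows.

Successive approximations: E_W is Lipschitz in W with a constant of order ε⁻¹⁰ and |σ||A|² < ε¹¹, so
W ↦ V + σ|ψ_W|² contracts with a factor O(ε), uniformly in t. The limit is therefore holomorphic in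
t, and real-valued in x for real t (`potFamily_Wlim`, `Wlim_neg`).

Spectral meaning for real t: adding Ê⁺ to Ĥ_q moves λ̂⁺ out of the disc, so S(ζ) = (Ĥ_q + Ê⁺ + αX -
z)⁻¹ is holomorphic in the whole disc. The true resolvent is a rank one modification of S, with a
pole where Ê⁺ S Ê⁺ = Ê⁺. This scalar equation is a fixed point problem for a contraction that is
real on the real axis, so it has a real root, and the residue at the root is the rank one matrix E_W
(`eOp_eq_rank_one`). That the series for λ sums to λ̂⁺ plus this root follows by differentiating in
the coupling constant α ∈ [0, 1]: the derivatives of the root and of the series are both Tr(E_{αX}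
X), and both functions vanish at α = 0 (`exists_lamW_eq`). Simplicity holds because every bounded
solution g of the eigenvalue equation satisfies g = S Ê⁺ g (`eq_mul_of_eigen`). -/

theorem norm_deriv_le_of_bounded_ball {φ : ℂ → F} {c : ℂ} {ρ M : ℝ} (hρ : 0 < ρ)
    (hφ : DifferentiableOn ℂ φ (Metric.ball c ρ)) (hM : ∀ z ∈ Metric.ball c ρ, ‖φ z‖ ≤ M)
    {z : ℂ} (hz : z ∈ Metric.ball c (ρ / 2)) : ‖deriv φ z‖ ≤ 4 * M / ρ := by
  have hsub : Metric.closedBall z (ρ / 4) ⊆ Metric.ball c ρ := by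
    intro y hy
    rw [Metric.mem_ball] at hz ⊢
    rw [Metric.mem_closedBall] at hy
    linarith [dist_triangle y z c]
  have := Complex.norm_deriv_le_of_forall_mem_sphere_norm_le (f := φ) (c := z) (R := ρ / 4)
    (C := M) (by positivity)
    ((hφ.mono (Metric.closure_ball_subset_closedBall.trans hsub)).diffContOnCl)
    (fun y hy => hM y (hsub (Metric.sphere_subset_closedBall hy)))
  calc _ ≤ M / (ρ / 4) := this
    _ = 4 * M / ρ := by field_simp

theorem hasDerivAt_line {f : E → F} {x h : E} {s : ℂ} (hf : DifferentiableAt ℂ f (x + s • h)) :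
    HasDerivAt (fun s : ℂ => f (x + s • h)) (fderiv ℂ f (x + s • h) h) s := by
  have h1 : HasDerivAt (fun s : ℂ => x + s • h) h s := by
    simpa using ((hasDerivAt_id s).smul_const h).const_add x
  exact hf.hasFDerivAt.comp_hasDerivAt s h1

theorem line_mem_ball {x h : E} {r : ℝ} (hh : h ≠ 0) {s : ℂ}
    (hs : s ∈ Metric.ball (0 : ℂ) (r / ‖h‖)) : x + s • h ∈ Metric.ball x r := by
  have h0 : 0 < ‖h‖ := norm_pos_iff.mpr hh
  rw [mem_ball_zero_iff, lt_div_iff₀ h0] at hs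
  simpa [norm_smul] using hs

theorem norm_fderiv_apply_le {f : E → F} {x : E} {r M : ℝ} (hr : 0 < r)
    (hf : DifferentiableOn ℂ f (Metric.ball x r)) (hM : ∀ y ∈ Metric.ball x r, ‖f y‖ ≤ M)
    (h : E) : ‖fderiv ℂ f x h‖ ≤ 4 * M / r * ‖h‖ := by
  rcases eq_or_ne h 0 with rfl | hh
  · simp
  have h0 : 0 < ‖h‖ := norm_pos_iff.mpr hh
  have hd : ∀ s ∈ Metric.ball (0 : ℂ) (r / ‖h‖), HasDerivAt (fun s : ℂ => f (x + s • h))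
      (fderiv ℂ f (x + s • h) h) s := fun s hs =>
    hasDerivAt_line ((hf _ (line_mem_ball hh hs)).differentiableAt
      (Metric.isOpen_ball.mem_nhds (line_mem_ball hh hs)))
  have h00 : (0 : ℂ) ∈ Metric.ball (0 : ℂ) (r / ‖h‖) := by
    simpa using div_pos hr h0
  have := norm_deriv_le_of_bounded_ball (φ := fun s : ℂ => f (x + s • h)) (c := 0)
    (div_pos hr h0) (fun s hs => (hd s hs).differentiableAt.differentiableWithinAt)
    (fun s hs => hM _ (line_mem_ball hh hs)) (z := 0) (by simpa using div_pos hr h0)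
  rw [(hd 0 h00).deriv] at this
  simp only [zero_smul, add_zero] at this
  calc _ ≤ _ := this
    _ = _ := by field_simp

theorem norm_fderiv_le_of_bounded {f : E → F} {x : E} {r M : ℝ} (hr : 0 < r)
    (hf : DifferentiableOn ℂ f (Metric.ball x r)) (hM : ∀ y ∈ Metric.ball x r, ‖f y‖ ≤ M) :
    ‖fderiv ℂ f x‖ ≤ 4 * M / r := by
  have hM0 : 0 ≤ M := (norm_nonneg _).trans (hM x (Metric.mem_ball_self hr))
  exact ContinuousLinearMap.opNorm_le_bound _ (by positivity) (norm_fderiv_apply_le hr hf hM)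

/-- The remainder of the first order Taylor expansion is bounded in terms of the sup norm. -/
theorem norm_taylor_remainder_le [CompleteSpace F] {f : E → F} {x : E} {r M : ℝ} (hr : 0 < r)
    (hf : DifferentiableOn ℂ f (Metric.ball x r)) (hM : ∀ y ∈ Metric.ball x r, ‖f y‖ ≤ M)
    {h : E} (hh : ‖h‖ < r / 4) :
    ‖f (x + h) - f x - fderiv ℂ f x h‖ ≤ 32 * M / r ^ 2 * ‖h‖ ^ 2 := by
  have hM0 : 0 ≤ M := (norm_nonneg _).trans (hM x (Metric.mem_ball_self hr))
  rcases eq_or_ne h 0 with rfl | hne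
  · simp
  have h0 : 0 < ‖h‖ := norm_pos_iff.mpr hne
  -- On the line s ↦ x + s h the function is holomorphic for |s| < ρ, and ρ > 4. Two one-variable
  -- Cauchy estimates, on radii ρ/2 and ρ/4, bound the second derivative by 32 M / ρ² on a disc that
  -- contains [0, 1].
  set ρ := r / ‖h‖ with hρ
  have hρ4 : 4 < ρ := by rw [hρ, lt_div_iff₀ h0]; linarith
  have hρ0 : 0 < ρ := by linarith
  set φ : ℂ → F := fun s => f (x + s • h) with hφ
  have hd : ∀ s ∈ Metric.ball (0 : ℂ) ρ, HasDerivAt φ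
      (fderiv ℂ f (x + s • h) h) s := fun s hs =>
    hasDerivAt_line ((hf _ (line_mem_ball hne hs)).differentiableAt
      (Metric.isOpen_ball.mem_nhds (line_mem_ball hne hs)))
  have hφd : DifferentiableOn ℂ φ (Metric.ball 0 ρ) :=
    fun s hs => (hd s hs).differentiableAt.differentiableWithinAt
  have h1 : ∀ z ∈ Metric.ball (0 : ℂ) (ρ / 2), ‖deriv φ z‖ ≤ 4 * M / ρ := fun z hz =>
    norm_deriv_le_of_bounded_ball hρ0 hφd (fun s hs => hM _ (line_mem_ball hne hs)) hz
  have hφ' : DifferentiableOn ℂ (deriv φ) (Metric.ball 0 (ρ / 2)) :=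
    (hφd.deriv Metric.isOpen_ball).mono (Metric.ball_subset_ball (by linarith))
  have h2 : ∀ z ∈ Metric.ball (0 : ℂ) (ρ / 4), ‖deriv (deriv φ) z‖ ≤ 32 * M / ρ ^ 2 := by
    intro z hz
    have := norm_deriv_le_of_bounded_ball (by positivity) hφ' h1 (z := z)
      (by rwa [show ρ / 2 / 2 = ρ / 4 by ring])
    calc _ ≤ _ := this
      _ = _ := by field_simp; ring
  have hb : ∀ z ∈ Metric.closedBall (0 : ℂ) 1, ‖deriv φ z - deriv φ 0‖ ≤ 32 * M / ρ ^ 2 := by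
    intro z hz
    have hs : ∀ y ∈ Metric.closedBall (0 : ℂ) 1, y ∈ Metric.ball (0 : ℂ) (ρ / 4) := by
      intro y hy
      rw [mem_closedBall_zero_iff] at hy
      rw [mem_ball_zero_iff]; linarith
    have := (convex_closedBall (0 : ℂ) 1).norm_image_sub_le_of_norm_deriv_le (f := deriv φ)
      (C := 32 * M / ρ ^ 2) (x := 0) (y := z) (𝕜 := ℂ) (fun y hy => by
        have hy' := hs y hy
        exact (hφ' y (Metric.ball_subset_ball (by linarith) hy')).differentiableAt
          (Metric.isOpen_ball.mem_nhds (Metric.ball_subset_ball (by linarith) hy')))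
      (fun y hy => h2 y (hs y hy)) (by simp) hz
    rw [mem_closedBall_zero_iff] at hz
    calc _ ≤ _ := this
      _ ≤ 32 * M / ρ ^ 2 * 1 := by gcongr; simpa using hz
      _ = _ := mul_one _
  have hc : ∀ y ∈ Metric.closedBall (0 : ℂ) 1, y ∈ Metric.ball (0 : ℂ) ρ := by
    intro y hy
    rw [mem_closedBall_zero_iff] at hy
    rw [mem_ball_zero_iff]; linarith
  have h3 := (convex_closedBall (0 : ℂ) 1).norm_image_sub_le_of_norm_hasDerivWithin_le
    (f := fun s => φ s - s • deriv φ 0) (f' := fun s => deriv φ s - deriv φ 0)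
    (C := 32 * M / ρ ^ 2) (x := 0) (y := 1) (𝕜 := ℂ) (fun y hy => by
      have : HasDerivAt (fun s => φ s - s • deriv φ 0) (deriv φ y - (1 : ℂ) • deriv φ 0) y :=
        (hd y (hc y hy)).differentiableAt.hasDerivAt.sub
          ((hasDerivAt_id y).smul_const (deriv φ 0))
      rw [one_smul] at this
      exact this.hasDerivWithinAt) hb (by simp) (by simp)
  have e0 : deriv φ 0 = fderiv ℂ f x h := by
    rw [(hd 0 (hc 0 (by simp))).deriv]; simp
  have : φ 1 - (1 : ℂ) • deriv φ 0 - (φ 0 - (0 : ℂ) • deriv φ 0) =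
      f (x + h) - f x - fderiv ℂ f x h := by
    rw [e0]
    simp only [hφ, one_smul, zero_smul, add_zero, sub_zero]
    abel
  rw [← this]
  calc _ ≤ _ := h3
    _ = _ := by rw [hρ]; simp; field_simp

theorem hasFDerivAt_of_norm_remainder_le {f : E → F} {L : E →L[ℂ] F} {x : E} {r K : ℝ}
    (hr : 0 < r) (h : ∀ h : E, ‖h‖ < r → ‖f (x + h) - f x - L h‖ ≤ K * ‖h‖ ^ 2) :
    HasFDerivAt f L x := by
  rw [hasFDerivAt_iff_isLittleO_nhds_zero]
  have : (fun h : E => f (x + h) - f x - L h) =O[𝓝 0] fun h : E => ‖h‖ ^ 2 := by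
    refine Asymptotics.IsBigO.of_bound K ?_
    filter_upwards [Metric.ball_mem_nhds (0 : E) hr] with y hy
    rw [mem_ball_zero_iff] at hy
    simpa using h y hy
  refine this.trans_isLittleO ?_
  have := (Asymptotics.isLittleO_pow_id (𝕜 := ℝ) (n := 2) (by norm_num)).comp_tendsto
    (tendsto_norm_zero (E := E))
  exact (Asymptotics.isLittleO_norm_right.mp this)

/-- A sum of holomorphic functions whose absolute values have a bounded sum is holomorphic. -/
theorem differentiableOn_tsum_of_sum_norm_le {ι : Type*} {f : ι → E → ℂ} {U : Set E}
    (hU : IsOpen U) (hf : ∀ i, DifferentiableOn ℂ (f i) U) {M : ℝ}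
    (hM : ∀ x ∈ U, ∀ s : Finset ι, ∑ i ∈ s, ‖f i x‖ ≤ M) :
    DifferentiableOn ℂ (fun x => ∑' i, f i x) U := by
  intro x hx
  obtain ⟨r, hr, hball⟩ := Metric.isOpen_iff.mp hU x hx
  have hfd : ∀ i, DifferentiableOn ℂ (f i) (Metric.ball x r) := fun i => (hf i).mono hball
  -- Phases fixed at one point turn a sum of moduli into the modulus of a single holomorphic
  -- function ∑ cᵢ fᵢ, still bounded by M. So the Cauchy and Taylor bounds hold for sums of moduli
  -- over every finite set, and no locally uniform convergence has to be assumed.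
  have phase : ∀ z : ℂ, ∃ c : ℂ, ‖c‖ ≤ 1 ∧ c * z = ‖z‖ := fun z => by
    rcases eq_or_ne z 0 with rfl | hz
    · exact ⟨0, by simp⟩
    · refine ⟨‖z‖ / z, ?_, by field_simp⟩
      rw [norm_div, Complex.norm_real, norm_norm, div_self (norm_ne_zero_iff.mpr hz)]
  choose c hc1 hc2 using phase
  have hsumd : ∀ (s : Finset ι) (a : ι → ℂ),
      DifferentiableOn ℂ (fun y => ∑ i ∈ s, a i * f i y) (Metric.ball x r) := fun s a =>
    DifferentiableOn.fun_sum fun i _ => (hfd i).const_mul (a i)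
  have hsumb : ∀ (s : Finset ι) (a : ι → ℂ), (∀ i, ‖a i‖ ≤ 1) → ∀ y ∈ Metric.ball x r,
      ‖∑ i ∈ s, a i * f i y‖ ≤ M := fun s a ha y hy =>
    (norm_sum_le _ _).trans <| (Finset.sum_le_sum fun i _ => by
      rw [norm_mul]; exact mul_le_of_le_one_left (norm_nonneg _) (ha i)).trans (hM y (hball hy) s)
  have hfdsum : ∀ (s : Finset ι) (a : ι → ℂ) (h : E),
      fderiv ℂ (fun y => ∑ i ∈ s, a i * f i y) x h = ∑ i ∈ s, a i * fderiv ℂ (f i) x h := by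
    intro s a h
    have hat : ∀ i, DifferentiableAt ℂ (f i) x := fun i =>
      (hfd i x (Metric.mem_ball_self hr)).differentiableAt (Metric.ball_mem_nhds x hr)
    rw [fderiv_fun_sum fun i _ => (hat i).const_mul (a i), _root_.sum_apply]
    refine Finset.sum_congr rfl fun i _ => ?_
    rw [fderiv_const_mul (hat i)]; rfl
  have hsummable : ∀ y ∈ U, Summable fun i => f i y := fun y hy =>
    (summable_of_sum_le (fun i => norm_nonneg _) (hM y hy)).of_norm
  have hD : ∀ (h : E) (s : Finset ι), ∑ i ∈ s, ‖fderiv ℂ (f i) x h‖ ≤ 4 * M / r * ‖h‖ := by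
    intro h s
    have h1 := norm_fderiv_apply_le hr (hsumd s fun i => c (fderiv ℂ (f i) x h))
      (hsumb s _ fun i => hc1 _) h
    rw [hfdsum] at h1
    simp only [hc2] at h1
    rw [← Complex.ofReal_sum, Complex.norm_real] at h1
    exact (le_abs_self _).trans h1
  have hDs : ∀ h : E, Summable fun i => fderiv ℂ (f i) x h := fun h =>
    (summable_of_sum_le (fun i => norm_nonneg _) (hD h)).of_norm
  have hDn : ∀ h : E, Summable fun i => ‖fderiv ℂ (f i) x h‖ := fun h =>
    summable_of_sum_le (fun i => norm_nonneg _) (hD h)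
  let L : E →ₗ[ℂ] ℂ :=
    { toFun := fun h => ∑' i, fderiv ℂ (f i) x h
      map_add' := fun a b => by simp only [map_add]; exact (hDs a).tsum_add (hDs b)
      map_smul' := fun a b => by simp only [map_smul, smul_eq_mul, RingHom.id_apply, tsum_mul_left] }
  let L' : E →L[ℂ] ℂ := L.mkContinuous (4 * M / r) fun h =>
    (norm_tsum_le_tsum_norm (hDn h)).trans ((hDn h).tsum_le_of_sum_le (hD h))
  refine DifferentiableAt.differentiableWithinAt ⟨L', ?_⟩
  refine hasFDerivAt_of_norm_remainder_le (r := r / 4) (K := 32 * M / r ^ 2) (by positivity) ?_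
  intro h hh
  have hxh : x + h ∈ Metric.ball x r := by simp; linarith
  have hR : ∀ s : Finset ι, ∑ i ∈ s, ‖f i (x + h) - f i x - fderiv ℂ (f i) x h‖ ≤
      32 * M / r ^ 2 * ‖h‖ ^ 2 := by
    intro s
    have h1 := norm_taylor_remainder_le hr
      (hsumd s fun i => c (f i (x + h) - f i x - fderiv ℂ (f i) x h))
      (hsumb s _ fun i => hc1 _) hh
    rw [hfdsum, ← Finset.sum_sub_distrib, ← Finset.sum_sub_distrib] at h1
    simp only [← mul_sub, hc2] at h1
    rw [← Complex.ofReal_sum, Complex.norm_real] at h1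
    exact (le_abs_self _).trans h1
  have e : ∑' i, f i (x + h) - ∑' i, f i x - L' h =
      ∑' i, (f i (x + h) - f i x - fderiv ℂ (f i) x h) := by
    rw [((hsummable _ (hball hxh)).sub (hsummable x hx)).tsum_sub (hDs h),
      (hsummable _ (hball hxh)).tsum_sub (hsummable x hx)]
    rfl
  rw [e]
  have hs := summable_of_sum_le (fun i => norm_nonneg _) hR
  exact (norm_tsum_le_tsum_norm hs).trans (hs.tsum_le_of_sum_le hR)

/-- Holomorphic dependence of an integral on a parameter. -/
theorem differentiableOn_intervalIntegral [CompleteSpace F] {f : E → ℝ → F} {U : Set E}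
    (hU : IsOpen U) {a b M : ℝ}
    (hf : ∀ θ, DifferentiableOn ℂ (fun x => f x θ) U) (hc : ∀ x ∈ U, Continuous (f x))
    (hM : ∀ x ∈ U, ∀ θ, ‖f x θ‖ ≤ M) :
    DifferentiableOn ℂ (fun x => ∫ θ in a..b, f x θ) U := by
  intro x hx
  obtain ⟨r, hr, hball⟩ := Metric.isOpen_iff.mp hU x hx
  have hfd : ∀ θ, DifferentiableOn ℂ (fun y => f y θ) (Metric.ball x r) :=
    fun θ => (hf θ).mono hball
  have hfM : ∀ θ, ∀ y ∈ Metric.ball x r, ‖f y θ‖ ≤ M := fun θ y hy => hM y (hball hy) θ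
  have hM0 : 0 ≤ M := (norm_nonneg _).trans (hM x hx 0)
  let D : ℝ → E → F := fun θ h => fderiv ℂ (fun y => f y θ) x h
  have hDle : ∀ θ h, ‖D θ h‖ ≤ 4 * M / r * ‖h‖ := fun θ h =>
    norm_fderiv_apply_le hr (hfd θ) (hfM θ) h
  have hrem : ∀ θ h, ‖h‖ < r / 4 → ‖f (x + h) θ - f x θ - D θ h‖ ≤ 32 * M / r ^ 2 * ‖h‖ ^ 2 :=
    fun θ h hh => norm_taylor_remainder_le hr (hfd θ) (hfM θ) hh
  have hmem : ∀ h : E, ‖h‖ < r / 4 → x + h ∈ U := fun h hh => hball (by simp; linarith)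
  -- Joint continuity is not assumed. Continuity of the derivative in θ comes from writing it as a
  -- limit of difference quotients with steps 1/(n+1), uniform in θ because the Taylor bound is.
  have hDc : ∀ h, Continuous fun θ => D θ h := by
    intro h
    have hlim : Filter.Tendsto (fun n : ℕ => ((n : ℝ) + 1)⁻¹ * ‖h‖) Filter.atTop (𝓝 0) := by
      simpa using (tendsto_inv_atTop_zero.comp
        (Filter.tendsto_atTop_add_const_right _ 1 tendsto_natCast_atTop_atTop)).mul_const ‖h‖
    have hsm : ∀ n : ℕ, ‖((n : ℂ) + 1)⁻¹ • h‖ = ((n : ℝ) + 1)⁻¹ * ‖h‖ := fun n => by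
      rw [norm_smul, norm_inv]
      congr 2
      exact_mod_cast Complex.norm_natCast (n + 1)
    have hunif : TendstoUniformly
        (fun (n : ℕ) θ => ((n : ℂ) + 1) • (f (x + ((n : ℂ) + 1)⁻¹ • h) θ - f x θ))
        (fun θ => D θ h) Filter.atTop := by
      rw [Metric.tendstoUniformly_iff]
      intro e he
      have h2 : Filter.Tendsto (fun n : ℕ => 32 * M / r ^ 2 * ‖h‖ * (((n : ℝ) + 1)⁻¹ * ‖h‖))
          Filter.atTop (𝓝 0) := by simpa using hlim.const_mul (32 * M / r ^ 2 * ‖h‖)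
      filter_upwards [hlim.eventually_lt_const (show 0 < r / 4 by positivity),
        h2.eventually_lt_const he] with n hn1 hn2 θ
      have hn0 : ((n : ℂ) + 1) ≠ 0 := by exact_mod_cast n.succ_ne_zero
      have h3 := hrem θ (((n : ℂ) + 1)⁻¹ • h) (by rw [hsm]; exact hn1)
      have e1 : D θ h = ((n : ℂ) + 1) • D θ (((n : ℂ) + 1)⁻¹ • h) := by
        simp only [D, map_smul, smul_smul, mul_inv_cancel₀ hn0, one_smul]
      rw [dist_comm, dist_eq_norm, e1, ← smul_sub, norm_smul]
      have hn : ‖((n : ℂ) + 1)‖ = (n : ℝ) + 1 := by exact_mod_cast Complex.norm_natCast (n + 1)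
      rw [hn]
      rw [hsm] at h3
      calc _ ≤ ((n : ℝ) + 1) * (32 * M / r ^ 2 * (((n : ℝ) + 1)⁻¹ * ‖h‖) ^ 2) := by gcongr
        _ = 32 * M / r ^ 2 * ‖h‖ * (((n : ℝ) + 1)⁻¹ * ‖h‖) := by field_simp
        _ < e := hn2
    refine hunif.continuous (Filter.Eventually.frequently ?_)
    filter_upwards [hlim.eventually_lt_const (show 0 < r / 4 by positivity)] with n hn
    exact ((hc _ (hmem _ (by rw [hsm]; exact hn))).sub (hc x hx)).const_smul _
  let L : E →ₗ[ℂ] F :=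
    { toFun := fun h => ∫ θ in a..b, D θ h
      map_add' := fun u v => by
        simp only [D, map_add]
        exact intervalIntegral.integral_add ((hDc u).intervalIntegrable _ _)
          ((hDc v).intervalIntegrable _ _)
      map_smul' := fun u v => by
        simp only [D, map_smul, RingHom.id_apply, intervalIntegral.integral_smul] }
  let L' : E →L[ℂ] F := L.mkContinuous (4 * M / r * |b - a|) fun h => by
    have := intervalIntegral.norm_integral_le_of_norm_le_const (a := a) (b := b)
      (f := fun θ => D θ h) (C := 4 * M / r * ‖h‖) fun θ _ => hDle θ h
    calc _ ≤ _ := this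
      _ = _ := by ring
  refine DifferentiableAt.differentiableWithinAt ⟨L', ?_⟩
  refine hasFDerivAt_of_norm_remainder_le (r := r / 4) (K := 32 * M / r ^ 2 * |b - a|)
    (by positivity) ?_
  intro h hh
  have e : ∫ θ in a..b, (f (x + h) θ - f x θ - D θ h) =
      (∫ θ in a..b, f (x + h) θ) - (∫ θ in a..b, f x θ) - L' h := by
    rw [intervalIntegral.integral_sub, intervalIntegral.integral_sub]
    · rfl
    · exact (hc _ (hmem h hh)).intervalIntegrable _ _
    · exact (hc x hx).intervalIntegrable _ _
    · exact ((hc _ (hmem h hh)).sub (hc x hx)).intervalIntegrable _ _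
    · exact (hDc h).intervalIntegrable _ _
  rw [← e]
  have := intervalIntegral.norm_integral_le_of_norm_le_const (a := a) (b := b)
      (f := fun θ => f (x + h) θ - f x θ - D θ h) (C := 32 * M / r ^ 2 * ‖h‖ ^ 2)
      fun θ _ => hrem θ h hh
  calc _ ≤ _ := this
    _ = _ := by ring

/-- Holomorphic dependence of a circle integral on a parameter. -/
theorem differentiableOn_circleIntegral [CompleteSpace F] {f : E → ℂ → F} {U : Set E}
    (hU : IsOpen U) {c : ℂ} {R M : ℝ} (hR : 0 ≤ R)
    (hf : ∀ z ∈ Metric.sphere c R, DifferentiableOn ℂ (fun x => f x z) U)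
    (hc : ∀ x ∈ U, ContinuousOn (f x) (Metric.sphere c R))
    (hM : ∀ x ∈ U, ∀ z ∈ Metric.sphere c R, ‖f x z‖ ≤ M) :
    DifferentiableOn ℂ (fun x => ∮ z in C(c, R), f x z) U := by
  refine differentiableOn_intervalIntegral hU (M := R * M) (fun θ => ?_) (fun x hx => ?_) ?_
  · exact (hf _ (circleMap_mem_sphere c hR θ)).const_smul _
  · refine Continuous.smul ?_ ?_
    · have : deriv (circleMap c R) = fun θ => circleMap 0 R θ * Complex.I :=
        funext fun θ => deriv_circleMap c R θ
      rw [this]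
      exact (continuous_circleMap 0 R).mul continuous_const
    · exact (hc x hx).comp_continuous (continuous_circleMap c R) (circleMap_mem_sphere c hR)
  · intro x hx θ
    rw [norm_smul]
    simp only [deriv_circleMap, norm_mul, norm_circleMap_zero, Complex.norm_I, mul_one,
      abs_of_nonneg hR]
    exact mul_le_mul_of_nonneg_left (hM x hx _ (circleMap_mem_sphere c hR θ)) hR

/-- Termwise differentiation of a series of holomorphic functions. -/
theorem hasFDerivAt_tsum_of_bounded [CompleteSpace F] {f : ℕ → E → F} {u : ℕ → ℝ}
    (hu : Summable u) {x : E} {r : ℝ} (hr : 0 < r)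
    (hf : ∀ n, DifferentiableOn ℂ (f n) (Metric.ball x r))
    (hM : ∀ n, ∀ y ∈ Metric.ball x r, ‖f n y‖ ≤ u n) :
    HasFDerivAt (fun y => ∑' n, f n y) (∑' n, fderiv ℂ (f n) x) x := by
  -- Halving the radius leaves a Cauchy ball of radius r/2 around each point of the smaller ball, so
  -- the derivatives have a summable bound that is uniform there.
  have hsub : ∀ y ∈ Metric.ball x (r / 2), Metric.ball y (r / 2) ⊆ Metric.ball x r :=
    fun y hy => Metric.ball_subset_ball' (by rw [Metric.mem_ball] at hy; linarith)
  refine hasFDerivAt_tsum_of_isPreconnected (u := fun n => 4 * u n / (r / 2))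
    ((hu.mul_left 4).div_const _) (Metric.isOpen_ball (x := x) (ε := r / 2))
    (convex_ball x (r / 2)).isPreconnected (fun n y hy => ?_) (fun n y hy => ?_)
    (Metric.mem_ball_self (by positivity))
    (Summable.of_norm_bounded hu fun n => hM n x (Metric.mem_ball_self hr))
    (Metric.mem_ball_self (by positivity))
  · have hy' : y ∈ Metric.ball x r := Metric.ball_subset_ball (by linarith) hy
    exact ((hf n y hy').differentiableAt (Metric.isOpen_ball.mem_nhds hy')).hasFDerivAt
  · exact norm_fderiv_le_of_bounded (by positivity) ((hf n).mono (hsub y hy))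
      fun z hz => hM n z (hsub y hy hz)

theorem summable_fderiv_of_bounded [CompleteSpace F] {f : ℕ → E → F} {u : ℕ → ℝ}
    (hu : Summable u) {x : E} {r : ℝ} (hr : 0 < r)
    (hf : ∀ n, DifferentiableOn ℂ (f n) (Metric.ball x r))
    (hM : ∀ n, ∀ y ∈ Metric.ball x r, ‖f n y‖ ≤ u n) :
    Summable fun n => fderiv ℂ (f n) x :=
  Summable.of_norm_bounded ((hu.mul_left 4).div_const r) fun n =>
    norm_fderiv_le_of_bounded hr (hf n) (hM n)

end Cauchy

/-! ### The Banach algebra of matrices with bounded row and column sums -/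

/-- The space `ℓ¹(ℤ²)`. -/
abbrev L1 : Type := lp (fun _ : Idx => ℂ) 1

/-- Bounded operators on `ℓ¹(ℤ²)`. -/
abbrev Op : Type := L1 →L[ℂ] L1

/-- The unit vectors of `ℓ¹`. -/
def unitVec (n : Idx) : L1 := lp.single 1 n 1

/-- The coordinate functionals on `ℓ¹`. -/
def coord (m : Idx) : L1 →L[ℂ] ℂ := lp.evalCLM ℂ (fun _ : Idx => ℂ) 1 m

theorem coord_apply (m : Idx) (f : L1) : coord m f = f m := rfl

theorem coord_unitVec (m n : Idx) : coord m (unitVec n) = if m = n then 1 else 0 := by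
  rw [coord_apply, unitVec, lp.single_apply]
  split_ifs with h
  · subst h; simp
  · simp [h]

theorem hasSum_unitVec (f : L1) : HasSum (fun n => coord n f • unitVec n) f := by
  have := lp.hasSum_single (p := 1) (by simp) f
  convert this using 2 with n
  rw [unitVec, coord_apply, ← lp.single_smul]
  simp

theorem norm_unitVec (n : Idx) : ‖unitVec n‖ = 1 := by
  rw [unitVec, lp.norm_single one_pos]; simp

theorem L1.hasSum_norm (f : L1) : HasSum (fun m => ‖coord m f‖) ‖f‖ := by
  have := lp.hasSum_norm (p := 1) (by simp) f
  simp only [ENNReal.toReal_one, Real.rpow_one] at this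
  exact this

theorem L1.sum_norm_le (f : L1) (s : Finset Idx) : ∑ m ∈ s, ‖coord m f‖ ≤ ‖f‖ :=
  sum_le_hasSum s (fun _ _ => norm_nonneg _) (L1.hasSum_norm f)

theorem L1.norm_le_of_sum_le {f : L1} {C : ℝ} (h : ∀ s : Finset Idx, ∑ m ∈ s, ‖coord m f‖ ≤ C) :
    ‖f‖ ≤ C := by
  rw [← (L1.hasSum_norm f).tsum_eq]
  exact (L1.hasSum_norm f).summable.tsum_le_of_sum_le h

theorem L1.exists_of_sum_le {a : Idx → ℂ} {C : ℝ} (h : ∀ s : Finset Idx, ∑ m ∈ s, ‖a m‖ ≤ C) :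
    ∃ f : L1, (∀ m, coord m f = a m) ∧ ‖f‖ ≤ C := by
  have hs : Summable fun m => ‖a m‖ := summable_of_sum_le (fun _ => norm_nonneg _) h
  refine ⟨⟨a, memℓp_gen (by simpa using hs)⟩, fun m => rfl, ?_⟩
  exact L1.norm_le_of_sum_le h

theorem L1.ext {f g : L1} (h : ∀ m, coord m f = coord m g) : f = g := lp.ext (funext h)

/-- The entries of an operator on `ℓ¹`. -/
def opEnt (T : Op) (m n : Idx) : ℂ := coord m (T (unitVec n))

theorem hasSum_opEnt_mul (S T : Op) (m n : Idx) :
    HasSum (fun p => opEnt S m p * opEnt T p n) (opEnt (S * T) m n) := by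
  have h := ((coord m).comp S).hasSum (hasSum_unitVec (T (unitVec n)))
  simp only [map_smul, smul_eq_mul] at h
  refine h.congr_fun fun p => ?_
  simp [opEnt, mul_comm]

theorem Op.norm_le_of_sum_le {T : Op} {C : ℝ} (hC : 0 ≤ C)
    (h : ∀ n, ∀ s : Finset Idx, ∑ m ∈ s, ‖opEnt T m n‖ ≤ C) : ‖T‖ ≤ C := by
  refine T.opNorm_le_bound hC fun f => ?_
  have h1 : HasSum (fun n => coord n f • T (unitVec n)) (T f) := by
    simpa using T.hasSum (hasSum_unitVec f)
  have hb : ∀ n, ‖coord n f • T (unitVec n)‖ ≤ C * ‖coord n f‖ := fun n => by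
    rw [norm_smul, mul_comm]
    exact mul_le_mul_of_nonneg_right (L1.norm_le_of_sum_le (h n)) (norm_nonneg _)
  rw [← h1.tsum_eq]
  exact tsum_of_norm_bounded ((L1.hasSum_norm f).mul_left C) hb

theorem Op.sum_le (T : Op) (n : Idx) (s : Finset Idx) : ∑ m ∈ s, ‖opEnt T m n‖ ≤ ‖T‖ :=
  (L1.sum_norm_le _ s).trans (by simpa [norm_unitVec] using T.le_opNorm (unitVec n))

theorem Op.ext_ent {S T : Op} (h : ∀ m n, opEnt S m n = opEnt T m n) : S = T := by
  refine ContinuousLinearMap.ext fun f => ?_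
  have h1 := S.hasSum (hasSum_unitVec f)
  have h2 := T.hasSum (hasSum_unitVec f)
  have : ∀ n, S (unitVec n) = T (unitVec n) := fun n => L1.ext fun m => h m n
  simp only [map_smul, this] at h1 h2
  exact h1.unique h2

theorem Op.exists_of_sum_le {a : Mat ℂ} {C : ℝ}
    (h : ∀ n, ∀ s : Finset Idx, ∑ m ∈ s, ‖a m n‖ ≤ C) :
    ∃ T : Op, ∀ m n, opEnt T m n = a m n := by
  choose c hc hcn using fun n => L1.exists_of_sum_le (h n)
  have hbd : ∀ f : L1, ∀ n, ‖coord n f • c n‖ ≤ C * ‖coord n f‖ := fun f n => by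
    rw [norm_smul, mul_comm]
    exact mul_le_mul_of_nonneg_right (hcn n) (norm_nonneg _)
  have hs : ∀ f : L1, Summable fun n => coord n f • c n := fun f =>
    Summable.of_norm_bounded ((L1.hasSum_norm f).summable.mul_left C) (hbd f)
  let L : L1 →ₗ[ℂ] L1 :=
    { toFun := fun f => ∑' n, coord n f • c n
      map_add' := fun f g => by simp only [map_add, add_smul]; exact (hs f).tsum_add (hs g)
      map_smul' := fun z f => by
        simp only [map_smul, smul_assoc, RingHom.id_apply]
        exact (hs f).tsum_const_smul z }
  refine ⟨L.mkContinuous C fun f => tsum_of_norm_bounded ((L1.hasSum_norm f).mul_left C) (hbd f),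
    fun m n => ?_⟩
  change coord m (∑' p, coord p (unitVec n) • c p) = a m n
  rw [tsum_eq_single n, coord_unitVec, if_pos rfl, one_smul, hc]
  intro p hp
  rw [coord_unitVec, if_neg hp, zero_smul]

theorem opEnt_one (m n : Idx) : opEnt 1 m n = if m = n then 1 else 0 := coord_unitVec m n

theorem continuous_opEnt (m n : Idx) : Continuous fun T : Op => opEnt T m n :=
  (coord m).continuous.comp (ContinuousLinearMap.apply ℂ L1 (unitVec n)).continuous

/-- Pairs of an operator on `ℓ¹` and its transpose. -/
def schurSub : Subalgebra ℂ (Op × Opᵐᵒᵖ) where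
  carrier := {x | ∀ m n, opEnt x.1 m n = opEnt x.2.unop n m}
  -- Transposition reverses products; this is the reason for the opposite algebra in the second
  -- factor.
  mul_mem' := by
    intro x y hx hy m n
    refine (hasSum_opEnt_mul x.1 y.1 m n).unique ?_
    refine (hasSum_opEnt_mul y.2.unop x.2.unop n m).congr_fun fun p => ?_
    rw [hx, hy, mul_comm]
  add_mem' := by
    intro x y hx hy m n
    simp only [opEnt, Prod.fst_add, Prod.snd_add, MulOpposite.unop_add,
      _root_.add_apply, map_add]
    exact congrArg₂ _ (hx m n) (hy m n)
  algebraMap_mem' := by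
    intro c m n
    simp only [Algebra.algebraMap_eq_smul_one, opEnt, Prod.smul_fst, Prod.smul_snd, Prod.fst_one,
      Prod.snd_one, MulOpposite.unop_smul, MulOpposite.unop_one, _root_.smul_apply,
      map_smul, one_apply_eq_self, coord_unitVec, eq_comm]

/-- The Banach algebra of matrices over `ℤ²` with bounded row sums and bounded column sums. -/
def Schur : Type := schurSub

instance : NormedRing Schur := inferInstanceAs (NormedRing schurSub)
instance : NormedAlgebra ℂ Schur := inferInstanceAs (NormedAlgebra ℂ schurSub)
instance : CompleteSpace Schur := by
  have : IsClosed (schurSub : Set (Op × Opᵐᵒᵖ)) := by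
    have : (schurSub : Set (Op × Opᵐᵒᵖ)) =
        ⋂ m, ⋂ n, {x | opEnt x.1 m n = opEnt x.2.unop n m} := by
      ext x; simp only [Set.mem_iInter]; rfl
    rw [this]
    exact isClosed_iInter fun m => isClosed_iInter fun n => isClosed_eq
      ((continuous_opEnt m n).comp continuous_fst)
      ((continuous_opEnt n m).comp (MulOpposite.continuous_unop.comp continuous_snd))
  exact this.completeSpace_coe

namespace Schur

/-- The operator on `ℓ¹` given by a matrix. -/
def toOp : Schur →L[ℂ] Op := (ContinuousLinearMap.fst ℂ Op Opᵐᵒᵖ).comp schurSub.toSubmodule.subtypeL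

/-- The matrix entries. -/
def ent (m n : Idx) : Schur →L[ℂ] ℂ :=
  ((coord m).comp (ContinuousLinearMap.apply ℂ L1 (unitVec n))).comp toOp

theorem ent_eq_snd (x : Schur) (m n : Idx) : ent m n x = opEnt x.1.2.unop n m := x.2 m n

theorem hasSum_ent_mul (x y : Schur) (m n : Idx) :
    HasSum (fun p => ent m p x * ent p n y) (ent m n (x * y)) :=
  hasSum_opEnt_mul x.1.1 y.1.1 m n

theorem ent_one (m n : Idx) : ent m n 1 = if m = n then 1 else 0 := opEnt_one m n

theorem col_sum_le (x : Schur) (n : Idx) (s : Finset Idx) : ∑ m ∈ s, ‖ent m n x‖ ≤ ‖x‖ :=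
  (Op.sum_le x.1.1 n s).trans (le_max_left _ _)

theorem row_sum_le (x : Schur) (m : Idx) (s : Finset Idx) : ∑ n ∈ s, ‖ent m n x‖ ≤ ‖x‖ := by
  simp only [ent_eq_snd]
  exact (Op.sum_le x.1.2.unop m s).trans (le_max_right _ _)

theorem norm_ent_le (x : Schur) (m n : Idx) : ‖ent m n x‖ ≤ ‖x‖ := by
  simpa using col_sum_le x n {m}

/-- The norm is the larger of two operator norms on ℓ¹. Such a norm is governed by column sums,
which for the transpose are the row sums. -/
theorem norm_le_of {x : Schur} {C : ℝ} (hcol : ∀ n, ∀ s : Finset Idx, ∑ m ∈ s, ‖ent m n x‖ ≤ C)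
    (hrow : ∀ m, ∀ s : Finset Idx, ∑ n ∈ s, ‖ent m n x‖ ≤ C) : ‖x‖ ≤ C := by
  have hC : 0 ≤ C := by simpa using hcol 0 ∅
  simp only [ent_eq_snd] at hrow
  exact max_le (Op.norm_le_of_sum_le hC hcol) (Op.norm_le_of_sum_le hC hrow)

@[ext] theorem ext {x y : Schur} (h : ∀ m n, ent m n x = ent m n y) : x = y := by
  refine Subtype.ext (Prod.ext (Op.ext_ent h) (MulOpposite.unop_injective (Op.ext_ent ?_)))
  intro m n
  have := h n m
  rwa [ent_eq_snd, ent_eq_snd] at this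

/-- `a` has row sums and column sums at most `C`. -/
def Bdd (a : Mat ℂ) (C : ℝ) : Prop :=
  (∀ n, ∀ s : Finset Idx, ∑ m ∈ s, ‖a m n‖ ≤ C) ∧ ∀ m, ∀ s : Finset Idx, ∑ n ∈ s, ‖a m n‖ ≤ C

theorem exists_of_bdd {a : Mat ℂ} {C : ℝ} (h : Bdd a C) : ∃ x : Schur, ∀ m n, ent m n x = a m n := by
  obtain ⟨S, hS⟩ := Op.exists_of_sum_le h.1
  obtain ⟨T, hT⟩ := Op.exists_of_sum_le (a := fun m n => a n m) h.2
  exact ⟨⟨⟨S, MulOpposite.op T⟩, fun m n => by simp [hS, hT]⟩, hS⟩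

open Classical in
/-- The element of the algebra with the given entries (zero if the sums are unbounded). -/
def ofMat (a : Mat ℂ) : Schur := if h : ∃ x : Schur, ∀ m n, ent m n x = a m n then h.choose else 0

theorem ent_ofMat {a : Mat ℂ} {C : ℝ} (h : Bdd a C) (m n : Idx) : ent m n (ofMat a) = a m n := by
  have h' := exists_of_bdd h
  rw [ofMat, dif_pos h']
  exact h'.choose_spec m n

theorem norm_ofMat_le {a : Mat ℂ} {C : ℝ} (h : Bdd a C) : ‖ofMat a‖ ≤ C := by
  refine norm_le_of ?_ ?_ <;> simp only [ent_ofMat h]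
  exacts [h.1, h.2]

theorem mul_ent (x y : Schur) :
    mul (fun m n => ent m n x) (fun m n => ent m n y) = fun m n => ent m n (x * y) := by
  funext m n
  exact (hasSum_ent_mul x y m n).tsum_eq

theorem pow_ent (x : Schur) (r : ℕ) :
    pow (fun m n => ent m n x) r = fun m n => ent m n (x ^ r) := by
  induction r with
  | zero => funext m n; simp [pow, ent_one]
  | succ r ih => rw [pow, ih, mul_ent, pow_succ]

/-! #### Comparison with the norm `‖·‖₀` -/

theorem tsum_enorm_le_of_sum_le {ι : Type*} {V : Type*} [NormedAddCommGroup V] {a : ι → V} {C : ℝ}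
    (h : ∀ s : Finset ι, ∑ i ∈ s, ‖a i‖ ≤ C) : ∑' i, ‖a i‖ₑ ≤ ENNReal.ofReal C := by
  rw [ENNReal.tsum_eq_iSup_sum]
  refine iSup_le fun s => ?_
  calc ∑ i ∈ s, ‖a i‖ₑ = ENNReal.ofReal (∑ i ∈ s, ‖a i‖) := by
        rw [ENNReal.ofReal_sum_of_nonneg fun i _ => norm_nonneg _]
        simp [ofReal_norm]
    _ ≤ _ := ENNReal.ofReal_le_ofReal (h s)

theorem norm0_le_of_sum_le {V : Type} [NormedAddCommGroup V] {a : Mat V} {C : ℝ}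
    (hcol : ∀ n, ∀ s : Finset Idx, ∑ m ∈ s, ‖a m n‖ ≤ C)
    (hrow : ∀ m, ∀ s : Finset Idx, ∑ n ∈ s, ‖a m n‖ ≤ C) : norm0 a ≤ ENNReal.ofReal C := by
  have : (⨆ r, ∑' p, (‖a p r‖ₑ + ‖a r p‖ₑ)) ≤ ENNReal.ofReal C * 2 := by
    refine iSup_le fun r => ?_
    rw [ENNReal.tsum_add, mul_two]
    exact add_le_add (tsum_enorm_le_of_sum_le (hcol r)) (tsum_enorm_le_of_sum_le (hrow r))
  rw [norm0]
  exact ENNReal.div_le_of_le_mul this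

/-- ‖·‖₀ averages a column sum and a row sum with the same index, while the algebra norm bounds each
of them. Convergence and differentiability in ‖·‖₀ are thereby reduced to the algebra norm. -/
theorem norm0_ent_le (x : Schur) : norm0 (fun m n => ent m n x) ≤ ENNReal.ofReal ‖x‖ :=
  norm0_le_of_sum_le (col_sum_le x) (row_sum_le x)

/-! #### Holomorphic families -/

section

variable {E : Type*} [NormedAddCommGroup E] [NormedSpace ℂ E]

theorem exists_phase (z : ℂ) : ∃ c : ℂ, ‖c‖ ≤ 1 ∧ c * z = ‖z‖ := by
  rcases eq_or_ne z 0 with rfl | hz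
  · exact ⟨0, by simp⟩
  · refine ⟨‖z‖ / z, ?_, by field_simp⟩
    rw [norm_div, Complex.norm_real, norm_norm, div_self (norm_ne_zero_iff.mpr hz)]

theorem norm_sum_phase_le {ι : Type*} (s : Finset ι) (c a : ι → ℂ) (hc : ∀ i, ‖c i‖ ≤ 1) :
    ‖∑ i ∈ s, c i * a i‖ ≤ ∑ i ∈ s, ‖a i‖ :=
  (norm_sum_le _ _).trans (Finset.sum_le_sum fun i _ => by
    rw [norm_mul]; exact mul_le_of_le_one_left (norm_nonneg _) (hc i))

/-- Phases adapted to the derivatives at x in direction h reduce the sum to the Cauchy estimate of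
one scalar function. -/
theorem sum_fderiv_le {ι : Type*} {f : ι → E → ℂ} {x : E} {r M : ℝ} (hr : 0 < r)
    (s : Finset ι) (hf : ∀ i, DifferentiableOn ℂ (f i) (Metric.ball x r))
    (hM : ∀ y ∈ Metric.ball x r, ∑ i ∈ s, ‖f i y‖ ≤ M) (h : E) :
    ∑ i ∈ s, ‖fderiv ℂ (f i) x h‖ ≤ 4 * M / r * ‖h‖ := by
  choose c hc1 hc2 using fun i => exists_phase (fderiv ℂ (f i) x h)
  have hat : ∀ i, DifferentiableAt ℂ (f i) x := fun i =>
    (hf i x (Metric.mem_ball_self hr)).differentiableAt (Metric.ball_mem_nhds x hr)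
  have h1 := norm_fderiv_apply_le (f := fun y => ∑ i ∈ s, c i * f i y) hr
    (DifferentiableOn.fun_sum fun i _ => (hf i).const_mul (c i))
    (fun y hy => (norm_sum_phase_le s c _ hc1).trans (hM y hy)) h
  rw [fderiv_fun_sum fun i _ => (hat i).const_mul (c i), _root_.sum_apply] at h1
  have : ∀ i, fderiv ℂ (fun y => c i * f i y) x h = ‖fderiv ℂ (f i) x h‖ := fun i => by
    rw [fderiv_const_mul (hat i), ← hc2]; rfl
  simp only [this] at h1
  rw [← Complex.ofReal_sum, Complex.norm_real] at h1
  exact (le_abs_self _).trans h1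

theorem sum_taylor_remainder_le {ι : Type*} {f : ι → E → ℂ} {x : E} {r M : ℝ} (hr : 0 < r)
    (s : Finset ι) (hf : ∀ i, DifferentiableOn ℂ (f i) (Metric.ball x r))
    (hM : ∀ y ∈ Metric.ball x r, ∑ i ∈ s, ‖f i y‖ ≤ M) {h : E} (hh : ‖h‖ < r / 4) :
    ∑ i ∈ s, ‖f i (x + h) - f i x - fderiv ℂ (f i) x h‖ ≤ 32 * M / r ^ 2 * ‖h‖ ^ 2 := by
  choose c hc1 hc2 using fun i => exists_phase (f i (x + h) - f i x - fderiv ℂ (f i) x h)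
  have hat : ∀ i, DifferentiableAt ℂ (f i) x := fun i =>
    (hf i x (Metric.mem_ball_self hr)).differentiableAt (Metric.ball_mem_nhds x hr)
  have h1 := norm_taylor_remainder_le (f := fun y => ∑ i ∈ s, c i * f i y) hr
    (DifferentiableOn.fun_sum fun i _ => (hf i).const_mul (c i))
    (fun y hy => (norm_sum_phase_le s c _ hc1).trans (hM y hy)) hh
  rw [fderiv_fun_sum fun i _ => (hat i).const_mul (c i), _root_.sum_apply] at h1
  have : ∀ i, fderiv ℂ (fun y => c i * f i y) x h = c i * fderiv ℂ (f i) x h := fun i => by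
    rw [fderiv_const_mul (hat i)]; rfl
  simp only [this] at h1
  rw [← Finset.sum_sub_distrib, ← Finset.sum_sub_distrib] at h1
  simp only [← mul_sub, hc2] at h1
  rw [← Complex.ofReal_sum, Complex.norm_real] at h1
  exact (le_abs_self _).trans h1

/-- A bounded family of matrices with holomorphic entries is holomorphic in norm. -/
theorem differentiableOn_of_ent {G : E → Schur} {U : Set E} (hU : IsOpen U) {M : ℝ}
    (hG : ∀ m n, DifferentiableOn ℂ (fun x => ent m n (G x)) U) (hM : ∀ x ∈ U, ‖G x‖ ≤ M) :
    DifferentiableOn ℂ G U := by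
  intro x hx
  obtain ⟨r, hr, hball⟩ := Metric.isOpen_iff.mp hU x hx
  have hd : ∀ m n, DifferentiableOn ℂ (fun x => ent m n (G x)) (Metric.ball x r) :=
    fun m n => (hG m n).mono hball
  have hcol : ∀ n, ∀ s : Finset Idx, ∀ y ∈ Metric.ball x r, ∑ m ∈ s, ‖ent m n (G y)‖ ≤ M :=
    fun n s y hy => (col_sum_le _ n s).trans (hM y (hball hy))
  have hrow : ∀ m, ∀ s : Finset Idx, ∀ y ∈ Metric.ball x r, ∑ n ∈ s, ‖ent m n (G y)‖ ≤ M :=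
    fun m s y hy => (row_sum_le _ m s).trans (hM y (hball hy))
  -- The candidate for the derivative is the matrix of entrywise derivatives. Cauchy's estimate for
  -- finite row and column sums shows that it belongs to the algebra.
  have hb : ∀ h, Bdd (fun m n => fderiv ℂ (fun x => ent m n (G x)) x h) (4 * M / r * ‖h‖) :=
    fun h => ⟨fun n s => sum_fderiv_le hr s (fun m => hd m n) (hcol n s) h,
      fun m s => sum_fderiv_le hr s (fun n => hd m n) (hrow m s) h⟩
  let L : E →ₗ[ℂ] Schur :=
    { toFun := fun h => ofMat fun m n => fderiv ℂ (fun x => ent m n (G x)) x h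
      map_add' := fun a b => by
        ext m n
        rw [map_add, ent_ofMat (hb _), ent_ofMat (hb _), ent_ofMat (hb _), map_add]
      map_smul' := fun c a => by
        ext m n
        rw [RingHom.id_apply, map_smul, ent_ofMat (hb _), ent_ofMat (hb _), map_smul] }
  let L' : E →L[ℂ] Schur := L.mkContinuous (4 * M / r) fun h => norm_ofMat_le (hb h)
  refine DifferentiableAt.differentiableWithinAt ⟨L', ?_⟩
  refine hasFDerivAt_of_norm_remainder_le (r := r / 4) (K := 32 * M / r ^ 2) (by positivity) ?_
  intro h hh
  have e : ∀ m n, ent m n (G (x + h) - G x - L' h) =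
      ent m n (G (x + h)) - ent m n (G x) - fderiv ℂ (fun x => ent m n (G x)) x h := by
    intro m n
    rw [map_sub, map_sub]
    congr 1
    exact ent_ofMat (hb h) m n
  refine norm_le_of (fun n s => ?_) (fun m s => ?_) <;> simp only [e]
  · exact sum_taylor_remainder_le hr s (fun m => hd m n) (hcol n s) hh
  · exact sum_taylor_remainder_le hr s (fun n => hd m n) (hrow m s) hh

end

theorem grad_ent {G : C2 → Schur} {t : C2} (hG : DifferentiableAt ℂ G t) (m n : Idx) (i : Fin 2) :
    grad (fun s => ent m n (G s)) t i = ent m n (fderiv ℂ G t (EuclideanSpace.single i 1)) := by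
  have := ((ent m n).hasFDerivAt.comp t hG.hasFDerivAt).fderiv
  simp only [grad]
  erw [this]
  rfl

theorem norm_C2_le (x : C2) : ‖x‖ ≤ ‖x 0‖ + ‖x 1‖ := by
  rw [EuclideanSpace.norm_eq, Fin.sum_univ_two]
  refine Real.sqrt_le_iff.mpr ⟨by positivity, ?_⟩
  nlinarith [norm_nonneg (x 0), norm_nonneg (x 1)]

/-- The length of a vector in ℂ² is at most the sum of its two coordinates' moduli, and each partial
derivative is an element of the algebra. This is the source of the factor 2. -/
theorem norm0_matGrad_le {T : C2 → Mat ℂ} {G : C2 → Schur} {t : C2} (hG : DifferentiableAt ℂ G t)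
    (hT : ∀ᶠ s in 𝓝 t, ∀ m n, T s m n = ent m n (G s)) :
    norm0 (matGrad T t) ≤ ENNReal.ofReal (2 * ‖fderiv ℂ G t‖) := by
  have e : ∀ m n, matGrad T t m n = grad (fun s => ent m n (G s)) t := fun m n => by
    have : (fun s => T s m n) =ᶠ[𝓝 t] fun s => ent m n (G s) := hT.mono fun s hs => hs m n
    simp only [matGrad, grad, this.fderiv_eq]
  have hb : ∀ m n, ‖matGrad T t m n‖ ≤ ‖ent m n (fderiv ℂ G t (EuclideanSpace.single 0 1))‖ +
      ‖ent m n (fderiv ℂ G t (EuclideanSpace.single 1 1))‖ := fun m n => by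
    rw [e]
    refine (norm_C2_le _).trans_eq ?_
    rw [grad_ent hG, grad_ent hG]
  have hle : ∀ i : Fin 2, ‖fderiv ℂ G t (EuclideanSpace.single i 1)‖ ≤ ‖fderiv ℂ G t‖ := fun i => by
    simpa using (fderiv ℂ G t).le_opNorm (EuclideanSpace.single i 1)
  refine norm0_le_of_sum_le (fun n s => ?_) (fun m s => ?_)
  · refine (Finset.sum_le_sum fun m _ => hb m n).trans ?_
    rw [Finset.sum_add_distrib]
    linarith [col_sum_le (fderiv ℂ G t (EuclideanSpace.single 0 1)) n s, hle 0, hle 1,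
      col_sum_le (fderiv ℂ G t (EuclideanSpace.single 1 1)) n s]
  · refine (Finset.sum_le_sum fun n _ => hb m n).trans ?_
    rw [Finset.sum_add_distrib]
    linarith [row_sum_le (fderiv ℂ G t (EuclideanSpace.single 0 1)) m s, hle 0, hle 1,
      row_sum_le (fderiv ℂ G t (EuclideanSpace.single 1 1)) m s]

theorem matGrad_eq_of_eventuallyEq {T : C2 → Mat ℂ} {G : C2 → Schur} {t : C2}
    (hT : ∀ᶠ s in 𝓝 t, ∀ m n, T s m n = ent m n (G s)) :
    matGrad T t = matGrad (fun s m n => ent m n (G s)) t := by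
  funext m n
  have : (fun s => T s m n) =ᶠ[𝓝 t] fun s => ent m n (G s) := hT.mono fun s hs => hs m n
  simp only [matGrad, grad, this.fderiv_eq]

/-- The entries of the Taylor remainder in the algebra are exactly the remainders of the definition,
and the algebra norm dominates ‖·‖₀. -/
theorem differentiableAt0_of_ent {T : C2 → Mat ℂ} {G : C2 → Schur} {t : C2}
    (hG : DifferentiableAt ℂ G t) (hT : ∀ᶠ s in 𝓝 t, ∀ m n, T s m n = ent m n (G s)) :
    DifferentiableAt0 T t := by
  have ev : ∀ m n, (fun s => T s m n) =ᶠ[𝓝 t] fun s => ent m n (G s) :=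
    fun m n => hT.mono fun s hs => hs m n
  refine ⟨fun m n => (((ent m n).differentiableAt.comp t hG).congr_of_eventuallyEq (ev m n)), ?_⟩
  have hdec : ∀ h : C2, fderiv ℂ G t h = ∑ i, h i • fderiv ℂ G t (EuclideanSpace.single i 1) := by
    intro h
    have : h = ∑ i, h i • (EuclideanSpace.single i 1 : C2) := by
      ext k; fin_cases k <;> simp [Fin.sum_univ_two]
    conv_lhs => rw [this]
    simp
  have hlo := (hasFDerivAt_iff_isLittleO_nhds_zero.mp hG.hasFDerivAt)
  have hb : ∀ᶠ h in 𝓝[≠] (0 : C2),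
      norm0 (fun m n => T (t + h) m n - T t m n - ∑ i, h i * matGrad T t m n i) / ‖h‖ₑ ≤
        ENNReal.ofReal (‖G (t + h) - G t - fderiv ℂ G t h‖ / ‖h‖) := by
    have h1 : ∀ᶠ h in 𝓝 (0 : C2), ∀ m n, T (t + h) m n = ent m n (G (t + h)) := by
      have : Filter.Tendsto (fun h : C2 => t + h) (𝓝 0) (𝓝 t) := by
        simpa using (continuous_const_add t).tendsto (0 : C2)
      exact this.eventually hT
    filter_upwards [h1.filter_mono nhdsWithin_le_nhds, self_mem_nhdsWithin] with h hh hne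
    have hpos : 0 < ‖h‖ := norm_pos_iff.mpr hne
    have e : (fun m n => T (t + h) m n - T t m n - ∑ i, h i * matGrad T t m n i) =
        fun m n => ent m n (G (t + h) - G t - fderiv ℂ G t h) := by
      funext m n
      rw [hh, hT.self_of_nhds, map_sub, map_sub, hdec, map_sum]
      congr 1
      refine Finset.sum_congr rfl fun i _ => ?_
      rw [map_smul, smul_eq_mul, matGrad_eq_of_eventuallyEq hT, matGrad, grad_ent hG]
    rw [e, ENNReal.ofReal_div_of_pos hpos, ofReal_norm h]
    exact ENNReal.div_le_div_right (norm0_ent_le _) _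
  have hlim : Filter.Tendsto (fun h => ENNReal.ofReal (‖G (t + h) - G t - fderiv ℂ G t h‖ / ‖h‖))
      (𝓝[≠] (0 : C2)) (𝓝 0) := by
    have := hlo.norm_norm.tendsto_div_nhds_zero.mono_left (nhdsWithin_le_nhds (s := {0}ᶜ))
    simpa using ENNReal.tendsto_ofReal this
  exact tendsto_of_tendsto_of_tendsto_of_le_of_le' tendsto_const_nhds hlim
    (Filter.Eventually.of_forall fun _ => zero_le) hb

end Schur

/-! ### Neumann series -/

section Neumann

variable {𝔸 : Type*} [NormedRing 𝔸] [NormedAlgebra ℂ 𝔸]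

theorem norm_neg_one_pow_smul (r : ℕ) (x : 𝔸) : ‖(-1 : ℂ) ^ r • x‖ = ‖x‖ := by
  rw [norm_smul, norm_pow, norm_neg, norm_one, one_pow, one_mul]

/-- The weight `ε² P + (1 - P)`. -/
def wt (P : 𝔸) (ε : ℝ) : 𝔸 := ((ε ^ 2 : ℝ) : ℂ) • P + (1 - P)

/-- The inverse weight. -/
def wtInv (P : 𝔸) (ε : ℝ) : 𝔸 := (((ε ^ 2)⁻¹ : ℝ) : ℂ) • P + (1 - P)

theorem smul_add_compl_mul {P : 𝔸} (hP : P * P = P) (a b : ℂ) :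
    (a • P + (1 - P)) * (b • P + (1 - P)) = (a * b) • P + (1 - P) := by
  have h1 : P * (1 - P) = 0 := by rw [mul_sub, mul_one, hP, sub_self]
  have h2 : (1 - P) * P = 0 := by rw [sub_mul, one_mul, hP, sub_self]
  have h3 : (1 - P) * (1 - P) = 1 - P := by rw [mul_sub, mul_one, h2, sub_zero]
  rw [add_mul, mul_add, mul_add, h3, smul_mul_assoc, smul_mul_assoc, mul_smul_comm, mul_smul_comm,
    hP, h1, h2, smul_zero, smul_zero, smul_smul, add_zero, zero_add]

theorem wt_mul_wtInv {P : 𝔸} (hP : P * P = P) {ε : ℝ} (hε : 0 < ε) : wt P ε * wtInv P ε = 1 := by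
  rw [wt, wtInv, smul_add_compl_mul hP, ← Complex.ofReal_mul, mul_inv_cancel₀ (by positivity),
    Complex.ofReal_one, one_smul, add_sub_cancel]

theorem wtInv_mul_wt {P : 𝔸} (hP : P * P = P) {ε : ℝ} (hε : 0 < ε) : wtInv P ε * wt P ε = 1 := by
  rw [wt, wtInv, smul_add_compl_mul hP, ← Complex.ofReal_mul, inv_mul_cancel₀ (by positivity),
    Complex.ofReal_one, one_smul, add_sub_cancel]

/-- The conjugated kernel. -/
def wtKer (P R X : 𝔸) (ε : ℝ) : 𝔸 := wt P ε * (R * X) * wtInv P ε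

theorem norm_real_smul {c : ℝ} (hc : 0 ≤ c) (x : 𝔸) : ‖((c : ℝ) : ℂ) • x‖ = c * ‖x‖ := by
  rw [norm_smul, Complex.norm_real, Real.norm_of_nonneg hc]

/-- Bounds for the blocks of the free resolvent `R` and of the potential `X` with respect to the
projection `P`. -/
structure BlockBound (P R X : 𝔸) (ε : ℝ) : Prop where
  idem : P * P = P
  norm_le : ‖P‖ ≤ 1
  norm_compl_le : ‖1 - P‖ ≤ 1
  comm : R * P = P * R
  res : ‖P * R‖ ≤ 10 * (ε ^ 10)⁻¹
  res_compl : ‖(1 - P) * R‖ ≤ (ε ^ 6)⁻¹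
  pot_block : ‖P * X * P‖ ≤ 18 * ε ^ 11
  pot : ‖X‖ ≤ 6 * ε ^ 9

/-- The Neumann series `∑ (-1)^r (R X)^r R` for `(R⁻¹ + X)⁻¹`. -/
def neu (R X : 𝔸) : 𝔸 := ∑' r : ℕ, (-1 : ℂ) ^ r • ((R * X) ^ r * R)

/-- Absolute convergence of the Neumann series. -/
def NeuSummable (R X : 𝔸) : Prop := Summable fun r : ℕ => ‖(R * X) ^ r * R‖

namespace BlockBound

variable {P R X : 𝔸} {ε : ℝ}

/-- Before conjugation the corners of RX have sizes ε (block to block), ε⁻¹ (complement to block),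
ε³ (block to complement) and ε³. The weights multiply the second by ε² and the third by ε⁻², so
everything becomes O(ε). The four contributions are 180 ε, 60 ε, 6 ε and at most 6 ε. -/
theorem norm_wtKer_le (h : BlockBound P R X ε) (hε : 0 < ε) (hε1 : ε ≤ 1) :
    ‖wtKer P R X ε‖ ≤ 260 * ε := by
  have hPR : P * R = P * R * P := by rw [mul_assoc, h.comm, ← mul_assoc, h.idem]
  have e : wtKer P R X ε = P * R * (P * X * P) + ((ε ^ 2 : ℝ) : ℂ) • (P * R * (X * (1 - P))) +
      (((ε ^ 2)⁻¹ : ℝ) : ℂ) • ((1 - P) * R * (X * P)) + (1 - P) * R * (X * (1 - P)) := by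
    have e1 : P * R * (P * X * P) = P * R * X * P := by
      conv_rhs => rw [hPR]
      simp only [mul_assoc]
    have hc : (((ε ^ 2 : ℝ) : ℂ) * (((ε ^ 2)⁻¹ : ℝ) : ℂ)) = 1 := by
      rw [← Complex.ofReal_mul, mul_inv_cancel₀ (by positivity), Complex.ofReal_one]
    rw [e1, wtKer, wt, wtInv]
    simp only [add_mul, mul_add, smul_mul_assoc, mul_smul_comm, smul_smul, smul_add]
    rw [mul_comm, hc, one_smul]
    simp only [mul_assoc]
    abel
  have hXP : ‖X * P‖ ≤ 6 * ε ^ 9 := (norm_mul_le _ _).trans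
    ((mul_le_of_le_one_right (norm_nonneg _) h.norm_le).trans h.pot)
  have hXQ : ‖X * (1 - P)‖ ≤ 6 * ε ^ 9 := (norm_mul_le _ _).trans
    ((mul_le_of_le_one_right (norm_nonneg _) h.norm_compl_le).trans h.pot)
  have t1 : ‖P * R * (P * X * P)‖ ≤ 10 * (ε ^ 10)⁻¹ * (18 * ε ^ 11) :=
    (norm_mul_le _ _).trans (mul_le_mul h.res h.pot_block (norm_nonneg _) (by positivity))
  have t2 : ‖((ε ^ 2 : ℝ) : ℂ) • (P * R * (X * (1 - P)))‖ ≤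
      ε ^ 2 * (10 * (ε ^ 10)⁻¹ * (6 * ε ^ 9)) := by
    rw [norm_real_smul (by positivity)]
    gcongr
    exact (norm_mul_le _ _).trans (mul_le_mul h.res hXQ (norm_nonneg _) (by positivity))
  have t3 : ‖(((ε ^ 2)⁻¹ : ℝ) : ℂ) • ((1 - P) * R * (X * P))‖ ≤
      (ε ^ 2)⁻¹ * ((ε ^ 6)⁻¹ * (6 * ε ^ 9)) := by
    rw [norm_real_smul (by positivity)]
    gcongr
    exact (norm_mul_le _ _).trans (mul_le_mul h.res_compl hXP (norm_nonneg _) (by positivity))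
  have t4 : ‖(1 - P) * R * (X * (1 - P))‖ ≤ (ε ^ 6)⁻¹ * (6 * ε ^ 9) :=
    (norm_mul_le _ _).trans (mul_le_mul h.res_compl hXQ (norm_nonneg _) (by positivity))
  rw [e]
  have s1 : 10 * (ε ^ 10)⁻¹ * (18 * ε ^ 11) = 180 * ε := by field_simp; ring
  have s2 : ε ^ 2 * (10 * (ε ^ 10)⁻¹ * (6 * ε ^ 9)) = 60 * ε := by field_simp; ring
  have s3 : (ε ^ 2)⁻¹ * ((ε ^ 6)⁻¹ * (6 * ε ^ 9)) = 6 * ε := by field_simp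
  have s4 : (ε ^ 6)⁻¹ * (6 * ε ^ 9) ≤ 6 * ε := by
    have : (ε ^ 6)⁻¹ * (6 * ε ^ 9) = 6 * ε * ε ^ 2 := by field_simp
    rw [this]
    exact mul_le_of_le_one_right (by positivity) (pow_le_one₀ hε.le hε1)
  refine (norm_add_le _ _).trans ?_
  linarith [norm_add₃_le (a := P * R * (P * X * P))
    (b := ((ε ^ 2 : ℝ) : ℂ) • (P * R * (X * (1 - P))))
    (c := (((ε ^ 2)⁻¹ : ℝ) : ℂ) • ((1 - P) * R * (X * P)))]

theorem pow_eq (h : BlockBound P R X ε) (hε : 0 < ε) (r : ℕ) :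
    (R * X) ^ r = wtInv P ε * wtKer P R X ε ^ r * wt P ε := by
  induction r with
  | zero => rw [pow_zero, pow_zero, mul_one, wtInv_mul_wt h.idem hε]
  | succ r ih =>
    rw [pow_succ (R * X), ih, pow_succ (wtKer P R X ε)]
    have : wtKer P R X ε * wt P ε = wt P ε * (R * X) := by
      rw [wtKer, mul_assoc, wtInv_mul_wt h.idem hε, mul_one]
    rw [← mul_assoc (wtInv P ε), mul_assoc _ (wtKer P R X ε) (wt P ε), this]
    simp only [mul_assoc]

variable [NormOneClass 𝔸]

theorem norm_pow_wtKer_le (h : BlockBound P R X ε) (hε : 0 < ε) (hε1 : ε ≤ 1) (r : ℕ) :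
    ‖wtKer P R X ε ^ r‖ ≤ (260 * ε) ^ r :=
  (norm_pow_le _ r).trans (pow_le_pow_left₀ (norm_nonneg _) (h.norm_wtKer_le hε hε1) r)

/-- Undoing the conjugation costs ε⁻² only in the term whose last factor is (1 - P) R, of size ε⁻⁶.
The total ε⁻⁸ is still below the ε⁻¹⁰ of the block, so the weights leave no trace in the final
bound. -/
theorem norm_pow_mul_le (h : BlockBound P R X ε) (hε : 0 < ε) (hε1 : ε ≤ 1 / 10) (r : ℕ) :
    ‖(R * X) ^ r * R‖ ≤ 20 * (ε ^ 10)⁻¹ * (260 * ε) ^ r := by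
  have hM := h.norm_pow_wtKer_le hε (by linarith) r
  have e : (R * X) ^ r * R = P * wtKer P R X ε ^ r * (P * R) +
      (((ε ^ 2)⁻¹ : ℝ) : ℂ) • (P * wtKer P R X ε ^ r * ((1 - P) * R)) +
      ((ε ^ 2 : ℝ) : ℂ) • ((1 - P) * wtKer P R X ε ^ r * (P * R)) +
      (1 - P) * wtKer P R X ε ^ r * ((1 - P) * R) := by
    have hc : (((ε ^ 2 : ℝ) : ℂ) * (((ε ^ 2)⁻¹ : ℝ) : ℂ)) = 1 := by
      rw [← Complex.ofReal_mul, mul_inv_cancel₀ (by positivity), Complex.ofReal_one]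
    rw [h.pow_eq hε, wt, wtInv]
    simp only [add_mul, mul_add, smul_mul_assoc, mul_smul_comm, smul_smul, smul_add, mul_assoc]
    rw [hc, one_smul]
    abel
  set K := wtKer P R X ε ^ r
  set m := (260 * ε) ^ r
  have hm : 0 ≤ m := by positivity
  have hPK : ‖P * K‖ ≤ m :=
    (norm_mul_le _ _).trans ((mul_le_of_le_one_left (norm_nonneg _) h.norm_le).trans hM)
  have hQK : ‖(1 - P) * K‖ ≤ m :=
    (norm_mul_le _ _).trans ((mul_le_of_le_one_left (norm_nonneg _) h.norm_compl_le).trans hM)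
  have t1 : ‖P * K * (P * R)‖ ≤ m * (10 * (ε ^ 10)⁻¹) :=
    (norm_mul_le _ _).trans (mul_le_mul hPK h.res (norm_nonneg _) hm)
  have t2 : ‖(((ε ^ 2)⁻¹ : ℝ) : ℂ) • (P * K * ((1 - P) * R))‖ ≤
      (ε ^ 2)⁻¹ * (m * (ε ^ 6)⁻¹) := by
    rw [norm_real_smul (by positivity)]
    gcongr
    exact (norm_mul_le _ _).trans (mul_le_mul hPK h.res_compl (norm_nonneg _) hm)
  have t3 : ‖((ε ^ 2 : ℝ) : ℂ) • ((1 - P) * K * (P * R))‖ ≤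
      ε ^ 2 * (m * (10 * (ε ^ 10)⁻¹)) := by
    rw [norm_real_smul (by positivity)]
    gcongr
    exact (norm_mul_le _ _).trans (mul_le_mul hQK h.res (norm_nonneg _) hm)
  have t4 : ‖(1 - P) * K * ((1 - P) * R)‖ ≤ m * (ε ^ 6)⁻¹ :=
    (norm_mul_le _ _).trans (mul_le_mul hQK h.res_compl (norm_nonneg _) hm)
  have hε2 : ε ^ 2 ≤ 1 / 10 := by nlinarith
  have hε4 : ε ^ 4 ≤ 1 / 10 := by nlinarith
  have s2 : (ε ^ 2)⁻¹ * (m * (ε ^ 6)⁻¹) ≤ m * (ε ^ 10)⁻¹ := by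
    have : (ε ^ 2)⁻¹ * (m * (ε ^ 6)⁻¹) = m * (ε ^ 10)⁻¹ * ε ^ 2 := by field_simp
    rw [this]; exact mul_le_of_le_one_right (by positivity) (by linarith)
  have s3 : ε ^ 2 * (m * (10 * (ε ^ 10)⁻¹)) ≤ m * (ε ^ 10)⁻¹ := by
    have : ε ^ 2 * (m * (10 * (ε ^ 10)⁻¹)) = m * (ε ^ 10)⁻¹ * (10 * ε ^ 2) := by ring
    rw [this]; exact mul_le_of_le_one_right (by positivity) (by linarith)
  have s4 : m * (ε ^ 6)⁻¹ ≤ m * (ε ^ 10)⁻¹ := by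
    have : m * (ε ^ 6)⁻¹ = m * (ε ^ 10)⁻¹ * ε ^ 4 := by field_simp
    rw [this]; exact mul_le_of_le_one_right (by positivity) (by linarith)
  have hp : 0 ≤ m * (ε ^ 10)⁻¹ := by positivity
  rw [e]
  refine (norm_add_le _ _).trans ?_
  linarith [norm_add₃_le (a := P * K * (P * R))
    (b := (((ε ^ 2)⁻¹ : ℝ) : ℂ) • (P * K * ((1 - P) * R)))
    (c := ((ε ^ 2 : ℝ) : ℂ) • ((1 - P) * K * (P * R)))]

theorem neuSummable (h : BlockBound P R X ε) (hε : 0 < ε) (hε1 : ε ≤ 1 / 1000) :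
    NeuSummable R X := by
  refine Summable.of_nonneg_of_le (fun _ => norm_nonneg _)
    (fun r => h.norm_pow_mul_le hε (by linarith) r) (Summable.mul_left _ ?_)
  exact summable_geometric_of_lt_one (by positivity) (by linarith)

theorem norm_neu_le (h : BlockBound P R X ε) (hε : 0 < ε) (hε1 : ε ≤ 1 / 10000) :
    ‖neu R X‖ ≤ 21 * (ε ^ 10)⁻¹ := by
  have hg : HasSum (fun r : ℕ => 20 * (ε ^ 10)⁻¹ * (260 * ε) ^ r)
      (20 * (ε ^ 10)⁻¹ * (1 - 260 * ε)⁻¹) :=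
    (hasSum_geometric_of_lt_one (by positivity) (by linarith)).mul_left _
  refine (tsum_of_norm_bounded hg fun r => ?_).trans ?_
  · rw [norm_neg_one_pow_smul]; exact h.norm_pow_mul_le hε (by linarith) r
  · have : (1 - 260 * ε)⁻¹ ≤ 21 / 20 := by
      rw [inv_le_comm₀ (by linarith) (by norm_num)]; linarith
    calc _ ≤ 20 * (ε ^ 10)⁻¹ * (21 / 20) := by gcongr
      _ = _ := by ring

end BlockBound

variable [CompleteSpace 𝔸]

theorem NeuSummable.hasSum {R X : 𝔸} (h : NeuSummable R X) :
    HasSum (fun r : ℕ => (-1 : ℂ) ^ r • ((R * X) ^ r * R)) (neu R X) :=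
  (Summable.of_norm (by simp only [norm_neg_one_pow_smul]; exact h)).hasSum

theorem neu_eq_left {R X : 𝔸} (h : NeuSummable R X) : neu R X = R - R * X * neu R X := by
  have h1 := h.hasSum
  have h2 := (hasSum_nat_add_iff' 1).mpr h1
  have h3 := (h1.mul_left (R * X)).neg
  have : (fun r : ℕ => -(R * X * (-1 : ℂ) ^ r • ((R * X) ^ r * R))) =
      fun r : ℕ => (-1 : ℂ) ^ (r + 1) • ((R * X) ^ (r + 1) * R) := by
    funext r
    rw [pow_succ' (R * X), pow_succ (-1 : ℂ), mul_smul_comm, mul_neg_one, neg_smul, mul_assoc (R * X)]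
  rw [this] at h3
  have := h2.unique h3
  simp only [Finset.range_one, Finset.sum_singleton, pow_zero, one_smul, one_mul] at this
  rw [sub_eq_iff_eq_add] at this
  conv_lhs => rw [this]
  abel

theorem neu_eq_right {R X : 𝔸} (h : NeuSummable R X) : neu R X = R - neu R X * X * R := by
  have h1 := h.hasSum
  have h2 := (hasSum_nat_add_iff' 1).mpr h1
  have h3 := (h1.mul_right (X * R)).neg
  have : (fun r : ℕ => -((-1 : ℂ) ^ r • ((R * X) ^ r * R) * (X * R))) =
      fun r : ℕ => (-1 : ℂ) ^ (r + 1) • ((R * X) ^ (r + 1) * R) := by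
    funext r
    rw [pow_succ (R * X), pow_succ (-1 : ℂ), smul_mul_assoc, mul_neg_one, neg_smul]
    simp only [mul_assoc]
  rw [this] at h3
  have := h2.unique h3
  simp only [Finset.range_one, Finset.sum_singleton, pow_zero, one_smul, one_mul] at this
  rw [sub_eq_iff_eq_add] at this
  conv_lhs => rw [this]
  rw [← mul_assoc]
  abel

/-- The second resolvent identity, for two spectral parameters and two potentials. -/
theorem neu_sub_neu {R R' X X' : 𝔸} (h : NeuSummable R X) (h' : NeuSummable R' X') {c : ℂ}
    (hR : R - R' = c • (R * R')) :
    neu R X - neu R' X' = neu R X * (c • 1 - (X - X')) * neu R' X' := by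
  have e1 := neu_eq_right h
  have e2 := neu_eq_left h'
  set S := neu R X
  set T := neu R' X'
  have f1 : (1 - S * X) * R = S := by rw [sub_mul, one_mul]; exact e1.symm
  have f2 : R' * (1 - X' * T) = T := by rw [mul_sub, mul_one, ← mul_assoc]; exact e2.symm
  -- The factors 1 - S X on the left and 1 - X' T on the right turn R into S and R' into T.
  -- Evaluating the product in two ways gives the identity without inverting R or R', which are
  -- resolvents of unbounded operators in the application.
  have key : (1 - S * X) * (R - R') * (1 - X' * T) = c • (S * T) := by
    rw [hR, mul_smul_comm, smul_mul_assoc]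
    congr 1
    rw [← mul_assoc, f1, mul_assoc, f2]
  have key2 : (1 - S * X) * (R - R') * (1 - X' * T) =
      S * (1 - X' * T) - (1 - S * X) * T := by
    rw [mul_sub (1 - S * X), f1, sub_mul, mul_assoc (1 - S * X) R', f2]
  have key3 := key2.symm.trans key
  have : S * (c • 1 - (X - X')) * T = c • (S * T) - S * X * T + S * X' * T := by
    rw [mul_sub, mul_smul_comm, mul_one, sub_mul, smul_mul_assoc, mul_sub, sub_mul]
    abel
  rw [this, ← key3]
  noncomm_ring

/-- Two Neumann series whose free resolvents differ by a rank one perturbation. -/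
theorem neu_rank_one {R R' X E : 𝔸} (h : NeuSummable R X) (h' : NeuSummable R' X) {τ : ℂ}
    (hR : R = R' + R * E * R') (hτ : E * neu R' X * E = τ • E) (h1 : 1 - τ ≠ 0) :
    neu R X = neu R' X + (1 - τ)⁻¹ • (neu R' X * E * neu R' X) := by
  have e1 := neu_eq_right h
  have e2 := neu_eq_left h'
  set S := neu R X
  set T := neu R' X
  have hx : R' * X * T = R' - T := by rw [eq_sub_iff_add_eq, add_comm, ← eq_sub_iff_add_eq]; exact e2
  have a1 : R * X * T = R' - T + R * E * (R' - T) := by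
    conv_lhs => rw [hR]
    rw [add_mul, add_mul, hx, mul_assoc (R * E * R'), mul_assoc (R * E), ← mul_assoc R', hx]
  have a2 : T + R * X * T = R - R * E * T := by
    have : R * E * R' = R - R' := by conv_rhs => rw [hR, add_sub_cancel_left]
    rw [a1, mul_sub, this]
    abel
  -- The Sherman–Morrison candidate. It satisfies Y + R X Y = R, and left multiplication by 1 - S X,
  -- which turns R into S, then forces Y = S.
  set Y := T + (1 - τ)⁻¹ • (T * E * T) with hY
  have a3 : (T + R * X * T) * E * T = (1 - τ) • (R * E * T) := by
    have hEE : R * E * T * E * T = τ • (R * E * T) := by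
      have : R * E * T * E * T = R * (E * T * E) * T := by noncomm_ring
      rw [this, hτ, mul_smul_comm, smul_mul_assoc]
    rw [a2, sub_mul, sub_mul, hEE, sub_smul, one_smul]
  have a4 : Y + R * X * Y = R := by
    have : Y + R * X * Y = (T + R * X * T) + (1 - τ)⁻¹ • ((T + R * X * T) * E * T) := by
      rw [hY, mul_add, mul_smul_comm, add_mul, add_mul, smul_add]
      simp only [mul_assoc]
      abel
    rw [this, a3, smul_smul, inv_mul_cancel₀ h1, one_smul, a2]
    abel
  have a5 : S = (1 - S * X) * R := by rw [sub_mul, one_mul]; exact e1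
  have a6 : (1 - S * X) * R * X = S * X := by rw [← a5]
  calc S = (1 - S * X) * (Y + R * X * Y) := by rw [a4]; exact a5
    _ = (1 - S * X) * Y + (1 - S * X) * R * X * Y := by noncomm_ring
    _ = Y := by rw [a6]; noncomm_ring

namespace BlockBound

variable {P R X : 𝔸} {ε : ℝ}

variable [NormOneClass 𝔸]

/-- The matrix X - X S X is the effective potential seen by the block. Bounding X S X by norms would
only give ε⁸. In each term of its Neumann series, however, the right end carries the weight ε² and
the left factor is either P X P, of size ε¹¹, or P X (1 - P), of size ε⁹, which appears with that ε²
uncompensated. -/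
theorem norm_block_le (h : BlockBound P R X ε) (hε : 0 < ε) (hε1 : ε ≤ 1 / 10000) :
    ‖P * (X - X * neu R X * X) * P‖ ≤ 30 * ε ^ 11 := by
  have hs := h.neuSummable hε (by linarith)
  have h1 : HasSum (fun r : ℕ => (-1 : ℂ) ^ r • (P * X * (R * X) ^ (r + 1) * P))
      (P * X * neu R X * X * P) := by
    refine (((hs.hasSum.mul_left (P * X)).mul_right (X * P)).congr_fun fun r => ?_).trans_eq ?_
    · rw [mul_smul_comm, smul_mul_assoc, pow_succ]; simp only [mul_assoc]
    · simp only [mul_assoc]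
  have hb : ∀ r : ℕ, ‖(-1 : ℂ) ^ r • (P * X * (R * X) ^ (r + 1) * P)‖ ≤
      24 * ε ^ 11 * (260 * ε) * (260 * ε) ^ r := by
    intro r
    have e : P * X * (R * X) ^ (r + 1) * P =
        P * X * P * wtKer P R X ε ^ (r + 1) * P + ((ε ^ 2 : ℝ) : ℂ) •
          (P * X * (1 - P) * wtKer P R X ε ^ (r + 1) * P) := by
      have hw : wt P ε * P = ((ε ^ 2 : ℝ) : ℂ) • P := by
        rw [wt, add_mul, smul_mul_assoc, h.idem, sub_mul, one_mul, h.idem, sub_self, add_zero]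
      have hc : (((ε ^ 2 : ℝ) : ℂ) * (((ε ^ 2)⁻¹ : ℝ) : ℂ)) = 1 := by
        rw [← Complex.ofReal_mul, mul_inv_cancel₀ (by positivity), Complex.ofReal_one]
      rw [h.pow_eq hε, mul_assoc (P * X), mul_assoc _ (wt P ε) P, hw, wtInv]
      simp only [add_mul, mul_add, smul_mul_assoc, mul_smul_comm, smul_smul, smul_add, mul_assoc]
      rw [hc, one_smul]
    have hM := h.norm_pow_wtKer_le hε (by linarith) (r + 1)
    set K := wtKer P R X ε ^ (r + 1)
    set m := (260 * ε) ^ (r + 1) with hm'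
    have hm : 0 ≤ m := by positivity
    have t1 : ‖P * X * P * K * P‖ ≤ 18 * ε ^ 11 * m :=
      (norm_mul_le _ _).trans ((mul_le_of_le_one_right (norm_nonneg _) h.norm_le).trans
        ((norm_mul_le _ _).trans (mul_le_mul h.pot_block hM (norm_nonneg _) (by positivity))))
    have hPXQ : ‖P * X * (1 - P)‖ ≤ 6 * ε ^ 9 :=
      (norm_mul_le _ _).trans ((mul_le_of_le_one_right (norm_nonneg _) h.norm_compl_le).trans
        ((norm_mul_le _ _).trans ((mul_le_of_le_one_left (norm_nonneg _) h.norm_le).trans h.pot)))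
    have t2 : ‖((ε ^ 2 : ℝ) : ℂ) • (P * X * (1 - P) * K * P)‖ ≤ ε ^ 2 * (6 * ε ^ 9 * m) := by
      rw [norm_real_smul (by positivity)]
      gcongr
      exact (norm_mul_le _ _).trans ((mul_le_of_le_one_right (norm_nonneg _) h.norm_le).trans
        ((norm_mul_le _ _).trans (mul_le_mul hPXQ hM (norm_nonneg _) (by positivity))))
    rw [norm_neg_one_pow_smul, e]
    calc _ ≤ 18 * ε ^ 11 * m + ε ^ 2 * (6 * ε ^ 9 * m) := norm_add_le_of_le t1 t2
      _ = _ := by rw [hm']; ring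
  have hg := (hasSum_geometric_of_lt_one (r := 260 * ε) (by positivity) (by linarith)).mul_left
    (24 * ε ^ 11 * (260 * ε))
  have h2 := tsum_of_norm_bounded hg hb
  rw [h1.tsum_eq] at h2
  have e : P * (X - X * neu R X * X) * P = P * X * P - P * X * neu R X * X * P := by
    simp only [mul_sub, sub_mul, mul_assoc]
  rw [e]
  refine (norm_sub_le _ _).trans ?_
  have : 24 * ε ^ 11 * (260 * ε) * (1 - 260 * ε)⁻¹ ≤ 12 * ε ^ 11 := by
    have h3 : 260 * ε * (1 - 260 * ε)⁻¹ ≤ 1 / 2 := by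
      rw [← div_eq_mul_inv, div_le_iff₀ (by linarith)]; linarith
    calc _ = 24 * ε ^ 11 * (260 * ε * (1 - 260 * ε)⁻¹) := by ring
      _ ≤ 24 * ε ^ 11 * (1 / 2) := by gcongr
      _ = _ := by ring
  linarith [h.pot_block]

end BlockBound

end Neumann

namespace Schur

/-! #### Diagonal and Toeplitz matrices -/

instance : NormOneClass Schur := ⟨by
  refine le_antisymm (norm_le_of (fun n s => ?_) fun m s => ?_) ?_
  · simp only [ent_one, apply_ite norm, norm_one, norm_zero, Finset.sum_ite_eq']
    split_ifs <;> norm_num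
  · simp only [ent_one, apply_ite norm, norm_one, norm_zero, Finset.sum_ite_eq]
    split_ifs <;> norm_num
  · have := norm_ent_le 1 0 0
    rwa [ent_one, if_pos rfl, norm_one] at this⟩

theorem bdd_diag {d : Idx → ℂ} {C : ℝ} (h : ∀ m, ‖d m‖ ≤ C) :
    Bdd (fun m n => if m = n then d m else 0) C := by
  have hC : 0 ≤ C := (norm_nonneg _).trans (h 0)
  refine ⟨fun n s => ?_, fun m s => ?_⟩
  · simp only [apply_ite norm, norm_zero, Finset.sum_ite_eq']
    split_ifs
    exacts [h n, hC]
  · simp only [apply_ite norm, norm_zero, Finset.sum_ite_eq]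
    split_ifs
    exacts [h m, hC]

/-- The diagonal matrix with bounded entries `d`. -/
def diag (d : Idx → ℂ) : Schur := ofMat fun m n => if m = n then d m else 0

theorem ent_diag {d : Idx → ℂ} {C : ℝ} (h : ∀ m, ‖d m‖ ≤ C) (m n : Idx) :
    ent m n (diag d) = if m = n then d m else 0 := ent_ofMat (bdd_diag h) m n

theorem norm_diag_le {d : Idx → ℂ} {C : ℝ} (h : ∀ m, ‖d m‖ ≤ C) : ‖diag d‖ ≤ C :=
  norm_ofMat_le (bdd_diag h)

theorem ent_diag_mul {d : Idx → ℂ} {C : ℝ} (h : ∀ m, ‖d m‖ ≤ C) (x : Schur) (m n : Idx) :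
    ent m n (diag d * x) = d m * ent m n x := by
  refine (hasSum_ent_mul _ _ m n).unique ?_
  simp only [ent_diag h, ite_mul, zero_mul]
  have := hasSum_ite_eq m (d m * ent m n x)
  refine this.congr_fun fun p => ?_
  split_ifs with h1 h2 h2
  · rw [h1]
  · exact absurd h1.symm h2
  · exact absurd h2.symm h1
  · rfl

theorem ent_mul_diag {d : Idx → ℂ} {C : ℝ} (h : ∀ m, ‖d m‖ ≤ C) (x : Schur) (m n : Idx) :
    ent m n (x * diag d) = ent m n x * d n := by
  refine (hasSum_ent_mul _ _ m n).unique ?_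
  simp only [ent_diag h, mul_ite, mul_zero]
  have := hasSum_ite_eq n (ent m n x * d n)
  refine this.congr_fun fun p => ?_
  split_ifs with h1
  · rw [h1]
  · rfl

/-- The matrix `(w_{m-n})`. -/
def toep (w : Idx → ℂ) : Schur := ofMat fun m n => w (m - n)

theorem sum_norm_le_of_tsum_enorm_le {ι : Type*} {a : ι → ℂ} {C : ℝ} (hC : 0 ≤ C)
    (h : ∑' i, ‖a i‖ₑ ≤ ENNReal.ofReal C) (s : Finset ι) : ∑ i ∈ s, ‖a i‖ ≤ C := by
  have h1 : ENNReal.ofReal (∑ i ∈ s, ‖a i‖) ≤ ENNReal.ofReal C := by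
    refine le_trans ?_ ((ENNReal.sum_le_tsum s).trans h)
    rw [ENNReal.ofReal_sum_of_nonneg fun i _ => norm_nonneg _]
    simp [ofReal_norm]
  exact (ENNReal.ofReal_le_ofReal_iff hC).mp h1

theorem bdd_toep {w : Idx → ℂ} {C : ℝ} (hC : 0 ≤ C) (h : starNorm w ≤ ENNReal.ofReal C) :
    Bdd (fun m n => w (m - n)) C := by
  refine ⟨fun n s => sum_norm_le_of_tsum_enorm_le hC ?_ s,
    fun m s => sum_norm_le_of_tsum_enorm_le hC ?_ s⟩
  · exact ((Equiv.subRight n).tsum_eq fun b => ‖w b‖ₑ).trans_le h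
  · exact ((Equiv.subLeft m).tsum_eq fun b => ‖w b‖ₑ).trans_le h

theorem ent_toep {w : Idx → ℂ} (h : starNorm w ≠ ∞) (m n : Idx) : ent m n (toep w) = w (m - n) :=
  ent_ofMat (bdd_toep ENNReal.toReal_nonneg (ENNReal.ofReal_toReal h).ge) m n

theorem norm_toep_le {w : Idx → ℂ} {C : ℝ} (hC : 0 ≤ C) (h : starNorm w ≤ ENNReal.ofReal C) :
    ‖toep w‖ ≤ C := norm_ofMat_le (bdd_toep hC h)

open Classical in
/-- The coordinate projection `P_q` onto the indices `j`, `j - q`. -/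
def proj (q j : Idx) : Schur := diag fun m => if inBlock q j m then 1 else 0

open Classical in
theorem norm_proj_coeff_le (q j m : Idx) : ‖(if inBlock q j m then 1 else 0 : ℂ)‖ ≤ 1 := by
  split_ifs <;> simp

open Classical in
theorem ent_proj_mul (q j : Idx) (x : Schur) (m n : Idx) :
    ent m n (proj q j * x) = if inBlock q j m then ent m n x else 0 := by
  rw [proj, ent_diag_mul (norm_proj_coeff_le q j)]
  split_ifs <;> simp

open Classical in
theorem ent_mul_proj (q j : Idx) (x : Schur) (m n : Idx) :
    ent m n (x * proj q j) = if inBlock q j n then ent m n x else 0 := by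
  rw [proj, ent_mul_diag (norm_proj_coeff_le q j)]
  split_ifs <;> simp

open Classical in
theorem ent_proj (q j m n : Idx) :
    ent m n (proj q j) = if m = n ∧ inBlock q j m then 1 else 0 := by
  rw [proj, ent_diag (norm_proj_coeff_le q j)]
  by_cases h1 : m = n
  · subst h1; simp
  · simp [h1]

theorem proj_mul_proj (q j : Idx) : proj q j * proj q j = proj q j := by
  ext m n
  rw [ent_proj_mul, ent_proj]
  by_cases h1 : m = n
  · subst h1; simp
  · simp [h1]

theorem norm_proj_le (q j : Idx) : ‖proj q j‖ ≤ 1 := norm_diag_le (norm_proj_coeff_le q j)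

open Classical in
theorem norm_one_sub_proj_le (q j : Idx) : ‖1 - proj q j‖ ≤ 1 := by
  have : 1 - proj q j = diag fun m => if inBlock q j m then 0 else 1 := by
    ext m n
    rw [map_sub, ent_one, ent_proj, ent_diag (C := 1) (fun m => by split_ifs <;> simp)]
    split_ifs <;> simp_all
  rw [this]
  exact norm_diag_le fun m => by split_ifs <;> simp

/-- The matrix unit at the diagonal position `p`. -/
def unit (p : Idx) : Schur := diag fun m => if m = p then 1 else 0

theorem norm_unit_coeff_le (p m : Idx) : ‖(if m = p then 1 else 0 : ℂ)‖ ≤ 1 := by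
  split_ifs <;> simp

theorem ent_mul_unit_mul (x y : Schur) (p m n : Idx) :
    ent m n (x * unit p * y) = ent m p x * ent p n y := by
  refine (hasSum_ent_mul _ _ m n).unique ?_
  simp only [unit, ent_mul_diag (norm_unit_coeff_le p), mul_ite, ite_mul, mul_one, mul_zero,
    zero_mul]
  have := hasSum_ite_eq p (ent m p x * ent p n y)
  refine this.congr_fun fun i => ?_
  split_ifs with h1
  · rw [h1]
  · rfl

/-! ### Trace bounds for products that pass through the block -/

theorem sum_ent_mul_unit_mul_le (x y : Schur) (p : Idx) (s : Finset Idx) :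
    ∑ m ∈ s, ‖ent m m (x * unit p * y)‖ ≤ ‖x‖ * ‖y‖ := by
  simp only [ent_mul_unit_mul, norm_mul]
  calc _ ≤ ∑ m ∈ s, ‖ent m p x‖ * ‖y‖ := by gcongr; exact norm_ent_le _ _ _
    _ = (∑ m ∈ s, ‖ent m p x‖) * ‖y‖ := by rw [Finset.sum_mul]
    _ ≤ _ := by gcongr; exact col_sum_le x p s

open Classical in
theorem proj_eq_unit_add {q : Idx} (hq : q ≠ 0) (j : Idx) :
    proj q j = unit j + unit (j - q) := by
  have hne : j ≠ j - q := fun h => hq (by rwa [eq_comm, sub_eq_self] at h)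
  ext m n
  rw [ent_proj, map_add, unit, unit, ent_diag (norm_unit_coeff_le j),
    ent_diag (norm_unit_coeff_le (j - q))]
  by_cases h1 : m = n
  · subst h1
    by_cases h2 : m = j
    · subst h2; simp [inBlock, hne]
    · simp [inBlock, h2]
  · simp [h1]

/-- Each of the two matrix units in the projection contributes the product of a column of x with a
row of y; the column is summable and the row entries are bounded. -/
theorem sum_ent_mul_proj_mul_le {q : Idx} (hq : q ≠ 0) (j : Idx) (x y : Schur) (s : Finset Idx) :
    ∑ m ∈ s, ‖ent m m (x * proj q j * y)‖ ≤ 2 * (‖x‖ * ‖y‖) := by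
  have : ∀ m, ‖ent m m (x * proj q j * y)‖ ≤
      ‖ent m m (x * unit j * y)‖ + ‖ent m m (x * unit (j - q) * y)‖ := fun m => by
    rw [proj_eq_unit_add hq, mul_add, add_mul, map_add]
    exact norm_add_le _ _
  refine (Finset.sum_le_sum fun m _ => this m).trans ?_
  rw [Finset.sum_add_distrib]
  linarith [sum_ent_mul_unit_mul_le x y j s, sum_ent_mul_unit_mul_le x y (j - q) s]

/-- Write M = P M + (1 - P) M and sort the words of M ^ r by the first factor at which P occurs. -/
theorem pow_sub_pow_eq {A : Type*} [Ring A] (P M : A) (r : ℕ) :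
    M ^ r - ((1 - P) * M) ^ r =
      ∑ i ∈ Finset.range r, ((1 - P) * M) ^ i * P * M ^ (r - i) := by
  induction r with
  | zero => simp
  | succ r ih =>
    rw [Finset.sum_range_succ']
    have : ∀ i ∈ Finset.range r, ((1 - P) * M) ^ (i + 1) * P * M ^ (r + 1 - (i + 1)) =
        (1 - P) * M * (((1 - P) * M) ^ i * P * M ^ (r - i)) := fun i _ => by
      rw [pow_succ', Nat.add_sub_add_right]; simp only [mul_assoc]
    rw [Finset.sum_congr rfl this, ← Finset.mul_sum, ← ih]
    simp only [pow_zero, one_mul, Nat.sub_zero, pow_succ' M r, pow_succ' ((1 - P) * M) r]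
    noncomm_ring

theorem wt_proj_eq (q j : Idx) (ε : ℝ) : ∃ d : Idx → ℂ, (∃ C, ∀ m, ‖d m‖ ≤ C) ∧
    wt (proj q j) ε = diag d := by
  classical
  have hb : ∀ m, ‖(if inBlock q j m then ((ε ^ 2 : ℝ) : ℂ) else 1 : ℂ)‖ ≤ max (ε ^ 2) 1 := by
    intro m
    split_ifs
    · rw [Complex.norm_real, Real.norm_of_nonneg (by positivity)]; exact le_max_left _ _
    · rw [norm_one]; exact le_max_right _ _
  refine ⟨_, ⟨_, hb⟩, ?_⟩
  ext m n
  rw [wt, map_add, map_smul, map_sub, ent_one, ent_proj, ent_diag hb]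
  split_ifs <;> simp_all

/-- The weight is a diagonal matrix, and conjugation by a diagonal matrix does not change the
diagonal. So traces may be estimated with the small conjugated kernel. -/
theorem ent_conj_wt (q j : Idx) {ε : ℝ} (hε : 0 < ε) (x : Schur) (m : Idx) :
    ent m m (wt (proj q j) ε * x * wtInv (proj q j) ε) = ent m m x := by
  obtain ⟨d, ⟨C, hd⟩, hw⟩ := wt_proj_eq q j ε
  have h1 : ent m m (wt (proj q j) ε * x * wtInv (proj q j) ε * wt (proj q j) ε) =
      ent m m (wt (proj q j) ε * x) := by
    rw [mul_assoc, wtInv_mul_wt (proj_mul_proj q j) hε, mul_one]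
  have h2 : ent m m (wt (proj q j) ε * wtInv (proj q j) ε) = 1 := by
    rw [wt_mul_wtInv (proj_mul_proj q j) hε, ent_one, if_pos rfl]
  rw [hw, ent_diag_mul hd] at h2
  have hdm : d m ≠ 0 := fun h => by simp [h] at h2
  rw [hw, ent_mul_diag hd, ent_diag_mul hd] at h1
  rw [hw]
  exact mul_right_cancel₀ hdm (h1.trans (mul_comm _ _))

/-- Trace bound for the part of `(R X)^r` that visits the block. -/
theorem sum_diag_pow_sub_le {q j : Idx} (hq : q ≠ 0) {R X : Schur} {ε : ℝ}
    (h : BlockBound (proj q j) R X ε) (hε : 0 < ε) (hε1 : ε ≤ 1) (r : ℕ) (s : Finset Idx) :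
    ∑ m ∈ s, ‖ent m m ((R * X) ^ r - ((1 - proj q j) * (R * X)) ^ r)‖ ≤
      2 * r * (260 * ε) ^ r := by
  set P := proj q j
  set M := wtKer P R X ε with hM
  have hn := h.norm_wtKer_le hε hε1
  rw [← hM] at hn
  have h1 : wtInv P ε * wt P ε = 1 := wtInv_mul_wt h.idem hε
  have hcomm : wt P ε * (1 - P) = (1 - P) * wt P ε := by
    rw [wt]; simp only [mul_add, add_mul, mul_sub, sub_mul, smul_mul_assoc, mul_smul_comm, h.idem,
      mul_one, one_mul, sub_self, smul_zero, add_zero, sub_zero, add_sub_cancel_left, zero_add]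
  have hconj : ∀ x : Schur, ∀ i : ℕ, wt P ε * x ^ i * wtInv P ε = (wt P ε * x * wtInv P ε) ^ i := by
    intro x i
    induction i with
    | zero => rw [pow_zero, pow_zero, mul_one, wt_mul_wtInv h.idem hε]
    | succ i ih =>
      rw [pow_succ, pow_succ, ← ih]
      have : wt P ε * x ^ i * wtInv P ε * (wt P ε * x * wtInv P ε) =
        wt P ε * x ^ i * (wtInv P ε * wt P ε) * x * wtInv P ε := by simp only [mul_assoc]
      rw [this, h1]; simp only [mul_assoc, mul_one]
  have e : wt P ε * ((R * X) ^ r - ((1 - P) * (R * X)) ^ r) * wtInv P ε =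
      M ^ r - ((1 - P) * M) ^ r := by
    rw [mul_sub, sub_mul, hconj, hconj, ← mul_assoc (wt P ε) (1 - P), hcomm, hM, wtKer]
    simp only [mul_assoc]
  have e2 : ∀ m, ent m m ((R * X) ^ r - ((1 - P) * (R * X)) ^ r) =
      ∑ i ∈ Finset.range r, ent m m (((1 - P) * M) ^ i * P * M ^ (r - i)) := fun m => by
    rw [← ent_conj_wt q j hε, e, pow_sub_pow_eq, map_sum]
  have hQM : ‖(1 - P) * M‖ ≤ 260 * ε :=
    (norm_mul_le _ _).trans ((mul_le_of_le_one_left (norm_nonneg _) h.norm_compl_le).trans hn)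
  simp only [e2]
  calc _ ≤ ∑ m ∈ s, ∑ i ∈ Finset.range r, ‖ent m m (((1 - P) * M) ^ i * P * M ^ (r - i))‖ :=
        Finset.sum_le_sum fun m _ => norm_sum_le _ _
    _ = ∑ i ∈ Finset.range r, ∑ m ∈ s, ‖ent m m (((1 - P) * M) ^ i * P * M ^ (r - i))‖ :=
        Finset.sum_comm
    _ ≤ ∑ i ∈ Finset.range r, 2 * (260 * ε) ^ r := by
        refine Finset.sum_le_sum fun i hi => (sum_ent_mul_proj_mul_le hq j _ _ s).trans ?_
        have h2 : ‖((1 - P) * M) ^ i‖ ≤ (260 * ε) ^ i :=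
          (norm_pow_le _ _).trans (pow_le_pow_left₀ (norm_nonneg _) hQM i)
        have h3 : ‖M ^ (r - i)‖ ≤ (260 * ε) ^ (r - i) :=
          (norm_pow_le _ _).trans (pow_le_pow_left₀ (norm_nonneg _) hn _)
        have h4 : (260 * ε) ^ r = (260 * ε) ^ i * (260 * ε) ^ (r - i) := by
          rw [← pow_add, Nat.add_sub_cancel' (Finset.mem_range.mp hi).le]
        rw [h4]
        gcongr
    _ = _ := by rw [Finset.sum_const, Finset.card_range, nsmul_eq_mul]; ring

end Schur

/-! ### The eigenvalues of the model operator near a resonant point -/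

/-- The difference `p_j² - p_{j-q}²`. -/
def psqDiff (q j : Idx) (t : C2) : ℂ := psq j t - psq (j - q) t

theorem psqDiff_sub (q j : Idx) (t s : C2) :
    psqDiff q j t - psqDiff q j s = 2 * ∑ i, (q i : ℂ) * (t i - s i) := by
  simp only [psqDiff, psq, Fin.sum_univ_two, Pi.sub_apply, Int.cast_sub]; ring

/-- The quadratic parts in t cancel, so the spectral gaps move at a rate proportional to |m - j| and
not to |P_m|. -/
theorem psq_sub_psq_sub (j m : Idx) (t s : C2) :
    psq m t - psq j t - (psq m s - psq j s) = 2 * ∑ i, ((m i - j i : ℤ) : ℂ) * (t i - s i) := by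
  simp only [psq, Fin.sum_univ_two, Int.cast_sub]; ring

/-- The `ℓ¹` length of a lattice vector. -/
def len (q : Idx) : ℝ := |(q 0 : ℝ)| + |(q 1 : ℝ)|

theorem len_nonneg (q : Idx) : 0 ≤ len q := by unfold len; positivity

theorem norm_sum_int_mul_le (d : Idx) (h : C2) : ‖∑ i, (d i : ℂ) * h i‖ ≤ len d * ‖h‖ := by
  rw [Fin.sum_univ_two, len, add_mul]
  refine norm_add_le_of_le ?_ ?_ <;>
  · rw [norm_mul, Complex.norm_intCast]
    exact mul_le_mul_of_nonneg_left (PiLp.norm_apply_le h _) (abs_nonneg _)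

theorem psq_toC (m : Idx) (s : R2) : psq m (toC s) = ((‖momentum m s‖ ^ 2 : ℝ) : ℂ) := by
  rw [EuclideanSpace.norm_sq_eq]
  simp [psq, toC, momentum, Fin.sum_univ_two]

theorem lamPlus_eq (v : Idx → ℂ) (q j : Idx) (t : C2) :
    lamPlus v q j t = psq j t + (twoB v q j t - psqDiff q j t) / 2 := by
  simp only [lamPlus, psqDiff]; ring

theorem lamMinus_eq (v : Idx → ℂ) (q j : Idx) (t : C2) :
    lamMinus v q j t = lamPlus v q j t - twoB v q j t := by
  simp only [lamPlus, lamMinus]; ring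

/-- The radicand in the definition of `twoB`. -/
def radicand (v : Idx → ℂ) (q j : Idx) (t : C2) : ℂ := 4 * (‖v q‖ : ℂ) ^ 2 + psqDiff q j t ^ 2

theorem twoB_eq (v : Idx → ℂ) (q j : Idx) (t : C2) :
    twoB v q j t = radicand v q j t ^ (1 / 2 : ℂ) := rfl

theorem sq_cpow_half (w : ℂ) : (w ^ (1 / 2 : ℂ)) ^ 2 = w := by
  simp

/-- The principal root halves the argument. Nonnegativity of the real part keeps the sum of two such
roots away from zero when one of them is positive. -/
theorem cpow_half_re_nonneg (w : ℂ) : 0 ≤ (w ^ (1 / 2 : ℂ)).re := by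
  rcases eq_or_ne w 0 with rfl | hw
  · simp
  rw [Complex.cpow_def_of_ne_zero hw, Complex.exp_re]
  refine mul_nonneg (Real.exp_pos _).le (Real.cos_nonneg_of_mem_Icc ?_)
  have h1 : (Complex.log w * (1 / 2)).im = Complex.arg w / 2 := by
    rw [show Complex.log w * (1 / 2) = Complex.log w / (2 : ℝ) by push_cast; ring,
      Complex.div_ofReal_im, Complex.log_im]
  rw [h1]
  constructor <;> linarith [Complex.neg_pi_lt_arg w, Complex.arg_le_pi w]

theorem cpow_half_ofReal {x : ℝ} (hx : 0 ≤ x) : (x : ℂ) ^ (1 / 2 : ℂ) = (√x : ℝ) := by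
  rw [Real.sqrt_eq_rpow, Complex.ofReal_cpow hx]; norm_num

/-- The geometric facts about the model operator that are used for the perturbation series. -/
structure ModelBounds (v : Idx → ℂ) (q j : Idx) (ε : ℝ) (t : C2) : Prop where
  slit : radicand v q j t ∈ Complex.slitPlane
  twoB_ge : 3 / 2 * ε ^ 10 ≤ ‖twoB v q j t‖
  diff_le : ‖psqDiff q j t‖ ≤ ‖twoB v q j t‖
  pot_le : ‖v q‖ ≤ ‖twoB v q j t‖
  gap : ∀ m, ¬ inBlock q j m → ∀ ζ : ℂ, ‖ζ‖ ≤ ε ^ 10 → ε ^ 6 ≤ ‖psq m t - lamPlus v q j t - ζ‖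

/-- Since x₀ is real, |Im x| ≤ η. The only negative contribution, -(Im x)², is absorbed by a². This
keeps the radicand off the branch cut and makes |2b| dominate both |v_q| and the detuning. -/
theorem radicand_bounds {a x₀ η : ℝ} {x : ℂ} (hη : 0 ≤ η) (hη1 : η ≤ 1)
    (ha : 6 * η ≤ a ^ 2) (ha0 : 0 < a) (hx : ‖x - x₀‖ ≤ η) :
    0 < (4 * (a : ℂ) ^ 2 + x ^ 2).re ∧ 3 * a ^ 2 + ‖x‖ ^ 2 ≤ ‖4 * (a : ℂ) ^ 2 + x ^ 2‖ := by
  have hre : |x.re - x₀| ≤ η := by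
    simpa using (Complex.abs_re_le_norm (x - x₀)).trans hx
  have him : |x.im| ≤ η := by
    simpa using (Complex.abs_im_le_norm (x - x₀)).trans hx
  have e : (4 * (a : ℂ) ^ 2 + x ^ 2).re = 4 * a ^ 2 + x.re ^ 2 - x.im ^ 2 := by
    simp [pow_two]; ring
  have hn : ‖x‖ ^ 2 = x.re ^ 2 + x.im ^ 2 := by
    rw [← Complex.normSq_eq_norm_sq, Complex.normSq_apply]; ring
  have him2 : x.im ^ 2 ≤ η := by
    have := sq_le_sq' (neg_le_of_abs_le him) (le_of_abs_le him)
    nlinarith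
  have hle := (le_abs_self _).trans (Complex.abs_re_le_norm (4 * (a : ℂ) ^ 2 + x ^ 2))
  rw [e] at hle ⊢
  have ha2 : 0 < a ^ 2 := by positivity
  constructor <;> nlinarith [sq_nonneg x.re]

theorem norm_twoB_sq (v : Idx → ℂ) (q j : Idx) (t : C2) :
    ‖twoB v q j t‖ ^ 2 = ‖radicand v q j t‖ := by
  rw [← norm_pow, twoB_eq, sq_cpow_half]

theorem norm_momentum_sub (j m : Idx) (s : R2) :
    ‖momentum m s‖ ^ 2 - ‖momentum j s‖ ^ 2 =
      2 * ∑ i, momentum j s i * ((m i : ℝ) - j i) + ∑ i, ((m i : ℝ) - j i) ^ 2 := by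
  rw [EuclideanSpace.norm_sq_eq, EuclideanSpace.norm_sq_eq]
  simp only [momentum, Fin.sum_univ_two, Real.norm_eq_abs, sq_abs]
  ring

/-- Far from j the quadratic term |m - j|² outweighs the linear term 2⟨P_j, m - j⟩; the threshold 8k
leaves half of it. -/
theorem norm_momentum_sub_ge (j m : Idx) (s : R2) {k : ℝ} (hk : ‖momentum j s‖ = k)
    (hd : 8 * k ≤ len (m - j)) :
    2 * k * len (m - j) ≤ ‖momentum m s‖ ^ 2 - ‖momentum j s‖ ^ 2 := by
  have hk0 : 0 ≤ k := hk ▸ norm_nonneg _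
  have hi : ∀ i, |momentum j s i| ≤ k := fun i => by
    rw [← hk, ← Real.norm_eq_abs]; exact PiLp.norm_apply_le _ _
  have hlen : len (m - j) = |(m 0 : ℝ) - j 0| + |(m 1 : ℝ) - j 1| := by simp [len]
  rw [norm_momentum_sub, Fin.sum_univ_two, Fin.sum_univ_two]
  have h0 : -(k * |(m 0 : ℝ) - j 0|) ≤ momentum j s 0 * ((m 0 : ℝ) - j 0) := by
    refine neg_le_of_abs_le ?_
    rw [abs_mul]; exact mul_le_mul_of_nonneg_right (hi 0) (abs_nonneg _)
  have h1 : -(k * |(m 1 : ℝ) - j 1|) ≤ momentum j s 1 * ((m 1 : ℝ) - j 1) := by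
    refine neg_le_of_abs_le ?_
    rw [abs_mul]; exact mul_le_mul_of_nonneg_right (hi 1) (abs_nonneg _)
  rw [← sq_abs ((m 0 : ℝ) - j 0), ← sq_abs ((m 1 : ℝ) - j 1)]
  set a := |(m 0 : ℝ) - j 0|
  set b := |(m 1 : ℝ) - j 1|
  have ha : 0 ≤ a := abs_nonneg _
  have hb : 0 ≤ b := abs_nonneg _
  rw [hlen] at hd ⊢
  have h2 : (a + b) ^ 2 ≤ 2 * (a ^ 2 + b ^ 2) := by nlinarith [sq_nonneg (a - b)]
  have h3 : 8 * k * (a + b) ≤ (a + b) ^ 2 := by nlinarith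
  nlinarith

/-- Level repulsion: the upper eigenvalue of the block exceeds the larger diagonal entry by at most
|v_q|. -/
theorem abs_half_sub_le {a x : ℝ} (ha : 0 ≤ a) : |(√(4 * a ^ 2 + x ^ 2) - |x|) / 2| ≤ a := by
  have h0 : |x| ≤ √(4 * a ^ 2 + x ^ 2) := Real.abs_le_sqrt (by nlinarith)
  have h1 : √(4 * a ^ 2 + x ^ 2) ≤ 2 * a + |x| := by
    rw [Real.sqrt_le_iff]
    refine ⟨by positivity, ?_⟩
    nlinarith [sq_abs x, mul_nonneg ha (abs_nonneg x)]
  rw [abs_of_nonneg (by linarith)]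
  linarith

/-! ### Stability of the resonance in a complex ball around a resonant point -/

section

variable {v : Idx → ℂ} {q j : Idx} {k ε : ℝ} {t₀ : R2}

theorem psqDiff_toC (q j : Idx) (s : R2) :
    psqDiff q j (toC s) = ((‖momentum j s‖ ^ 2 - ‖momentum (j - q) s‖ ^ 2 : ℝ) : ℂ) := by
  rw [psqDiff, psq_toC, psq_toC]; push_cast; ring

theorem twoB_toC (v : Idx → ℂ) (q j : Idx) (s : R2) :
    twoB v q j (toC s) = (√(4 * ‖v q‖ ^ 2 +
      (‖momentum j s‖ ^ 2 - ‖momentum (j - q) s‖ ^ 2) ^ 2) : ℝ) := by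
  rw [twoB_eq, radicand, psqDiff_toC, ← cpow_half_ofReal (by positivity)]
  push_cast; rfl

theorem inBlock_iff (q j m : Idx) : inBlock q j m ↔ m = j ∨ m = j - q := Iff.rfl

/-- λ̂⁺ lies within |v_q| ≤ ε⁹ of the larger of p_j² and p_{j-q}². Either of them can be the larger
one, and this is why both gap conditions enter. -/
theorem gap_center (hres : IsResonantPoint q k ε t₀ j) (hv : ‖v q‖ ≤ ε ^ 9)
    {m : Idx} (hm : ¬ inBlock q j m) :
    2 * ε ^ 6 - ε ^ 9 ≤ ‖psq m (toC t₀) - lamPlus v q j (toC t₀)‖ := by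
  rw [inBlock_iff, not_or] at hm
  have h1 := hres.gap m hm.1 hm.2
  have h2 := hres.gap' m hm.1 hm.2
  have h3 := abs_half_sub_le (a := ‖v q‖)
    (x := ‖momentum j t₀‖ ^ 2 - ‖momentum (j - q) t₀‖ ^ 2) (norm_nonneg _)
  have e : psq m (toC t₀) - lamPlus v q j (toC t₀) = ((‖momentum m t₀‖ ^ 2 - ‖momentum j t₀‖ ^ 2 -
      (√(4 * ‖v q‖ ^ 2 + (‖momentum j t₀‖ ^ 2 - ‖momentum (j - q) t₀‖ ^ 2) ^ 2) -
        (‖momentum j t₀‖ ^ 2 - ‖momentum (j - q) t₀‖ ^ 2)) / 2 : ℝ) : ℂ) := by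
    rw [lamPlus_eq, twoB_toC, psqDiff_toC, psq_toC, psq_toC]; push_cast; ring
  rw [e, Complex.norm_real, Real.norm_eq_abs]
  set b := √(4 * ‖v q‖ ^ 2 + (‖momentum j t₀‖ ^ 2 - ‖momentum (j - q) t₀‖ ^ 2) ^ 2)
  set A := ‖momentum j t₀‖ ^ 2
  set B := ‖momentum (j - q) t₀‖ ^ 2
  set M := ‖momentum m t₀‖ ^ 2
  have h4 := abs_le.mp (h3.trans hv)
  rcases le_total 0 (A - B) with hx | hx
  · rw [abs_of_nonneg hx] at h4
    rcases lt_abs.mp h1 with h | h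
    · exact le_trans (by linarith) (neg_le_abs _)
    · exact le_trans (by linarith) (le_abs_self _)
  · rw [abs_of_nonpos hx] at h4
    rcases lt_abs.mp h2 with h | h
    · exact le_trans (by linarith) (neg_le_abs _)
    · exact le_trans (by linarith) (le_abs_self _)

/-- For large k the block hardly changes over the ball: its detuning has slope of order |q|, so it
varies by at most ε⁴⁰. The distance to the other levels survives because near levels move by O(ε⁷)
and far levels are separated by a multiple of k |m - j|. -/
theorem modelBounds (hε : 0 < ε) (hε1 : ε ≤ 1 / 100) (hres : IsResonantPoint q k ε t₀ j)
    (hv : ‖v q‖ ≤ ε ^ 9) (hvq : ε ^ 10 < ‖v q‖) (hk : 1 ≤ k) (hkq : 4 * len q ≤ k * ε ^ 40)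
    {t : C2} (ht : t ∈ Metric.ball (toC t₀) (2 * k⁻¹ * ε ^ 7)) : ModelBounds v q j ε t := by
  have hk0 : 0 < k := by linarith
  have hε1' : ε ≤ 1 := by linarith
  have hdist : ‖t - toC t₀‖ ≤ 2 * k⁻¹ * ε ^ 7 := by
    rw [← dist_eq_norm]; exact (Metric.mem_ball.mp ht).le
  have hp : ∀ n : ℕ, ε ^ (n + 1) ≤ ε ^ n / 100 := fun n => by
    rw [pow_succ]; nlinarith [pow_pos hε n]
  have hp7 := hp 6
  have hp8 := hp 7
  have hp9 := hp 8
  have hp10 := hp 9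
  have p6 : 0 < ε ^ 6 := by positivity
  have p10 : 0 < ε ^ 10 := by positivity
  have p40 : 0 < ε ^ 40 := by positivity
  have hx : ‖psqDiff q j t - psqDiff q j (toC t₀)‖ ≤ ε ^ 40 := by
    rw [psqDiff_sub, norm_mul, Complex.norm_ofNat]
    have h1 := norm_sum_int_mul_le q (t - toC t₀)
    simp only [PiLp.sub_apply] at h1
    have h2 : len q * ‖t - toC t₀‖ ≤ k * ε ^ 40 / 4 * (2 * k⁻¹ * ε ^ 7) :=
      mul_le_mul (by linarith) hdist (norm_nonneg _) (by positivity)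
    have h3 : k * ε ^ 40 / 4 * (2 * k⁻¹ * ε ^ 7) = ε ^ 40 * ε ^ 7 / 2 := by field_simp; ring
    have h4 : ε ^ 40 * ε ^ 7 ≤ ε ^ 40 :=
      mul_le_of_le_one_right (by positivity) (pow_le_one₀ hε.le hε1')
    linarith
  set x₀ : ℝ := ‖momentum j t₀‖ ^ 2 - ‖momentum (j - q) t₀‖ ^ 2 with hx₀
  have hx0c : psqDiff q j (toC t₀) = (x₀ : ℂ) := psqDiff_toC q j t₀
  have hx01 : |x₀| ≤ ε := by rw [hx₀, abs_sub_comm]; exact hres.close.le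
  have h20 : ε ^ 20 ≤ ‖v q‖ ^ 2 := by
    have := pow_le_pow_left₀ p10.le hvq.le 2
    rwa [← pow_mul] at this
  have h40 : ε ^ 40 ≤ ε ^ 20 / 100 := by
    have : ε ^ 40 ≤ ε ^ 21 := pow_le_pow_of_le_one hε.le hε1' (by norm_num)
    exact this.trans (hp 20)
  have hη1 : ε ^ 40 ≤ 1 := pow_le_one₀ hε.le hε1'
  rw [hx0c] at hx
  obtain ⟨hre, hnorm⟩ := radicand_bounds (a := ‖v q‖) (x := psqDiff q j t) p40.le hη1
    (by nlinarith [pow_pos hε 20]) (p10.trans hvq) hx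
  change 0 < (radicand v q j t).re at hre
  change _ ≤ ‖radicand v q j t‖ at hnorm
  rw [← norm_twoB_sq] at hnorm
  refine ⟨Or.inl hre, ?_, ?_, ?_, ?_⟩
  · refine le_of_sq_le_sq ?_ (norm_nonneg _)
    have : (3 / 2 * ε ^ 10) ^ 2 = 9 / 4 * ε ^ 20 := by ring
    rw [this]
    nlinarith [sq_nonneg ‖psqDiff q j t‖]
  · exact le_of_sq_le_sq (by nlinarith [sq_nonneg ‖v q‖]) (norm_nonneg _)
  · exact le_of_sq_le_sq (by nlinarith [sq_nonneg ‖psqDiff q j t‖, sq_nonneg ‖v q‖])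
      (norm_nonneg _)
  intro m hm ζ hζ
  -- variation of `2b`
  set b₀ : ℝ := √(4 * ‖v q‖ ^ 2 + x₀ ^ 2) with hb₀
  have hb0c : twoB v q j (toC t₀) = (b₀ : ℂ) := twoB_toC v q j t₀
  have hb0ge : 2 * ε ^ 10 ≤ b₀ := by
    refine Real.le_sqrt_of_sq_le ?_
    nlinarith [sq_nonneg x₀]
  -- Factor the difference of the squares. The sum 2b(t) + b₀ has real part at least b₀ ≥ 2ε¹⁰, so
  -- division by it costs only ε⁻¹⁰ out of ε⁴⁰.
  have hb : ‖twoB v q j t - b₀‖ ≤ ε ^ 20 := by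
    have e1 : (twoB v q j t - b₀) * (twoB v q j t + b₀) =
        (psqDiff q j t - x₀) * (psqDiff q j t + x₀) := by
      have h1 : twoB v q j t ^ 2 = radicand v q j t := sq_cpow_half _
      have h2 : (b₀ : ℂ) ^ 2 = 4 * (‖v q‖ : ℂ) ^ 2 + (x₀ : ℂ) ^ 2 := by
        rw [hb₀, ← Complex.ofReal_pow, Real.sq_sqrt (by positivity)]; push_cast; ring
      rw [radicand] at h1
      linear_combination h1 - h2
    have h3 : 2 * ε ^ 10 ≤ ‖twoB v q j t + b₀‖ := by
      refine le_trans ?_ ((le_abs_self _).trans (Complex.abs_re_le_norm _))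
      have := cpow_half_re_nonneg (radicand v q j t)
      rw [← twoB_eq] at this
      rw [Complex.add_re, Complex.ofReal_re]; linarith
    have h4 : ‖psqDiff q j t + x₀‖ ≤ 1 := by
      have : psqDiff q j t + x₀ = (psqDiff q j t - x₀) + ((2 * x₀ : ℝ) : ℂ) := by push_cast; ring
      rw [this]
      refine (norm_add_le _ _).trans ?_
      rw [Complex.norm_real, Real.norm_eq_abs, abs_mul, abs_two]
      have : ε ^ 40 ≤ ε := by
        simpa using pow_le_pow_of_le_one hε.le hε1' (show 1 ≤ 40 by norm_num)
      linarith
    have h5 : ‖twoB v q j t - b₀‖ * (2 * ε ^ 10) ≤ ε ^ 40 * 1 := by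
      calc _ ≤ ‖twoB v q j t - b₀‖ * ‖twoB v q j t + b₀‖ := by gcongr
        _ = ‖psqDiff q j t - x₀‖ * ‖psqDiff q j t + x₀‖ := by rw [← norm_mul, e1, norm_mul]
        _ ≤ _ := by gcongr
    have h6 : ε ^ 40 ≤ ε ^ 20 * (2 * ε ^ 10) := by
      have : ε ^ 40 = ε ^ 20 * ε ^ 10 * ε ^ 10 := by ring
      rw [this]
      have : ε ^ 10 ≤ 1 := pow_le_one₀ hε.le hε1'
      have : 0 < ε ^ 20 * ε ^ 10 := by positivity
      nlinarith
    exact le_of_mul_le_mul_right (by linarith) (show 0 < 2 * ε ^ 10 by positivity)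
  have h20' : ε ^ 20 ≤ ε ^ 10 := pow_le_pow_of_le_one hε.le hε1' (by norm_num)
  have h40' : ε ^ 40 ≤ ε ^ 10 := pow_le_pow_of_le_one hε.le hε1' (by norm_num)
  -- the shift of `p_m² - λ⁺`
  have hshift : ‖(twoB v q j t - psqDiff q j t) / 2 - ((b₀ : ℂ) - x₀) / 2‖ ≤ ε ^ 10 := by
    have : (twoB v q j t - psqDiff q j t) / 2 - ((b₀ : ℂ) - x₀) / 2 =
      ((twoB v q j t - b₀) - (psqDiff q j t - x₀)) / 2 := by ring
    rw [this, norm_div, Complex.norm_ofNat]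
    linarith [norm_sub_le (twoB v q j t - b₀) (psqDiff q j t - x₀)]
  set N := len (m - j) with hN
  have hvar : ‖psq m t - psq j t - (psq m (toC t₀) - psq j (toC t₀))‖ ≤ 4 * N * k⁻¹ * ε ^ 7 := by
    rw [psq_sub_psq_sub, norm_mul, Complex.norm_ofNat]
    have h1 := norm_sum_int_mul_le (m - j) (t - toC t₀)
    simp only [PiLp.sub_apply, Pi.sub_apply] at h1
    have h2 : N * ‖t - toC t₀‖ ≤ N * (2 * k⁻¹ * ε ^ 7) :=
      mul_le_mul_of_nonneg_left hdist (len_nonneg _)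
    linarith
  have hsplit : psq m t - lamPlus v q j t - ζ =
      (psq m (toC t₀) - lamPlus v q j (toC t₀)) +
      ((psq m t - psq j t - (psq m (toC t₀) - psq j (toC t₀))) -
        ((twoB v q j t - psqDiff q j t) / 2 - ((b₀ : ℂ) - x₀) / 2) - ζ) := by
    rw [lamPlus_eq, lamPlus_eq, hb0c, hx0c]; ring
  have herr : ‖(psq m t - psq j t - (psq m (toC t₀) - psq j (toC t₀))) -
        ((twoB v q j t - psqDiff q j t) / 2 - ((b₀ : ℂ) - x₀) / 2) - ζ‖ ≤
      4 * N * k⁻¹ * ε ^ 7 + ε ^ 10 + ε ^ 10 :=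
    norm_sub_le_of_le (norm_sub_le_of_le hvar hshift) hζ
  have hlow : ‖psq m (toC t₀) - lamPlus v q j (toC t₀)‖ -
      (4 * N * k⁻¹ * ε ^ 7 + ε ^ 10 + ε ^ 10) ≤ ‖psq m t - lamPlus v q j t - ζ‖ := by
    rw [hsplit]
    have := norm_sub_norm_le (psq m (toC t₀) - lamPlus v q j (toC t₀))
      (-((psq m t - psq j t - (psq m (toC t₀) - psq j (toC t₀))) -
        ((twoB v q j t - psqDiff q j t) / 2 - ((b₀ : ℂ) - x₀) / 2) - ζ))
    rw [norm_neg, sub_neg_eq_add] at this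
    linarith
  refine le_trans ?_ hlow
  have hN0 : 0 ≤ N := len_nonneg _
  -- Within distance 8k of j the drift is at most 32 ε⁷, negligible against ε⁶. Beyond it the drift
  -- is at most N, against a separation of at least 2kN - 1.
  rcases lt_or_ge N (8 * k) with hNk | hNk
  · have h1 := gap_center hres hv hm
    have h2 : 4 * N * k⁻¹ * ε ^ 7 ≤ 32 * ε ^ 7 := by
      have : N * k⁻¹ ≤ 8 := by rw [← div_eq_mul_inv, div_le_iff₀ hk0]; linarith
      calc 4 * N * k⁻¹ * ε ^ 7 = 4 * (N * k⁻¹) * ε ^ 7 := by ring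
        _ ≤ 4 * 8 * ε ^ 7 := by gcongr
        _ = 32 * ε ^ 7 := by ring
    linarith
  · have h1 := norm_momentum_sub_ge j m t₀ hres.norm_eq hNk
    have h3 : |(b₀ - x₀) / 2| ≤ 1 := by
      have hb1 : |(b₀ - |x₀|) / 2| ≤ ‖v q‖ := abs_half_sub_le (norm_nonneg _)
      have h9 : ε ^ 9 ≤ 1 / 100 := by
        have : ε ^ 8 ≤ 1 := pow_le_one₀ hε.le hε1'
        linarith
      rw [abs_le] at hb1 ⊢
      have := abs_le.mp hx01
      have := le_abs_self x₀
      have := neg_abs_le x₀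
      constructor <;> linarith
    have h4 : ‖psq m (toC t₀) - lamPlus v q j (toC t₀)‖ ≥ 2 * k * N - 1 := by
      have e : psq m (toC t₀) - lamPlus v q j (toC t₀) =
          ((‖momentum m t₀‖ ^ 2 - ‖momentum j t₀‖ ^ 2 - (b₀ - x₀) / 2 : ℝ) : ℂ) := by
        rw [lamPlus_eq, hb0c, hx0c, psq_toC, psq_toC]; push_cast; ring
      rw [e, Complex.norm_real, Real.norm_eq_abs]
      refine le_trans ?_ (le_abs_self _)
      have := (abs_le.mp h3).2
      linarith
    have h5 : 4 * N * k⁻¹ * ε ^ 7 ≤ N := by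
      have hk1 : k⁻¹ ≤ 1 := inv_le_one_of_one_le₀ hk
      have h7 : ε ^ 7 ≤ 1 / 100 := by
        have : ε ^ 6 ≤ 1 := pow_le_one₀ hε.le hε1'
        linarith
      calc 4 * N * k⁻¹ * ε ^ 7 ≤ 4 * N * 1 * (1 / 100) := by gcongr
        _ ≤ N := by linarith
    have h6 : ε ^ 6 ≤ 1 := pow_le_one₀ hε.le hε1'
    have h10 : ε ^ 10 ≤ 1 := pow_le_one₀ hε.le hε1'
    have h11 : N ≤ k * N := le_mul_of_one_le_left hN0 hk
    linarith

theorem differentiable_psq (m : Idx) : Differentiable ℂ (psq m) := by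
  unfold psq
  fun_prop

theorem differentiable_psqDiff (q j : Idx) : Differentiable ℂ (psqDiff q j) :=
  (differentiable_psq j).sub (differentiable_psq (j - q))

theorem ModelBounds.differentiableAt_twoB {t : C2} (h : ModelBounds v q j ε t) :
    DifferentiableAt ℂ (twoB v q j) t := by
  refine DifferentiableAt.cpow_const (f := radicand v q j) ?_ h.slit
  exact (((differentiable_psqDiff q j) t).pow 2).const_add _

theorem ModelBounds.differentiableAt_lamPlus {t : C2} (h : ModelBounds v q j ε t) :
    DifferentiableAt ℂ (lamPlus v q j) t := by
  have h1 := h.differentiableAt_twoB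
  have h2 := differentiable_psq j t
  have h3 := differentiable_psq (j - q) t
  unfold lamPlus
  simp only [div_eq_mul_inv]
  fun_prop

theorem ModelBounds.twoB_ne_zero {t : C2} (h : ModelBounds v q j ε t) (hε : 0 < ε) :
    twoB v q j t ≠ 0 :=
  norm_pos_iff.mp (lt_of_lt_of_le (by positivity) h.twoB_ge)

end

open Schur

/-! ### The model resolvent as an element of the Banach algebra -/

/-- Standing assumptions: `B` is an open set of quasimomenta on which the model operator is
controlled. -/
structure ModelData (v : Idx → ℂ) (q j : Idx) (ε : ℝ) (B : Set C2) : Prop where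
  pos : 0 < ε
  small : ε ≤ 1 / 100000
  zero : v 0 = 0
  real : ∀ p, v (-p) = conj (v p)
  ne : q ≠ 0
  norm_le : starNorm v ≤ ENNReal.ofReal (ε ^ 9)
  isOpen : IsOpen B
  bounds : ∀ t ∈ B, ModelBounds v q j ε t

/-- The projection `Ê⁺(t)`. -/
def ePlus (v : Idx → ℂ) (q j : Idx) (t : C2) : Schur := ofMat (EPlus v q j t)

theorem bdd_of_block {q j : Idx} {a : Mat ℂ} {c : ℝ} (hc : 0 ≤ c)
    (h0 : ∀ m n, ¬ (inBlock q j m ∧ inBlock q j n) → a m n = 0) (h : ∀ m n, ‖a m n‖ ≤ c) :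
    Bdd a (2 * c) := by
  have key : ∀ f : Idx → ℂ, (∀ m, ¬ inBlock q j m → f m = 0) → (∀ m, ‖f m‖ ≤ c) →
      ∀ s : Finset Idx, ∑ m ∈ s, ‖f m‖ ≤ 2 * c := by
    intro f hf hfc s
    have hne : ∀ m ∈ s, m ∉ s.filter (fun m => m ∈ ({j, j - q} : Finset Idx)) → ‖f m‖ = 0 := by
      intro m hm hm'
      rw [hf m, norm_zero]
      intro hb
      exact hm' (Finset.mem_filter.mpr ⟨hm, by simpa [inBlock] using hb⟩)
    rw [← Finset.sum_subset (Finset.filter_subset _ s) hne]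
    calc _ ≤ ∑ m ∈ s.filter (fun m => m ∈ ({j, j - q} : Finset Idx)), c :=
          Finset.sum_le_sum fun m _ => hfc m
      _ ≤ ∑ m ∈ ({j, j - q} : Finset Idx), c :=
          Finset.sum_le_sum_of_subset_of_nonneg
            (fun m hm => (Finset.mem_filter.mp hm).2) fun _ _ _ => hc
      _ ≤ 2 * c := by
          rw [Finset.sum_const, nsmul_eq_mul]
          gcongr
          exact_mod_cast Finset.card_le_two
  exact ⟨fun n => key _ (fun m hm => h0 m n fun h => hm h.1) fun m => h m n,
    fun m => key _ (fun n hn => h0 m n fun h => hn h.2) fun n => h m n⟩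

theorem ent_mul_of_mul_proj {q : Idx} (hq : q ≠ 0) {j : Idx} {x : Schur} (hx : x * proj q j = x)
    (y : Schur) (m n : Idx) :
    ent m n (x * y) = ent m j x * ent j n y + ent m (j - q) x * ent (j - q) n y := by
  rw [← hx, proj_eq_unit_add hq, mul_add, add_mul, map_add, ent_mul_unit_mul, ent_mul_unit_mul,
    ← mul_add, ← proj_eq_unit_add hq, hx]

namespace ModelData

variable {v : Idx → ℂ} {q j : Idx} {ε : ℝ} {B : Set C2} {t : C2}

theorem sub_ne (D : ModelData v q j ε B) : j - q ≠ j := fun h => D.ne (by rwa [sub_eq_self] at h)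

theorem lamPlus_sub_lamMinus : lamPlus v q j t - lamMinus v q j t = twoB v q j t := by
  rw [lamMinus_eq]; ring

theorem sq_twoB : twoB v q j t ^ 2 = 4 * (‖v q‖ : ℂ) ^ 2 + psqDiff q j t ^ 2 := sq_cpow_half _

theorem EPlus_jj (D : ModelData v q j ε B) :
    EPlus v q j t j j = (twoB v q j t + psqDiff q j t) / (2 * twoB v q j t) := by
  simp only [EPlus, inBlock, true_or, and_self, if_true, freeOp, blockV, sub_self, D.zero,
    lamPlus_sub_lamMinus]
  rw [lamMinus_eq, lamPlus_eq, ← div_div]; congr 1; ring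

theorem EPlus_qq (D : ModelData v q j ε B) :
    EPlus v q j t (j - q) (j - q) = (twoB v q j t - psqDiff q j t) / (2 * twoB v q j t) := by
  simp only [EPlus, inBlock, or_true, and_self, if_true, freeOp, blockV, sub_self, D.zero,
    lamPlus_sub_lamMinus]
  rw [lamMinus_eq, lamPlus_eq, ← div_div]; congr 1; rw [psqDiff]; ring

theorem EPlus_jq (D : ModelData v q j ε B) :
    EPlus v q j t j (j - q) = v q / twoB v q j t := by
  simp [EPlus, inBlock, freeOp, blockV, lamPlus_sub_lamMinus, D.sub_ne.symm]

theorem EPlus_qj (D : ModelData v q j ε B) :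
    EPlus v q j t (j - q) j = conj (v q) / twoB v q j t := by
  simp [EPlus, inBlock, freeOp, blockV, lamPlus_sub_lamMinus, D.sub_ne, D.real]

theorem EPlus_eq_zero {m n : Idx} (h : ¬ (inBlock q j m ∧ inBlock q j n)) :
    EPlus v q j t m n = 0 := if_neg h

theorem norm_EPlus_le (D : ModelData v q j ε B) (ht : t ∈ B) (m n : Idx) :
    ‖EPlus v q j t m n‖ ≤ 1 := by
  have hb := D.bounds t ht
  have h0 : 0 < ‖twoB v q j t‖ := norm_pos_iff.mpr (hb.twoB_ne_zero D.pos)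
  by_cases h : inBlock q j m ∧ inBlock q j n
  · rcases h with ⟨h1 | h1, h2 | h2⟩ <;> rw [h1, h2]
    · rw [D.EPlus_jj, norm_div, norm_mul, Complex.norm_ofNat, div_le_one (by positivity)]
      linarith [norm_add_le (twoB v q j t) (psqDiff q j t), hb.diff_le]
    · rw [D.EPlus_jq, norm_div, div_le_one h0]; exact hb.pot_le
    · rw [D.EPlus_qj, norm_div, div_le_one h0, RCLike.norm_conj]; exact hb.pot_le
    · rw [D.EPlus_qq, norm_div, norm_mul, Complex.norm_ofNat, div_le_one (by positivity)]
      linarith [norm_sub_le (twoB v q j t) (psqDiff q j t), hb.diff_le]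
  · rw [EPlus_eq_zero h, norm_zero]; exact zero_le_one

theorem bdd_EPlus (D : ModelData v q j ε B) (ht : t ∈ B) : Bdd (EPlus v q j t) (2 * 1) :=
  bdd_of_block zero_le_one (fun _ _ => EPlus_eq_zero) (D.norm_EPlus_le ht)

theorem ent_ePlus (D : ModelData v q j ε B) (ht : t ∈ B) (m n : Idx) :
    ent m n (ePlus v q j t) = EPlus v q j t m n := ent_ofMat (D.bdd_EPlus ht) m n

theorem norm_ePlus_le (D : ModelData v q j ε B) (ht : t ∈ B) : ‖ePlus v q j t‖ ≤ 2 :=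
  (norm_ofMat_le (D.bdd_EPlus ht)).trans_eq (mul_one 2)

theorem ePlus_mul_proj (D : ModelData v q j ε B) (ht : t ∈ B) :
    ePlus v q j t * proj q j = ePlus v q j t := by
  ext m n
  rw [ent_mul_proj, D.ent_ePlus ht]
  split_ifs with h
  · rfl
  · rw [EPlus_eq_zero fun h' => h h'.2]

theorem proj_mul_ePlus (D : ModelData v q j ε B) (ht : t ∈ B) :
    proj q j * ePlus v q j t = ePlus v q j t := by
  ext m n
  rw [ent_proj_mul, D.ent_ePlus ht]
  split_ifs with h
  · rfl
  · rw [EPlus_eq_zero fun h' => h h'.1]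

/-- The determinant of the block vanishes. With trace one this makes it a rank one idempotent, also
at complex t, where it need not be self-adjoint. -/
theorem EPlus_det (D : ModelData v q j ε B) (ht : t ∈ B) :
    EPlus v q j t j (j - q) * EPlus v q j t (j - q) j =
      EPlus v q j t j j * EPlus v q j t (j - q) (j - q) := by
  have h0 := (D.bounds t ht).twoB_ne_zero D.pos
  rw [D.EPlus_jq, D.EPlus_qj, D.EPlus_jj, D.EPlus_qq]
  have h1 : v q * conj (v q) = (‖v q‖ : ℂ) ^ 2 := Complex.mul_conj' _
  have h2 := sq_twoB (v := v) (q := q) (j := j) (t := t)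
  field_simp
  rw [h1]
  linear_combination -h2

theorem EPlus_trace (D : ModelData v q j ε B) (ht : t ∈ B) :
    EPlus v q j t j j + EPlus v q j t (j - q) (j - q) = 1 := by
  have h0 := (D.bounds t ht).twoB_ne_zero D.pos
  rw [D.EPlus_jj, D.EPlus_qq]
  field_simp
  ring

theorem ePlus_mul_ePlus (D : ModelData v q j ε B) (ht : t ∈ B) :
    ePlus v q j t * ePlus v q j t = ePlus v q j t := by
  ext m n
  rw [ent_mul_of_mul_proj D.ne (D.ePlus_mul_proj ht)]
  simp only [D.ent_ePlus ht]
  have h1 := D.EPlus_det ht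
  have h2 := D.EPlus_trace ht
  by_cases h : inBlock q j m ∧ inBlock q j n
  · rcases h with ⟨h3 | h3, h4 | h4⟩ <;> rw [h3, h4]
    · linear_combination h1 + EPlus v q j t j j * h2
    · linear_combination EPlus v q j t j (j - q) * h2
    · linear_combination EPlus v q j t (j - q) j * h2
    · linear_combination h1 + EPlus v q j t (j - q) (j - q) * h2
  · rw [EPlus_eq_zero h]
    rw [not_and_or] at h
    rcases h with h | h
    · rw [EPlus_eq_zero fun h' => h h'.1, EPlus_eq_zero (n := j - q) fun h' => h h'.1]; ring
    · rw [EPlus_eq_zero (n := n) fun h' => h h'.2,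
        EPlus_eq_zero (m := j - q) (n := n) fun h' => h h'.2]; ring

theorem EMinus_eq (D : ModelData v q j ε B) (ht : t ∈ B) (m n : Idx) :
    EMinus v q j t m n = ent m n (proj q j - ePlus v q j t) := by
  have h0 := (D.bounds t ht).twoB_ne_zero D.pos
  rw [map_sub, D.ent_ePlus ht, ent_proj, EMinus, EPlus, lamPlus_sub_lamMinus]
  by_cases h : inBlock q j m ∧ inBlock q j n
  · rw [if_pos h, if_pos h]
    by_cases hmn : m = n
    · rw [if_pos hmn, if_pos ⟨hmn, h.1⟩, if_pos hmn, lamMinus_eq]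
      field_simp; ring
    · rw [if_neg hmn, if_neg fun h' => hmn h'.1, if_neg hmn]; ring
  · rw [if_neg h, if_neg h, if_neg (fun h' : m = n ∧ inBlock q j m => h ⟨h'.2, h'.1 ▸ h'.2⟩), sub_zero]

theorem norm_eMinus_le (D : ModelData v q j ε B) (ht : t ∈ B) :
    ‖proj q j - ePlus v q j t‖ ≤ 2 := by
  have : Bdd (fun m n => ent m n (proj q j - ePlus v q j t)) (2 * 1) := by
    have hb := D.bounds t ht
    refine bdd_of_block (q := q) (j := j) zero_le_one (fun m n h => ?_) (fun m n => ?_)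
    · rw [← D.EMinus_eq ht]; exact if_neg h
    · have tr := D.EPlus_trace ht
      rw [map_sub, D.ent_ePlus ht, ent_proj]
      by_cases h : m = n ∧ inBlock q j m
      · rw [if_pos h]
        rcases h with ⟨rfl, rfl | rfl⟩
        · rw [← tr, add_sub_cancel_left]; exact D.norm_EPlus_le ht _ _
        · rw [← tr, add_sub_cancel_right]; exact D.norm_EPlus_le ht _ _
      · rw [if_neg h, zero_sub, norm_neg]; exact D.norm_EPlus_le ht _ _
  simpa using norm_le_of this.1 this.2

end ModelData

/-! ### Resolvents and potentials in the algebra, and their block bounds -/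

open Classical in
/-- The part of the model resolvent outside of the block; `z = λ̂⁺(t) + ζ`. -/
def resOut (v : Idx → ℂ) (q j : Idx) (t : C2) (ζ : ℂ) : Schur :=
  diag fun m => if inBlock q j m then 0 else (psq m t - lamPlus v q j t - ζ)⁻¹

/-- The matrix `c Ê⁺ + (λ̂⁻ - z)⁻¹ Ê⁻ + (H₀ - z)⁻¹ (1 - P_q)`, where `z = λ̂⁺(t) + ζ`. -/
def resGen (v : Idx → ℂ) (q j : Idx) (c : ℂ) (t : C2) (ζ : ℂ) : Schur :=
  c • ePlus v q j t + (-twoB v q j t - ζ)⁻¹ • (proj q j - ePlus v q j t) + resOut v q j t ζ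

/-- The model resolvent `(Ĥ_q(t) - λ̂⁺(t) - ζ)⁻¹`. -/
def res (v : Idx → ℂ) (q j : Idx) (t : C2) (ζ : ℂ) : Schur := resGen v q j (-ζ)⁻¹ t ζ

/-- The resolvent `(Ĥ_q(t) + Ê⁺(t) - λ̂⁺(t) - ζ)⁻¹`. -/
def resSh (v : Idx → ℂ) (q j : Idx) (t : C2) (ζ : ℂ) : Schur := resGen v q j (1 - ζ)⁻¹ t ζ

/-- The matrix `W - P_q V P_q`. -/
def pot (v : Idx → ℂ) (q j : Idx) (w : Idx → ℂ) : Schur :=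
  toep w - proj q j * toep v * proj q j

namespace ModelData

variable {v : Idx → ℂ} {q j : Idx} {ε : ℝ} {B : Set C2} {t : C2}

theorem norm_resOut_coeff_le (D : ModelData v q j ε B) (ht : t ∈ B) {ζ : ℂ} (hζ : ‖ζ‖ ≤ ε ^ 10)
    [DecidablePred (inBlock q j)] (m : Idx) :
    ‖(if inBlock q j m then 0 else (psq m t - lamPlus v q j t - ζ)⁻¹ : ℂ)‖ ≤ (ε ^ 6)⁻¹ := by
  have hε := D.pos
  split_ifs with h
  · rw [norm_zero]; positivity
  · rw [norm_inv]
    exact inv_anti₀ (by positivity) ((D.bounds t ht).gap m h ζ hζ)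

open Classical in
theorem ent_resOut (D : ModelData v q j ε B) (ht : t ∈ B) {ζ : ℂ} (hζ : ‖ζ‖ ≤ ε ^ 10)
    (m n : Idx) : ent m n (resOut v q j t ζ) =
      if m = n ∧ ¬ inBlock q j m then (psq m t - lamPlus v q j t - ζ)⁻¹ else 0 := by
  rw [resOut, ent_diag (D.norm_resOut_coeff_le ht hζ)]
  by_cases h : m = n
  · subst h; by_cases h2 : inBlock q j m <;> simp [h2]
  · simp [h]

theorem norm_resOut_le (D : ModelData v q j ε B) (ht : t ∈ B) {ζ : ℂ} (hζ : ‖ζ‖ ≤ ε ^ 10) :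
    ‖resOut v q j t ζ‖ ≤ (ε ^ 6)⁻¹ := by
  classical
  exact norm_diag_le (D.norm_resOut_coeff_le ht hζ)

theorem proj_mul_resOut (D : ModelData v q j ε B) (ht : t ∈ B) {ζ : ℂ} (hζ : ‖ζ‖ ≤ ε ^ 10) :
    proj q j * resOut v q j t ζ = 0 := by
  ext m n
  rw [ent_proj_mul, D.ent_resOut ht hζ, map_zero]
  by_cases h : m = n
  · subst h; by_cases h2 : inBlock q j m <;> simp [h2]
  · simp [h]

theorem resOut_mul_proj (D : ModelData v q j ε B) (ht : t ∈ B) {ζ : ℂ} (hζ : ‖ζ‖ ≤ ε ^ 10) :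
    resOut v q j t ζ * proj q j = 0 := by
  ext m n
  rw [ent_mul_proj, D.ent_resOut ht hζ, map_zero]
  by_cases h : m = n
  · subst h; split_ifs <;> simp_all
  · simp [h]

theorem ent_res (D : ModelData v q j ε B) (ht : t ∈ B) {ζ : ℂ} (hζ : ‖ζ‖ ≤ ε ^ 10) (m n : Idx) :
    ent m n (res v q j t ζ) = modelResolvent v q j t (lamPlus v q j t + ζ) m n := by
  rw [res, resGen, map_add, map_add, map_smul, map_smul, D.ent_ePlus ht, D.ent_resOut ht hζ,
    ← D.EMinus_eq ht, modelResolvent, lamMinus_eq]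
  simp only [smul_eq_mul, sub_add_cancel_left, sub_sub]
  congr 4
  ring

/-- Inside the block the subtraction of P V P leaves only W - V, so the size drops from ε⁹ to ε¹¹.
The bound 3 ε⁹ counts W - V, V and P V P with ε⁹ each. -/
theorem potBound (D : ModelData v q j ε B) {w : Idx → ℂ}
    (hw : starNorm (w - v) ≤ ENNReal.ofReal (9 * ε ^ 11)) :
    starNorm w ≠ ∞ ∧ ‖pot v q j w‖ ≤ 3 * ε ^ 9 ∧
      ‖proj q j * pot v q j w * proj q j‖ ≤ 9 * ε ^ 11 := by
  have hε := D.pos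
  have hε1 := D.small
  have hsum : starNorm w ≤ ENNReal.ofReal (9 * ε ^ 11 + ε ^ 9) := by
    rw [ENNReal.ofReal_add (by positivity) (by positivity)]
    refine le_trans ?_ (add_le_add hw D.norm_le)
    rw [starNorm, starNorm, starNorm, ← ENNReal.tsum_add]
    refine ENNReal.tsum_le_tsum fun b => ?_
    calc ‖w b‖ₑ = ‖(w - v) b + v b‖ₑ := by rw [Pi.sub_apply, sub_add_cancel]
      _ ≤ _ := enorm_add_le _ _
  have hwf : starNorm w ≠ ∞ := ne_top_of_le_ne_top ENNReal.ofReal_ne_top hsum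
  have hvf : starNorm v ≠ ∞ := ne_top_of_le_ne_top ENNReal.ofReal_ne_top D.norm_le
  have hdf : starNorm (w - v) ≠ ∞ := ne_top_of_le_ne_top ENNReal.ofReal_ne_top hw
  have e : toep w = toep (w - v) + toep v := by
    ext m n
    rw [map_add, ent_toep hwf, ent_toep hvf, ent_toep hdf, Pi.sub_apply, sub_add_cancel]
  have hP := norm_proj_le q j
  have hPxP : ∀ x : Schur, ‖proj q j * x * proj q j‖ ≤ ‖x‖ := fun x =>
    (norm_mul_le _ _).trans ((mul_le_of_le_one_right (norm_nonneg _) hP).trans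
      ((norm_mul_le _ _).trans (mul_le_of_le_one_left (norm_nonneg _) hP)))
  have n1 := norm_toep_le (by positivity) hsum
  have n2 := norm_toep_le (by positivity) D.norm_le
  have n3 := norm_toep_le (by positivity) hw
  refine ⟨hwf, ?_, ?_⟩
  · have h11 : 9 * ε ^ 11 ≤ ε ^ 9 := by
      have : ε ^ 11 = ε ^ 9 * ε ^ 2 := by ring
      rw [this]
      have : ε ^ 2 ≤ 1 / 9 := by nlinarith
      nlinarith [pow_pos hε 9]
    refine (norm_sub_le _ _).trans ?_
    linarith [hPxP (toep v)]
  · have : proj q j * pot v q j w * proj q j = proj q j * toep (w - v) * proj q j := by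
      rw [pot, e]
      simp only [mul_sub, sub_mul, mul_add, add_mul]
      have : proj q j * (proj q j * toep v * proj q j) * proj q j =
          proj q j * toep v * proj q j := by
        simp only [← mul_assoc, proj_mul_proj]
        rw [mul_assoc _ (proj q j), proj_mul_proj]
      rw [this]; abel
    rw [this]
    exact (hPxP _).trans n3

theorem proj_mul_resGen (D : ModelData v q j ε B) (ht : t ∈ B) {ζ : ℂ} (hζ : ‖ζ‖ ≤ ε ^ 10)
    (c : ℂ) : proj q j * resGen v q j c t ζ =
      c • ePlus v q j t + (-twoB v q j t - ζ)⁻¹ • (proj q j - ePlus v q j t) := by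
  rw [resGen, mul_add, mul_add, mul_smul_comm, mul_smul_comm, mul_sub, proj_mul_proj,
    D.proj_mul_ePlus ht, D.proj_mul_resOut ht hζ, add_zero]

theorem resGen_mul_proj (D : ModelData v q j ε B) (ht : t ∈ B) {ζ : ℂ} (hζ : ‖ζ‖ ≤ ε ^ 10)
    (c : ℂ) : resGen v q j c t ζ * proj q j =
      c • ePlus v q j t + (-twoB v q j t - ζ)⁻¹ • (proj q j - ePlus v q j t) := by
  rw [resGen, add_mul, add_mul, smul_mul_assoc, smul_mul_assoc, sub_mul, proj_mul_proj,
    D.ePlus_mul_proj ht, D.resOut_mul_proj ht hζ, add_zero]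

theorem compl_mul_resGen (D : ModelData v q j ε B) (ht : t ∈ B) {ζ : ℂ} (hζ : ‖ζ‖ ≤ ε ^ 10)
    (c : ℂ) : (1 - proj q j) * resGen v q j c t ζ = resOut v q j t ζ := by
  rw [sub_mul, one_mul, D.proj_mul_resGen ht hζ, resGen, add_sub_cancel_left]

theorem norm_twoB_add_ge (D : ModelData v q j ε B) (ht : t ∈ B) {ζ : ℂ} (hζ : ‖ζ‖ ≤ ε ^ 10 / 2) :
    ε ^ 10 ≤ ‖-twoB v q j t - ζ‖ := by
  have h1 := (D.bounds t ht).twoB_ge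
  have h2 := norm_sub_norm_le (-twoB v q j t) ζ
  rw [norm_neg] at h2
  linarith

theorem half_le (D : ModelData v q j ε B) {ζ : ℂ} (hζ : ‖ζ‖ ≤ ε ^ 10 / 2) : ‖ζ‖ ≤ ε ^ 10 := by
  have := pow_pos D.pos 10
  linarith

/-- On the block both spectral projections have norm at most 2, with coefficients at most 4 ε⁻¹⁰ and
ε⁻¹⁰; this gives 10 ε⁻¹⁰. The coupling constant up to 2, instead of 1, doubles the potential bounds
and leaves room for differentiation in α on [0, 1]. -/
theorem blockBound (D : ModelData v q j ε B) (ht : t ∈ B) {w : Idx → ℂ}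
    (hw : starNorm (w - v) ≤ ENNReal.ofReal (9 * ε ^ 11)) {ζ c α : ℂ} (hζ : ‖ζ‖ ≤ ε ^ 10 / 2)
    (hc : ‖c‖ ≤ 4 * (ε ^ 10)⁻¹) (hα : ‖α‖ ≤ 2) :
    BlockBound (proj q j) (resGen v q j c t ζ) (α • pot v q j w) ε := by
  have hε := D.pos
  have hζ' := D.half_le hζ
  obtain ⟨-, h1, h2⟩ := D.potBound hw
  refine ⟨proj_mul_proj q j, norm_proj_le q j, norm_one_sub_proj_le q j, ?_, ?_, ?_, ?_, ?_⟩
  · rw [D.proj_mul_resGen ht hζ', D.resGen_mul_proj ht hζ']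
  · rw [D.proj_mul_resGen ht hζ']
    have h3 : ‖(-twoB v q j t - ζ)⁻¹‖ ≤ (ε ^ 10)⁻¹ := by
      rw [norm_inv]; exact inv_anti₀ (by positivity) (D.norm_twoB_add_ge ht hζ)
    refine (norm_add_le _ _).trans ?_
    rw [norm_smul, norm_smul]
    have h4 := mul_le_mul hc (D.norm_ePlus_le ht) (norm_nonneg _) (by positivity)
    have h5 := mul_le_mul h3 (D.norm_eMinus_le ht) (norm_nonneg _) (by positivity)
    linarith
  · rw [D.compl_mul_resGen ht hζ']; exact D.norm_resOut_le ht hζ'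
  · rw [mul_smul_comm, smul_mul_assoc, norm_smul]
    have := mul_le_mul hα h2 (norm_nonneg _) (by norm_num)
    linarith
  · rw [norm_smul]
    have := mul_le_mul hα h1 (norm_nonneg _) (by norm_num)
    linarith

theorem blockBound_res (D : ModelData v q j ε B) (ht : t ∈ B) {w : Idx → ℂ}
    (hw : starNorm (w - v) ≤ ENNReal.ofReal (9 * ε ^ 11)) {ζ α : ℂ} (hζ : ‖ζ‖ = ε ^ 10 / 4)
    (hα : ‖α‖ ≤ 2) : BlockBound (proj q j) (res v q j t ζ) (α • pot v q j w) ε := by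
  have h10 := pow_pos D.pos 10
  refine D.blockBound ht hw (by linarith) ?_ hα
  rw [norm_inv, norm_neg, hζ]
  apply le_of_eq
  field_simp

/-- After the shift by Ê⁺ the coefficient (1 - ζ)⁻¹ is bounded by 2, so the bounds hold on the full
disc and not only on the contour. -/
theorem blockBound_resSh (D : ModelData v q j ε B) (ht : t ∈ B) {w : Idx → ℂ}
    (hw : starNorm (w - v) ≤ ENNReal.ofReal (9 * ε ^ 11)) {ζ α : ℂ} (hζ : ‖ζ‖ ≤ ε ^ 10 / 2)
    (hα : ‖α‖ ≤ 2) : BlockBound (proj q j) (resSh v q j t ζ) (α • pot v q j w) ε := by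
  have hε := D.pos
  have h10 : ε ^ 10 ≤ 1 := pow_le_one₀ hε.le (by linarith [D.small])
  refine D.blockBound ht hw hζ ?_ hα
  have h1 : 1 / 2 ≤ ‖1 - ζ‖ := by
    have := norm_sub_norm_le 1 ζ
    rw [norm_one] at this
    linarith
  have h2 : 1 ≤ (ε ^ 10)⁻¹ := (one_le_inv₀ (by positivity)).mpr h10
  calc ‖(1 - ζ)⁻¹‖ ≤ (1 / 2)⁻¹ := by rw [norm_inv]; exact inv_anti₀ (by norm_num) h1
    _ ≤ _ := by linarith

/-! #### Holomorphy -/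

theorem differentiableOn_ePlus (D : ModelData v q j ε B) : DifferentiableOn ℂ (ePlus v q j) B := by
  refine differentiableOn_of_ent D.isOpen (M := 2) (fun m n => ?_) fun t ht => D.norm_ePlus_le ht
  refine DifferentiableOn.congr (f := fun t => EPlus v q j t m n) ?_ fun t ht => D.ent_ePlus ht m n
  intro t ht
  have hb := D.bounds t ht
  have h0 := hb.twoB_ne_zero D.pos
  have hd := hb.differentiableAt_twoB
  have hx := differentiable_psqDiff q j t
  refine DifferentiableAt.differentiableWithinAt ?_
  by_cases h : inBlock q j m ∧ inBlock q j n
  · rcases h with ⟨h1 | h1, h2 | h2⟩ <;> rw [h1, h2]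
    · simp only [D.EPlus_jj, div_eq_mul_inv]
      exact (hd.add hx).mul ((hd.const_mul 2).fun_inv (mul_ne_zero two_ne_zero h0))
    · simp only [D.EPlus_jq, div_eq_mul_inv]
      exact (differentiableAt_const _).mul (hd.fun_inv h0)
    · simp only [D.EPlus_qj, div_eq_mul_inv]
      exact (differentiableAt_const _).mul (hd.fun_inv h0)
    · simp only [D.EPlus_qq, div_eq_mul_inv]
      exact (hd.sub hx).mul ((hd.const_mul 2).fun_inv (mul_ne_zero two_ne_zero h0))
  · simp only [EPlus_eq_zero h]
    exact differentiableAt_const _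

theorem isOpen_prod (D : ModelData v q j ε B) :
    IsOpen (B ×ˢ Metric.ball (0 : ℂ) (ε ^ 10) : Set (C2 × ℂ)) := D.isOpen.prod Metric.isOpen_ball

theorem differentiableOn_resOut (D : ModelData v q j ε B) :
    DifferentiableOn ℂ (fun p : C2 × ℂ => resOut v q j p.1 p.2)
      (B ×ˢ Metric.ball (0 : ℂ) (ε ^ 10)) := by
  have hmem : ∀ p ∈ (B ×ˢ Metric.ball (0 : ℂ) (ε ^ 10) : Set (C2 × ℂ)), ‖p.2‖ ≤ ε ^ 10 :=
    fun p hp => (mem_ball_zero_iff.mp hp.2).le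
  refine differentiableOn_of_ent D.isOpen_prod (M := (ε ^ 6)⁻¹) (fun m n => ?_)
    fun p hp => D.norm_resOut_le hp.1 (hmem p hp)
  classical
  refine DifferentiableOn.congr ?_ fun p hp => D.ent_resOut hp.1 (hmem p hp) m n
  by_cases h : m = n ∧ ¬ inBlock q j m
  · simp only [if_pos h]
    intro p hp
    have hb := D.bounds p.1 hp.1
    have h0 : psq m p.1 - lamPlus v q j p.1 - p.2 ≠ 0 := norm_pos_iff.mp
      (lt_of_lt_of_le (pow_pos D.pos 6) (hb.gap m h.2 p.2 (hmem p hp)))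
    have h1 : DifferentiableAt ℂ (fun p : C2 × ℂ => psq m p.1) p :=
      (differentiable_psq m p.1).comp p differentiableAt_fst
    have h2 : DifferentiableAt ℂ (fun p : C2 × ℂ => lamPlus v q j p.1) p :=
      hb.differentiableAt_lamPlus.comp p differentiableAt_fst
    exact (((h1.sub h2).sub differentiableAt_snd).fun_inv h0).differentiableWithinAt
  · simp only [if_neg h]
    exact differentiableOn_const _

theorem differentiableAt_resGen (D : ModelData v q j ε B) {c : ℂ → ℂ} {t : C2} {ζ : ℂ} (ht : t ∈ B)
    (hζ : ‖ζ‖ < ε ^ 10 / 2 + ε ^ 10 / 100) (hc : DifferentiableAt ℂ c ζ) :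
    DifferentiableAt ℂ (fun p : C2 × ℂ => resGen v q j (c p.2) p.1 p.2) (t, ζ) := by
  have h10 := pow_pos D.pos 10
  have h1 : DifferentiableAt ℂ (fun p : C2 × ℂ => resOut v q j p.1 p.2) (t, ζ) :=
    D.differentiableOn_resOut.differentiableAt (D.isOpen_prod.mem_nhds
      ⟨ht, mem_ball_zero_iff.mpr (by linarith)⟩)
  have h2 : DifferentiableAt ℂ (fun p : C2 × ℂ => ePlus v q j p.1) (t, ζ) :=
    DifferentiableAt.comp (t, ζ) (g := ePlus v q j)
      (D.differentiableOn_ePlus.differentiableAt (D.isOpen.mem_nhds ht)) differentiableAt_fst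
  have h3 : DifferentiableAt ℂ (fun p : C2 × ℂ => twoB v q j p.1) (t, ζ) :=
    DifferentiableAt.comp (t, ζ) (g := twoB v q j) (D.bounds t ht).differentiableAt_twoB
      differentiableAt_fst
  have h4 : DifferentiableAt ℂ (fun p : C2 × ℂ => c p.2) (t, ζ) :=
    DifferentiableAt.comp (t, ζ) (g := c) hc differentiableAt_snd
  have h5 : -twoB v q j t - ζ ≠ 0 := by
    have h1 := (D.bounds t ht).twoB_ge
    have h2 := norm_sub_norm_le (-twoB v q j t) ζ
    rw [norm_neg] at h2
    exact norm_pos_iff.mp (by linarith)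
  have h6 : DifferentiableAt ℂ (fun p : C2 × ℂ => (-twoB v q j p.1 - p.2)⁻¹) (t, ζ) :=
    (h3.neg.sub differentiableAt_snd).fun_inv h5
  exact ((h4.smul h2).add (h6.smul (h2.const_sub _))).add h1

theorem differentiableAt_res (D : ModelData v q j ε B) {t : C2} {ζ : ℂ} (ht : t ∈ B)
    (hζ : ‖ζ‖ ≤ ε ^ 10 / 2) (h0 : ζ ≠ 0) :
    DifferentiableAt ℂ (fun p : C2 × ℂ => res v q j p.1 p.2) (t, ζ) :=
  D.differentiableAt_resGen (c := fun ζ => (-ζ)⁻¹) ht (by linarith [pow_pos D.pos 10])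
    (differentiableAt_id.fun_neg.fun_inv (neg_ne_zero.mpr h0))

theorem differentiableAt_resSh (D : ModelData v q j ε B) {t : C2} {ζ : ℂ} (ht : t ∈ B)
    (hζ : ‖ζ‖ ≤ ε ^ 10 / 2) :
    DifferentiableAt ℂ (fun p : C2 × ℂ => resSh v q j p.1 p.2) (t, ζ) := by
  have h10 : ε ^ 10 ≤ 1 := pow_le_one₀ D.pos.le (by linarith [D.small])
  have : 1 - ζ ≠ 0 := fun h => by
    rw [sub_eq_zero] at h
    rw [← h, norm_one] at hζ
    linarith
  exact D.differentiableAt_resGen (c := fun ζ => (1 - ζ)⁻¹) ht (by linarith [pow_pos D.pos 10])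
    ((differentiableAt_id.const_sub 1).fun_inv this)

end ModelData

/-! ### The perturbation series -/

/-- The contour moves with λ̂⁺(t). Recentring at the origin gives a contour independent of t, as
differentiation under the integral requires. -/
theorem circleIntegral_shift {F : Type*} [NormedAddCommGroup F] [NormedSpace ℂ F] (f : ℂ → F)
    (c : ℂ) (R : ℝ) : ∮ z in C(c, R), f z = ∮ ζ in C(0, R), f (c + ζ) := by
  simp only [circleIntegral, deriv_circleMap]
  simp only [circleMap, zero_add]

theorem map_circleIntegral {F G : Type*} [NormedAddCommGroup F] [NormedSpace ℂ F] [CompleteSpace F]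
    [NormedAddCommGroup G] [NormedSpace ℂ G] [CompleteSpace G] (L : F →L[ℂ] G) {f : ℂ → F} {c : ℂ}
    {R : ℝ} (hf : CircleIntegrable f c R) :
    L (∮ z in C(c, R), f z) = ∮ z in C(c, R), L (f z) := by
  simp only [circleIntegral]
  rw [← L.intervalIntegral_comp_comm hf.out]
  simp only [map_smul]

theorem norm_circleIntegral_le {F : Type*} [NormedAddCommGroup F] [NormedSpace ℂ F] {f : ℂ → F}
    {c : ℂ} {R C : ℝ} (hR : 0 ≤ R) (hf : ∀ z ∈ Metric.sphere c R, ‖f z‖ ≤ C) :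
    ‖∮ z in C(c, R), f z‖ ≤ 2 * Real.pi * R * C :=
  circleIntegral.norm_integral_le_of_norm_le_const hR hf

theorem norm_two_pi_I_inv : ‖(2 * Real.pi * Complex.I : ℂ)⁻¹‖ = (2 * Real.pi)⁻¹ := by
  rw [norm_inv, norm_mul, norm_mul, Complex.norm_I, Complex.norm_ofNat, Complex.norm_real,
    Real.norm_of_nonneg Real.pi_pos.le, mul_one]

/-- The term `∮ ((Ĥ_q - z)⁻¹ X)^r (Ĥ_q - z)⁻¹ dz` of the series for the projection. -/
def gOp (v : Idx → ℂ) (q j : Idx) (ε : ℝ) (X : Schur) (r : ℕ) (t : C2) : Schur :=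
  ((-1) ^ (r + 1) * (2 * Real.pi * Complex.I : ℂ)⁻¹) •
    ∮ ζ in C(0, ε ^ 10 / 4), (res v q j t ζ * X) ^ r * res v q j t ζ

/-- The sum of the series for the projection. -/
def eOp (v : Idx → ℂ) (q j : Idx) (ε : ℝ) (X : Schur) (t : C2) : Schur :=
  ePlus v q j t + ∑' r : ℕ, gOp v q j ε X (r + 1) t

/-- `X` is an admissible perturbation at `t`. -/
def Admissible (v : Idx → ℂ) (q j : Idx) (ε : ℝ) (X : Schur) (t : C2) : Prop :=
  ∀ ζ ∈ Metric.sphere (0 : ℂ) (ε ^ 10 / 4), BlockBound (proj q j) (res v q j t ζ) X ε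

namespace ModelData

variable {v : Idx → ℂ} {q j : Idx} {ε : ℝ} {B : Set C2} {t : C2} {X : Schur}

theorem admissible (D : ModelData v q j ε B) (ht : t ∈ B) {w : Idx → ℂ}
    (hw : starNorm (w - v) ≤ ENNReal.ofReal (9 * ε ^ 11)) {α : ℂ} (hα : ‖α‖ ≤ 2) :
    Admissible v q j ε (α • pot v q j w) t := fun _ hζ =>
  D.blockBound_res ht hw (mem_sphere_zero_iff_norm.mp hζ) hα

theorem admissible_pot (D : ModelData v q j ε B) (ht : t ∈ B) {w : Idx → ℂ}
    (hw : starNorm (w - v) ≤ ENNReal.ofReal (9 * ε ^ 11)) :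
    Admissible v q j ε (pot v q j w) t := by
  simpa using D.admissible ht hw (α := 1) (by norm_num)

theorem radius_pos (D : ModelData v q j ε B) : 0 < ε ^ 10 / 4 := by
  have := pow_pos D.pos 10
  positivity

theorem sphere_norm_le (D : ModelData v q j ε B) {ζ : ℂ}
    (hζ : ζ ∈ Metric.sphere (0 : ℂ) (ε ^ 10 / 4)) : ‖ζ‖ ≤ ε ^ 10 / 2 ∧ ζ ≠ 0 := by
  have h10 := pow_pos D.pos 10
  rw [mem_sphere_zero_iff_norm] at hζ
  exact ⟨by linarith, norm_pos_iff.mp (by linarith)⟩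

theorem differentiableAt_res_snd (D : ModelData v q j ε B) (ht : t ∈ B) {ζ : ℂ}
    (hζ : ζ ∈ Metric.sphere (0 : ℂ) (ε ^ 10 / 4)) : DifferentiableAt ℂ (res v q j t) ζ :=
  DifferentiableAt.comp ζ (g := fun p : C2 × ℂ => res v q j p.1 p.2) (f := fun ζ => (t, ζ))
    (D.differentiableAt_res ht (D.sphere_norm_le hζ).1 (D.sphere_norm_le hζ).2)
    ((differentiableAt_const _).prodMk differentiableAt_id)

theorem differentiableOn_res_fst (D : ModelData v q j ε B) {ζ : ℂ}
    (hζ : ζ ∈ Metric.sphere (0 : ℂ) (ε ^ 10 / 4)) :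
    DifferentiableOn ℂ (fun t => res v q j t ζ) B := fun t ht =>
  (DifferentiableAt.comp t (g := fun p : C2 × ℂ => res v q j p.1 p.2) (f := fun t => (t, ζ))
    (D.differentiableAt_res ht (D.sphere_norm_le hζ).1 (D.sphere_norm_le hζ).2)
    (differentiableAt_id.prodMk (differentiableAt_const _))).differentiableWithinAt

theorem continuousOn_res (D : ModelData v q j ε B) (ht : t ∈ B) :
    ContinuousOn (res v q j t) (Metric.sphere 0 (ε ^ 10 / 4)) := fun _ hζ =>
  (D.differentiableAt_res_snd ht hζ).continuousAt.continuousWithinAt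

theorem continuousOn_pow (D : ModelData v q j ε B) (ht : t ∈ B) (X : Schur) (r : ℕ) :
    ContinuousOn (fun ζ => (res v q j t ζ * X) ^ r) (Metric.sphere 0 (ε ^ 10 / 4)) :=
  ((D.continuousOn_res ht).mul continuousOn_const).pow r

theorem circleIntegrable (D : ModelData v q j ε B) {F : Type*} [NormedAddCommGroup F]
    [NormedSpace ℂ F] {f : ℂ → F} (hf : ContinuousOn f (Metric.sphere 0 (ε ^ 10 / 4))) :
    CircleIntegrable f 0 (ε ^ 10 / 4) := hf.circleIntegrable D.radius_pos.le

/-- The length of the contour, of order ε¹⁰, cancels the ε⁻¹⁰ of the resolvent. -/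
theorem norm_gOp_le (D : ModelData v q j ε B) (hX : Admissible v q j ε X t) (r : ℕ) :
    ‖gOp v q j ε X r t‖ ≤ 5 * (260 * ε) ^ r := by
  have h10 := pow_pos D.pos 10
  have hpi := Real.pi_pos
  have h1 := norm_circleIntegral_le D.radius_pos.le fun ζ hζ =>
    (hX ζ hζ).norm_pow_mul_le D.pos (by linarith [D.small]) r
  rw [gOp, norm_smul, norm_mul, norm_two_pi_I_inv, norm_pow, norm_neg, norm_one, one_pow, one_mul]
  calc _ ≤ (2 * Real.pi)⁻¹ * (2 * Real.pi * (ε ^ 10 / 4) *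
        (20 * (ε ^ 10)⁻¹ * (260 * ε) ^ r)) := by gcongr
    _ = _ := by
      generalize (260 * ε) ^ r = y
      generalize ε ^ 10 = x at *
      field_simp
      ring

theorem ratio_lt (D : ModelData v q j ε B) : 260 * ε ≤ 1 / 300 := by linarith [D.small]

theorem ratio_nonneg (D : ModelData v q j ε B) : 0 ≤ 260 * ε := by linarith [D.pos]

theorem hasSum_ratio (D : ModelData v q j ε B) (a : ℝ) :
    HasSum (fun r : ℕ => a * (260 * ε) ^ (r + 1)) (a * (260 * ε) * (1 - 260 * ε)⁻¹) := by
  have := (hasSum_geometric_of_lt_one D.ratio_nonneg (by linarith [D.ratio_lt])).mul_left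
    (a * (260 * ε))
  refine this.congr_fun fun r => ?_
  ring

theorem ratio_sum_le (D : ModelData v q j ε B) {a : ℝ} (ha : 0 ≤ a) :
    a * (260 * ε) * (1 - 260 * ε)⁻¹ ≤ a * (300 * ε) := by
  rw [mul_assoc]
  refine mul_le_mul_of_nonneg_left ?_ ha
  rw [← div_eq_mul_inv, div_le_iff₀ (by linarith [D.ratio_lt])]
  nlinarith [D.pos, D.small]

theorem summable_gOp (D : ModelData v q j ε B) (hX : Admissible v q j ε X t) :
    Summable fun r : ℕ => gOp v q j ε X (r + 1) t :=
  Summable.of_norm_bounded (D.hasSum_ratio 5).summable fun r => D.norm_gOp_le hX (r + 1)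

theorem norm_eOp_sub_le (D : ModelData v q j ε B) (hX : Admissible v q j ε X t) :
    ‖eOp v q j ε X t - ePlus v q j t‖ ≤ 1500 * ε := by
  rw [eOp, add_sub_cancel_left]
  refine (tsum_of_norm_bounded (D.hasSum_ratio 5) fun r => D.norm_gOp_le hX (r + 1)).trans ?_
  exact (D.ratio_sum_le (by norm_num)).trans_eq (by ring)

theorem norm_eOp_le (D : ModelData v q j ε B) (ht : t ∈ B) (hX : Admissible v q j ε X t) :
    ‖eOp v q j ε X t‖ ≤ 3 := by
  have h1 := norm_add_le (eOp v q j ε X t - ePlus v q j t) (ePlus v q j t)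
  rw [sub_add_cancel] at h1
  linarith [D.norm_eOp_sub_le hX, D.norm_ePlus_le ht, D.small]

/-! #### The series in terms of the frozen definitions -/

theorem kernelMat_eq (D : ModelData v q j ε B) (ht : t ∈ B) {w : Idx → ℂ} (hw : starNorm w ≠ ∞)
    {ζ : ℂ} (hζ : ‖ζ‖ ≤ ε ^ 10) :
    kernelMat v q j w t (lamPlus v q j t + ζ) =
      fun m n => ent m n (res v q j t ζ * pot v q j w) := by
  have hvf : starNorm v ≠ ∞ := ne_top_of_le_ne_top ENNReal.ofReal_ne_top D.norm_le
  have h1 : modelResolvent v q j t (lamPlus v q j t + ζ) =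
      fun m n => ent m n (res v q j t ζ) := by
    funext m n; rw [D.ent_res ht hζ]
  have h2 : (fun m n => w (m - n) - blockV v q j m n) = fun m n => ent m n (pot v q j w) := by
    funext m n
    rw [pot, map_sub, ent_toep hw, ent_mul_proj, ent_proj_mul, ent_toep hvf, blockV]
    by_cases h3 : inBlock q j m <;> by_cases h4 : inBlock q j n <;> simp [h3, h4]
  rw [kernelMat, h1, h2, mul_ent]

theorem sphere_norm_le' (D : ModelData v q j ε B) {ζ : ℂ}
    (hζ : ζ ∈ Metric.sphere (0 : ℂ) (ε ^ 10 / 4)) : ‖ζ‖ ≤ ε ^ 10 :=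
  D.half_le (D.sphere_norm_le hζ).1

theorem GTerm_eq (D : ModelData v q j ε B) (ht : t ∈ B) {w : Idx → ℂ} (hw : starNorm w ≠ ∞)
    (r : ℕ) (m n : Idx) :
    GTerm v q j ε w r t m n = ent m n (gOp v q j ε (pot v q j w) r t) := by
  rw [GTerm, gOp, map_smul, smul_eq_mul, div_eq_mul_inv, map_circleIntegral, circleIntegral_shift]
  · congr 1
    refine circleIntegral.integral_congr D.radius_pos.le fun ζ hζ => ?_
    have hζ' := D.sphere_norm_le' hζ
    have h1 : modelResolvent v q j t (lamPlus v q j t + ζ) =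
        fun m n => ent m n (res v q j t ζ) := by
      funext m n; rw [D.ent_res ht hζ']
    simp only [D.kernelMat_eq ht hw hζ', pow_ent, h1, mul_ent]
  · exact D.circleIntegrable ((D.continuousOn_pow ht _ r).mul (D.continuousOn_res ht))

theorem gMat_eq (D : ModelData v q j ε B) (ht : t ∈ B) {w : Idx → ℂ} (hw : starNorm w ≠ ∞)
    (r : ℕ) (m n : Idx) : gMat v q j ε w r t m n =
      ∮ ζ in C(0, ε ^ 10 / 4), ent m n ((res v q j t ζ * pot v q j w) ^ r) := by
  rw [gMat, circleIntegral_shift]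
  refine circleIntegral.integral_congr D.radius_pos.le fun ζ hζ => ?_
  simp only [D.kernelMat_eq ht hw (D.sphere_norm_le' hζ), pow_ent]

theorem EW_eq (D : ModelData v q j ε B) (ht : t ∈ B) {w : Idx → ℂ}
    (hw : starNorm (w - v) ≤ ENNReal.ofReal (9 * ε ^ 11)) (m n : Idx) :
    EW v q j ε w t m n = ent m n (eOp v q j ε (pot v q j w) t) := by
  have hwf := (D.potBound hw).1
  rw [EW, eOp, map_add, (ent m n).map_tsum (D.summable_gOp (D.admissible_pot ht hw)),
    D.ent_ePlus ht]
  simp only [D.GTerm_eq ht hwf]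

/-! #### Traces -/

/-- No level outside the block comes within ε⁶ of the disc, so the integrand is holomorphic in it.
-/
theorem circleIntegral_out_eq_zero (D : ModelData v q j ε B) (ht : t ∈ B) (X : Schur) {r : ℕ} :
    ∮ ζ in C(0, ε ^ 10 / 4), (resOut v q j t ζ * X) ^ r = 0 := by
  have hd : ∀ ζ ∈ Metric.closedBall (0 : ℂ) (ε ^ 10 / 4),
      DifferentiableAt ℂ (fun ζ => (resOut v q j t ζ * X) ^ r) ζ := by
    intro ζ hζ
    have h10 := pow_pos D.pos 10
    rw [mem_closedBall_zero_iff] at hζ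
    have h1 : DifferentiableAt ℂ (resOut v q j t) ζ :=
      DifferentiableAt.comp ζ (g := fun p : C2 × ℂ => resOut v q j p.1 p.2) (f := fun ζ => (t, ζ))
        (D.differentiableOn_resOut.differentiableAt (D.isOpen_prod.mem_nhds
          ⟨ht, mem_ball_zero_iff.mpr (by linarith)⟩))
        ((differentiableAt_const _).prodMk differentiableAt_id)
    exact (h1.mul_const X).pow r
  exact Complex.circleIntegral_eq_zero_of_differentiable_on_off_countable D.radius_pos.le
    Set.countable_empty (fun ζ hζ => (hd ζ hζ).continuousAt.continuousWithinAt)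
    fun ζ hζ => hd ζ (Metric.ball_subset_closedBall hζ.1)

/-- Subtracting the words that avoid the block does not change the integral. The difference of
integrands is summable along the diagonal uniformly on the contour, since each of its words passes
through the rank two projection. -/
theorem sum_diag_circleIntegral_le (D : ModelData v q j ε B) (ht : t ∈ B)
    (hX : Admissible v q j ε X t) (r : ℕ) (s : Finset Idx) :
    ∑ m ∈ s, ‖∮ ζ in C(0, ε ^ 10 / 4), ent m m ((res v q j t ζ * X) ^ r)‖ ≤
      Real.pi * ε ^ 10 * r * (260 * ε) ^ r := by
  have hout : ∀ ζ ∈ Metric.sphere (0 : ℂ) (ε ^ 10 / 4),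
      (1 - proj q j) * (res v q j t ζ * X) = resOut v q j t ζ * X := fun ζ hζ => by
    rw [← mul_assoc, res, D.compl_mul_resGen ht (D.sphere_norm_le' hζ)]
  have hcont := D.continuousOn_pow ht X r
  have hcout : ContinuousOn (fun ζ => (resOut v q j t ζ * X) ^ r)
      (Metric.sphere 0 (ε ^ 10 / 4)) := by
    refine ContinuousOn.congr (f := fun ζ => ((1 - proj q j) * (res v q j t ζ * X)) ^ r) ?_
      fun ζ hζ => by simp only [hout ζ hζ]
    exact (continuousOn_const.mul ((D.continuousOn_res ht).mul continuousOn_const)).pow r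
  let f : Idx → ℂ → ℂ := fun m ζ => ent m m ((res v q j t ζ * X) ^ r - (resOut v q j t ζ * X) ^ r)
  have hf : ∀ m, ContinuousOn (f m) (Metric.sphere 0 (ε ^ 10 / 4)) := fun m =>
    (ent m m).continuous.comp_continuousOn (hcont.sub hcout)
  have e : ∀ m, ∮ ζ in C(0, ε ^ 10 / 4), ent m m ((res v q j t ζ * X) ^ r) =
      ∮ ζ in C(0, ε ^ 10 / 4), f m ζ := fun m => by
    have i1 : CircleIntegrable (fun ζ => ent m m ((res v q j t ζ * X) ^ r)) 0 (ε ^ 10 / 4) :=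
      D.circleIntegrable ((ent m m).continuous.comp_continuousOn hcont)
    have i2 : CircleIntegrable (fun ζ => ent m m ((resOut v q j t ζ * X) ^ r)) 0 (ε ^ 10 / 4) :=
      D.circleIntegrable ((ent m m).continuous.comp_continuousOn hcout)
    simp only [f, map_sub]
    rw [circleIntegral.integral_sub i1 i2,
      ← map_circleIntegral (ent m m) (D.circleIntegrable hcout),
      D.circleIntegral_out_eq_zero ht X, map_zero, sub_zero]
  -- The phases are taken from the integrals, so the sum of their moduli is one integral of a
  -- function whose modulus is bounded by the diagonal sum.
  choose c hc1 hc2 using fun m => exists_phase (∮ ζ in C(0, ε ^ 10 / 4), f m ζ)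
  have h1 : ∮ ζ in C(0, ε ^ 10 / 4), ∑ m ∈ s, c m * f m ζ =
      ((∑ m ∈ s, ‖∮ ζ in C(0, ε ^ 10 / 4), f m ζ‖ : ℝ) : ℂ) := by
    have hci : ∀ m ∈ s, CircleIntegrable (fun ζ => c m * f m ζ) 0 (ε ^ 10 / 4) := fun m _ =>
      D.circleIntegrable (continuousOn_const.mul (hf m))
    rw [circleIntegral.integral_fun_sum hci, Complex.ofReal_sum]
    refine Finset.sum_congr rfl fun m _ => ?_
    rw [← hc2, circleIntegral.integral_const_mul]
  have h2 := norm_circleIntegral_le (f := fun ζ => ∑ m ∈ s, c m * f m ζ) D.radius_pos.le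
    fun ζ hζ => (norm_sum_phase_le s c (fun m => f m ζ) hc1).trans (by
      have := sum_diag_pow_sub_le D.ne (hX ζ hζ) D.pos (by linarith [D.small]) r s
      simpa only [f, hout ζ hζ] using this)
  rw [h1, Complex.norm_real, Real.norm_of_nonneg (Finset.sum_nonneg fun _ _ => norm_nonneg _)] at h2
  simp only [e]
  calc _ ≤ _ := h2
    _ = _ := by ring

theorem sum_gMat_le (D : ModelData v q j ε B) (ht : t ∈ B) {w : Idx → ℂ}
    (hw : starNorm (w - v) ≤ ENNReal.ofReal (9 * ε ^ 11)) (r : ℕ) (s : Finset Idx) :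
    ∑ m ∈ s, ‖gMat v q j ε w r t m m‖ ≤ Real.pi * ε ^ 10 * r * (260 * ε) ^ r := by
  simp only [D.gMat_eq ht (D.potBound hw).1]
  exact D.sum_diag_circleIntegral_le ht (D.admissible_pot ht hw) r s

theorem summable_gMat (D : ModelData v q j ε B) (ht : t ∈ B) {w : Idx → ℂ}
    (hw : starNorm (w - v) ≤ ENNReal.ofReal (9 * ε ^ 11)) (r : ℕ) :
    Summable fun m => gMat v q j ε w r t m m :=
  (summable_of_sum_le (fun _ => norm_nonneg _) (D.sum_gMat_le ht hw r)).of_norm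

/-- The factor 1/r of the definition cancels the number r of terms in the telescoping sum. -/
theorem norm_gTerm_le (D : ModelData v q j ε B) (ht : t ∈ B) {w : Idx → ℂ}
    (hw : starNorm (w - v) ≤ ENNReal.ofReal (9 * ε ^ 11)) (r : ℕ) :
    ‖gTerm v q j ε w r t‖ ≤ ε ^ 10 * (260 * ε) ^ r := by
  have hε := D.pos
  have hpi := Real.pi_pos
  rcases Nat.eq_zero_or_pos r with rfl | hr
  · simp [gTerm]; positivity
  have hs := summable_of_sum_le (fun _ => norm_nonneg _) (D.sum_gMat_le ht hw r)
  have h1 : ‖∑' m, gMat v q j ε w r t m m‖ ≤ Real.pi * ε ^ 10 * r * (260 * ε) ^ r :=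
    (norm_tsum_le_tsum_norm hs).trans (hs.tsum_le_of_sum_le (D.sum_gMat_le ht hw r))
  have hr' : 0 < (r : ℝ) := by exact_mod_cast hr
  have h2 : ‖((-1) ^ r / (2 * Real.pi * Complex.I * r) : ℂ)‖ = (2 * Real.pi * r)⁻¹ := by
    rw [norm_div, norm_pow, norm_neg, norm_one, one_pow, norm_mul, norm_mul, norm_mul,
      Complex.norm_I, Complex.norm_ofNat, Complex.norm_real, Complex.norm_natCast,
      Real.norm_of_nonneg hpi.le, mul_one, one_div]
  rw [gTerm, norm_mul, h2]
  calc _ ≤ (2 * Real.pi * r)⁻¹ * (Real.pi * ε ^ 10 * r * (260 * ε) ^ r) := by gcongr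
    _ = ε ^ 10 * (260 * ε) ^ r / 2 := by field_simp
    _ ≤ _ := by
      have : 0 ≤ ε ^ 10 * (260 * ε) ^ r := by positivity
      linarith

theorem summable_gTerm (D : ModelData v q j ε B) (ht : t ∈ B) {w : Idx → ℂ}
    (hw : starNorm (w - v) ≤ ENNReal.ofReal (9 * ε ^ 11)) :
    Summable fun r : ℕ => gTerm v q j ε w (r + 1) t :=
  Summable.of_norm_bounded (D.hasSum_ratio (ε ^ 10)).summable fun r => D.norm_gTerm_le ht hw (r + 1)

/-! #### The projection as a contour integral of the perturbed resolvent -/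

/-- Of the three parts of the resolvent only -ζ⁻¹ Ê⁺ has a pole in the disc. So Ê⁺ is the missing
term r = 0, and Ê⁺ together with its corrections forms a single series. -/
theorem gOp_zero (D : ModelData v q j ε B) (ht : t ∈ B) (X : Schur) :
    gOp v q j ε X 0 t = ePlus v q j t := by
  have h10 := pow_pos D.pos 10
  let h : ℂ → Schur := fun ζ => (-twoB v q j t - ζ)⁻¹ • (proj q j - ePlus v q j t) +
    resOut v q j t ζ
  have hd : ∀ ζ ∈ Metric.closedBall (0 : ℂ) (ε ^ 10 / 4), DifferentiableAt ℂ h ζ := by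
    intro ζ hζ
    rw [mem_closedBall_zero_iff] at hζ
    have h1 : DifferentiableAt ℂ (resOut v q j t) ζ :=
      DifferentiableAt.comp ζ (g := fun p : C2 × ℂ => resOut v q j p.1 p.2) (f := fun ζ => (t, ζ))
        (D.differentiableOn_resOut.differentiableAt (D.isOpen_prod.mem_nhds
          ⟨ht, mem_ball_zero_iff.mpr (by linarith)⟩))
        ((differentiableAt_const _).prodMk differentiableAt_id)
    have h2 : -twoB v q j t - ζ ≠ 0 := norm_pos_iff.mp
      (h10.trans_le (D.norm_twoB_add_ge ht (by linarith)))
    exact (((differentiableAt_id.const_sub _).fun_inv h2).smul_const _).add h1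
  have hz : ∮ ζ in C(0, ε ^ 10 / 4), h ζ = 0 :=
    Complex.circleIntegral_eq_zero_of_differentiable_on_off_countable D.radius_pos.le
      Set.countable_empty (fun ζ hζ => (hd ζ hζ).continuousAt.continuousWithinAt)
      fun ζ hζ => hd ζ (Metric.ball_subset_closedBall hζ.1)
  have e : ∀ ζ, (res v q j t ζ * X) ^ 0 * res v q j t ζ =
      (ζ - 0)⁻¹ • (-ePlus v q j t) + h ζ := fun ζ => by
    rw [pow_zero, one_mul, res, resGen, sub_zero, inv_neg, neg_smul, smul_neg, add_assoc]
  have hc1 : CircleIntegrable (fun ζ : ℂ => (ζ - 0)⁻¹ • (-ePlus v q j t)) 0 (ε ^ 10 / 4) := by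
    refine D.circleIntegrable ?_
    have h1 : ContinuousOn (fun ζ : ℂ => (ζ - 0)⁻¹) (Metric.sphere 0 (ε ^ 10 / 4)) :=
      (continuousOn_id.sub continuousOn_const).inv₀ fun ζ hζ => by
        simpa using (D.sphere_norm_le hζ).2
    exact h1.smul continuousOn_const
  have hc2 : CircleIntegrable h 0 (ε ^ 10 / 4) := D.circleIntegrable fun ζ hζ =>
    (hd ζ (Metric.sphere_subset_closedBall hζ)).continuousAt.continuousWithinAt
  simp only [gOp, e]
  rw [circleIntegral.integral_add hc1 hc2, hz, add_zero, circleIntegral.integral_smul_const,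
    circleIntegral.integral_sub_inv_of_mem_ball (Metric.mem_ball_self D.radius_pos), smul_smul]
  have : (-1 : ℂ) ^ (0 + 1) * (2 * Real.pi * Complex.I : ℂ)⁻¹ * (2 * Real.pi * Complex.I) = -1 := by
    have := Complex.two_pi_I_ne_zero
    field_simp
    norm_num
  rw [this, neg_smul, one_smul, neg_neg]

theorem hasSum_gOp (D : ModelData v q j ε B) (ht : t ∈ B) (hX : Admissible v q j ε X t) :
    HasSum (fun r : ℕ => gOp v q j ε X r t) (eOp v q j ε X t) := by
  have := (hasSum_nat_add_iff (f := fun r : ℕ => gOp v q j ε X r t) 1).mp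
    (D.summable_gOp hX).hasSum
  rwa [Finset.sum_range_one, D.gOp_zero ht, add_comm] at this

/-- Summation and integration are exchanged by dominated convergence, which turns the series into a
Riesz integral of the perturbed resolvent. -/
theorem eOp_eq (D : ModelData v q j ε B) (ht : t ∈ B) (hX : Admissible v q j ε X t) :
    eOp v q j ε X t = (-(2 * Real.pi * Complex.I : ℂ)⁻¹) •
      ∮ ζ in C(0, ε ^ 10 / 4), neu (res v q j t ζ) X := by
  have h10 := pow_pos D.pos 10
  have h1 : HasSum (fun r : ℕ => ∮ ζ in C(0, ε ^ 10 / 4),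
      (-1 : ℂ) ^ r • ((res v q j t ζ * X) ^ r * res v q j t ζ))
      (∮ ζ in C(0, ε ^ 10 / 4), neu (res v q j t ζ) X) := by
    simp only [circleIntegral]
    refine intervalIntegral.hasSum_integral_of_dominated_convergence
      (fun r _ => ε ^ 10 / 4 * (20 * (ε ^ 10)⁻¹ * (260 * ε) ^ r)) (fun r => ?_) (fun r => ?_) ?_ ?_ ?_
    · refine Continuous.aestronglyMeasurable ?_
      have h1 : Continuous fun θ : ℝ => deriv (circleMap 0 (ε ^ 10 / 4)) θ := by
        simp only [deriv_circleMap]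
        exact (continuous_circleMap 0 _).mul continuous_const
      refine h1.smul ?_
      · have h2 : ContinuousOn (fun ζ => (-1 : ℂ) ^ r • ((res v q j t ζ * X) ^ r * res v q j t ζ))
            (Metric.sphere 0 (ε ^ 10 / 4)) :=
          ((D.continuousOn_pow ht X r).mul (D.continuousOn_res ht)).const_smul ((-1 : ℂ) ^ r)
        exact h2.comp_continuous (continuous_circleMap 0 _) (circleMap_mem_sphere 0 D.radius_pos.le)
    · refine Filter.Eventually.of_forall fun θ _ => ?_
      rw [norm_smul, norm_neg_one_pow_smul, deriv_circleMap, norm_mul, Complex.norm_I, mul_one,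
        norm_circleMap_zero, abs_of_pos D.radius_pos]
      exact mul_le_mul_of_nonneg_left ((hX _ (circleMap_mem_sphere 0 D.radius_pos.le θ)).norm_pow_mul_le
        D.pos (by linarith [D.small]) r) D.radius_pos.le
    · refine Filter.Eventually.of_forall fun θ _ => ?_
      exact ((summable_geometric_of_lt_one D.ratio_nonneg
        (by linarith [D.ratio_lt])).mul_left _).mul_left _
    · exact intervalIntegrable_const
    · refine Filter.Eventually.of_forall fun θ _ => ?_
      exact (((hX _ (circleMap_mem_sphere 0 D.radius_pos.le θ)).neuSummable D.pos
        (by linarith [D.small])).hasSum).const_smul _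
  have h2 := h1.const_smul (-(2 * Real.pi * Complex.I : ℂ)⁻¹)
  refine (D.hasSum_gOp ht hX).unique (h2.congr_fun fun r => ?_)
  rw [gOp, circleIntegral.integral_smul, smul_smul, pow_succ]
  congr 1
  ring

/-- The resolvent identity gives two resolvents of norm 21 ε⁻¹⁰, and the contour returns ε¹⁰/4;
21²/4 is below 111. -/
theorem norm_eOp_sub_eOp_le (D : ModelData v q j ε B) (ht : t ∈ B) {X' : Schur}
    (hX : Admissible v q j ε X t) (hX' : Admissible v q j ε X' t) :
    ‖eOp v q j ε X t - eOp v q j ε X' t‖ ≤ 111 * (ε ^ 10)⁻¹ * ‖X - X'‖ := by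
  have h10 := pow_pos D.pos 10
  have hpi := Real.pi_pos
  have hs : ε ≤ 1 / 10000 := by linarith [D.small]
  have hcont : ∀ {Y : Schur}, Admissible v q j ε Y t →
      CircleIntegrable (fun ζ => neu (res v q j t ζ) Y) 0 (ε ^ 10 / 4) := by
    intro Y hY
    refine D.circleIntegrable ?_
    refine continuousOn_tsum (u := fun r => 20 * (ε ^ 10)⁻¹ * (260 * ε) ^ r) (fun r => ?_)
      ((summable_geometric_of_lt_one D.ratio_nonneg (by linarith [D.ratio_lt])).mul_left _)
      fun r ζ hζ => ?_
    · exact ((D.continuousOn_pow ht Y r).mul (D.continuousOn_res ht)).const_smul ((-1 : ℂ) ^ r)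
    · rw [norm_neg_one_pow_smul]
      exact (hY ζ hζ).norm_pow_mul_le D.pos (by linarith) r
  rw [D.eOp_eq ht hX, D.eOp_eq ht hX', ← smul_sub,
    ← circleIntegral.integral_sub (hcont hX) (hcont hX'), norm_smul, norm_neg, norm_two_pi_I_inv]
  have hb : ∀ ζ ∈ Metric.sphere (0 : ℂ) (ε ^ 10 / 4),
      ‖neu (res v q j t ζ) X - neu (res v q j t ζ) X'‖ ≤
        21 * (ε ^ 10)⁻¹ * ‖X - X'‖ * (21 * (ε ^ 10)⁻¹) := by
    intro ζ hζ
    rw [neu_sub_neu ((hX ζ hζ).neuSummable D.pos (by linarith))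
      ((hX' ζ hζ).neuSummable D.pos (by linarith)) (c := 0) (by simp)]
    rw [zero_smul, zero_sub]
    refine (norm_mul_le _ _).trans ?_
    refine mul_le_mul ((norm_mul_le _ _).trans ?_) ((hX' ζ hζ).norm_neu_le D.pos hs)
      (norm_nonneg _) (by positivity)
    rw [norm_neg]
    exact mul_le_mul_of_nonneg_right ((hX ζ hζ).norm_neu_le D.pos hs) (norm_nonneg _)
  have h1 := norm_circleIntegral_le D.radius_pos.le hb
  calc _ ≤ (2 * Real.pi)⁻¹ * (2 * Real.pi * (ε ^ 10 / 4) *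
        (21 * (ε ^ 10)⁻¹ * ‖X - X'‖ * (21 * (ε ^ 10)⁻¹))) := by gcongr
    _ = 441 / 4 * ((ε ^ 10)⁻¹ * ‖X - X'‖) := by field_simp; ring
    _ ≤ 111 * ((ε ^ 10)⁻¹ * ‖X - X'‖) := by gcongr; norm_num
    _ = _ := by ring

/-! #### Holomorphy of the series -/

/-- `w` is a holomorphic family of potentials on `B`, close to `v`. -/
structure _root_.ResonantGP.PotFamily (v : Idx → ℂ) (ε : ℝ) (B : Set C2)
    (w : C2 → Idx → ℂ) : Prop where
  diff : ∀ b, DifferentiableOn ℂ (fun t => w t b) B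
  close : ∀ t ∈ B, starNorm (w t - v) ≤ ENNReal.ofReal (9 * ε ^ 11)

variable {w : C2 → Idx → ℂ}

theorem differentiableOn_pot (D : ModelData v q j ε B) (hw : PotFamily v ε B w) :
    DifferentiableOn ℂ (fun t => pot v q j (w t)) B := by
  refine differentiableOn_of_ent D.isOpen (M := 3 * ε ^ 9) (fun m n => ?_)
    fun t ht => (D.potBound (hw.close t ht)).2.1
  simp only [pot, map_sub]
  refine DifferentiableOn.sub ?_ (differentiableOn_const _)
  exact (hw.diff (m - n)).congr fun t ht => ent_toep (D.potBound (hw.close t ht)).1 m n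

theorem differentiableOn_pow (D : ModelData v q j ε B) (hw : PotFamily v ε B w) {ζ : ℂ}
    (hζ : ζ ∈ Metric.sphere (0 : ℂ) (ε ^ 10 / 4)) (r : ℕ) :
    DifferentiableOn ℂ (fun t => (res v q j t ζ * pot v q j (w t)) ^ r) B :=
  ((D.differentiableOn_res_fst hζ).mul (D.differentiableOn_pot hw)).pow r

theorem differentiableOn_gOp (D : ModelData v q j ε B) (hw : PotFamily v ε B w) (r : ℕ) :
    DifferentiableOn ℂ (fun t => gOp v q j ε (pot v q j (w t)) r t) B := by
  have h : DifferentiableOn ℂ (fun t => ∮ ζ in C(0, ε ^ 10 / 4),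
      (res v q j t ζ * pot v q j (w t)) ^ r * res v q j t ζ) B := by
    refine differentiableOn_circleIntegral D.isOpen
      (M := 20 * (ε ^ 10)⁻¹ * (260 * ε) ^ r) D.radius_pos.le (fun ζ hζ => ?_) (fun t ht => ?_)
      fun t ht ζ hζ => ?_
    · exact (D.differentiableOn_pow hw hζ r).mul (D.differentiableOn_res_fst hζ)
    · exact (D.continuousOn_pow ht _ r).mul (D.continuousOn_res ht)
    · exact (D.admissible_pot ht (hw.close t ht) ζ hζ).norm_pow_mul_le D.pos
        (by linarith [D.small]) r
  exact h.const_smul ((-1) ^ (r + 1) * (2 * Real.pi * Complex.I : ℂ)⁻¹)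

theorem norm_res_le (D : ModelData v q j ε B) {t : C2} (hX : Admissible v q j ε X t) {ζ : ℂ}
    (hζ : ζ ∈ Metric.sphere (0 : ℂ) (ε ^ 10 / 4)) : ‖res v q j t ζ‖ ≤ 20 * (ε ^ 10)⁻¹ := by
  simpa using (hX ζ hζ).norm_pow_mul_le D.pos (by linarith [D.small]) 0

/-- The diagonal integrals are holomorphic one by one, and the bound on the sum of their moduli
makes the trace holomorphic. -/
theorem differentiableOn_gTerm (D : ModelData v q j ε B) (hw : PotFamily v ε B w) (r : ℕ) :
    DifferentiableOn ℂ (fun t => gTerm v q j ε (w t) r t) B := by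
  refine DifferentiableOn.const_mul (differentiableOn_tsum_of_sum_norm_le D.isOpen (fun m => ?_)
    fun t ht => D.sum_gMat_le ht (hw.close t ht) r) _
  refine DifferentiableOn.congr ?_ fun t ht => D.gMat_eq ht (D.potBound (hw.close t ht)).1 r m m
  refine differentiableOn_circleIntegral D.isOpen
    (M := (20 * (ε ^ 10)⁻¹ * (6 * ε ^ 9)) ^ r) D.radius_pos.le (fun ζ hζ => ?_) (fun t ht => ?_)
    fun t ht ζ hζ => ?_
  · exact (ent m m).differentiable.comp_differentiableOn (D.differentiableOn_pow hw hζ r)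
  · exact (ent m m).continuous.comp_continuousOn (D.continuousOn_pow ht _ r)
  · have hX := D.admissible_pot ht (hw.close t ht)
    have h10 := pow_pos D.pos 10
    refine (norm_ent_le _ _ _).trans ((norm_pow_le _ _).trans
      (pow_le_pow_left₀ (norm_nonneg _) ((norm_mul_le _ _).trans ?_) r))
    exact mul_le_mul (D.norm_res_le hX hζ) (hX ζ hζ).pot (norm_nonneg _) (by positivity)

theorem differentiableOn_eOp (D : ModelData v q j ε B) (hw : PotFamily v ε B w) :
    DifferentiableOn ℂ (fun t => eOp v q j ε (pot v q j (w t)) t) B := by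
  refine D.differentiableOn_ePlus.add fun t ht => ?_
  obtain ⟨r, hr, hball⟩ := Metric.isOpen_iff.mp D.isOpen t ht
  exact (hasFDerivAt_tsum_of_bounded (D.hasSum_ratio 5).summable hr
    (fun n => (D.differentiableOn_gOp hw (n + 1)).mono hball)
    fun n y hy => D.norm_gOp_le (D.admissible_pot (hball hy) (hw.close y (hball hy)))
      (n + 1)).differentiableAt.differentiableWithinAt

end ModelData

/-! ### Complex conjugation of quasimomenta -/

theorem conjC_apply (t : C2) (i : Fin 2) : conjC t i = conj (t i) := rfl

theorem conjC_toC (s : R2) : conjC (toC s) = toC s := by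
  ext i; simp [conjC_apply, toC]

theorem conjC_sub (t s : C2) : conjC (t - s) = conjC t - conjC s := by
  ext i; simp [conjC_apply]

theorem norm_conjC (t : C2) : ‖conjC t‖ = ‖t‖ := by
  simp [EuclideanSpace.norm_eq, conjC_apply]

theorem conjC_mem_ball {t₀ : R2} {r : ℝ} {t : C2} (ht : t ∈ Metric.ball (toC t₀) r) :
    conjC t ∈ Metric.ball (toC t₀) r := by
  rw [mem_ball_iff_norm] at ht ⊢
  rwa [← conjC_toC t₀, ← conjC_sub, norm_conjC]

/-- Conjugation of quasimomenta as a real linear map. -/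
def conjCL : C2 →L[ℝ] C2 :=
  LinearMap.mkContinuous
    { toFun := conjC
      map_add' := fun x y => by ext i; simp [conjC_apply]
      map_smul' := fun a x => by ext i; simp [conjC_apply] } 1
    fun x => by simp [norm_conjC]

/-- `h ↦ conj (L (conjC h))`. -/
def conjDual (L : C2 →L[ℂ] ℂ) : C2 →L[ℂ] ℂ :=
  LinearMap.mkContinuous
    { toFun := fun h => conj (L (conjC h))
      map_add' := fun x y => by
        rw [show conjC (x + y) = conjC x + conjC y by ext i; simp [conjC_apply]]
        simp
      map_smul' := fun a x => by
        rw [show conjC (a • x) = conj a • conjC x by ext i; simp [conjC_apply]]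
        simp } ‖L‖
    fun x => by
      simpa [norm_conjC] using L.le_opNorm (conjC x)

/-- The two conjugations make the real derivative complex linear again. -/
theorem differentiableAt_conj_conj {f : C2 → ℂ} {t : C2} (hf : DifferentiableAt ℂ f (conjC t)) :
    DifferentiableAt ℂ (fun s => conj (f (conjC s))) t := by
  have h1 : HasFDerivAt f ((fderiv ℂ f (conjC t)).restrictScalars ℝ) (conjCL t) :=
    hf.hasFDerivAt.restrictScalars ℝ
  have h2 := (Complex.conjCLE.toContinuousLinearMap.hasFDerivAt (x := f (conjC t))).comp t
    (h1.comp t conjCL.hasFDerivAt)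
  have h3 : HasFDerivAt (fun s => conj (f (conjC s))) (conjDual (fderiv ℂ f (conjC t))) t :=
    hasFDerivAt_of_restrictScalars ℝ h2 (by ext h; rfl)
  exact h3.differentiableAt

theorem differentiableOn_conj_conj {f : C2 → ℂ} {B : Set C2} (hB : IsOpen B)
    (hc : ∀ t ∈ B, conjC t ∈ B) (hf : DifferentiableOn ℂ f B) :
    DifferentiableOn ℂ (fun s => conj (f (conjC s))) B := fun t ht =>
  (differentiableAt_conj_conj
    (hf.differentiableAt (hB.mem_nhds (hc t ht)))).differentiableWithinAt

/-! ### Correlations of summable families -/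

/-- The Fourier coefficients of `f ḡ`. -/
def corr (f g : Idx → ℂ) (b : Idx) : ℂ := ∑' c, f (b + c) * conj (g c)

theorem starNorm_add_le (f g : Idx → ℂ) : starNorm (f + g) ≤ starNorm f + starNorm g := by
  rw [starNorm, starNorm, starNorm, ← ENNReal.tsum_add]
  exact ENNReal.tsum_le_tsum fun b => enorm_add_le _ _

theorem starNorm_smul (a : ℂ) (f : Idx → ℂ) : starNorm (a • f) = ‖a‖ₑ * starNorm f := by
  simp only [starNorm, Pi.smul_apply, enorm_smul, ENNReal.tsum_mul_left]

theorem starNorm_sub_comm (f g : Idx → ℂ) : starNorm (f - g) = starNorm (g - f) := by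
  simp only [starNorm, Pi.sub_apply]
  exact tsum_congr fun b => enorm_sub_rev _ _

theorem starNorm_corr_le (f g : Idx → ℂ) : starNorm (corr f g) ≤ starNorm f * starNorm g := by
  calc starNorm (corr f g) ≤ ∑' b, ∑' c, ‖f (b + c)‖ₑ * ‖g c‖ₑ := by
        refine ENNReal.tsum_le_tsum fun b => ?_
        refine (enorm_tsum_le_tsum_enorm).trans (ENNReal.tsum_le_tsum fun c => ?_)
        rw [enorm_mul, RCLike.enorm_conj]
    _ = ∑' c, (∑' b, ‖f (b + c)‖ₑ) * ‖g c‖ₑ := by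
        rw [ENNReal.tsum_comm]
        simp only [ENNReal.tsum_mul_right]
    _ = ∑' c, starNorm f * ‖g c‖ₑ := by
        refine tsum_congr fun c => ?_
        exact congrArg (· * ‖g c‖ₑ) ((Equiv.addRight c).tsum_eq fun b => ‖f b‖ₑ)
    _ = _ := by rw [ENNReal.tsum_mul_left, starNorm, starNorm]

theorem norm_le_of_starNorm {f : Idx → ℂ} {C : ℝ} (hC : 0 ≤ C)
    (h : starNorm f ≤ ENNReal.ofReal C) (b : Idx) : ‖f b‖ ≤ C := by
  simpa using sum_norm_le_of_tsum_enorm_le hC h {b}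

theorem sum_corr_le {f g : Idx → ℂ} {a c : ℝ} (ha : 0 ≤ a) (hc : 0 ≤ c)
    (hf : starNorm f ≤ ENNReal.ofReal a) (hg : starNorm g ≤ ENNReal.ofReal c) (b : Idx)
    (s : Finset Idx) : ∑ d ∈ s, ‖f (b + d) * conj (g d)‖ ≤ a * c := by
  calc _ ≤ ∑ d ∈ s, a * ‖g d‖ := by
        refine Finset.sum_le_sum fun d _ => ?_
        rw [norm_mul, RCLike.norm_conj]
        exact mul_le_mul_of_nonneg_right (norm_le_of_starNorm ha hf _) (norm_nonneg _)
    _ = a * ∑ d ∈ s, ‖g d‖ := by rw [Finset.mul_sum]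
    _ ≤ _ := mul_le_mul_of_nonneg_left (sum_norm_le_of_tsum_enorm_le hc hg s) ha

theorem summable_corr {f g : Idx → ℂ} {a c : ℝ} (ha : 0 ≤ a) (hc : 0 ≤ c)
    (hf : starNorm f ≤ ENNReal.ofReal a) (hg : starNorm g ≤ ENNReal.ofReal c) (b : Idx) :
    Summable fun d => f (b + d) * conj (g d) :=
  (summable_of_sum_le (fun _ => norm_nonneg _) (sum_corr_le ha hc hf hg b)).of_norm

theorem corr_sub_corr {f f' g g' : Idx → ℂ} {a c : ℝ} (ha : 0 ≤ a) (hc : 0 ≤ c)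
    (hf : starNorm f ≤ ENNReal.ofReal a) (hf' : starNorm f' ≤ ENNReal.ofReal a)
    (hg : starNorm g ≤ ENNReal.ofReal c) (hg' : starNorm g' ≤ ENNReal.ofReal c) :
    corr f g - corr f' g' = corr (f - f') g + corr f' (g - g') := by
  have hff : starNorm (f - f') ≤ ENNReal.ofReal (a + a) := by
    rw [sub_eq_add_neg, ENNReal.ofReal_add ha ha]
    refine (starNorm_add_le _ _).trans (add_le_add hf ?_)
    simpa [starNorm] using hf'
  have hgg : starNorm (g - g') ≤ ENNReal.ofReal (c + c) := by
    rw [sub_eq_add_neg, ENNReal.ofReal_add hc hc]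
    refine (starNorm_add_le _ _).trans (add_le_add hg ?_)
    simpa [starNorm] using hg'
  funext b
  rw [Pi.sub_apply, Pi.add_apply, corr, corr, corr, corr, ← (summable_corr ha hc hf hg b).tsum_sub (summable_corr ha hc hf' hg' b)]
  have h1 := summable_corr (add_nonneg ha ha) hc hff hg b
  have h2 := summable_corr ha (add_nonneg hc hc) hf' hgg b
  rw [← h1.tsum_add h2]
  refine tsum_congr fun d => ?_
  simp only [Pi.sub_apply, map_sub]
  ring

/-- This is the reality of |f|², expressed by its Fourier coefficients. -/
theorem corr_neg (f : Idx → ℂ) (b : Idx) : corr f f (-b) = conj (corr f f b) := by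
  rw [corr, corr, Complex.conj_tsum, ← (Equiv.addRight b).tsum_eq]
  refine tsum_congr fun c => ?_
  rw [Equiv.coe_addRight]
  beta_reduce
  rw [show -b + (c + b) = c by abel, map_mul, Complex.conj_conj, mul_comm, add_comm c b]

/-! ### Successive approximation -/

theorem Wseq_succ (v : Idx → ℂ) (q j : Idx) (ε σ : ℝ) (A : ℂ) (m : ℕ) (t : C2) :
    Wseq v q j ε σ A (m + 1) t = v + (σ : ℂ) • corr
      (psi v q j ε A (Wseq v q j ε σ A m t) t)
      (psi v q j ε A (Wseq v q j ε σ A m (conjC t)) (conjC t)) := rfl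

/-- The limit of the successive approximations. -/
def Wlim (v : Idx → ℂ) (q j : Idx) (ε σ : ℝ) (A : ℂ) (t : C2) (b : Idx) : ℂ :=
  v b + ∑' m : ℕ, (Wseq v q j ε σ A (m + 1) t b - Wseq v q j ε σ A m t b)

namespace ModelData

variable {v : Idx → ℂ} {q j : Idx} {ε σ : ℝ} {A : ℂ} {B : Set C2} {t : C2}

theorem starNorm_column_le (j : Idx) (x : Schur) :
    starNorm (fun b => ent (j + b) j x) ≤ ENNReal.ofReal ‖x‖ := by
  refine ((Equiv.addLeft j).tsum_eq fun m => ‖ent m j x‖ₑ).trans_le ?_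
  exact tsum_enorm_le_of_sum_le (col_sum_le x j)

theorem psi_eq (D : ModelData v q j ε B) (ht : t ∈ B) {w : Idx → ℂ}
    (hw : starNorm (w - v) ≤ ENNReal.ofReal (9 * ε ^ 11)) :
    psi v q j ε A w t = A • fun b => ent (j + b) j (eOp v q j ε (pot v q j w) t) := by
  funext b
  rw [psi, D.EW_eq ht hw, Pi.smul_apply, smul_eq_mul]

theorem starNorm_psi_le (D : ModelData v q j ε B) (ht : t ∈ B) {w : Idx → ℂ}
    (hw : starNorm (w - v) ≤ ENNReal.ofReal (9 * ε ^ 11)) :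
    starNorm (psi v q j ε A w t) ≤ ENNReal.ofReal (3 * ‖A‖) := by
  rw [D.psi_eq ht hw, starNorm_smul, ← ofReal_norm, mul_comm 3, ENNReal.ofReal_mul (norm_nonneg _)]
  gcongr
  exact (starNorm_column_le _ _).trans
    (ENNReal.ofReal_le_ofReal (D.norm_eOp_le ht (D.admissible_pot ht hw)))

theorem norm_pot_sub_le (D : ModelData v q j ε B) {w w' : Idx → ℂ}
    (hw : starNorm (w - v) ≤ ENNReal.ofReal (9 * ε ^ 11))
    (hw' : starNorm (w' - v) ≤ ENNReal.ofReal (9 * ε ^ 11)) {d : ℝ} (hd : 0 ≤ d)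
    (h : starNorm (w - w') ≤ ENNReal.ofReal d) : ‖pot v q j w - pot v q j w'‖ ≤ d := by
  have e : pot v q j w - pot v q j w' = toep (w - w') := by
    rw [pot, pot, sub_sub_sub_cancel_right]
    ext m n
    rw [map_sub, ent_toep (D.potBound hw).1, ent_toep (D.potBound hw').1,
      ent_toep (ne_top_of_le_ne_top ENNReal.ofReal_ne_top h), Pi.sub_apply]
  rw [e]
  exact norm_toep_le hd h

theorem starNorm_psi_sub_le (D : ModelData v q j ε B) (ht : t ∈ B) {w w' : Idx → ℂ}
    (hw : starNorm (w - v) ≤ ENNReal.ofReal (9 * ε ^ 11))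
    (hw' : starNorm (w' - v) ≤ ENNReal.ofReal (9 * ε ^ 11)) {d : ℝ} (hd : 0 ≤ d)
    (h : starNorm (w - w') ≤ ENNReal.ofReal d) :
    starNorm (psi v q j ε A w t - psi v q j ε A w' t) ≤
      ENNReal.ofReal (‖A‖ * (111 * (ε ^ 10)⁻¹ * d)) := by
  have h10 := pow_pos D.pos 10
  rw [D.psi_eq ht hw, D.psi_eq ht hw', ← smul_sub, starNorm_smul, ← ofReal_norm,
    ENNReal.ofReal_mul (norm_nonneg _)]
  gcongr
  have h1 := starNorm_column_le j
    (eOp v q j ε (pot v q j w) t - eOp v q j ε (pot v q j w') t)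
  simp only [map_sub] at h1
  refine h1.trans (ENNReal.ofReal_le_ofReal ?_)
  refine (D.norm_eOp_sub_eOp_le ht (D.admissible_pot ht hw) (D.admissible_pot ht hw')).trans ?_
  exact mul_le_mul_of_nonneg_left (D.norm_pot_sub_le hw hw' hd h) (by positivity)

/-- The radius 9 ε¹¹ reproduces itself: each projection has norm at most 3, so ‖ψ‖_* ≤ 3|A| and the
correction is at most 9|σ||A|². Holomorphy of the nonlinear term uses that the ball is invariant
under conjugation. -/
theorem potFamily_Wseq (D : ModelData v q j ε B) (hB : ∀ t ∈ B, conjC t ∈ B)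
    (hσ : |σ| * ‖A‖ ^ 2 ≤ ε ^ 11) (m : ℕ) : PotFamily v ε B (Wseq v q j ε σ A m) := by
  have hε := D.pos
  induction m with
  | zero =>
    refine ⟨fun b => differentiableOn_const _, fun t _ => ?_⟩
    simp [Wseq, starNorm]
  | succ m ih =>
    have hpsi : ∀ t ∈ B, starNorm (psi v q j ε A (Wseq v q j ε σ A m t) t) ≤
        ENNReal.ofReal (3 * ‖A‖) := fun t ht => D.starNorm_psi_le ht (ih.close t ht)
    have hpd : ∀ b, DifferentiableOn ℂ (fun t => psi v q j ε A (Wseq v q j ε σ A m t) t b) B := by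
      intro b
      have h1 : DifferentiableOn ℂ
          (fun t => A * ent (j + b) j (eOp v q j ε (pot v q j (Wseq v q j ε σ A m t)) t)) B :=
        ((ent (j + b) j).differentiable.comp_differentiableOn
          (D.differentiableOn_eOp ih)).const_mul A
      exact h1.congr fun t ht => by rw [psi, D.EW_eq ht (ih.close t ht)]
    have h3 : 0 ≤ 3 * ‖A‖ := by positivity
    refine ⟨fun b => ?_, fun t ht => ?_⟩
    · have h1 : DifferentiableOn ℂ (fun t => ∑' c : Idx,
          psi v q j ε A (Wseq v q j ε σ A m t) t (b + c) *
            conj (psi v q j ε A (Wseq v q j ε σ A m (conjC t)) (conjC t) c)) B :=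
        differentiableOn_tsum_of_sum_norm_le D.isOpen
          (fun c => (hpd (b + c)).mul (differentiableOn_conj_conj D.isOpen hB (hpd c)))
          fun t ht s => sum_corr_le h3 h3 (hpsi t ht) (hpsi _ (hB t ht)) b s
      exact (h1.const_mul (σ : ℂ)).const_add (v b)
    · rw [Wseq_succ, add_sub_cancel_left, starNorm_smul, ← ofReal_norm, Complex.norm_real,
        Real.norm_eq_abs]
      calc _ ≤ ENNReal.ofReal |σ| * (ENNReal.ofReal (3 * ‖A‖) * ENNReal.ofReal (3 * ‖A‖)) := by
            gcongr
            exact (starNorm_corr_le _ _).trans (mul_le_mul' (hpsi t ht) (hpsi _ (hB t ht)))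
        _ = ENNReal.ofReal (9 * (|σ| * ‖A‖ ^ 2)) := by
            rw [← ENNReal.ofReal_mul h3, ← ENNReal.ofReal_mul (abs_nonneg _)]
            congr 1; ring
        _ ≤ _ := ENNReal.ofReal_le_ofReal (by linarith)

/-- The contraction factor is 2 · 3 · 111 ε⁻¹⁰ |σ||A|² ≤ 666 ε ≤ 1/2: two factors ψ, the bound 3|A|
for one and the Lipschitz constant for the other. The induction runs over all t at once because the
step at t also uses the conjugate point. -/
theorem starNorm_Wseq_sub_le (D : ModelData v q j ε B) (hB : ∀ t ∈ B, conjC t ∈ B)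
    (hσ : |σ| * ‖A‖ ^ 2 ≤ ε ^ 11) (m : ℕ) : ∀ t ∈ B,
    starNorm (Wseq v q j ε σ A (m + 1) t - Wseq v q j ε σ A m t) ≤
      ENNReal.ofReal (9 * ε ^ 11 * (1 / 2) ^ m) := by
  have hε := D.pos
  have hP := D.potFamily_Wseq hB hσ
  induction m with
  | zero =>
    intro t ht
    simpa [Wseq] using (hP 1).close t ht
  | succ m ih =>
    intro t ht
    have hd : 0 ≤ 9 * ε ^ 11 * (1 / 2) ^ m := by positivity
    have hA := norm_nonneg A
    have h3 : 0 ≤ 3 * ‖A‖ := by positivity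
    have hpsi : ∀ i, ∀ t ∈ B, starNorm (psi v q j ε A (Wseq v q j ε σ A i t) t) ≤
        ENNReal.ofReal (3 * ‖A‖) := fun i t ht => D.starNorm_psi_le ht ((hP i).close t ht)
    have hdiff : ∀ t ∈ B, starNorm (psi v q j ε A (Wseq v q j ε σ A (m + 1) t) t -
        psi v q j ε A (Wseq v q j ε σ A m t) t) ≤
        ENNReal.ofReal (‖A‖ * (111 * (ε ^ 10)⁻¹ * (9 * ε ^ 11 * (1 / 2) ^ m))) := fun t ht =>
      D.starNorm_psi_sub_le ht ((hP _).close t ht) ((hP _).close t ht) hd (ih t ht)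
    have ht' := hB t ht
    rw [Wseq_succ _ _ _ _ _ _ (m + 1) t]
    nth_rw 3 [Wseq_succ]
    rw [add_sub_add_left_eq_sub,
      ← smul_sub, starNorm_smul, ← ofReal_norm, Complex.norm_real, Real.norm_eq_abs,
      corr_sub_corr h3 h3 (hpsi _ t ht) (hpsi _ t ht) (hpsi _ _ ht') (hpsi _ _ ht')]
    generalize hd' : ‖A‖ * (111 * (ε ^ 10)⁻¹ * (9 * ε ^ 11 * (1 / 2) ^ m)) = d at hdiff
    have hd0 : 0 ≤ d := by rw [← hd']; positivity
    calc _ ≤ ENNReal.ofReal |σ| * (ENNReal.ofReal d * ENNReal.ofReal (3 * ‖A‖) +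
          ENNReal.ofReal (3 * ‖A‖) * ENNReal.ofReal d) := by
          gcongr
          refine (starNorm_add_le _ _).trans (add_le_add ?_ ?_)
          · exact (starNorm_corr_le _ _).trans (mul_le_mul' (hdiff t ht) (hpsi _ _ ht'))
          · exact (starNorm_corr_le _ _).trans (mul_le_mul' (hpsi _ t ht) (hdiff _ ht'))
      _ = ENNReal.ofReal (|σ| * (d * (3 * ‖A‖) + 3 * ‖A‖ * d)) := by
          rw [← ENNReal.ofReal_mul h3, ← ENNReal.ofReal_mul hd0, ← ENNReal.ofReal_add (by positivity)
            (by positivity), ← ENNReal.ofReal_mul (abs_nonneg _)]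
      _ ≤ _ := by
          refine ENNReal.ofReal_le_ofReal ?_
          have h10 := pow_pos hε 10
          calc _ = |σ| * ‖A‖ ^ 2 * (666 * (ε ^ 10)⁻¹ * (9 * ε ^ 11 * (1 / 2) ^ m)) := by
                rw [← hd']; ring
            _ ≤ ε ^ 11 * (666 * (ε ^ 10)⁻¹ * (9 * ε ^ 11 * (1 / 2) ^ m)) :=
                mul_le_mul_of_nonneg_right hσ (by positivity)
            _ = 666 * ε * (9 * ε ^ 11 * (1 / 2) ^ m) := by field_simp
            _ ≤ 1 / 2 * (9 * ε ^ 11 * (1 / 2) ^ m) :=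
                mul_le_mul_of_nonneg_right (by linarith [D.small]) hd
            _ = _ := by ring

theorem norm_Wseq_sub_le (D : ModelData v q j ε B) (hB : ∀ t ∈ B, conjC t ∈ B)
    (hσ : |σ| * ‖A‖ ^ 2 ≤ ε ^ 11) (m : ℕ) (ht : t ∈ B) (b : Idx) :
    ‖Wseq v q j ε σ A (m + 1) t b - Wseq v q j ε σ A m t b‖ ≤ 9 * ε ^ 11 * (1 / 2) ^ m := by
  have hε := D.pos
  exact norm_le_of_starNorm (f := Wseq v q j ε σ A (m + 1) t - Wseq v q j ε σ A m t)
    (by positivity) (D.starNorm_Wseq_sub_le hB hσ m t ht) b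

theorem summable_half (C : ℝ) : Summable fun m : ℕ => C * (1 / 2 : ℝ) ^ m :=
  summable_geometric_two.mul_left C

theorem tendsto_Wseq (D : ModelData v q j ε B) (hB : ∀ t ∈ B, conjC t ∈ B)
    (hσ : |σ| * ‖A‖ ^ 2 ≤ ε ^ 11) (ht : t ∈ B) (b : Idx) :
    Filter.Tendsto (fun m => Wseq v q j ε σ A m t b) Filter.atTop
      (𝓝 (Wlim v q j ε σ A t b)) := by
  have h1 : Summable fun m : ℕ => Wseq v q j ε σ A (m + 1) t b - Wseq v q j ε σ A m t b :=
    Summable.of_norm_bounded (summable_half _) fun m => D.norm_Wseq_sub_le hB hσ m ht b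
  have h2 := h1.hasSum.tendsto_sum_nat.const_add (v b)
  refine h2.congr fun m => ?_
  rw [Finset.sum_range_sub (fun m => Wseq v q j ε σ A m t b)]
  simp [Wseq]

theorem starNorm_Wseq_sub_Wlim_le (D : ModelData v q j ε B) (hB : ∀ t ∈ B, conjC t ∈ B)
    (hσ : |σ| * ‖A‖ ^ 2 ≤ ε ^ 11) (ht : t ∈ B) (m : ℕ) :
    starNorm (Wseq v q j ε σ A m t - Wlim v q j ε σ A t) ≤
      ENNReal.ofReal (18 * ε ^ 11 * (1 / 2) ^ m) := by
  have hε := D.pos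
  have h1 : ∀ b, ‖Wseq v q j ε σ A m t b - Wlim v q j ε σ A t b‖ₑ ≤
      ∑' i, ‖Wseq v q j ε σ A (m + i + 1) t b - Wseq v q j ε σ A (m + i) t b‖ₑ := by
    intro b
    have := edist_le_tsum_of_edist_le_of_tendsto
      (fun i => ‖Wseq v q j ε σ A (i + 1) t b - Wseq v q j ε σ A i t b‖ₑ)
      (fun n => by rw [edist_comm, edist_eq_enorm_sub]) (D.tendsto_Wseq hB hσ ht b) m
    rwa [edist_eq_enorm_sub] at this
  calc _ ≤ ∑' b, ∑' i, ‖Wseq v q j ε σ A (m + i + 1) t b - Wseq v q j ε σ A (m + i) t b‖ₑ :=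
        ENNReal.tsum_le_tsum h1
    _ = ∑' i, starNorm (Wseq v q j ε σ A (m + i + 1) t - Wseq v q j ε σ A (m + i) t) :=
        ENNReal.tsum_comm
    _ ≤ ∑' i : ℕ, ENNReal.ofReal (9 * ε ^ 11 * (1 / 2) ^ m * (1 / 2) ^ i) := by
        refine ENNReal.tsum_le_tsum fun i => (D.starNorm_Wseq_sub_le hB hσ (m + i) t ht).trans_eq ?_
        rw [pow_add, ← mul_assoc]
    _ = _ := by
        rw [← ENNReal.ofReal_tsum_of_nonneg (fun i => by positivity) (summable_half _),
          tsum_mul_left, tsum_geometric_two]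
        congr 1; ring

theorem tendsto_starNorm_Wseq (D : ModelData v q j ε B) (hB : ∀ t ∈ B, conjC t ∈ B)
    (hσ : |σ| * ‖A‖ ^ 2 ≤ ε ^ 11) (ht : t ∈ B) :
    Filter.Tendsto (fun m => starNorm (Wseq v q j ε σ A m t - Wlim v q j ε σ A t)) Filter.atTop
      (𝓝 0) := by
  have h1 : Filter.Tendsto (fun m : ℕ => ENNReal.ofReal (18 * ε ^ 11 * (1 / 2) ^ m)) Filter.atTop
      (𝓝 0) := by
    have := ENNReal.tendsto_ofReal ((summable_half (18 * ε ^ 11)).tendsto_atTop_zero)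
    simpa using this
  exact tendsto_of_tendsto_of_tendsto_of_le_of_le tendsto_const_nhds h1 (fun _ => zero_le)
    fun m => D.starNorm_Wseq_sub_Wlim_le hB hσ ht m

/-- The increments are bounded by a geometric series uniformly on the ball, so holomorphy passes to
the limit; the closeness to V is a closed condition. -/
theorem potFamily_Wlim (D : ModelData v q j ε B) (hB : ∀ t ∈ B, conjC t ∈ B)
    (hσ : |σ| * ‖A‖ ^ 2 ≤ ε ^ 11) : PotFamily v ε B (Wlim v q j ε σ A) := by
  have hP := D.potFamily_Wseq hB hσ
  refine ⟨fun b t ht => ?_, fun t ht => ?_⟩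
  · obtain ⟨r, hr, hball⟩ := Metric.isOpen_iff.mp D.isOpen t ht
    have h1 := hasFDerivAt_tsum_of_bounded (summable_half (9 * ε ^ 11)) hr
      (f := fun m t => Wseq v q j ε σ A (m + 1) t b - Wseq v q j ε σ A m t b)
      (fun m => (((hP (m + 1)).diff b).sub ((hP m).diff b)).mono hball)
      fun m y hy => D.norm_Wseq_sub_le hB hσ m (hball hy) b
    exact (h1.differentiableAt.const_add (v b)).differentiableWithinAt
  · have h1 : ∀ m, starNorm (Wlim v q j ε σ A t - v) ≤
        starNorm (Wseq v q j ε σ A m t - Wlim v q j ε σ A t) + ENNReal.ofReal (9 * ε ^ 11) := by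
      intro m
      rw [starNorm_sub_comm (Wseq v q j ε σ A m t)]
      refine le_trans ?_ (add_le_add_right ((hP m).close t ht) _)
      simpa using starNorm_add_le (Wlim v q j ε σ A t - Wseq v q j ε σ A m t)
        (Wseq v q j ε σ A m t - v)
    have h2 := (D.tendsto_starNorm_Wseq hB hσ ht).add_const (ENNReal.ofReal (9 * ε ^ 11))
    rw [zero_add] at h2
    exact ge_of_tendsto' h2 h1

/-- No induction is needed: at a real point every later iterate is V plus a real multiple of some
|ψ|². -/
theorem Wseq_neg (D : ModelData v q j ε B) (s : R2) (m : ℕ) (b : Idx) :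
    Wseq v q j ε σ A m (toC s) (-b) = conj (Wseq v q j ε σ A m (toC s) b) := by
  cases m with
  | zero => exact D.real b
  | succ m =>
    rw [Wseq_succ, conjC_toC]
    simp only [Pi.add_apply, Pi.smul_apply, smul_eq_mul, map_add, map_mul, Complex.conj_ofReal,
      D.real, corr_neg]

theorem Wlim_neg (D : ModelData v q j ε B) (hB : ∀ t ∈ B, conjC t ∈ B)
    (hσ : |σ| * ‖A‖ ^ 2 ≤ ε ^ 11) {s : R2} (hs : toC s ∈ B) (b : Idx) :
    Wlim v q j ε σ A (toC s) (-b) = conj (Wlim v q j ε σ A (toC s) b) := by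
  refine tendsto_nhds_unique (D.tendsto_Wseq hB hσ hs (-b)) ?_
  refine ((Complex.continuous_conj.tendsto _).comp (D.tendsto_Wseq hB hσ hs b)).congr fun m => ?_
  exact (D.Wseq_neg s m b).symm

end ModelData

/-! ### The perturbed resolvent near the eigenvalue -/

/-- The linear functional `T ↦ τ(T)` with `Ê⁺ T Ê⁺ = τ(T) Ê⁺`. -/
def tau (v : Idx → ℂ) (q j : Idx) (t : C2) : Schur →L[ℂ] ℂ :=
  (EPlus v q j t j j)⁻¹ •
    (ent j j).comp (ContinuousLinearMap.mulLeftRight ℂ Schur (ePlus v q j t) (ePlus v q j t))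

theorem tau_apply (v : Idx → ℂ) (q j : Idx) (t : C2) (x : Schur) :
    tau v q j t x = (EPlus v q j t j j)⁻¹ * ent j j (ePlus v q j t * x * ePlus v q j t) := rfl

/-- The resolvent `(Ĥ_q(t) + Ê⁺(t) + αX - λ̂⁺(t) - ζ)⁻¹`. -/
def neuSh (v : Idx → ℂ) (q j : Idx) (t : C2) (X : Schur) (α ζ : ℂ) : Schur :=
  neu (resSh v q j t ζ) (α • X)

/-- `Ĥ_q(t) + Ê⁺(t) + αX - λ̂⁺(t) - ζ` is not invertible if and only if `shift = ζ`. -/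
def shift (v : Idx → ℂ) (q j : Idx) (t : C2) (X : Schur) (α ζ : ℂ) : ℂ :=
  ζ + (1 - ζ) * (1 - tau v q j t (neuSh v q j t X α ζ))

/-- The resolvents `neuSh` exist for `|α| ≤ 2` near `ζ = 0`. -/
def StrongAdmissible (v : Idx → ℂ) (q j : Idx) (ε : ℝ) (X : Schur) (t : C2) : Prop :=
  ∀ α : ℂ, ‖α‖ ≤ 2 → Admissible v q j ε (α • X) t ∧
    ∀ ζ : ℂ, ‖ζ‖ ≤ ε ^ 10 / 2 → BlockBound (proj q j) (resSh v q j t ζ) (α • X) ε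

namespace ModelData

variable {v : Idx → ℂ} {q j : Idx} {ε : ℝ} {B : Set C2} {t : C2} {X : Schur}

theorem strongAdmissible (D : ModelData v q j ε B) (ht : t ∈ B) {w : Idx → ℂ}
    (hw : starNorm (w - v) ≤ ENNReal.ofReal (9 * ε ^ 11)) :
    StrongAdmissible v q j ε (pot v q j w) t := fun _ hα =>
  ⟨D.admissible ht hw hα, fun _ hζ => D.blockBound_resSh ht hw hζ hα⟩

/-! #### Rank one algebra -/

theorem EPlus_mul_EPlus (D : ModelData v q j ε B) (ht : t ∈ B) (m n : Idx) :
    EPlus v q j t m j * EPlus v q j t j n = EPlus v q j t j j * EPlus v q j t m n := by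
  have h1 := D.EPlus_det ht
  by_cases h : inBlock q j m ∧ inBlock q j n
  · rcases h with ⟨h3 | h3, h4 | h4⟩ <;> rw [h3, h4]
    · ring
    · linear_combination h1
  · rw [EPlus_eq_zero h, mul_zero]
    rw [not_and_or] at h
    rcases h with h | h
    · rw [EPlus_eq_zero fun h' => h h'.1, zero_mul]
    · rw [EPlus_eq_zero (n := n) fun h' => h h'.2, mul_zero]

theorem ePlus_mul_unit_mul (D : ModelData v q j ε B) (ht : t ∈ B) :
    ePlus v q j t * unit j * ePlus v q j t = EPlus v q j t j j • ePlus v q j t := by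
  ext m n
  rw [ent_mul_unit_mul, map_smul, smul_eq_mul, D.ent_ePlus ht, D.ent_ePlus ht, D.ent_ePlus ht,
    D.EPlus_mul_EPlus ht]

/-- Entries of a product through the rank one projection. -/
theorem ent_mul_ePlus_mul (D : ModelData v q j ε B) (ht : t ∈ B) (hp : EPlus v q j t j j ≠ 0)
    (x y : Schur) (m n : Idx) : ent m n (x * ePlus v q j t * y) =
      (EPlus v q j t j j)⁻¹ * (ent m j (x * ePlus v q j t) * ent j n (ePlus v q j t * y)) := by
  have h : ePlus v q j t = (EPlus v q j t j j)⁻¹ • (ePlus v q j t * unit j * ePlus v q j t) := by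
    rw [D.ePlus_mul_unit_mul ht, smul_smul, inv_mul_cancel₀ hp, one_smul]
  conv_lhs => rw [h]
  rw [mul_smul_comm, smul_mul_assoc, map_smul, smul_eq_mul, ← ent_mul_unit_mul]
  simp only [mul_assoc]

/-- Compression to a rank one range is scalar. Normalising by the entry at (j, j) requires that
entry to be nonzero, which holds at real points when v_q ≠ 0. -/
theorem ePlus_mul_mul_ePlus (D : ModelData v q j ε B) (ht : t ∈ B) (hp : EPlus v q j t j j ≠ 0)
    (x : Schur) : ePlus v q j t * x * ePlus v q j t = tau v q j t x • ePlus v q j t := by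
  have hE := D.ePlus_mul_ePlus ht
  have e : ePlus v q j t * x * ePlus v q j t =
      ePlus v q j t * ePlus v q j t * (x * ePlus v q j t) := by rw [hE, mul_assoc]
  ext m n
  have e2 : ePlus v q j t * (x * ePlus v q j t) =
      ePlus v q j t * x * ePlus v q j t * 1 := by rw [mul_one, mul_assoc]
  rw [e, D.ent_mul_ePlus_mul ht hp, hE, e2, D.ent_mul_ePlus_mul ht hp, mul_one, D.ent_ePlus ht,
    D.ent_ePlus ht, map_smul, smul_eq_mul, D.ent_ePlus ht, tau_apply]
  have := D.EPlus_mul_EPlus ht m n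
  field_simp
  linear_combination (ent j j (ePlus v q j t * x * ePlus v q j t)) * this

theorem ePlus_ne_zero (D : ModelData v q j ε B) (ht : t ∈ B) (hp : EPlus v q j t j j ≠ 0) :
    ePlus v q j t ≠ 0 := fun h => hp (by rw [← D.ent_ePlus ht, h, map_zero])

theorem one_le_norm_ePlus (D : ModelData v q j ε B) (ht : t ∈ B) (hp : EPlus v q j t j j ≠ 0) :
    1 ≤ ‖ePlus v q j t‖ := by
  have h1 := norm_mul_le (ePlus v q j t) (ePlus v q j t)
  rw [D.ePlus_mul_ePlus ht] at h1
  have h2 := norm_pos_iff.mpr (D.ePlus_ne_zero ht hp)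
  exact le_of_mul_le_mul_right (by linarith) h2

/-- Only the block of x is seen, so the estimate can use the ε¹¹ bound on the effective potential.
The constant uses ‖Ê⁺‖ ≤ 2 twice, and ‖Ê⁺‖ ≥ 1 because it is a nonzero idempotent. -/
theorem norm_tau_le (D : ModelData v q j ε B) (ht : t ∈ B) (hp : EPlus v q j t j j ≠ 0)
    (x : Schur) : ‖tau v q j t x‖ ≤ 4 * ‖proj q j * x * proj q j‖ := by
  have h1 := D.one_le_norm_ePlus ht hp
  have h2 := D.norm_ePlus_le ht
  have h3 : ‖ePlus v q j t * x * ePlus v q j t‖ = ‖tau v q j t x‖ * ‖ePlus v q j t‖ := by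
    rw [D.ePlus_mul_mul_ePlus ht hp, norm_smul]
  have h4 : ePlus v q j t * x * ePlus v q j t =
      ePlus v q j t * (proj q j * x * proj q j) * ePlus v q j t := by
    conv_lhs => rw [← D.ePlus_mul_proj ht]
    conv_lhs => enter [2]; rw [D.ePlus_mul_proj ht, ← D.proj_mul_ePlus ht]
    simp only [mul_assoc]
  have h5 : ‖ePlus v q j t * x * ePlus v q j t‖ ≤ 2 * ‖proj q j * x * proj q j‖ * 2 := by
    rw [h4]
    refine (norm_mul_le _ _).trans (mul_le_mul ((norm_mul_le _ _).trans ?_) h2 (norm_nonneg _)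
      (by positivity))
    exact mul_le_mul_of_nonneg_right h2 (norm_nonneg _)
  nlinarith [norm_nonneg (tau v q j t x)]

theorem ePlus_mul_resGen (D : ModelData v q j ε B) (ht : t ∈ B) {ζ : ℂ} (hζ : ‖ζ‖ ≤ ε ^ 10)
    (c : ℂ) : ePlus v q j t * resGen v q j c t ζ = c • ePlus v q j t := by
  conv_lhs => rw [← D.ePlus_mul_proj ht, mul_assoc, D.proj_mul_resGen ht hζ]
  rw [mul_add, mul_smul_comm, mul_smul_comm, mul_sub, D.ePlus_mul_ePlus ht, D.ePlus_mul_proj ht,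
    sub_self, smul_zero, add_zero]

theorem resGen_mul_ePlus (D : ModelData v q j ε B) (ht : t ∈ B) {ζ : ℂ} (hζ : ‖ζ‖ ≤ ε ^ 10)
    (c : ℂ) : resGen v q j c t ζ * ePlus v q j t = c • ePlus v q j t := by
  conv_lhs => rw [← D.proj_mul_ePlus ht, ← mul_assoc, D.resGen_mul_proj ht hζ]
  rw [add_mul, smul_mul_assoc, smul_mul_assoc, sub_mul, D.ePlus_mul_ePlus ht, D.proj_mul_ePlus ht,
    sub_self, smul_zero, add_zero]

theorem resOut_mul_resOut (D : ModelData v q j ε B) (ht : t ∈ B) {ζ ξ : ℂ} (hζ : ‖ζ‖ ≤ ε ^ 10)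
    (hξ : ‖ξ‖ ≤ ε ^ 10) : resOut v q j t ζ - resOut v q j t ξ =
      (ζ - ξ) • (resOut v q j t ζ * resOut v q j t ξ) := by
  classical
  ext m n
  rw [map_sub, map_smul, smul_eq_mul, D.ent_resOut ht hζ, D.ent_resOut ht hξ]
  rw [resOut, ent_diag_mul (D.norm_resOut_coeff_le ht hζ), D.ent_resOut ht hξ]
  by_cases h : m = n ∧ ¬ inBlock q j m
  · have hb := D.bounds t ht
    have h0 : ∀ ζ : ℂ, ‖ζ‖ ≤ ε ^ 10 → psq m t - lamPlus v q j t - ζ ≠ 0 := fun ζ hζ =>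
      norm_pos_iff.mp (lt_of_lt_of_le (pow_pos D.pos 6) (hb.gap m h.2 ζ hζ))
    have h1 := h0 ζ hζ
    have h2 := h0 ξ hξ
    rw [if_pos h, if_pos h, if_neg h.2]
    field_simp
    ring
  · rw [if_neg h, if_neg h]; ring

theorem one_sub_ne_zero (D : ModelData v q j ε B) {ζ : ℂ} (hζ : ‖ζ‖ ≤ ε ^ 10 / 2) :
    1 / 2 ≤ ‖1 - ζ‖ ∧ 1 - ζ ≠ 0 := by
  have h10 : ε ^ 10 ≤ 1 := pow_le_one₀ D.pos.le (by linarith [D.small])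
  have := norm_sub_norm_le 1 ζ
  rw [norm_one] at this
  have h : 1 / 2 ≤ ‖1 - ζ‖ := by linarith
  exact ⟨h, norm_pos_iff.mp (by linarith)⟩

theorem resSh_sub_resSh (D : ModelData v q j ε B) (ht : t ∈ B) {ζ ξ : ℂ} (hζ : ‖ζ‖ ≤ ε ^ 10 / 2)
    (hξ : ‖ξ‖ ≤ ε ^ 10 / 2) : resSh v q j t ζ - resSh v q j t ξ =
      (ζ - ξ) • (resSh v q j t ζ * resSh v q j t ξ) := by
  have hE := D.ePlus_mul_ePlus ht
  have hPE := D.proj_mul_ePlus ht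
  have hEP := D.ePlus_mul_proj ht
  have hζ' := D.half_le hζ
  have hξ' := D.half_le hξ
  have a1 := (D.one_sub_ne_zero hζ).2
  have a2 := (D.one_sub_ne_zero hξ).2
  have h10 := pow_pos D.pos 10
  have b1 : -twoB v q j t - ζ ≠ 0 := norm_pos_iff.mp (h10.trans_le (D.norm_twoB_add_ge ht hζ))
  have b2 : -twoB v q j t - ξ ≠ 0 := norm_pos_iff.mp (h10.trans_le (D.norm_twoB_add_ge ht hξ))
  have hEo : ∀ {ξ}, ‖ξ‖ ≤ ε ^ 10 → ePlus v q j t * resOut v q j t ξ = 0 := fun hξ => by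
    rw [← hEP, mul_assoc, D.proj_mul_resOut ht hξ, mul_zero]
  have hoE : ∀ {ξ}, ‖ξ‖ ≤ ε ^ 10 → resOut v q j t ξ * ePlus v q j t = 0 := fun hξ => by
    rw [← hPE, ← mul_assoc, D.resOut_mul_proj ht hξ, zero_mul]
  have hmul : resSh v q j t ζ * resSh v q j t ξ =
      ((1 - ζ)⁻¹ * (1 - ξ)⁻¹) • ePlus v q j t +
      ((-twoB v q j t - ζ)⁻¹ * (-twoB v q j t - ξ)⁻¹) • (proj q j - ePlus v q j t) +
      resOut v q j t ζ * resOut v q j t ξ := by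
    simp only [resSh, resGen, add_mul, mul_add, smul_mul_assoc, mul_smul_comm, smul_smul, sub_mul,
      mul_sub, hE, hPE, hEP, proj_mul_proj, hEo hξ', hoE hζ', D.proj_mul_resOut ht hξ',
      D.resOut_mul_proj ht hζ', sub_self, smul_zero, add_zero, zero_add]
    rw [add_sub_cancel_left, smul_smul, mul_comm (-twoB v q j t - ξ)⁻¹,
      mul_comm (1 - ξ)⁻¹]
  rw [hmul, smul_add, smul_add, ← D.resOut_mul_resOut ht hζ' hξ', smul_smul, smul_smul]
  have c1 : (ζ - ξ) * ((1 - ζ)⁻¹ * (1 - ξ)⁻¹) = (1 - ζ)⁻¹ - (1 - ξ)⁻¹ := by field_simp; ring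
  have c2 : (ζ - ξ) * ((-twoB v q j t - ζ)⁻¹ * (-twoB v q j t - ξ)⁻¹) =
      (-twoB v q j t - ζ)⁻¹ - (-twoB v q j t - ξ)⁻¹ := by field_simp; ring
  rw [c1, c2, resSh, resSh, resGen, resGen, sub_smul _ _ (ePlus v q j t),
    sub_smul _ _ (proj q j - ePlus v q j t)]
  abel

/-- The two resolvents differ only on the range of Ê⁺, by the scalar identity (-ζ)⁻¹ = (1 - ζ)⁻¹ +
(-ζ)⁻¹ (1 - ζ)⁻¹. -/
theorem res_eq (D : ModelData v q j ε B) (ht : t ∈ B) {ζ : ℂ} (hζ : ‖ζ‖ ≤ ε ^ 10 / 2)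
    (h0 : ζ ≠ 0) : res v q j t ζ = resSh v q j t ζ +
      res v q j t ζ * ePlus v q j t * resSh v q j t ζ := by
  have a1 := (D.one_sub_ne_zero hζ).2
  have hζ' := D.half_le hζ
  have e1 : res v q j t ζ * ePlus v q j t * resSh v q j t ζ =
      ((-ζ)⁻¹ * (1 - ζ)⁻¹) • ePlus v q j t := by
    rw [res, D.resGen_mul_ePlus ht hζ', smul_mul_assoc, resSh, D.ePlus_mul_resGen ht hζ', smul_smul]
  have c1 : (-ζ)⁻¹ = (1 - ζ)⁻¹ + (-ζ)⁻¹ * (1 - ζ)⁻¹ := by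
    rw [inv_neg]; field_simp; ring
  rw [e1, res, resSh, resGen, resGen]
  conv_lhs => rw [c1, add_smul]
  abel

/-! #### The scalar equation for the eigenvalue -/

theorem neuSummable_sh (D : ModelData v q j ε B) (hX : StrongAdmissible v q j ε X t) {α ζ : ℂ}
    (hα : ‖α‖ ≤ 2) (hζ : ‖ζ‖ ≤ ε ^ 10 / 2) : NeuSummable (resSh v q j t ζ) (α • X) :=
  ((hX α hα).2 ζ hζ).neuSummable D.pos (by linarith [D.small])

theorem norm_neuSh_le (D : ModelData v q j ε B) (hX : StrongAdmissible v q j ε X t) {α ζ : ℂ}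
    (hα : ‖α‖ ≤ 2) (hζ : ‖ζ‖ ≤ ε ^ 10 / 2) : ‖neuSh v q j t X α ζ‖ ≤ 21 * (ε ^ 10)⁻¹ :=
  ((hX α hα).2 ζ hζ).norm_neu_le D.pos (by linarith [D.small])

theorem neuSh_sub_neuSh (D : ModelData v q j ε B) (ht : t ∈ B)
    (hX : StrongAdmissible v q j ε X t) {α ζ β ξ : ℂ} (hα : ‖α‖ ≤ 2) (hζ : ‖ζ‖ ≤ ε ^ 10 / 2)
    (hβ : ‖β‖ ≤ 2) (hξ : ‖ξ‖ ≤ ε ^ 10 / 2) :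
    neuSh v q j t X α ζ - neuSh v q j t X β ξ =
      (ζ - ξ) • (neuSh v q j t X α ζ * neuSh v q j t X β ξ) -
        (α - β) • (neuSh v q j t X α ζ * X * neuSh v q j t X β ξ) := by
  have h := neu_sub_neu (D.neuSummable_sh hX hα hζ) (D.neuSummable_sh hX hβ hξ)
    (D.resSh_sub_resSh ht hζ hξ)
  rw [neuSh, neuSh, h, ← sub_smul, mul_sub, sub_mul, mul_smul_comm, mul_one, smul_mul_assoc,
    mul_smul_comm, smul_mul_assoc]

theorem differentiableOn_neuSh (D : ModelData v q j ε B) (ht : t ∈ B)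
    (hX : StrongAdmissible v q j ε X t) {α : ℂ} (hα : ‖α‖ ≤ 2) :
    DifferentiableOn ℂ (neuSh v q j t X α) (Metric.ball 0 (ε ^ 10 / 2)) := by
  intro ζ hζ
  obtain ⟨r, hr, hball⟩ := Metric.isOpen_iff.mp Metric.isOpen_ball ζ hζ
  have hR : DifferentiableOn ℂ (resSh v q j t) (Metric.ball 0 (ε ^ 10 / 2)) := fun ξ hξ =>
    (DifferentiableAt.comp ξ (g := fun p : C2 × ℂ => resSh v q j p.1 p.2) (f := fun ξ => (t, ξ))
      (D.differentiableAt_resSh ht (mem_ball_zero_iff.mp hξ).le)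
      ((differentiableAt_const _).prodMk differentiableAt_id)).differentiableWithinAt
  refine (hasFDerivAt_tsum_of_bounded (u := fun r => 20 * (ε ^ 10)⁻¹ * (260 * ε) ^ r)
    ((summable_geometric_of_lt_one D.ratio_nonneg (by linarith [D.ratio_lt])).mul_left _) hr
    (f := fun r ζ => (-1 : ℂ) ^ r • ((resSh v q j t ζ * α • X) ^ r * resSh v q j t ζ))
    (fun n => DifferentiableOn.mono ?_ hball) fun n ξ hξ => ?_).differentiableAt.differentiableWithinAt
  · exact (((hR.mul_const (α • X)).pow n).mul hR).const_smul ((-1 : ℂ) ^ n)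
  · rw [norm_neg_one_pow_smul]
    exact ((hX α hα).2 ξ (mem_ball_zero_iff.mp (hball hξ)).le).norm_pow_mul_le D.pos
      (by linarith [D.small]) n

/-- Expanding S on both sides gives S = R - R (A - A S A) R with A = αX, and R acts on Ê⁺ as the
scalar (1 - ζ)⁻¹. In this form the displacement of the eigenvalue is visibly as small as the
effective potential in the block. -/
theorem shift_eq (D : ModelData v q j ε B) (ht : t ∈ B) (hp : EPlus v q j t j j ≠ 0)
    (hX : StrongAdmissible v q j ε X t) {α ζ : ℂ} (hα : ‖α‖ ≤ 2) (hζ : ‖ζ‖ ≤ ε ^ 10 / 2) :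
    shift v q j t X α ζ = (1 - ζ)⁻¹ *
      tau v q j t (α • X - α • X * neuSh v q j t X α ζ * (α • X)) := by
  have hs := D.neuSummable_sh hX hα hζ
  have e1 := neu_eq_left hs
  have e2 := neu_eq_right hs
  have hζ' := D.half_le hζ
  have a1 := (D.one_sub_ne_zero hζ).2
  have hE0 := D.ePlus_ne_zero ht hp
  set A := α • X with hA
  set S := neuSh v q j t X α ζ with hS
  change S = _ at e1 e2
  change S = _ - S * A * _ at e2
  change S = _ - _ * A * S at e1
  set R := resSh v q j t ζ
  have e3 : S = R - R * (A - A * S * A) * R := by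
    conv_lhs => rw [e1, e2]
    noncomm_ring
  have h1 : ePlus v q j t * R = (1 - ζ)⁻¹ • ePlus v q j t := D.ePlus_mul_resGen ht hζ' _
  have h2 : R * ePlus v q j t = (1 - ζ)⁻¹ • ePlus v q j t := D.resGen_mul_ePlus ht hζ' _
  have e4 : ePlus v q j t * S * ePlus v q j t = ((1 - ζ)⁻¹ -
      (1 - ζ)⁻¹ * (1 - ζ)⁻¹ * tau v q j t (A - A * S * A)) • ePlus v q j t := by
    conv_lhs => rw [e3]
    have : ePlus v q j t * (R - R * (A - A * S * A) * R) * ePlus v q j t =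
        (ePlus v q j t * R) * ePlus v q j t -
          (ePlus v q j t * R) * (A - A * S * A) * (R * ePlus v q j t) := by noncomm_ring
    rw [this, h1, h2, smul_mul_assoc, D.ePlus_mul_ePlus ht, smul_mul_assoc, smul_mul_assoc,
      mul_smul_comm, D.ePlus_mul_mul_ePlus ht hp, smul_smul, smul_smul, ← sub_smul]
  rw [D.ePlus_mul_mul_ePlus ht hp] at e4
  have e5 := smul_left_injective ℂ hE0 e4
  rw [shift, e5]
  field_simp
  ring

theorem norm_shift_le (D : ModelData v q j ε B) (ht : t ∈ B) (hp : EPlus v q j t j j ≠ 0)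
    (hX : StrongAdmissible v q j ε X t) {α ζ : ℂ} (hα : ‖α‖ ≤ 2) (hζ : ‖ζ‖ ≤ ε ^ 10 / 2) :
    ‖shift v q j t X α ζ‖ ≤ 240 * ε ^ 11 := by
  have hε := D.pos
  have h1 := ((hX α hα).2 ζ hζ).norm_block_le D.pos (by linarith [D.small])
  have h2 := (D.norm_tau_le ht hp (α • X - α • X * neuSh v q j t X α ζ * (α • X))).trans
    (mul_le_mul_of_nonneg_left h1 (by norm_num))
  have h3 : ‖(1 - ζ)⁻¹‖ ≤ 2 := by
    rw [norm_inv]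
    exact (inv_anti₀ (by norm_num) (D.one_sub_ne_zero hζ).1).trans_eq (by norm_num)
  rw [D.shift_eq ht hp hX hα hζ, norm_mul]
  calc _ ≤ 2 * (4 * (30 * ε ^ 11)) := mul_le_mul h3 h2 (norm_nonneg _) (by norm_num)
    _ = _ := by ring

theorem differentiableOn_shift (D : ModelData v q j ε B) (ht : t ∈ B)
    (hX : StrongAdmissible v q j ε X t) {α : ℂ} (hα : ‖α‖ ≤ 2) :
    DifferentiableOn ℂ (shift v q j t X α) (Metric.ball 0 (ε ^ 10 / 2)) := by
  have h1 : DifferentiableOn ℂ (fun ζ => tau v q j t (neuSh v q j t X α ζ))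
      (Metric.ball 0 (ε ^ 10 / 2)) :=
    (tau v q j t).differentiable.comp_differentiableOn (D.differentiableOn_neuSh ht hX hα)
  exact differentiableOn_id.add ((differentiableOn_id.const_sub 1).mul (h1.const_sub 1))

/-- Cauchy's estimate: a function of size 240 ε¹¹ on a disc of radius ε¹⁰/2 has derivative at most
3840 ε on the concentric disc of half the radius. -/
theorem norm_shift_sub_le (D : ModelData v q j ε B) (ht : t ∈ B) (hp : EPlus v q j t j j ≠ 0)
    (hX : StrongAdmissible v q j ε X t) {α ζ ξ : ℂ} (hα : ‖α‖ ≤ 2) (hζ : ‖ζ‖ ≤ ε ^ 10 / 4)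
    (hξ : ‖ξ‖ ≤ ε ^ 10 / 4) :
    ‖shift v q j t X α ζ - shift v q j t X α ξ‖ ≤ 1 / 2 * ‖ζ - ξ‖ := by
  have hε := D.pos
  have h10 := pow_pos hε 10
  have hd := D.differentiableOn_shift ht hX hα
  refine Convex.norm_image_sub_le_of_norm_deriv_le (𝕜 := ℂ)
    (s := Metric.closedBall 0 (ε ^ 10 / 4)) (fun x hx => ?_) (fun x hx => ?_)
    (convex_closedBall _ _) (mem_closedBall_zero_iff.mpr hξ) (mem_closedBall_zero_iff.mpr hζ)
  · exact hd.differentiableAt (Metric.isOpen_ball.mem_nhds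
      (Metric.closedBall_subset_ball (by linarith) hx))
  · rw [mem_closedBall_zero_iff] at hx
    have hsub : Metric.ball x (ε ^ 10 / 4) ⊆ Metric.ball 0 (ε ^ 10 / 2) :=
      Metric.ball_subset_ball' (by rw [dist_zero_right]; linarith)
    have h1 := norm_fderiv_le_of_bounded (f := shift v q j t X α) (x := x) (r := ε ^ 10 / 4)
      (M := 240 * ε ^ 11) (by positivity) (hd.mono hsub)
      fun y hy => D.norm_shift_le ht hp hX hα (mem_ball_zero_iff.mp (hsub hy)).le
    rw [← norm_deriv_eq_norm_fderiv] at h1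
    refine h1.trans ?_
    have : 4 * (240 * ε ^ 11) / (ε ^ 10 / 4) = 3840 * ε := by field_simp; ring
    rw [this]
    linarith [D.small]

end ModelData

namespace ModelData

variable {v : Idx → ℂ} {q j : Idx} {ε : ℝ} {B : Set C2} {t : C2} {X : Schur}

/-! #### The root of the scalar equation and the residue -/

/-- A root is a value of the small function `shift`, hence lies well inside the contour. -/
theorem norm_le_of_root (D : ModelData v q j ε B) (ht : t ∈ B) (hp : EPlus v q j t j j ≠ 0)
    (hX : StrongAdmissible v q j ε X t) {α ξ : ℂ} (hα : ‖α‖ ≤ 2) (hξ : ‖ξ‖ ≤ ε ^ 10 / 4)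
    (hr : shift v q j t X α ξ = ξ) : ‖ξ‖ ≤ ε ^ 10 / 8 := by
  have h10 := pow_pos D.pos 10
  have h1 := D.norm_shift_le ht hp hX hα (ζ := ξ) (by linarith)
  rw [hr] at h1
  have : ε ^ 11 = ε ^ 10 * ε := by ring
  nlinarith [D.small]

theorem tau_of_root (D : ModelData v q j ε B) {α ξ : ℂ} (hξ : ‖ξ‖ ≤ ε ^ 10 / 4)
    (hr : shift v q j t X α ξ = ξ) : tau v q j t (neuSh v q j t X α ξ) = 1 := by
  have h1 := (D.one_sub_ne_zero (ζ := ξ) (by linarith [pow_pos D.pos 10])).2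
  rw [shift, add_eq_left, mul_eq_zero] at hr
  exact (sub_eq_zero.mp (hr.resolve_left h1)).symm

/-- Since τ(S(ξ)) = 1 at a root, the resolvent identity between ζ and ξ factors the zero out of 1 -
τ(S(ζ)). -/
theorem one_sub_tau (D : ModelData v q j ε B) (ht : t ∈ B)
    (hX : StrongAdmissible v q j ε X t) {α ζ ξ : ℂ} (hα : ‖α‖ ≤ 2) (hζ : ‖ζ‖ ≤ ε ^ 10 / 4)
    (hξ : ‖ξ‖ ≤ ε ^ 10 / 4) (hr : shift v q j t X α ξ = ξ) :
    1 - tau v q j t (neuSh v q j t X α ζ) =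
      -((ζ - ξ) * tau v q j t (neuSh v q j t X α ζ * neuSh v q j t X α ξ)) := by
  have h10 := pow_pos D.pos 10
  have h1 := congrArg (tau v q j t)
    (D.neuSh_sub_neuSh ht hX hα (ζ := ζ) (by linarith) hα (ξ := ξ) (by linarith))
  rw [sub_self, zero_smul, sub_zero, map_sub, map_smul, D.tau_of_root hξ hr, smul_eq_mul] at h1
  rw [← h1]; ring

/-- The zero is simple: otherwise ζ - `shift` would vanish to higher order, whereas `shift`
contracts by 1/2. So |(1 - ζ) τ(S(ζ)S(ξ))| ≥ 1/2, and |1 - ζ| ≤ 2. -/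
theorem quarter_le_norm_tau (D : ModelData v q j ε B) (ht : t ∈ B) (hp : EPlus v q j t j j ≠ 0)
    (hX : StrongAdmissible v q j ε X t) {α ζ ξ : ℂ} (hα : ‖α‖ ≤ 2) (hζ : ‖ζ‖ ≤ ε ^ 10 / 4)
    (hξ : ‖ξ‖ ≤ ε ^ 10 / 4) (hr : shift v q j t X α ξ = ξ) :
    1 / 4 ≤ ‖tau v q j t (neuSh v q j t X α ζ * neuSh v q j t X α ξ)‖ := by
  have h10 := pow_pos D.pos 10
  have h10' : ε ^ 10 ≤ 1 := pow_le_one₀ D.pos.le (by linarith [D.small])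
  have key : ∀ ζ : ℂ, ‖ζ‖ ≤ ε ^ 10 / 4 → ζ ≠ ξ →
      1 / 4 ≤ ‖tau v q j t (neuSh v q j t X α ζ * neuSh v q j t X α ξ)‖ := by
    intro ζ hζ hne
    have h1 : shift v q j t X α ζ - shift v q j t X α ξ = (ζ - ξ) - (ζ - ξ) *
        ((1 - ζ) * tau v q j t (neuSh v q j t X α ζ * neuSh v q j t X α ξ)) := by
      rw [hr, shift, D.one_sub_tau ht hX hα hζ hξ hr]; ring
    have h2 := D.norm_shift_sub_le ht hp hX hα hζ hξ
    rw [h1] at h2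
    have h3 := norm_sub_norm_le (ζ - ξ) ((ζ - ξ) - ((ζ - ξ) - (ζ - ξ) *
        ((1 - ζ) * tau v q j t (neuSh v q j t X α ζ * neuSh v q j t X α ξ))))
    rw [sub_sub_cancel, norm_mul, norm_mul] at h3
    have h4 : 0 < ‖ζ - ξ‖ := norm_pos_iff.mpr (sub_ne_zero.mpr hne)
    have h5 : ‖1 - ζ‖ ≤ 2 := (norm_sub_le _ _).trans (by rw [norm_one]; linarith)
    have h6 := norm_nonneg (tau v q j t (neuSh v q j t X α ζ * neuSh v q j t X α ξ))
    have h7 := mul_le_mul_of_nonneg_right h5 h6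
    nlinarith
  -- At ζ = ξ no difference quotient is available; the bound follows by continuity from nearby
  -- points.
  rcases eq_or_ne ζ ξ with rfl | hne
  · have hζ8 := D.norm_le_of_root ht hp hX hα hζ hr
    have hc : ContinuousAt (fun ξ' => ‖tau v q j t (neuSh v q j t X α ξ' *
        neuSh v q j t X α ζ)‖) ζ := by
      have h1 : ContinuousAt (neuSh v q j t X α) ζ :=
        ((D.differentiableOn_neuSh ht hX hα).differentiableAt
          (Metric.isOpen_ball.mem_nhds (mem_ball_zero_iff.mpr (by linarith)))).continuousAt
      exact ((tau v q j t).continuous.continuousAt.comp (h1.mul continuousAt_const)).norm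
    refine ge_of_tendsto (hc.tendsto.mono_left (nhdsWithin_le_nhds (s := {ζ}ᶜ))) ?_
    have h2 : Metric.ball (0 : ℂ) (ε ^ 10 / 4) ∈ 𝓝 ζ :=
      Metric.isOpen_ball.mem_nhds (mem_ball_zero_iff.mpr (by linarith))
    filter_upwards [self_mem_nhdsWithin, nhdsWithin_le_nhds h2] with ξ' h3 h4
    exact key ξ' (mem_ball_zero_iff.mp h4).le h3
  · exact key ζ hζ hne

/-- On the contour the perturbed resolvent is S(ζ) plus a function with one simple pole at the root.
The first part integrates to zero and Cauchy's formula evaluates the second. -/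
theorem eOp_eq_rank_one (D : ModelData v q j ε B) (ht : t ∈ B) (hp : EPlus v q j t j j ≠ 0)
    (hX : StrongAdmissible v q j ε X t) {α ξ : ℂ} (hα : ‖α‖ ≤ 2) (hξ : ‖ξ‖ ≤ ε ^ 10 / 4)
    (hr : shift v q j t X α ξ = ξ) : eOp v q j ε (α • X) t =
      (tau v q j t (neuSh v q j t X α ξ * neuSh v q j t X α ξ))⁻¹ •
        (neuSh v q j t X α ξ * ePlus v q j t * neuSh v q j t X α ξ) := by
  have h10 := pow_pos D.pos 10
  have hξ8 := D.norm_le_of_root ht hp hX hα hξ hr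
  let S := neuSh v q j t X α
  let u : ℂ → ℂ := fun ζ => tau v q j t (S ζ * S ξ)
  have hu : ∀ ζ : ℂ, ‖ζ‖ ≤ ε ^ 10 / 4 → u ζ ≠ 0 := fun ζ hζ => norm_pos_iff.mp
    (lt_of_lt_of_le (by norm_num) (D.quarter_le_norm_tau ht hp hX hα hζ hξ hr))
  have hSd : ∀ ζ ∈ Metric.closedBall (0 : ℂ) (ε ^ 10 / 4), DifferentiableAt ℂ S ζ := fun ζ hζ =>
    (D.differentiableOn_neuSh ht hX hα).differentiableAt (Metric.isOpen_ball.mem_nhds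
      (Metric.closedBall_subset_ball (by linarith) hζ))
  let f : ℂ → Schur := fun ζ => (-(u ζ)⁻¹) • (S ζ * ePlus v q j t * S ζ)
  have hfd : ∀ ζ ∈ Metric.closedBall (0 : ℂ) (ε ^ 10 / 4), DifferentiableAt ℂ f ζ := by
    intro ζ hζ
    have h1 := hSd ζ hζ
    have h2 : DifferentiableAt ℂ u ζ :=
      (tau v q j t).differentiable.differentiableAt.comp ζ (h1.mul_const (S ξ))
    exact (h2.fun_inv (hu ζ (mem_closedBall_zero_iff.mp hζ))).fun_neg.smul
      ((h1.mul_const (ePlus v q j t)).mul h1)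
  have hne : ∀ ζ ∈ Metric.sphere (0 : ℂ) (ε ^ 10 / 4), ζ - ξ ≠ 0 := fun ζ hζ h => by
    rw [sub_eq_zero] at h
    rw [mem_sphere_zero_iff_norm, h] at hζ
    linarith
  have hneu : ∀ ζ ∈ Metric.sphere (0 : ℂ) (ε ^ 10 / 4),
      neu (res v q j t ζ) (α • X) = S ζ + (ζ - ξ)⁻¹ • f ζ := by
    intro ζ hζ
    have hζ2 := D.sphere_norm_le hζ
    have hζ4 : ‖ζ‖ ≤ ε ^ 10 / 4 := (mem_sphere_zero_iff_norm.mp hζ).le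
    have h1 := D.one_sub_tau ht hX hα hζ4 hξ hr
    have h2 : 1 - tau v q j t (S ζ) ≠ 0 := by
      rw [h1]
      exact neg_ne_zero.mpr (mul_ne_zero (hne ζ hζ) (hu ζ hζ4))
    have h3 := neu_rank_one (((hX α hα).1 ζ hζ).neuSummable D.pos (by linarith [D.small]))
      (D.neuSummable_sh hX hα hζ2.1) (D.res_eq ht hζ2.1 hζ2.2)
      (D.ePlus_mul_mul_ePlus ht hp (S ζ)) h2
    rw [h3, h1]
    change S ζ + _ • (S ζ * _ * S ζ) = _
    simp only [f, smul_smul]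
    congr 2
    rw [inv_neg, mul_inv, mul_neg]
  have i1 : CircleIntegrable S 0 (ε ^ 10 / 4) := D.circleIntegrable fun ζ hζ =>
    (hSd ζ (Metric.sphere_subset_closedBall hζ)).continuousAt.continuousWithinAt
  have i2 : CircleIntegrable (fun ζ => (ζ - ξ)⁻¹ • f ζ) 0 (ε ^ 10 / 4) := by
    refine D.circleIntegrable ?_
    have h1 : ContinuousOn (fun ζ : ℂ => (ζ - ξ)⁻¹) (Metric.sphere 0 (ε ^ 10 / 4)) :=
      (continuousOn_id.sub continuousOn_const).inv₀ hne
    exact h1.smul fun ζ hζ =>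
      (hfd ζ (Metric.sphere_subset_closedBall hζ)).continuousAt.continuousWithinAt
  have z1 : ∮ ζ in C(0, ε ^ 10 / 4), S ζ = 0 :=
    Complex.circleIntegral_eq_zero_of_differentiable_on_off_countable D.radius_pos.le
      Set.countable_empty (fun ζ hζ => (hSd ζ hζ).continuousAt.continuousWithinAt)
      fun ζ hζ => hSd ζ (Metric.ball_subset_closedBall hζ.1)
  have z2 : ∮ ζ in C(0, ε ^ 10 / 4), (ζ - ξ)⁻¹ • f ζ = (2 * Real.pi * Complex.I : ℂ) • f ξ :=
    Complex.circleIntegral_sub_inv_smul_of_differentiable_on_off_countable Set.countable_empty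
      (mem_ball_zero_iff.mpr (by linarith))
      (fun ζ hζ => (hfd ζ hζ).continuousAt.continuousWithinAt)
      fun ζ hζ => hfd ζ (Metric.ball_subset_closedBall hζ.1)
  rw [D.eOp_eq ht (hX α hα).1, circleIntegral.integral_congr D.radius_pos.le hneu,
    circleIntegral.integral_add i1 i2, z1, z2, zero_add, smul_smul]
  have hpi := Complex.two_pi_I_ne_zero
  rw [neg_mul, inv_mul_cancel₀ hpi]
  simp only [f, smul_smul, neg_mul_neg, one_mul]
  rfl

/-! #### Dependence of the root on the coupling constant -/

/-- The contraction in ζ absorbs the variation of the root, so root and resolvent depend Lipschitz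
continuously on α. With α = β this contains uniqueness of the root. The constant is irrelevant; only
continuity is used later. -/
theorem norm_root_sub_le (D : ModelData v q j ε B) (ht : t ∈ B) (hp : EPlus v q j t j j ≠ 0)
    (hX : StrongAdmissible v q j ε X t) : ∃ K : ℝ, ∀ α β ξ ζ : ℂ, ‖α‖ ≤ 2 → ‖β‖ ≤ 2 →
      ‖ξ‖ ≤ ε ^ 10 / 4 → ‖ζ‖ ≤ ε ^ 10 / 4 → shift v q j t X α ξ = ξ → shift v q j t X β ζ = ζ →
      ‖ξ - ζ‖ ≤ K * ‖α - β‖ ∧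
        ‖neuSh v q j t X α ξ - neuSh v q j t X β ζ‖ ≤ K * ‖α - β‖ := by
  have h10 := pow_pos D.pos 10
  have h10' : ε ^ 10 ≤ 1 := pow_le_one₀ D.pos.le (by linarith [D.small])
  set N := 21 * (ε ^ 10)⁻¹ with hN
  have hN0 : 0 ≤ N := by positivity
  set T := ‖tau v q j t‖
  have hprod : ∀ {α ζ β ξ : ℂ}, ‖α‖ ≤ 2 → ‖ζ‖ ≤ ε ^ 10 / 4 → ‖β‖ ≤ 2 → ‖ξ‖ ≤ ε ^ 10 / 4 →
      ‖neuSh v q j t X α ζ * X * neuSh v q j t X β ξ‖ ≤ N * ‖X‖ * N := by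
    intro α ζ β ξ hα hζ hβ hξ
    refine (norm_mul_le _ _).trans (mul_le_mul ((norm_mul_le _ _).trans ?_)
      (D.norm_neuSh_le hX hβ (by linarith)) (norm_nonneg _) (by positivity))
    exact mul_le_mul_of_nonneg_right (D.norm_neuSh_le hX hα (by linarith)) (norm_nonneg _)
  refine ⟨4 * (T * (N * ‖X‖ * N)) + (4 * (T * (N * ‖X‖ * N)) * (N * N) + N * ‖X‖ * N),
    fun α β ξ ζ hα hβ hξ hζ hr1 hr2 => ?_⟩
  have hab := norm_nonneg (α - β)
  have h1 : shift v q j t X α ζ - shift v q j t X β ζ = (1 - ζ) * ((α - β) *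
      tau v q j t (neuSh v q j t X α ζ * X * neuSh v q j t X β ζ)) := by
    have h := congrArg (tau v q j t)
      (D.neuSh_sub_neuSh ht hX hα (ζ := ζ) (by linarith) hβ (ξ := ζ) (by linarith))
    rw [sub_self, zero_smul, zero_sub, map_sub, map_neg, map_smul, smul_eq_mul] at h
    rw [shift, shift]
    linear_combination -(1 - ζ) * h
  have h2 : ‖shift v q j t X α ζ - shift v q j t X β ζ‖ ≤
      2 * (‖α - β‖ * (T * (N * ‖X‖ * N))) := by
    rw [h1, norm_mul, norm_mul]
    have h5 : ‖1 - ζ‖ ≤ 2 := (norm_sub_le _ _).trans (by rw [norm_one]; linarith)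
    gcongr
    exact ((tau v q j t).le_opNorm _).trans
      (mul_le_mul_of_nonneg_left (hprod hα hζ hβ hζ) (norm_nonneg _))
  have h3 := D.norm_shift_sub_le ht hp hX hα hξ hζ
  have h4 : ‖ξ - ζ‖ ≤ 4 * (T * (N * ‖X‖ * N)) * ‖α - β‖ := by
    have e : ξ - ζ = (shift v q j t X α ξ - shift v q j t X α ζ) +
        (shift v q j t X α ζ - shift v q j t X β ζ) := by rw [hr1, hr2]; ring
    have := norm_add_le (shift v q j t X α ξ - shift v q j t X α ζ)
      (shift v q j t X α ζ - shift v q j t X β ζ)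
    rw [← e] at this
    linarith
  have hTN : 0 ≤ T * (N * ‖X‖ * N) := by positivity
  have hNX : 0 ≤ N * ‖X‖ * N := by positivity
  refine ⟨h4.trans (mul_le_mul_of_nonneg_right (by nlinarith [mul_nonneg hTN (mul_nonneg hN0 hN0)])
    hab), ?_⟩
  rw [D.neuSh_sub_neuSh ht hX hα (ζ := ξ) (by linarith) hβ (ξ := ζ) (by linarith)]
  have h6 : ‖(ξ - ζ) • (neuSh v q j t X α ξ * neuSh v q j t X β ζ)‖ ≤
      4 * (T * (N * ‖X‖ * N)) * ‖α - β‖ * (N * N) := by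
    rw [norm_smul]
    refine mul_le_mul h4 ((norm_mul_le _ _).trans (mul_le_mul
      (D.norm_neuSh_le hX hα (by linarith)) (D.norm_neuSh_le hX hβ (by linarith)) (norm_nonneg _)
      hN0)) (norm_nonneg _) (by positivity)
  have h7 : ‖(α - β) • (neuSh v q j t X α ξ * X * neuSh v q j t X β ζ)‖ ≤
      ‖α - β‖ * (N * ‖X‖ * N) := by
    rw [norm_smul]
    exact mul_le_mul_of_nonneg_left (hprod hα hξ hβ hζ) hab
  calc _ ≤ _ := norm_sub_le_of_le h6 h7
    _ = (4 * (T * (N * ‖X‖ * N)) * (N * N) + N * ‖X‖ * N) * ‖α - β‖ := by ring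
    _ ≤ _ := mul_le_mul_of_nonneg_right (by linarith) hab

/-- The derivative of the root with respect to the coupling constant. -/
theorem hasDerivAt_root (D : ModelData v q j ε B) (ht : t ∈ B) (hp : EPlus v q j t j j ≠ 0)
    (hX : StrongAdmissible v q j ε X t) {z : ℝ → ℂ}
    (hz : ∀ α : ℝ, |α| ≤ 2 → ‖z α‖ ≤ ε ^ 10 / 4 ∧ shift v q j t X α (z α) = z α) {β : ℝ}
    (hβ : |β| < 2) :
    HasDerivAt z
      (tau v q j t (neuSh v q j t X β (z β) * X * neuSh v q j t X β (z β)) /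
        tau v q j t (neuSh v q j t X β (z β) * neuSh v q j t X β (z β))) β := by
  have h10 := pow_pos D.pos 10
  obtain ⟨K, hK⟩ := D.norm_root_sub_le ht hp hX
  have hn : ∀ {α : ℝ}, |α| ≤ 2 → ‖(α : ℂ)‖ ≤ 2 := fun h => by
    rwa [Complex.norm_real, Real.norm_eq_abs]
  have hmem : ∀ᶠ α : ℝ in 𝓝 β, |α| ≤ 2 :=
    (continuous_abs.tendsto β).eventually (Iic_mem_nhds hβ)
  let S : ℝ → Schur := fun α => neuSh v q j t X α (z α)
  have hS : Filter.Tendsto S (𝓝 β) (𝓝 (S β)) := by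
    rw [tendsto_iff_norm_sub_tendsto_zero]
    have h1 : Filter.Tendsto (fun α : ℝ => K * ‖(α : ℂ) - β‖) (𝓝 β) (𝓝 0) := by
      have : Continuous fun α : ℝ => K * ‖(α : ℂ) - β‖ := by fun_prop
      simpa using this.tendsto β
    refine squeeze_zero' (Filter.Eventually.of_forall fun _ => norm_nonneg _) ?_ h1
    filter_upwards [hmem] with α hα
    exact (hK α β (z α) (z β) (hn hα) (hn hβ.le) (hz α hα).1 (hz β hβ.le).1 (hz α hα).2
      (hz β hβ.le).2).2
  have hden : tau v q j t (S β * S β) ≠ 0 := norm_pos_iff.mp (lt_of_lt_of_le (by norm_num)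
    (D.quarter_le_norm_tau ht hp hX (hn hβ.le) (hz β hβ.le).1 (hz β hβ.le).1 (hz β hβ.le).2))
  have t1 : Filter.Tendsto (fun α => tau v q j t (S α * X * S β)) (𝓝 β)
      (𝓝 (tau v q j t (S β * X * S β))) :=
    ((tau v q j t).continuous.tendsto _).comp
      ((hS.mul tendsto_const_nhds).mul tendsto_const_nhds)
  have t2 : Filter.Tendsto (fun α => tau v q j t (S α * S β)) (𝓝 β)
      (𝓝 (tau v q j t (S β * S β))) :=
    ((tau v q j t).continuous.tendsto _).comp (hS.mul tendsto_const_nhds)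
  rw [hasDerivAt_iff_tendsto_slope]
  refine ((t1.div t2 hden).mono_left nhdsWithin_le_nhds).congr' ?_
  filter_upwards [self_mem_nhdsWithin, nhdsWithin_le_nhds hmem,
    nhdsWithin_le_nhds (t2.eventually_ne hden)] with α hne hα hu
  -- Subtracting the equations τ(S) = 1 at α and β, the resolvent identity gives (z_α - z_β) τ(S_α
  -- S_β) = (α - β) τ(S_α X S_β), an exact formula for the difference quotient.
  have h1 := congrArg (tau v q j t) (D.neuSh_sub_neuSh ht hX (hn hα) (ζ := z α)
    (by linarith [(hz α hα).1]) (hn hβ.le) (ξ := z β) (by linarith [(hz β hβ.le).1]))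
  rw [map_sub, map_sub, D.tau_of_root (hz α hα).1 (hz α hα).2,
    D.tau_of_root (hz β hβ.le).1 (hz β hβ.le).2, sub_self, map_smul, map_smul, smul_eq_mul,
    smul_eq_mul] at h1
  have hab : (α : ℂ) - β ≠ 0 := by
    rw [← Complex.ofReal_sub]
    exact Complex.ofReal_ne_zero.mpr (sub_ne_zero.mpr hne)
  rw [slope_def_module, Complex.real_smul, Pi.div_apply]
  push_cast
  rw [inv_mul_eq_div, div_eq_div_iff hu hab]
  linear_combination h1

/-! #### The trace formula for the derivative -/

theorem gOp_smul (α : ℂ) (r : ℕ) : gOp v q j ε (α • X) r t = α ^ r • gOp v q j ε X r t := by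
  simp only [gOp, mul_smul_comm, smul_pow, smul_mul_assoc, circleIntegral.integral_smul, smul_comm (α ^ r)]

theorem ent_gOp_mul (D : ModelData v q j ε B) (ht : t ∈ B) (r : ℕ) (m : Idx) :
    ent m m (gOp v q j ε X r t * X) = (-1) ^ (r + 1) * (2 * Real.pi * Complex.I : ℂ)⁻¹ *
      ∮ ζ in C(0, ε ^ 10 / 4), ent m m ((res v q j t ζ * X) ^ (r + 1)) := by
  have hi : CircleIntegrable (fun ζ => (res v q j t ζ * X) ^ r * res v q j t ζ) 0 (ε ^ 10 / 4) :=
    D.circleIntegrable ((D.continuousOn_pow ht X r).mul (D.continuousOn_res ht))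
  let L : Schur →L[ℂ] ℂ := (ent m m).comp ((ContinuousLinearMap.mul ℂ Schur).flip X)
  have h1 : L (gOp v q j ε X r t) = ent m m (gOp v q j ε X r t * X) := rfl
  rw [← h1, gOp, map_smul, smul_eq_mul, map_circleIntegral L hi]
  congr 1

/-- The polynomial factor r + 1 is absorbed by doubling the ratio of the geometric series. -/
theorem sum_ent_gOp_mul_le (D : ModelData v q j ε B) (ht : t ∈ B)
    (hX : Admissible v q j ε X t) (r : ℕ) (s : Finset Idx) :
    ∑ m ∈ s, ‖ent m m (gOp v q j ε X r t * X)‖ ≤ ε ^ 10 * (520 * ε) ^ (r + 1) := by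
  have hε := D.pos
  have hpi := Real.pi_pos
  have h1 : ∀ m, ‖ent m m (gOp v q j ε X r t * X)‖ = (2 * Real.pi)⁻¹ *
      ‖∮ ζ in C(0, ε ^ 10 / 4), ent m m ((res v q j t ζ * X) ^ (r + 1))‖ := fun m => by
    rw [D.ent_gOp_mul ht, norm_mul, norm_mul, norm_pow, norm_neg, norm_one, one_pow, one_mul,
      norm_two_pi_I_inv]
  simp only [h1]
  rw [← Finset.mul_sum]
  have h2 := D.sum_diag_circleIntegral_le ht hX (r + 1) s
  have h3 : ((r + 1 : ℕ) : ℝ) ≤ 2 ^ (r + 1) := by exact_mod_cast (Nat.lt_two_pow_self).le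
  calc _ ≤ (2 * Real.pi)⁻¹ * (Real.pi * ε ^ 10 * (r + 1 : ℕ) * (260 * ε) ^ (r + 1)) := by gcongr
    _ = 1 / 2 * (ε ^ 10 * ((r + 1 : ℕ) * (260 * ε) ^ (r + 1))) := by field_simp
    _ ≤ 1 * (ε ^ 10 * (2 ^ (r + 1) * (260 * ε) ^ (r + 1))) := by gcongr; norm_num
    _ = _ := by rw [one_mul, ← mul_pow]; congr 2; ring

/-- Multiplication by the index removes 1/r, and one factor X is split off the power: r g_r =
Tr(G_{r-1} X), the sign conventions of the two series agreeing after the shift of the index. -/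
theorem gTerm_eq_tsum (D : ModelData v q j ε B) (ht : t ∈ B) {w : Idx → ℂ}
    (hw : starNorm (w - v) ≤ ENNReal.ofReal (9 * ε ^ 11)) (r : ℕ) :
    ((r + 1 : ℕ) : ℂ) * gTerm v q j ε w (r + 1) t =
      ∑' m, ent m m (gOp v q j ε (pot v q j w) r t * pot v q j w) := by
  have hr : ((r + 1 : ℕ) : ℂ) ≠ 0 := Nat.cast_ne_zero.mpr r.succ_ne_zero
  simp only [D.ent_gOp_mul ht, ← D.gMat_eq ht (D.potBound hw).1]
  rw [tsum_mul_left, gTerm]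
  have := Complex.two_pi_I_ne_zero
  field_simp

/-- The right side is the derivative in α of ∑ α^r g_r, so this says that the eigenvalue series has
derivative Tr(E_{αX} X). Absolute summability over r and m allows the exchange. -/
theorem tsum_ent_eOp_mul (D : ModelData v q j ε B) (ht : t ∈ B) {w : Idx → ℂ}
    (hw : starNorm (w - v) ≤ ENNReal.ofReal (9 * ε ^ 11)) {α : ℂ} (hα : ‖α‖ ≤ 1) :
    ∑' m, ent m m (eOp v q j ε (α • pot v q j w) t * pot v q j w) =
      ∑' r : ℕ, α ^ r * (((r + 1 : ℕ) : ℂ) * gTerm v q j ε w (r + 1) t) := by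
  have hε := D.pos
  have hX := D.admissible_pot ht hw
  have hXα := D.admissible ht hw (α := α) (by linarith)
  set X := pot v q j w
  have h1 : ∀ m, ent m m (eOp v q j ε (α • X) t * X) =
      ∑' r : ℕ, α ^ r * ent m m (gOp v q j ε X r t * X) := fun m => by
    have h := (ent m m).hasSum ((D.hasSum_gOp ht hXα).mul_right X)
    rw [← h.tsum_eq]
    refine tsum_congr fun r => ?_
    rw [gOp_smul, smul_mul_assoc, map_smul, smul_eq_mul]
  have hb : ∀ r : ℕ, ∀ s : Finset Idx,
      ∑ m ∈ s, ‖α ^ r * ent m m (gOp v q j ε X r t * X)‖ ≤ ε ^ 10 * (520 * ε) ^ (r + 1) := by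
    intro r s
    refine (Finset.sum_le_sum fun m _ => ?_).trans (D.sum_ent_gOp_mul_le ht hX r s)
    rw [norm_mul, norm_pow]
    exact mul_le_of_le_one_left (norm_nonneg _) (pow_le_one₀ (norm_nonneg _) hα)
  have hs : ∀ r : ℕ, Summable fun m => ‖α ^ r * ent m m (gOp v q j ε X r t * X)‖ := fun r =>
    summable_of_sum_le (fun _ => norm_nonneg _) (hb r)
  have hgeo : Summable fun r : ℕ => ε ^ 10 * (520 * ε) ^ (r + 1) :=
    ((summable_nat_add_iff 1).mpr (summable_geometric_of_lt_one (by positivity)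
      (by linarith [D.small]))).mul_left _
  have hsum : Summable (Function.uncurry fun (r : ℕ) (m : Idx) =>
      α ^ r * ent m m (gOp v q j ε X r t * X)) := by
    refine Summable.of_norm ((summable_prod_of_nonneg fun _ => norm_nonneg _).mpr ⟨hs, ?_⟩)
    refine Summable.of_nonneg_of_le (fun r => tsum_nonneg fun _ => norm_nonneg _) (fun r => ?_) hgeo
    exact (hs r).tsum_le_of_sum_le (hb r)
  simp only [h1]
  rw [hsum.tsum_comm]
  refine tsum_congr fun r => ?_
  rw [tsum_mul_left, D.gTerm_eq_tsum ht hw]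

/-- Cyclicity of the trace through a rank one matrix, where both sides are explicit sums over one
index. -/
theorem tsum_ent_rank_one (D : ModelData v q j ε B) (ht : t ∈ B) (hp : EPlus v q j t j j ≠ 0)
    (S Y : Schur) :
    ∑' m, ent m m (S * ePlus v q j t * S * Y) = tau v q j t (S * Y * S) := by
  have h1 := (hasSum_ent_mul (ePlus v q j t * (S * Y)) (S * ePlus v q j t) j j).tsum_eq
  have h2 : ∀ m, ent m m (S * ePlus v q j t * S * Y) = (EPlus v q j t j j)⁻¹ *
      (ent j m (ePlus v q j t * (S * Y)) * ent m j (S * ePlus v q j t)) := fun m => by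
    rw [mul_assoc _ S Y, D.ent_mul_ePlus_mul ht hp, mul_comm (ent m j _)]
  simp only [h2]
  rw [tsum_mul_left, h1, tau_apply]
  simp only [mul_assoc]

end ModelData

/-! ### Adjoints -/

/-- `x` is the adjoint matrix of `y`. -/
def IsAdj (x y : Schur) : Prop := ∀ m n, ent m n x = conj (ent n m y)

namespace IsAdj

variable {x x' y y' : Schur}

theorem add (hx : IsAdj x x') (hy : IsAdj y y') : IsAdj (x + y) (x' + y') := fun m n => by
  rw [map_add, map_add, map_add, hx, hy]

theorem sub (hx : IsAdj x x') (hy : IsAdj y y') : IsAdj (x - y) (x' - y') := fun m n => by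
  rw [map_sub, map_sub, map_sub, hx, hy]

theorem smul (hx : IsAdj x x') {a a' : ℂ} (ha : a = conj a') : IsAdj (a • x) (a' • x') :=
  fun m n => by rw [map_smul, map_smul, smul_eq_mul, smul_eq_mul, map_mul, hx, ha]

theorem mul (hx : IsAdj x x') (hy : IsAdj y y') : IsAdj (x * y) (y' * x') := fun m n => by
  have h1 := hasSum_ent_mul x y m n
  have h2 := (hasSum_ent_mul y' x' n m).map (starRingEnd ℂ) Complex.continuous_conj
  refine h1.unique (h2.congr_fun fun p => ?_)
  rw [Function.comp_apply, map_mul, hx, hy, mul_comm]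

theorem one : IsAdj 1 1 := fun m n => by
  rw [ent_one, ent_one]
  by_cases h : m = n
  · simp [h]
  · simp [h, Ne.symm h]

theorem pow (hx : IsAdj x x') (r : ℕ) : IsAdj (x ^ r) (x' ^ r) := by
  induction r with
  | zero => simpa using one
  | succ r ih => rw [pow_succ, pow_succ']; exact ih.mul hx

theorem neu {R X : Schur} (hR : IsAdj R R) (hX : IsAdj X X) (h : NeuSummable R X) :
    IsAdj (neu R X) (neu R X) := fun m n => by
  have h1 := (ent m n).hasSum h.hasSum
  have h2 := ((ent n m).hasSum h.hasSum).map (starRingEnd ℂ) Complex.continuous_conj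
  refine h1.unique (h2.congr_fun fun r => ?_)
  -- Adjunction reverses the word; moving R to the other end shows that the word is a palindrome.
  have e : (R * X) ^ r * R = R * (X * R) ^ r := by
    induction r with
    | zero => simp
    | succ r ih => rw [pow_succ', mul_assoc, ih, pow_succ']; simp only [mul_assoc]
  have h3 : IsAdj ((-1 : ℂ) ^ r • ((R * X) ^ r * R)) ((-1 : ℂ) ^ r • ((R * X) ^ r * R)) := by
    refine IsAdj.smul ?_ (by simp)
    conv => arg 2; rw [e]
    exact ((hR.mul hX).pow r).mul hR
  exact h3 m n

theorem im_diag (hx : IsAdj x x) (m : Idx) : conj (ent m m x) = ent m m x := (hx m m).symm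

theorem diag {d : Idx → ℂ} {C : ℝ} (h : ∀ m, ‖d m‖ ≤ C) (hd : ∀ m, conj (d m) = d m) :
    IsAdj (diag d) (diag d) := fun m n => by
  rw [ent_diag h, ent_diag h]
  by_cases hmn : m = n
  · rw [if_pos hmn, if_pos hmn.symm, ← hmn, hd]
  · rw [if_neg hmn, if_neg (Ne.symm hmn), map_zero]

theorem toep {w : Idx → ℂ} (h : starNorm w ≠ ∞) (hw : ∀ b, w (-b) = conj (w b)) :
    IsAdj (toep w) (toep w) := fun m n => by
  rw [ent_toep h, ent_toep h, ← hw, neg_sub]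

end IsAdj

namespace ModelData

variable {v : Idx → ℂ} {q j : Idx} {ε : ℝ} {B : Set C2} {s : R2}

theorem conj_psq (m : Idx) (s : R2) : conj (psq m (toC s)) = psq m (toC s) := by
  rw [psq_toC, Complex.conj_ofReal]

theorem conj_psqDiff (q j : Idx) (s : R2) : conj (psqDiff q j (toC s)) = psqDiff q j (toC s) := by
  rw [psqDiff_toC, Complex.conj_ofReal]

theorem conj_twoB (v : Idx → ℂ) (q j : Idx) (s : R2) :
    conj (twoB v q j (toC s)) = twoB v q j (toC s) := by
  rw [twoB_toC, Complex.conj_ofReal]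

theorem conj_lamPlus (v : Idx → ℂ) (q j : Idx) (s : R2) :
    conj (lamPlus v q j (toC s)) = lamPlus v q j (toC s) := by
  rw [lamPlus_eq]
  simp only [map_add, map_sub, map_div₀, conj_psq, conj_psqDiff, conj_twoB, map_ofNat]

theorem isAdj_proj (q j : Idx) : IsAdj (proj q j) (proj q j) := by
  classical
  exact IsAdj.diag (norm_proj_coeff_le q j) fun m => by split_ifs <;> simp

theorem isAdj_ePlus (D : ModelData v q j ε B) (hs : toC s ∈ B) :
    IsAdj (ePlus v q j (toC s)) (ePlus v q j (toC s)) := fun m n => by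
  rw [D.ent_ePlus hs, D.ent_ePlus hs]
  by_cases h : inBlock q j m ∧ inBlock q j n
  · rcases h with ⟨h1 | h1, h2 | h2⟩ <;> rw [h1, h2] <;>
      simp only [D.EPlus_jj, D.EPlus_qq, D.EPlus_jq, D.EPlus_qj, map_div₀, map_add, map_sub, map_mul,
        conj_twoB, conj_psqDiff, map_ofNat, Complex.conj_conj]
  · rw [EPlus_eq_zero h, EPlus_eq_zero fun h' => h h'.symm, map_zero]

theorem isAdj_resOut (D : ModelData v q j ε B) (hs : toC s ∈ B) {x : ℝ} (hx : ‖(x : ℂ)‖ ≤ ε ^ 10) :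
    IsAdj (resOut v q j (toC s) x) (resOut v q j (toC s) x) := by
  classical
  rw [resOut]
  refine IsAdj.diag (D.norm_resOut_coeff_le hs hx) fun m => ?_
  split_ifs
  · exact map_zero _
  · rw [map_inv₀, map_sub, map_sub, conj_psq, conj_lamPlus, Complex.conj_ofReal]

theorem isAdj_resSh (D : ModelData v q j ε B) (hs : toC s ∈ B) {x : ℝ}
    (hx : ‖(x : ℂ)‖ ≤ ε ^ 10 / 2) :
    IsAdj (resSh v q j (toC s) x) (resSh v q j (toC s) x) := by
  refine (((D.isAdj_ePlus hs).smul ?_).add (((isAdj_proj q j).sub (D.isAdj_ePlus hs)).smul ?_)).add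
    (D.isAdj_resOut hs (D.half_le hx))
  · rw [map_inv₀, map_sub, map_one, Complex.conj_ofReal]
  · rw [map_inv₀, map_sub, map_neg, conj_twoB, Complex.conj_ofReal]

theorem isAdj_pot (D : ModelData v q j ε B) {w : Idx → ℂ}
    (hw : starNorm (w - v) ≤ ENNReal.ofReal (9 * ε ^ 11)) (hc : ∀ b, w (-b) = conj (w b)) :
    IsAdj (pot v q j w) (pot v q j w) := by
  have hvf : starNorm v ≠ ∞ := ne_top_of_le_ne_top ENNReal.ofReal_ne_top D.norm_le
  refine (IsAdj.toep (D.potBound hw).1 hc).sub ?_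
  have := ((isAdj_proj q j).mul (IsAdj.toep hvf D.real)).mul (isAdj_proj q j)
  rwa [← mul_assoc] at this

theorem isAdj_neuSh (D : ModelData v q j ε B) (hs : toC s ∈ B) {X : Schur}
    (hX : StrongAdmissible v q j ε X (toC s)) (hXa : IsAdj X X) {α x : ℝ} (hα : ‖(α : ℂ)‖ ≤ 2)
    (hx : ‖(x : ℂ)‖ ≤ ε ^ 10 / 2) :
    IsAdj (neuSh v q j (toC s) X α x) (neuSh v q j (toC s) X α x) :=
  IsAdj.neu (D.isAdj_resSh hs hx) (hXa.smul (Complex.conj_ofReal α).symm) (D.neuSummable_sh hX hα hx)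

/-- For v_q ≠ 0 and real detuning x one has b > |x|, so the eigenvector of the block has a nonzero
component at j. -/
theorem EPlus_jj_pos (D : ModelData v q j ε B) (hv : v q ≠ 0) (s : R2) :
    ∃ p : ℝ, 0 < p ∧ EPlus v q j (toC s) j j = p := by
  set x := ‖momentum j s‖ ^ 2 - ‖momentum (j - q) s‖ ^ 2 with hx
  set b := √(4 * ‖v q‖ ^ 2 + x ^ 2) with hb
  have h1 : |x| < b := by
    rw [hb]
    refine Real.lt_sqrt_of_sq_lt ?_
    have := pow_pos (norm_pos_iff.mpr hv) 2
    rw [sq_abs]; linarith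
  have h2 : 0 < b := (abs_nonneg x).trans_lt h1
  refine ⟨(b + x) / (2 * b), div_pos (by linarith [neg_abs_le x]) (by linarith), ?_⟩
  rw [D.EPlus_jj, twoB_toC, psqDiff_toC, ← hx, ← hb]
  push_cast
  rfl

theorem conj_tau (D : ModelData v q j ε B) (hs : toC s ∈ B) (hv : v q ≠ 0) {x : Schur}
    (hx : IsAdj x x) : conj (tau v q j (toC s) x) = tau v q j (toC s) x := by
  obtain ⟨p, -, hp⟩ := D.EPlus_jj_pos hv s
  have h1 := ((D.isAdj_ePlus hs).mul hx).mul (D.isAdj_ePlus hs)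
  rw [← mul_assoc] at h1
  rw [tau_apply, map_mul, map_inv₀, hp, Complex.conj_ofReal, h1.im_diag]

/-- For real t all ingredients are self-adjoint at real ζ, so `shift` is real there. It maps
[-ε¹⁰/4, ε¹⁰/4] into itself, and the intermediate value theorem applies. -/
theorem exists_real_root (D : ModelData v q j ε B) (hs : toC s ∈ B) (hv : v q ≠ 0) {X : Schur}
    (hX : StrongAdmissible v q j ε X (toC s)) (hXa : IsAdj X X) {α : ℝ} (hα : |α| ≤ 2) :
    ∃ x : ℝ, |x| ≤ ε ^ 10 / 4 ∧ shift v q j (toC s) X α x = x := by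
  have h10 := pow_pos D.pos 10
  have hα' : ‖(α : ℂ)‖ ≤ 2 := by rwa [Complex.norm_real]
  obtain ⟨p, hp0, hp⟩ := D.EPlus_jj_pos hv s
  have hpne : EPlus v q j (toC s) j j ≠ 0 := by rw [hp]; exact_mod_cast hp0.ne'
  set f : ℝ → ℝ := fun x => (shift v q j (toC s) X α x).re - x with hf
  have hnorm : ∀ x : ℝ, x ∈ Set.Icc (-(ε ^ 10 / 4)) (ε ^ 10 / 4) → ‖(x : ℂ)‖ ≤ ε ^ 10 / 4 := fun x hx => by
    rw [Complex.norm_real, Real.norm_eq_abs]; exact abs_le.mpr hx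
  have hc : ContinuousOn f (Set.Icc (-(ε ^ 10 / 4)) (ε ^ 10 / 4)) := by
    have h1 : ContinuousOn (fun x : ℝ => shift v q j (toC s) X α x)
        (Set.Icc (-(ε ^ 10 / 4)) (ε ^ 10 / 4)) :=
      (D.differentiableOn_shift hs hX hα').continuousOn.comp Complex.continuous_ofReal.continuousOn
        fun x hx => mem_ball_zero_iff.mpr (by linarith [hnorm x hx])
    exact (Complex.continuous_re.comp_continuousOn h1).sub continuousOn_id
  have hb : ∀ x : ℝ, x ∈ Set.Icc (-(ε ^ 10 / 4)) (ε ^ 10 / 4) →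
      |(shift v q j (toC s) X α x).re| ≤ ε ^ 10 / 4 := fun x hx => by
    refine (Complex.abs_re_le_norm _).trans ((D.norm_shift_le hs hpne hX hα'
      (by linarith [hnorm x hx])).trans ?_)
    have : ε ^ 11 = ε ^ 10 * ε := by ring
    nlinarith [D.small]
  have hle : -(ε ^ 10 / 4) ≤ ε ^ 10 / 4 := by linarith
  have h1 := hb _ (Set.left_mem_Icc.mpr hle)
  have h2 := hb _ (Set.right_mem_Icc.mpr hle)
  obtain ⟨x, hx, hx0⟩ := intermediate_value_Icc' hle hc
    (show (0 : ℝ) ∈ Set.Icc (f (ε ^ 10 / 4)) (f (-(ε ^ 10 / 4))) from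
      ⟨by simp only [hf]; linarith [(abs_le.mp h2).2], by simp only [hf]; linarith [(abs_le.mp h1).1]⟩)
  refine ⟨x, abs_le.mpr hx, ?_⟩
  have hx2 : ‖(x : ℂ)‖ ≤ ε ^ 10 / 2 := by linarith [hnorm x hx]
  have h3 : conj (shift v q j (toC s) X α x) = shift v q j (toC s) X α x := by
    rw [shift, map_add, map_mul, map_sub, map_sub, map_one, Complex.conj_ofReal,
      D.conj_tau hs hv (D.isAdj_neuSh hs hX hXa hα' hx2)]
  rw [← Complex.conj_eq_iff_re.mp h3]
  exact congrArg _ (by simp only [hf] at hx0; linarith)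

/-- The series for the eigenvalue sums up to the root of the scalar equation. -/
theorem exists_lamW_eq (D : ModelData v q j ε B) (hs : toC s ∈ B) (hv : v q ≠ 0) {w : Idx → ℂ}
    (hw : starNorm (w - v) ≤ ENNReal.ofReal (9 * ε ^ 11)) (hwc : ∀ b, w (-b) = conj (w b)) :
    ∃ x : ℝ, |x| ≤ ε ^ 10 / 4 ∧ shift v q j (toC s) (pot v q j w) 1 x = x ∧
      lamW v q j ε w (toC s) = lamPlus v q j (toC s) + x := by
  have hε := D.pos
  have hε1 := D.small
  have h10 := pow_pos D.pos 10
  have hX := D.strongAdmissible hs hw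
  have hXa := D.isAdj_pot hw hwc
  obtain ⟨p, hp0, hp⟩ := D.EPlus_jj_pos hv s
  have hpne : EPlus v q j (toC s) j j ≠ 0 := by rw [hp]; exact_mod_cast hp0.ne'
  have hex : ∀ α : ℝ, ∃ x : ℝ, |α| ≤ 2 →
      |x| ≤ ε ^ 10 / 4 ∧ shift v q j (toC s) (pot v q j w) α x = x := fun α => by
    by_cases hα : |α| ≤ 2
    · obtain ⟨x, hx⟩ := D.exists_real_root hs hv hX hXa hα
      exact ⟨x, fun _ => hx⟩
    · exact ⟨0, fun h => absurd h hα⟩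
  -- The roots are chosen for each α separately; their continuity and differentiability come from
  -- the Lipschitz estimate. The value for |α| > 2 is irrelevant.
  choose z hz using hex
  let Z : ℝ → ℂ := fun α => z α
  have hZ : ∀ α : ℝ, |α| ≤ 2 → ‖Z α‖ ≤ ε ^ 10 / 4 ∧
      shift v q j (toC s) (pot v q j w) α (Z α) = Z α := fun α hα =>
    ⟨by rw [Complex.norm_real]; exact (hz α hα).1, (hz α hα).2⟩
  let g : ℕ → ℂ → ℂ := fun r c => c ^ (r + 1) * gTerm v q j ε w (r + 1) (toC s)
  let F : ℂ → ℂ := fun c => ∑' r, g r c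
  have hgeo : Summable fun r : ℕ => ε ^ 10 * (520 * ε) ^ (r + 1) :=
    ((summable_nat_add_iff 1).mpr (summable_geometric_of_lt_one (by positivity)
      (by linarith))).mul_left _
  have hgb : ∀ r : ℕ, ∀ c ∈ Metric.ball (0 : ℂ) 2, ‖g r c‖ ≤ ε ^ 10 * (520 * ε) ^ (r + 1) := by
    intro r c hc
    rw [norm_mul, norm_pow]
    have h1 := (mem_ball_zero_iff.mp hc).le
    calc _ ≤ 2 ^ (r + 1) * (ε ^ 10 * (260 * ε) ^ (r + 1)) := by
          gcongr
          exact D.norm_gTerm_le hs hw (r + 1)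
      _ = ε ^ 10 * (2 ^ (r + 1) * (260 * ε) ^ (r + 1)) := by ring
      _ = _ := by rw [← mul_pow]; congr 2; ring
  have hgd : ∀ r, Differentiable ℂ (g r) := fun r => by fun_prop
  have hF : ∀ β : ℝ, |β| < 2 → HasDerivAt (fun α : ℝ => F α)
      (∑' r : ℕ, (β : ℂ) ^ r * (((r + 1 : ℕ) : ℂ) * gTerm v q j ε w (r + 1) (toC s))) β := by
    intro β hβ
    have hβ' : (β : ℂ) ∈ Metric.ball (0 : ℂ) 2 := by
      rw [mem_ball_zero_iff, Complex.norm_real]; exact hβ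
    obtain ⟨ρ, hρ, hball⟩ := Metric.isOpen_iff.mp Metric.isOpen_ball _ hβ'
    have h1 := hasFDerivAt_tsum_of_bounded hgeo hρ (fun r => (hgd r).differentiableOn)
      fun r c hc => hgb r c (hball hc)
    have h2 := summable_fderiv_of_bounded hgeo hρ (fun r => (hgd r).differentiableOn)
      fun r c hc => hgb r c (hball hc)
    have h3 := h1.hasDerivAt.comp_ofReal
    have h4 : (∑' n, fderiv ℂ (g n) (β : ℂ)) 1 = ∑' r : ℕ, (β : ℂ) ^ r *
        (((r + 1 : ℕ) : ℂ) * gTerm v q j ε w (r + 1) (toC s)) := by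
      refine ((ContinuousLinearMap.apply ℂ ℂ (1 : ℂ)).map_tsum h2).trans ?_
      refine tsum_congr fun r => ?_
      rw [ContinuousLinearMap.apply_apply, fderiv_apply_one_eq_deriv]
      have h5 : HasDerivAt (g r) (((r + 1 : ℕ) : ℂ) * (β : ℂ) ^ r *
          gTerm v q j ε w (r + 1) (toC s)) (β : ℂ) := by
        simpa using (hasDerivAt_pow (r + 1) (β : ℂ)).mul_const (gTerm v q j ε w (r + 1) (toC s))
      rw [h5.deriv]; ring
    rwa [h4] at h3
  -- The Feynman–Hellmann step. The root has derivative τ(S X S) / τ(S S), which by the rank one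
  -- form of the projection equals Tr(E_{βX} X), the derivative of the series.
  have hder : ∀ β ∈ Set.Icc (0 : ℝ) 1, HasDerivAt (fun α : ℝ => Z α - F α) 0 β := by
    intro β hβ
    have hβ2 : |β| < 2 := by rw [abs_of_nonneg hβ.1]; linarith [hβ.2]
    have hβ1 : ‖(β : ℂ)‖ ≤ 1 := by
      rw [Complex.norm_real, Real.norm_of_nonneg hβ.1]; exact hβ.2
    have h1 := (D.hasDerivAt_root hs hpne hX hZ hβ2).sub (hF β hβ2)
    rw [← D.tsum_ent_eOp_mul hs hw hβ1, D.eOp_eq_rank_one hs hpne hX (by linarith)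
      (hZ β hβ2.le).1 (hZ β hβ2.le).2] at h1
    simp only [smul_mul_assoc, map_smul, smul_eq_mul] at h1
    rwa [tsum_mul_left, D.tsum_ent_rank_one hs hpne, ← div_eq_inv_mul, sub_self] at h1
  have hconst := constant_of_has_deriv_right_zero
    (fun β hβ => (hder β hβ).continuousAt.continuousWithinAt)
    (fun β hβ => (hder β (Set.Ico_subset_Icc_self hβ)).hasDerivWithinAt) 1 (by norm_num)
  have hZ0 : Z 0 = 0 := by
    obtain ⟨h1, h2⟩ := hZ 0 (by norm_num)
    rw [← h2, D.shift_eq hs hpne hX (by simp) (by linarith)]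
    simp
  have hF0 : F ((0 : ℝ) : ℂ) = 0 := by simp [F, g]
  have hF1 : F ((1 : ℝ) : ℂ) = ∑' r : ℕ, gTerm v q j ε w (r + 1) (toC s) := by simp [F, g]
  rw [hZ0, hF0, hF1, sub_zero, sub_eq_zero] at hconst
  refine ⟨z 1, (hz 1 (by norm_num)).1, by simpa using (hz 1 (by norm_num)).2, ?_⟩
  rw [lamW, ← hconst]

end ModelData

/-! ### Matrices acting on bounded sequences -/

section Action

variable {g : Idx → ℂ} {M : ℝ}

theorem summable_coord_mul (hg : ∀ n, ‖g n‖ ≤ M) (f : L1) :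
    Summable fun n => ‖coord n f * g n‖ := by
  refine Summable.of_nonneg_of_le (fun _ => norm_nonneg _) (fun n => ?_)
    ((L1.hasSum_norm f).summable.mul_right M)
  rw [norm_mul]
  exact mul_le_mul_of_nonneg_left (hg n) (norm_nonneg _)

/-- The functional on `ℓ¹` given by a bounded sequence. -/
def pairing (hg : ∀ n, ‖g n‖ ≤ M) : L1 →L[ℂ] ℂ :=
  LinearMap.mkContinuous
    { toFun := fun f => ∑' n, coord n f * g n
      map_add' := fun f f' => by
        rw [← (summable_coord_mul hg f).of_norm.tsum_add (summable_coord_mul hg f').of_norm]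
        exact tsum_congr fun n => by rw [map_add, add_mul]
      map_smul' := fun a f => by
        rw [RingHom.id_apply, smul_eq_mul, ← tsum_mul_left]
        exact tsum_congr fun n => by rw [map_smul, smul_eq_mul, mul_assoc] } M
    fun f => by
      refine (norm_tsum_le_tsum_norm (summable_coord_mul hg f)).trans ?_
      rw [mul_comm M]
      refine (summable_coord_mul hg f).tsum_le_of_sum_le fun s => ?_
      calc _ ≤ ∑ n ∈ s, ‖coord n f‖ * M := Finset.sum_le_sum fun n _ => by
            rw [norm_mul]; exact mul_le_mul_of_nonneg_left (hg n) (norm_nonneg _)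
        _ = (∑ n ∈ s, ‖coord n f‖) * M := by rw [Finset.sum_mul]
        _ ≤ _ := mul_le_mul_of_nonneg_right (L1.sum_norm_le f s) ((norm_nonneg _).trans (hg 0))

theorem hasSum_pairing (hg : ∀ n, ‖g n‖ ≤ M) (f : L1) :
    HasSum (fun n => coord n f * g n) (pairing hg f) := (summable_coord_mul hg f).of_norm.hasSum

/-- The `m`-th entry of `x g` for a bounded sequence `g`. -/
def act (hg : ∀ n, ‖g n‖ ≤ M) (x : Schur) (m : Idx) : ℂ := pairing hg (x.1.2.unop (unitVec m))

theorem hasSum_act (hg : ∀ n, ‖g n‖ ≤ M) (x : Schur) (m : Idx) :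
    HasSum (fun n => ent m n x * g n) (act hg x m) := by
  refine (hasSum_pairing hg (x.1.2.unop (unitVec m))).congr_fun fun n => ?_
  rw [ent_eq_snd]; rfl

/-- Associativity (x y) g = x (y g) for a bounded sequence g: the pairing with g is continuous on ℓ¹
and the transposes act there. -/
theorem hasSum_act_mul (hg : ∀ n, ‖g n‖ ≤ M) (x y : Schur) (m : Idx) :
    HasSum (fun p => ent m p x * act hg y p) (act hg (x * y) m) := by
  have h1 := ((pairing hg).comp y.1.2.unop).hasSum (hasSum_unitVec (x.1.2.unop (unitVec m)))
  refine h1.congr_fun fun p => ?_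
  rw [map_smul, smul_eq_mul, ent_eq_snd]
  rfl

theorem act_sub (hg : ∀ n, ‖g n‖ ≤ M) (x y : Schur) (m : Idx) :
    act hg (x - y) m = act hg x m - act hg y m := by
  refine (hasSum_act hg (x - y) m).unique
    (((hasSum_act hg x m).sub (hasSum_act hg y m)).congr_fun fun n => ?_)
  rw [map_sub, sub_mul]

theorem act_add (hg : ∀ n, ‖g n‖ ≤ M) (x y : Schur) (m : Idx) :
    act hg (x + y) m = act hg x m + act hg y m := by
  refine (hasSum_act hg (x + y) m).unique
    (((hasSum_act hg x m).add (hasSum_act hg y m)).congr_fun fun n => ?_)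
  rw [map_add, add_mul]

theorem act_smul (hg : ∀ n, ‖g n‖ ≤ M) (a : ℂ) (x : Schur) (m : Idx) :
    act hg (a • x) m = a * act hg x m := by
  refine (hasSum_act hg (a • x) m).unique
    (((hasSum_act hg x m).mul_left a).congr_fun fun n => ?_)
  rw [map_smul, smul_eq_mul, mul_assoc]

theorem act_one (hg : ∀ n, ‖g n‖ ≤ M) (m : Idx) : act hg 1 m = g m := by
  refine (hasSum_act hg 1 m).unique ?_
  have h := hasSum_single (f := fun n => ent m n 1 * g n) m fun n hn => by
    rw [ent_one, if_neg hn.symm, zero_mul]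
  simpa [ent_one] using h

theorem act_eq_zero (hg : ∀ n, ‖g n‖ ≤ M) {x : Schur} {m : Idx} (h : ∀ n, ent m n x = 0) :
    act hg x m = 0 := by
  refine (hasSum_act hg x m).unique ?_
  simp only [h, zero_mul]
  exact hasSum_zero

theorem act_mul_congr (hg : ∀ n, ‖g n‖ ≤ M) {y y' : Schur} (h : ∀ p, act hg y p = act hg y' p)
    (x : Schur) (m : Idx) : act hg (x * y) m = act hg (x * y') m :=
  (hasSum_act_mul hg x y m).unique (by simp only [h]; exact hasSum_act_mul hg x y' m)

end Action

/-! ### The eigenvector -/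

/-- The block of the model operator. -/
def blockOp (v : Idx → ℂ) (q j : Idx) (t : C2) : Schur :=
  lamPlus v q j t • ePlus v q j t + lamMinus v q j t • (proj q j - ePlus v q j t)

namespace ModelData

variable {v : Idx → ℂ} {q j : Idx} {ε : ℝ} {B : Set C2} {t : C2} {X : Schur}

open Classical in
theorem ent_blockOp (D : ModelData v q j ε B) (ht : t ∈ B) (m n : Idx) :
    ent m n (blockOp v q j t) =
      if inBlock q j m ∧ inBlock q j n then freeOp t m n + blockV v q j m n else 0 := by
  have h0 := (D.bounds t ht).twoB_ne_zero D.pos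
  rw [blockOp, map_add, map_smul, map_smul, smul_eq_mul, smul_eq_mul, map_sub, D.ent_ePlus ht,
    ent_proj, EPlus, lamPlus_sub_lamMinus]
  by_cases h : inBlock q j m ∧ inBlock q j n
  · rw [if_pos h, if_pos h]
    have h1 := lamMinus_eq v q j t
    by_cases hmn : m = n
    · rw [if_pos hmn, if_pos ⟨hmn, h.1⟩, h1]
      field_simp; ring
    · rw [if_neg hmn, if_neg fun h' => hmn h'.1, h1]
      field_simp; ring
  · rw [if_neg h, if_neg h, if_neg fun h' : m = n ∧ inBlock q j m => h ⟨h'.2, h'.1 ▸ h'.2⟩]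
    ring

-- The unbounded part of H₀ + W is only the diagonal outside the block. The rest is an element of
-- the algebra, so all manipulations with the eigenvalue equation can be done row by row.
open Classical in
theorem fullOp_eq (D : ModelData v q j ε B) (ht : t ∈ B) {w : Idx → ℂ} (hw : starNorm w ≠ ∞)
    (m n : Idx) : fullOp w t m n = (if n = m then if inBlock q j m then 0 else psq m t else 0) +
      ent m n (blockOp v q j t + pot v q j w) := by
  have hvf : starNorm v ≠ ∞ := ne_top_of_le_ne_top ENNReal.ofReal_ne_top D.norm_le
  rw [map_add, D.ent_blockOp ht, pot, map_sub, ent_toep hw, ent_mul_proj, ent_proj_mul,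
    ent_toep hvf, fullOp, freeOp, blockV]
  by_cases hmn : m = n
  · subst hmn
    by_cases h : inBlock q j m <;> simp [h]
  · have hnm : ¬ n = m := fun h => hmn h.symm
    by_cases h1 : inBlock q j m <;> by_cases h2 : inBlock q j n <;> simp [h1, h2, hmn, hnm]

theorem blockOp_sub (v : Idx → ℂ) (q j : Idx) (t : C2) (ζ : ℂ) :
    blockOp v q j t - (lamPlus v q j t + ζ) • proj q j =
      (-ζ) • ePlus v q j t + (-twoB v q j t - ζ) • (proj q j - ePlus v q j t) := by
  rw [blockOp, lamMinus_eq]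
  module

theorem blockOp_sub_mul_resSh (D : ModelData v q j ε B) (ht : t ∈ B) {ζ : ℂ}
    (hζ : ‖ζ‖ ≤ ε ^ 10 / 2) :
    (blockOp v q j t - (lamPlus v q j t + ζ) • proj q j) * resSh v q j t ζ =
      proj q j - ePlus v q j t * resSh v q j t ζ := by
  have hζ' := D.half_le hζ
  have b1 : -twoB v q j t - ζ ≠ 0 :=
    norm_pos_iff.mp ((pow_pos D.pos 10).trans_le (D.norm_twoB_add_ge ht hζ))
  have a1 := (D.one_sub_ne_zero hζ).2
  rw [blockOp_sub, add_mul, smul_mul_assoc, smul_mul_assoc, sub_mul, resSh,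
    D.ePlus_mul_resGen ht hζ', D.proj_mul_resGen ht hζ', add_sub_cancel_left, smul_smul, smul_smul,
    mul_inv_cancel₀ b1, one_smul]
  have : -ζ * (1 - ζ)⁻¹ = 1 - (1 - ζ)⁻¹ := by field_simp; ring
  rw [this]
  module

theorem resSh_mul_blockOp_add (D : ModelData v q j ε B) (ht : t ∈ B) {ζ : ℂ}
    (hζ : ‖ζ‖ ≤ ε ^ 10 / 2) :
    resSh v q j t ζ * (blockOp v q j t - (lamPlus v q j t + ζ) • proj q j + ePlus v q j t) =
      proj q j := by
  have hζ' := D.half_le hζ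
  have b1 : -twoB v q j t - ζ ≠ 0 :=
    norm_pos_iff.mp ((pow_pos D.pos 10).trans_le (D.norm_twoB_add_ge ht hζ))
  have a1 := (D.one_sub_ne_zero hζ).2
  rw [blockOp_sub, mul_add, mul_add, mul_smul_comm, mul_smul_comm, mul_sub, resSh,
    D.resGen_mul_ePlus ht hζ', D.resGen_mul_proj ht hζ', add_sub_cancel_left, smul_smul, smul_smul,
    mul_inv_cancel₀ b1, one_smul]
  have : -ζ * (1 - ζ)⁻¹ = 1 - (1 - ζ)⁻¹ := by field_simp; ring
  rw [this]
  module

theorem ent_ePlus_mul_eq_zero (D : ModelData v q j ε B) (ht : t ∈ B) {m : Idx}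
    (hm : ¬ inBlock q j m) (x : Schur) (n : Idx) : ent m n (ePlus v q j t * x) = 0 := by
  rw [← D.proj_mul_ePlus ht, mul_assoc, ent_proj_mul, if_neg hm]

theorem blockOp_eq_proj_mul (D : ModelData v q j ε B) (ht : t ∈ B) :
    blockOp v q j t = proj q j * blockOp v q j t := by
  rw [blockOp, mul_add, mul_smul_comm, mul_smul_comm, mul_sub, proj_mul_proj, D.proj_mul_ePlus ht]

theorem ent_blockOp_mul_eq_zero (D : ModelData v q j ε B) (ht : t ∈ B) {m : Idx}
    (hm : ¬ inBlock q j m) (x : Schur) (n : Idx) : ent m n (blockOp v q j t * x) = 0 := by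
  rw [D.blockOp_eq_proj_mul ht, mul_assoc, ent_proj_mul, if_neg hm]

theorem ent_resSh_mul (D : ModelData v q j ε B) (ht : t ∈ B) {ζ : ℂ} (hζ : ‖ζ‖ ≤ ε ^ 10)
    {m : Idx} (hm : ¬ inBlock q j m) (x : Schur) (n : Idx) :
    (psq m t - (lamPlus v q j t + ζ)) * ent m n (resSh v q j t ζ * x) = ent m n x := by
  classical
  have h1 : ent m n (resSh v q j t ζ * x) = ent m n (resOut v q j t ζ * x) := by
    rw [← D.compl_mul_resGen ht hζ (1 - ζ)⁻¹, mul_assoc, sub_mul, one_mul, map_sub, ent_proj_mul,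
      if_neg hm, sub_zero, resSh]
  have h0 : psq m t - lamPlus v q j t - ζ ≠ 0 := norm_pos_iff.mp
    (lt_of_lt_of_le (pow_pos D.pos 6) ((D.bounds t ht).gap m hm ζ hζ))
  rw [h1, resOut, ent_diag_mul (D.norm_resOut_coeff_le ht hζ), if_neg hm, ← sub_sub,
    mul_inv_cancel_left₀ h0]

/-- The `j`-th column of `neuSh * Ê⁺` is an eigenvector. -/
theorem ent_eigen (D : ModelData v q j ε B) (ht : t ∈ B) (hp : EPlus v q j t j j ≠ 0)
    (hX : StrongAdmissible v q j ε X t) {ζ : ℂ} (hζ : ‖ζ‖ ≤ ε ^ 10 / 4)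
    (hr : shift v q j t X 1 ζ = ζ) (m n : Idx) :
    open Classical in
    (if inBlock q j m then 0 else psq m t) * ent m n (neuSh v q j t X 1 ζ * ePlus v q j t) +
      ent m n ((blockOp v q j t + X) * (neuSh v q j t X 1 ζ * ePlus v q j t)) =
      (lamPlus v q j t + ζ) * ent m n (neuSh v q j t X 1 ζ * ePlus v q j t) := by
  have hζ2 : ‖ζ‖ ≤ ε ^ 10 / 2 := by linarith [pow_pos D.pos 10]
  have hζ1 := D.half_le hζ2
  set S := neuSh v q j t X 1 ζ with hS
  set E := ePlus v q j t
  set R := resSh v q j t ζ with hR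
  have e1 : S = R - R * X * S := by
    have := neu_eq_left (D.neuSummable_sh hX (α := 1) (by simp) hζ2)
    rw [one_smul] at this
    rw [hS, neuSh, one_smul]
    exact this
  -- The root condition enters here. With Y = S Ê⁺ it gives Ê⁺ Y = Ê⁺, so the Ê⁺ added to the
  -- operator cancels and Y solves the equation for Ĥ_q + X itself.
  have hESE : E * (S * E) = E := by
    rw [← mul_assoc, D.ePlus_mul_mul_ePlus ht hp, D.tau_of_root hζ hr, one_smul]
  set Y := S * E with hY
  have hYR : Y = R * (E - X * Y) := by
    rw [hY]
    conv_lhs => rw [e1]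
    noncomm_ring
  by_cases hm : inBlock q j m
  · have h1 : (blockOp v q j t - (lamPlus v q j t + ζ) • proj q j) * Y = -(proj q j * (X * Y)) := by
      conv_lhs => rw [hYR, ← mul_assoc, D.blockOp_sub_mul_resSh ht hζ2, sub_mul, mul_assoc E,
        ← hYR, hESE, mul_sub, D.proj_mul_ePlus ht]
      abel
    have h2 := congrArg (ent m n) h1
    rw [sub_mul, map_sub, smul_mul_assoc, map_smul, map_neg, ent_proj_mul, ent_proj_mul, if_pos hm,
      if_pos hm, smul_eq_mul] at h2
    rw [if_pos hm, add_mul, map_add]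
    linear_combination h2
  · have h1 := D.ent_resSh_mul ht hζ1 hm (E - X * Y) n
    have h2 := D.ent_ePlus_mul_eq_zero ht hm 1 n
    rw [mul_one] at h2
    rw [← hR, ← hYR, map_sub, h2] at h1
    rw [if_neg hm, add_mul, map_add, D.ent_blockOp_mul_eq_zero ht hm]
    linear_combination h1

theorem hasSum_fullOp (D : ModelData v q j ε B) (ht : t ∈ B) {w : Idx → ℂ} (hw : starNorm w ≠ ∞)
    {g : Idx → ℂ} {m : Idx} {b : ℂ}
    (hb : HasSum (fun n => ent m n (blockOp v q j t + pot v q j w) * g n) b) :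
    open Classical in
    HasSum (fun n => fullOp w t m n * g n) ((if inBlock q j m then 0 else psq m t) * g m + b) := by
  classical
  have h1 := (hasSum_ite_eq m ((if inBlock q j m then 0 else psq m t) * g m)).add hb
  refine h1.congr_fun fun n => ?_
  rw [D.fullOp_eq ht hw]
  by_cases hn : n = m
  · rw [if_pos hn, if_pos hn, hn]; ring
  · rw [if_neg hn, if_neg hn]; ring

/-- Every bounded solution of the eigenvalue equation is a multiple of the eigenvector. -/
theorem eq_mul_of_eigen (D : ModelData v q j ε B) (ht : t ∈ B) (hp : EPlus v q j t j j ≠ 0)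
    {w : Idx → ℂ} (hw : starNorm (w - v) ≤ ENNReal.ofReal (9 * ε ^ 11)) {ζ : ℂ}
    (hζ : ‖ζ‖ ≤ ε ^ 10 / 2) {g : Idx → ℂ} {M : ℝ} (hg : ∀ n, ‖g n‖ ≤ M)
    (h : ∀ m, HasSum (fun n => fullOp w t m n * g n) ((lamPlus v q j t + ζ) * g m)) (m : Idx) :
    g m = (EPlus v q j t j j)⁻¹ * act hg (ePlus v q j t) j *
      ent m j (neuSh v q j t (pot v q j w) 1 ζ * ePlus v q j t) := by
  classical
  have hζ1 := D.half_le hζ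
  have hX := D.strongAdmissible ht hw
  have hwf := (D.potBound hw).1
  set X := pot v q j w
  set S := neuSh v q j t X 1 ζ with hS
  set E := ePlus v q j t
  set R := resSh v q j t ζ with hR
  set L := lamPlus v q j t + ζ with hL
  have e1 : S = R - S * X * R := by
    have := neu_eq_right (D.neuSummable_sh hX (α := 1) (by simp) hζ)
    rw [one_smul] at this
    rw [hS, neuSh, one_smul]
    exact this
  have heq : ∀ m, (if inBlock q j m then 0 else psq m t) * g m +
      act hg (blockOp v q j t + X) m = L * g m := fun m =>
    (D.hasSum_fullOp ht hwf (hasSum_act hg _ m)).unique (h m)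
  -- This is the equation (Ĥ_q + Ê⁺ + X - L) g = Ê⁺ g after multiplication by R. Rows in the block
  -- use the algebra; in the other rows R is division by p_m² - L.
  have hfix : ∀ m, act hg 1 m = act hg (R * (E - X)) m := by
    intro m
    by_cases hm : inBlock q j m
    · have h1 : act hg (R * (blockOp v q j t - L • proj q j + X)) m = 0 := by
        refine (hasSum_act_mul hg _ _ m).unique ?_
        refine hasSum_zero.congr_fun fun p => ?_
        by_cases hpb : inBlock q j p
        · have h2 := heq p
          rw [if_pos hpb, zero_mul, zero_add, act_add] at h2
          have h3 : act hg (proj q j) p = g p := by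
            rw [← act_one hg p]
            refine (hasSum_act hg _ p).unique ((hasSum_act hg 1 p).congr_fun fun n => ?_)
            rw [← mul_one (proj q j), ent_proj_mul, if_pos hpb]
          rw [act_add, act_sub, act_smul, h3, ← h2]
          ring
        · have h2 : ent m p R = 0 := by
            have h3 : ent m p (proj q j * R) = ent m p (R * proj q j) := by
              rw [hR, resSh, D.proj_mul_resGen ht hζ1, D.resGen_mul_proj ht hζ1]
            rwa [ent_proj_mul, ent_mul_proj, if_pos hm, if_neg hpb] at h3
          rw [h2, zero_mul]
      have h2 : R * (blockOp v q j t - L • proj q j + X) = proj q j - R * (E - X) := by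
        have h3 : R * (blockOp v q j t - L • proj q j + E) = proj q j :=
          D.resSh_mul_blockOp_add ht hζ
        conv_rhs => rw [← h3, ← mul_sub]
        congr 1
        abel
      have h3 : act hg (proj q j) m = act hg 1 m := by
        refine (hasSum_act hg _ m).unique ((hasSum_act hg 1 m).congr_fun fun n => ?_)
        rw [← mul_one (proj q j), ent_proj_mul, if_pos hm]
      rw [h2, act_sub, h3, sub_eq_zero] at h1
      exact h1
    · have h0 : psq m t - L ≠ 0 := by
        rw [hL, ← sub_sub]
        exact norm_pos_iff.mp
          (lt_of_lt_of_le (pow_pos D.pos 6) ((D.bounds t ht).gap m hm ζ hζ1))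
      have h1 : (psq m t - L) * act hg (R * (E - X)) m = act hg (E - X) m := by
        rw [← act_smul]
        refine (hasSum_act hg _ m).unique ((hasSum_act hg _ m).congr_fun fun n => ?_)
        rw [map_smul, smul_eq_mul, D.ent_resSh_mul ht hζ1 hm]
      have h2 : act hg E m = 0 := act_eq_zero hg fun n => by
        have := D.ent_ePlus_mul_eq_zero ht hm 1 n
        rwa [mul_one] at this
      have h3 : act hg (blockOp v q j t) m = 0 := act_eq_zero hg fun n => by
        have := D.ent_blockOp_mul_eq_zero ht hm 1 n
        rwa [mul_one] at this
      have h4 := heq m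
      rw [if_neg hm, act_add, h3, zero_add] at h4
      rw [act_sub, h2] at h1
      rw [act_one]
      refine mul_left_cancel₀ h0 ?_
      rw [h1]
      linear_combination h4
  -- The factor 1 - S X turns R into S and yields g = S Ê⁺ g, whose right side runs through a rank
  -- one matrix.
  have h1 := act_mul_congr hg hfix (1 - S * X) m
  have h2 : (1 - S * X) * (R * (E - X)) = S * E - S * X := by
    have : (1 - S * X) * R = S := by rw [sub_mul, one_mul]; exact e1.symm
    rw [← mul_assoc, this, mul_sub]
  rw [mul_one, h2, act_sub, act_sub, act_one, sub_left_inj] at h1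
  rw [h1]
  have h4 := (hasSum_act hg E j).mul_left ((EPlus v q j t j j)⁻¹ * ent m j (S * E))
  rw [mul_right_comm]
  refine (hasSum_act hg _ m).unique (h4.congr_fun fun n => ?_)
  have h3 := D.ent_mul_ePlus_mul ht hp S 1 m n
  rw [mul_one, mul_one] at h3
  rw [h3]; ring

/-- The eigenvector is the j-th column φ of S Ê⁺. Since S and Ê⁺ are self-adjoint, the rank one form
of the projection is φ φ* up to a scalar, and the scalar is 1/‖φ‖². An ℓ² solution is bounded, so
the uniqueness statement applies to it. -/
theorem isSimpleSpectralProjection (D : ModelData v q j ε B) {s : R2} (hs : toC s ∈ B)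
    (hv : v q ≠ 0) {w : Idx → ℂ} (hw : starNorm (w - v) ≤ ENNReal.ofReal (9 * ε ^ 11))
    (hwc : ∀ b, w (-b) = conj (w b)) :
    ∃ L : ℝ, lamW v q j ε w (toC s) = L ∧
      IsSimpleSpectralProjection (fullOp w (toC s)) (EW v q j ε w (toC s)) L := by
  obtain ⟨x, hx, hr, hlam⟩ := D.exists_lamW_eq hs hv hw hwc
  obtain ⟨p, hp0, hp⟩ := D.EPlus_jj_pos hv s
  have hpne : EPlus v q j (toC s) j j ≠ 0 := by rw [hp]; exact_mod_cast hp0.ne'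
  have hX := D.strongAdmissible hs hw
  have hXa := D.isAdj_pot hw hwc
  have hwf := (D.potBound hw).1
  have hx4 : ‖(x : ℂ)‖ ≤ ε ^ 10 / 4 := by rwa [Complex.norm_real]
  have hx2 : ‖(x : ℂ)‖ ≤ ε ^ 10 / 2 := by linarith [pow_pos D.pos 10]
  set t := toC s with ht
  set S := neuSh v q j t (pot v q j w) 1 x with hS
  set E := ePlus v q j t with hE
  have hSa : IsAdj S S := by
    have := D.isAdj_neuSh hs hX hXa (α := 1) (x := x) (by simp) hx2
    rwa [Complex.ofReal_one] at this
  have hEa : IsAdj E E := D.isAdj_ePlus hs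
  have hadj : IsAdj (E * S) (S * E) := hEa.mul hSa
  have hLre : lamPlus v q j t = ((lamPlus v q j t).re : ℂ) :=
    (Complex.conj_eq_iff_re.mp (conj_lamPlus v q j s)).symm
  set L : ℝ := (lamPlus v q j t).re + x with hLdef
  have hL : (L : ℂ) = lamPlus v q j t + x := by rw [hLdef, Complex.ofReal_add, ← hLre]
  have heig := D.ent_eigen hs hpne hX hx4 hr
  have hEW := fun m n => D.EW_eq hs hw m n
  have hrank := D.eOp_eq_rank_one hs hpne hX (α := 1) (by simp) hx4 hr
  rw [one_smul] at hrank
  set T := tau v q j t (S * S) with hT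
  have hTne : T ≠ 0 := norm_pos_iff.mp (lt_of_lt_of_le (by norm_num)
    (D.quarter_le_norm_tau hs hpne hX (α := 1) (by simp) hx4 hx4 hr))
  set φ : Idx → ℂ := fun m => ent m j (S * E) with hφ
  -- The norm ‖φ‖² is the entry (j, j) of Ê⁺ S S Ê⁺, that is, p τ(S S). Hence this number is real
  -- and, since τ(S S) ≠ 0, positive.
  have hsum : HasSum (fun m => ((‖φ m‖ ^ 2 : ℝ) : ℂ)) (p * T) := by
    have h1 := hasSum_ent_mul (E * S) (S * E) j j
    have h2 : ent j j (E * S * (S * E)) = p * T := by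
      rw [hT, tau_apply, hp, mul_inv_cancel_left₀ (by exact_mod_cast hp0.ne')]
      simp only [mul_assoc, hE]
    rw [h2] at h1
    refine h1.congr_fun fun m => ?_
    rw [hadj j m, Complex.ofReal_pow, ← Complex.conj_mul']
  have hN : HasSum (fun m => ‖φ m‖ ^ 2) (p * T).re := by
    have := Complex.hasSum_re hsum
    simpa only [Complex.ofReal_re] using this
  have hNT : ((p * T).re : ℂ) = p * T := by
    have := (Complex.hasSum_ofReal.mpr hN).unique hsum
    exact this
  set N := (p * T).re with hNdef
  have hN0 : 0 < N := by
    have h1 : 0 ≤ N := hN.nonneg fun _ => by positivity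
    refine lt_of_le_of_ne h1 fun h => ?_
    rw [← h, Complex.ofReal_zero] at hNT
    exact mul_ne_zero (by exact_mod_cast hp0.ne') hTne hNT.symm
  have hsqrt : (√N : ℂ) ≠ 0 := by exact_mod_cast (Real.sqrt_pos.mpr hN0).ne'
  have hsq : (√N : ℂ) * √N = N := by
    rw [← Complex.ofReal_mul, Real.mul_self_sqrt hN0.le]
  refine ⟨L, by rw [hlam, hL], fun m => (√N : ℂ)⁻¹ * φ m, ?_, fun m n => ?_, fun g hg => ?_⟩
  · have h1 := hN.mul_left N⁻¹
    rw [inv_mul_cancel₀ hN0.ne'] at h1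
    refine h1.congr_fun fun m => ?_
    rw [norm_mul, norm_inv, Complex.norm_real, Real.norm_of_nonneg (Real.sqrt_nonneg _), mul_pow,
      inv_pow, Real.sq_sqrt hN0.le]
  · rw [hEW, hrank, map_smul, smul_eq_mul, D.ent_mul_ePlus_mul hs hpne, hadj j n, hp]
    beta_reduce
    rw [map_mul (starRingEnd ℂ), map_inv₀, Complex.conj_ofReal]
    have hp' : (p : ℂ) ≠ 0 := by exact_mod_cast hp0.ne'
    calc _ = (p * T)⁻¹ * (φ m * conj (φ n)) := by rw [mul_inv]; ring
      _ = ((√N : ℂ) * √N)⁻¹ * (φ m * conj (φ n)) := by rw [hsq, hNT]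
      _ = _ := by rw [mul_inv]; ring
  · have hφe : ∀ m, HasSum (fun n => fullOp w t m n * φ n) (L * φ m) := by
      intro m
      have h1 := D.hasSum_fullOp hs hwf
        (hasSum_ent_mul (blockOp v q j t + pot v q j w) (S * E) m j)
      rw [heig m j, ← hL] at h1
      exact h1
    constructor
    · intro h
      have hgb : ∀ n, ‖g n‖ ≤ √(∑' m, ‖g m‖ ^ 2) := fun n =>
        Real.le_sqrt_of_sq_le (hg.le_tsum n fun _ _ => by positivity)
      have h1 := D.eq_mul_of_eigen hs hpne hw hx2 hgb (by simpa only [← hL] using h)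
      refine ⟨(EPlus v q j t j j)⁻¹ * act hgb E j * √N, fun m => ?_⟩
      rw [h1 m, mul_assoc _ (√N : ℂ), mul_inv_cancel_left₀ hsqrt]
    · rintro ⟨a, ha⟩ m
      have h1 := (hφe m).mul_left (a * (√N : ℂ)⁻¹)
      rw [ha m]
      have e : (L : ℂ) * (a * ((√N : ℂ)⁻¹ * φ m)) = a * (√N : ℂ)⁻¹ * (L * φ m) := by ring
      rw [e]
      refine h1.congr_fun fun n => ?_
      rw [ha n]; ring

end ModelData

/-! ### Gradients of the series -/

/-- The gradient as a linear function of the derivative. -/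
def gradOf : (C2 →L[ℂ] ℂ) →L[ℂ] C2 :=
  LinearMap.mkContinuous
    { toFun := fun L => WithLp.toLp 2 fun i => L (EuclideanSpace.single i 1)
      map_add' := fun _ _ => rfl
      map_smul' := fun _ _ => rfl } 2 fun L => by
    have h : ∀ i : Fin 2, ‖L (EuclideanSpace.single i 1)‖ ≤ ‖L‖ := fun i => by
      simpa using L.le_opNorm (EuclideanSpace.single i 1)
    refine (norm_C2_le _).trans ?_
    change ‖L (EuclideanSpace.single 0 1)‖ + ‖L (EuclideanSpace.single 1 1)‖ ≤ 2 * ‖L‖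
    linarith [h 0, h 1]

theorem grad_eq (f : C2 → ℂ) (t : C2) : grad f t = gradOf (fderiv ℂ f t) := rfl

theorem norm_grad_le (f : C2 → ℂ) (t : C2) : ‖grad f t‖ ≤ 2 * ‖fderiv ℂ f t‖ :=
  gradOf.le_of_opNorm_le (LinearMap.mkContinuous_norm_le _ (by norm_num) _) _

theorem norm_grad_le_of_bounded {f : C2 → ℂ} {t : C2} {ρ M : ℝ} (hρ : 0 < ρ)
    (hf : DifferentiableOn ℂ f (Metric.ball t ρ)) (hM : ∀ s ∈ Metric.ball t ρ, ‖f s‖ ≤ M) :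
    ‖grad f t‖ ≤ 8 * M / ρ := by
  have := norm_fderiv_le_of_bounded hρ hf hM
  calc _ ≤ 2 * ‖fderiv ℂ f t‖ := norm_grad_le f t
    _ ≤ 2 * (4 * M / ρ) := by linarith
    _ = 8 * M / ρ := by ring

theorem norm0_matGrad_le_of_bounded {T : C2 → Mat ℂ} {G : C2 → Schur} {t : C2} {ρ M : ℝ}
    (hρ : 0 < ρ) (hG : DifferentiableOn ℂ G (Metric.ball t ρ))
    (hM : ∀ s ∈ Metric.ball t ρ, ‖G s‖ ≤ M)
    (hT : ∀ s ∈ Metric.ball t ρ, ∀ m n, T s m n = ent m n (G s)) :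
    norm0 (matGrad T t) ≤ ENNReal.ofReal (8 * M / ρ) := by
  have h0 := Metric.ball_mem_nhds t hρ
  refine (norm0_matGrad_le (hG.differentiableAt h0)
    (Filter.mem_of_superset h0 hT)).trans (ENNReal.ofReal_le_ofReal ?_)
  have := norm_fderiv_le_of_bounded hρ hG hM
  calc _ ≤ 2 * (4 * M / ρ) := by linarith
    _ = 8 * M / ρ := by ring

/-! ### The gradient of the model eigenvalue -/

theorem fderiv_psq (m : Idx) (t : C2) (i : Fin 2) :
    fderiv ℂ (psq m) t (EuclideanSpace.single i 1) = 2 * ((m i : ℂ) + t i) := by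
  have h : HasFDerivAt (fun t : C2 => ∑ i, ((m i : ℂ) + t i) ^ 2)
      (∑ i, (2 * ((m i : ℂ) + t i)) • (EuclideanSpace.proj i : C2 →L[ℂ] ℂ)) t := by
    refine HasFDerivAt.fun_sum fun i _ => ?_
    have := ((EuclideanSpace.proj i : C2 →L[ℂ] ℂ).hasFDerivAt (x := t)).const_add (m i : ℂ)
    simpa [mul_add] using this.pow 2
  have e : fderiv ℂ (psq m) t = _ := h.fderiv
  rw [e]
  fin_cases i <;> simp [Fin.sum_univ_two]

theorem fderiv_psqDiff (q j : Idx) (t : C2) (i : Fin 2) :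
    fderiv ℂ (psqDiff q j) t (EuclideanSpace.single i 1) = 2 * (q i : ℂ) := by
  have e : fderiv ℂ (psqDiff q j) t = fderiv ℂ (psq j) t - fderiv ℂ (psq (j - q)) t :=
    ((differentiable_psq j t).hasFDerivAt.sub (differentiable_psq (j - q) t).hasFDerivAt).fderiv
  rw [e, sub_apply, fderiv_psq, fderiv_psq, Pi.sub_apply, Int.cast_sub]
  ring

section

variable {v : Idx → ℂ} {q j : Idx} {ε : ℝ} {t : C2}

/-- Differentiate the square: 2b · ∂ᵢ(2b) equals the detuning times 2qᵢ, and the detuning is at most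
|2b|. No inverse power of ε appears. -/
theorem ModelBounds.norm_fderiv_twoB_le (h : ModelBounds v q j ε t) (hε : 0 < ε) (i : Fin 2) :
    ‖fderiv ℂ (twoB v q j) t (EuclideanSpace.single i 1)‖ ≤ 2 * |(q i : ℝ)| := by
  have h0 := h.twoB_ne_zero hε
  have h1 := h.differentiableAt_twoB.hasFDerivAt.pow 2
  have h2 := ((differentiable_psqDiff q j t).hasFDerivAt.pow 2).const_add (4 * (‖v q‖ : ℂ) ^ 2)
  have e : (fun s => twoB v q j s ^ 2) = fun s => 4 * (‖v q‖ : ℂ) ^ 2 + psqDiff q j s ^ 2 :=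
    funext fun s => ModelData.sq_twoB
  have h3 := congrArg (fun L : C2 →L[ℂ] ℂ => L (EuclideanSpace.single i 1))
    ((e ▸ h1).unique h2)
  simp only [smul_apply, fderiv_psqDiff, smul_eq_mul, nsmul_eq_mul] at h3
  have h4 : ‖twoB v q j t‖ * ‖fderiv ℂ (twoB v q j) t (EuclideanSpace.single i 1)‖ =
      ‖psqDiff q j t‖ * (2 * |(q i : ℝ)|) := by
    rw [← norm_mul, ← Complex.norm_intCast, ← Complex.norm_two, ← norm_mul, ← norm_mul]
    congr 1
    simp only [Nat.cast_ofNat, Nat.add_one_sub_one, pow_one] at h3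
    linear_combination h3 / 2
  have hp : 0 < ‖twoB v q j t‖ := norm_pos_iff.mpr h0
  refine le_of_mul_le_mul_left ?_ hp
  rw [h4]
  exact mul_le_mul_of_nonneg_right h.diff_le (by positivity)

/-- The gradient of p_j² is 2 P_j(t); the remainder of λ̂⁺ depends on t only through the detuning,
whose gradient is 2q. -/
theorem ModelBounds.norm_grad_lamPlus_sub_le (h : ModelBounds v q j ε t) (hε : 0 < ε) :
    ‖grad (lamPlus v q j) t - WithLp.toLp 2 fun i => 2 * ((j i : ℂ) + t i)‖ ≤ 2 * len q := by
  have e : fderiv ℂ (lamPlus v q j) t = fderiv ℂ (psq j) t +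
      (2 : ℂ)⁻¹ • (fderiv ℂ (twoB v q j) t - fderiv ℂ (psqDiff q j) t) := by
    have h1 := (differentiable_psq j t).hasFDerivAt.add
      ((h.differentiableAt_twoB.hasFDerivAt.sub
        (differentiable_psqDiff q j t).hasFDerivAt).const_smul (2 : ℂ)⁻¹)
    refine (h1.congr_of_eventuallyEq (Filter.Eventually.of_forall fun s => ?_)).fderiv
    rw [lamPlus_eq]
    simp only [Pi.add_apply, Pi.smul_apply, Pi.sub_apply, smul_eq_mul]
    ring
  have key : ∀ i : Fin 2,
      ‖(grad (lamPlus v q j) t - WithLp.toLp 2 fun i => 2 * ((j i : ℂ) + t i) : C2) i‖ ≤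
        2 * |(q i : ℝ)| := fun i => by
    have e2 : (grad (lamPlus v q j) t - WithLp.toLp 2 fun i => 2 * ((j i : ℂ) + t i) : C2) i =
        (2 : ℂ)⁻¹ * (fderiv ℂ (twoB v q j) t (EuclideanSpace.single i 1) - 2 * (q i : ℂ)) := by
      change fderiv ℂ (lamPlus v q j) t (EuclideanSpace.single i 1) - 2 * ((j i : ℂ) + t i) = _
      rw [e]
      simp only [add_apply, smul_apply,
        sub_apply, fderiv_psq, fderiv_psqDiff, smul_eq_mul]
      ring
    rw [e2, norm_mul]
    have h1 := norm_sub_le (fderiv ℂ (twoB v q j) t (EuclideanSpace.single i 1)) (2 * (q i : ℂ))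
    have h2 := h.norm_fderiv_twoB_le hε i
    have h3 : ‖2 * (q i : ℂ)‖ = 2 * |(q i : ℝ)| := by
      rw [norm_mul, Complex.norm_intCast, Complex.norm_two]
    rw [norm_inv, Complex.norm_two]
    linarith
  refine (norm_C2_le _).trans ?_
  rw [len]
  linarith [key 0, key 1]

end

/-! ### Geometry of the neighbourhoods of quasimomenta -/

theorem toC_sub (s s' : R2) : toC (s - s') = toC s - toC s' := by
  ext i; simp [toC]

theorem norm_toC (s : R2) : ‖toC s‖ = ‖s‖ := by
  simp [EuclideanSpace.norm_eq, toC]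

theorem abs_norm_two_momentum_sub_le (j : Idx) (t₀ : R2) (t : C2) :
    |‖(WithLp.toLp 2 fun i => 2 * ((j i : ℂ) + t i) : C2)‖ - 2 * ‖momentum j t₀‖| ≤
      2 * ‖t - toC t₀‖ := by
  have h2 : ∀ x : C2, ‖(2 : ℂ) • x‖ = 2 * ‖x‖ := fun x => by rw [norm_smul, Complex.norm_two]
  rw [← norm_toC, ← h2, ← h2]
  refine (abs_norm_sub_norm_le _ _).trans_eq ?_
  congr 1
  ext i
  simp [toC, momentum]
  ring

/-- The radii add up to at most (1/2 + 1 + 1/8) k⁻¹ε⁷. The radius k⁻¹ε⁷/2 is the one on which all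
final Cauchy estimates are made. -/
theorem ball_subset_of_mem_nbhd {k ε : ℝ} (hk : 0 < k) (hε : 0 < ε) (hε1 : ε ≤ 1) {t₀ : R2} {t : C2}
    (ht : t ∈ nbhd k ε t₀) :
    Metric.ball t (k⁻¹ * ε ^ 7 / 2) ⊆ Metric.ball (toC t₀) (2 * k⁻¹ * ε ^ 7) := by
  obtain ⟨s, hs, hts⟩ := ht
  refine Metric.ball_subset_ball' ?_
  have h1 := dist_triangle t (toC s) (toC t₀)
  rw [dist_eq_norm t (toC s), dist_eq_norm (toC s) (toC t₀), ← toC_sub, norm_toC] at h1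
  have h2 : k⁻¹ * ε ^ 10 ≤ k⁻¹ * ε ^ 7 :=
    mul_le_mul_of_nonneg_left (pow_le_pow_of_le_one hε.le hε1 (by norm_num)) (inv_pos.mpr hk).le
  have h3 : 0 < k⁻¹ * ε ^ 7 := by positivity
  linarith

/-! ### Termwise differentiation -/

namespace ModelData

variable {v : Idx → ℂ} {q j : Idx} {ε : ℝ} {B : Set C2} {t : C2} {w : C2 → Idx → ℂ} {ρ : ℝ}

theorem tendsto_norm0_EW (D : ModelData v q j ε B) (ht : t ∈ B) {w : Idx → ℂ}
    (hw : starNorm (w - v) ≤ ENNReal.ofReal (9 * ε ^ 11)) :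
    Filter.Tendsto (fun N : ℕ => norm0 fun m n => EW v q j ε w t m n - EPlus v q j t m n -
      ∑ r ∈ Finset.range N, GTerm v q j ε w (r + 1) t m n) Filter.atTop (𝓝 0) := by
  have hX := D.admissible_pot ht hw
  have hlim := ((D.summable_gOp hX).hasSum.tendsto_sum_nat.const_sub
    (eOp v q j ε (pot v q j w) t - ePlus v q j t)).norm
  rw [eOp, add_sub_cancel_left, sub_self, norm_zero] at hlim
  have hlim' := ENNReal.tendsto_ofReal hlim
  rw [ENNReal.ofReal_zero] at hlim'
  refine tendsto_of_tendsto_of_tendsto_of_le_of_le tendsto_const_nhds hlim'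
    (fun _ => zero_le) fun N => ?_
  refine le_of_eq_of_le ?_ (norm0_ent_le _)
  congr 1
  funext m n
  rw [D.EW_eq ht hw, ← D.ent_ePlus ht, eOp, map_sub, map_add, map_sum, add_sub_cancel_left]
  simp only [D.GTerm_eq ht (D.potBound hw).1]

theorem hasFDerivAt_lamW (D : ModelData v q j ε B) (hw : PotFamily v ε B w) (hρ : 0 < ρ)
    (hball : Metric.ball t ρ ⊆ B) :
    HasFDerivAt (fun s => lamW v q j ε (w s) s) (fderiv ℂ (lamPlus v q j) t +
      ∑' r : ℕ, fderiv ℂ (fun s => gTerm v q j ε (w s) (r + 1) s) t) t :=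
  (D.bounds t (hball (Metric.mem_ball_self hρ))).differentiableAt_lamPlus.hasFDerivAt.add
    (hasFDerivAt_tsum_of_bounded (D.hasSum_ratio (ε ^ 10)).summable hρ
      (fun r => (D.differentiableOn_gTerm hw (r + 1)).mono hball)
      fun r s hs => D.norm_gTerm_le (hball hs) (hw.close s (hball hs)) (r + 1))

theorem hasSum_grad_gTerm (D : ModelData v q j ε B) (hw : PotFamily v ε B w) (hρ : 0 < ρ)
    (hball : Metric.ball t ρ ⊆ B) :
    HasSum (fun r : ℕ => grad (fun s => gTerm v q j ε (w s) (r + 1) s) t)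
      (grad (fun s => lamW v q j ε (w s) s) t - grad (lamPlus v q j) t) := by
  have h := gradOf.hasSum (summable_fderiv_of_bounded (D.hasSum_ratio (ε ^ 10)).summable hρ
      (fun r => (D.differentiableOn_gTerm hw (r + 1)).mono hball)
      fun r s hs => D.norm_gTerm_le (hball hs) (hw.close s (hball hs)) (r + 1)).hasSum
  rw [grad_eq _ t, grad_eq _ t, (D.hasFDerivAt_lamW hw hρ hball).fderiv, map_add,
    add_sub_cancel_left]
  exact h

theorem norm_grad_gTerm_le (D : ModelData v q j ε B) (hw : PotFamily v ε B w) (hρ : 0 < ρ)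
    (hball : Metric.ball t ρ ⊆ B) (r : ℕ) :
    ‖grad (fun s => gTerm v q j ε (w s) r s) t‖ ≤ 8 * (ε ^ 10 * (260 * ε) ^ r) / ρ :=
  norm_grad_le_of_bounded hρ ((D.differentiableOn_gTerm hw r).mono hball)
    fun s hs => D.norm_gTerm_le (hball hs) (hw.close s (hball hs)) r

theorem norm_grad_lamW_sub_le (D : ModelData v q j ε B) (hw : PotFamily v ε B w) (hρ : 0 < ρ)
    (hball : Metric.ball t ρ ⊆ B) :
    ‖grad (fun s => lamW v q j ε (w s) s - lamPlus v q j s) t‖ ≤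
      8 * (ε ^ 10 * (300 * ε)) / ρ := by
  refine norm_grad_le_of_bounded hρ (fun s hs => ?_) fun s hs => ?_
  · obtain ⟨ρ', hρ', hball'⟩ := Metric.isOpen_iff.mp D.isOpen s (hball hs)
    exact ((D.hasFDerivAt_lamW hw hρ' hball').differentiableAt.sub
      (D.bounds s (hball hs)).differentiableAt_lamPlus).differentiableWithinAt
  · rw [lamW, add_sub_cancel_left]
    exact (tsum_of_norm_bounded (D.hasSum_ratio (ε ^ 10)) fun r =>
      D.norm_gTerm_le (hball hs) (hw.close s (hball hs)) (r + 1)).trans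
      (D.ratio_sum_le (pow_pos D.pos 10).le)

theorem grad_lamW_sub (D : ModelData v q j ε B) (hw : PotFamily v ε B w) (ht : t ∈ B) :
    grad (fun s => lamW v q j ε (w s) s - lamPlus v q j s) t =
      grad (fun s => lamW v q j ε (w s) s) t - grad (lamPlus v q j) t := by
  obtain ⟨ρ, hρ, hball⟩ := Metric.isOpen_iff.mp D.isOpen t ht
  rw [grad_eq, fderiv_fun_sub (D.hasFDerivAt_lamW hw hρ hball).differentiableAt
    (D.bounds t ht).differentiableAt_lamPlus, map_sub]
  rfl

theorem differentiableAt0_EPlus (D : ModelData v q j ε B) (ht : t ∈ B) :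
    DifferentiableAt0 (EPlus v q j) t :=
  differentiableAt0_of_ent (D.differentiableOn_ePlus.differentiableAt (D.isOpen.mem_nhds ht))
    (Filter.mem_of_superset (D.isOpen.mem_nhds ht) fun _ hs m n => (D.ent_ePlus hs m n).symm)

theorem differentiableAt0_GTerm (D : ModelData v q j ε B) (hw : PotFamily v ε B w) (ht : t ∈ B)
    (r : ℕ) : DifferentiableAt0 (fun s => GTerm v q j ε (w s) r s) t :=
  differentiableAt0_of_ent ((D.differentiableOn_gOp hw r).differentiableAt (D.isOpen.mem_nhds ht))
    (Filter.mem_of_superset (D.isOpen.mem_nhds ht) fun s hs m n =>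
      D.GTerm_eq hs (D.potBound (hw.close s hs)).1 r m n)

theorem differentiableAt0_EW (D : ModelData v q j ε B) (hw : PotFamily v ε B w) (ht : t ∈ B) :
    DifferentiableAt0 (fun s => EW v q j ε (w s) s) t :=
  differentiableAt0_of_ent ((D.differentiableOn_eOp hw).differentiableAt (D.isOpen.mem_nhds ht))
    (Filter.mem_of_superset (D.isOpen.mem_nhds ht) fun s hs m n =>
      D.EW_eq hs (hw.close s hs) m n)

theorem norm0_matGrad_GTerm_le (D : ModelData v q j ε B) (hw : PotFamily v ε B w) (hρ : 0 < ρ)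
    (hball : Metric.ball t ρ ⊆ B) (r : ℕ) :
    norm0 (matGrad (fun s => GTerm v q j ε (w s) r s) t) ≤
      ENNReal.ofReal (8 * (5 * (260 * ε) ^ r) / ρ) :=
  norm0_matGrad_le_of_bounded hρ ((D.differentiableOn_gOp hw r).mono hball)
    (fun s hs => D.norm_gOp_le (D.admissible_pot (hball hs) (hw.close s (hball hs))) r)
    fun s hs m n => D.GTerm_eq (hball hs) (D.potBound (hw.close s (hball hs))).1 r m n

theorem norm0_matGrad_EW_sub_le (D : ModelData v q j ε B) (hw : PotFamily v ε B w) (hρ : 0 < ρ)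
    (hball : Metric.ball t ρ ⊆ B) :
    norm0 (matGrad (fun s m n => EW v q j ε (w s) s m n - EPlus v q j s m n) t) ≤
      ENNReal.ofReal (8 * (1500 * ε) / ρ) :=
  norm0_matGrad_le_of_bounded hρ
    (G := fun s => eOp v q j ε (pot v q j (w s)) s - ePlus v q j s)
    (((D.differentiableOn_eOp hw).sub D.differentiableOn_ePlus).mono hball)
    (fun s hs => D.norm_eOp_sub_le (D.admissible_pot (hball hs) (hw.close s (hball hs))))
    fun s hs m n => by
      rw [D.EW_eq (hball hs) (hw.close s (hball hs)), ← D.ent_ePlus (hball hs), map_sub]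

theorem tendsto_norm0_matGrad_EW (D : ModelData v q j ε B) (hw : PotFamily v ε B w) (ht : t ∈ B) :
    Filter.Tendsto (fun N : ℕ => norm0 fun m n =>
      matGrad (fun s => EW v q j ε (w s) s) t m n - matGrad (EPlus v q j) t m n -
        ∑ r ∈ Finset.range N, matGrad (fun s => GTerm v q j ε (w s) (r + 1) s) t m n)
      Filter.atTop (𝓝 0) := by
  obtain ⟨ρ, hρ, hball⟩ := Metric.isOpen_iff.mp D.isOpen t ht
  have hn := D.isOpen.mem_nhds ht
  have hg : ∀ r : ℕ, DifferentiableAt ℂ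
      (fun s => gOp v q j ε (pot v q j (w s)) (r + 1) s) t := fun r =>
    (D.differentiableOn_gOp hw (r + 1)).differentiableAt hn
  have hp := D.differentiableOn_ePlus.differentiableAt hn
  have hdiff := fun r : ℕ => (D.differentiableOn_gOp hw (r + 1)).mono hball
  have hbd := fun (r : ℕ) (s : C2) (hs : s ∈ Metric.ball t ρ) =>
    D.norm_gOp_le (D.admissible_pot (hball hs) (hw.close s (hball hs))) (r + 1)
  have hsum := (summable_fderiv_of_bounded (D.hasSum_ratio 5).summable hρ hdiff hbd).hasSum
  have hE := hp.hasFDerivAt.add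
    (hasFDerivAt_tsum_of_bounded (D.hasSum_ratio 5).summable hρ hdiff hbd)
  set S := ∑' r : ℕ, fderiv ℂ (fun s => gOp v q j ε (pot v q j (w s)) (r + 1) s) t with hS
  have hlim := (((hsum.tendsto_sum_nat.const_sub S).norm).const_mul 2)
  rw [sub_self, norm_zero, mul_zero] at hlim
  have hlim' := ENNReal.tendsto_ofReal hlim
  rw [ENNReal.ofReal_zero] at hlim'
  refine tendsto_of_tendsto_of_tendsto_of_le_of_le tendsto_const_nhds hlim'
    (fun _ => zero_le) fun N => ?_
  have hT : HasFDerivAt (fun s => eOp v q j ε (pot v q j (w s)) s - ePlus v q j s -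
      ∑ r ∈ Finset.range N, gOp v q j ε (pot v q j (w s)) (r + 1) s)
      (S - ∑ r ∈ Finset.range N,
        fderiv ℂ (fun s => gOp v q j ε (pot v q j (w s)) (r + 1) s) t) t := by
    refine HasFDerivAt.congr_fderiv ((HasFDerivAt.sub (f := fun s => eOp v q j ε (pot v q j (w s)) s)
      hE hp.hasFDerivAt).sub (HasFDerivAt.fun_sum fun r _ => (hg r).hasFDerivAt)) ?_
    rw [add_sub_cancel_left]
  have hle := norm0_matGrad_le hT.differentiableAt
    (T := fun s m n => ent m n (eOp v q j ε (pot v q j (w s)) s - ePlus v q j s -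
      ∑ r ∈ Finset.range N, gOp v q j ε (pot v q j (w s)) (r + 1) s))
    (Filter.Eventually.of_forall fun _ _ _ => rfl)
  rw [hT.fderiv] at hle
  refine le_of_eq_of_le ?_ hle
  congr 1
  have e1 := matGrad_eq_of_eventuallyEq (T := fun s => EW v q j ε (w s) s)
    (Filter.mem_of_superset hn fun s hs m n => D.EW_eq hs (hw.close s hs) m n)
  have e2 := matGrad_eq_of_eventuallyEq (T := EPlus v q j)
    (Filter.mem_of_superset hn fun s hs m n => (D.ent_ePlus hs m n).symm)
  have e3 := fun r : ℕ => matGrad_eq_of_eventuallyEq (T := fun s => GTerm v q j ε (w s) (r + 1) s)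
    (Filter.mem_of_superset hn fun s hs m n =>
      D.GTerm_eq hs (D.potBound (hw.close s hs)).1 (r + 1) m n)
  funext m n
  ext i
  rw [e1, e2]
  simp only [e3]
  simp only [matGrad, PiLp.sub_apply]
  have hs : (∑ r ∈ Finset.range N, grad (fun s => ent m n (gOp v q j ε (pot v q j (w s)) (r + 1) s)) t
      : C2) i = ∑ r ∈ Finset.range N,
        grad (fun s => ent m n (gOp v q j ε (pot v q j (w s)) (r + 1) s)) t i :=
    map_sum (EuclideanSpace.proj i : C2 →L[ℂ] ℂ) _ _
  have hE' : HasFDerivAt (fun s => eOp v q j ε (pot v q j (w s)) s)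
      (fderiv ℂ (ePlus v q j) t + S) t := hE
  rw [hs, grad_ent hT.differentiableAt, hT.fderiv, grad_ent hE'.differentiableAt, hE'.fderiv,
    grad_ent hp]
  simp only [fun r => grad_ent (hg r) m n i, add_apply,
    sub_apply, sum_apply, map_add, map_sub, map_sum]
  ring

/-- The three errors are the gradient of the series, the dependence of the block on q, and the
replacement of P_j(t) by P_j(t₀). -/
theorem abs_norm_grad_lamW_sub_le (D : ModelData v q j ε B) (hw : PotFamily v ε B w) (hρ : 0 < ρ)
    (hball : Metric.ball t ρ ⊆ B) (t₀ : R2) :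
    |‖grad (fun s => lamW v q j ε (w s) s) t‖ - 2 * ‖momentum j t₀‖| ≤
      8 * (ε ^ 10 * (300 * ε)) / ρ + 2 * len q + 2 * ‖t - toC t₀‖ := by
  have ht := hball (Metric.mem_ball_self hρ)
  have h1 := D.norm_grad_lamW_sub_le hw hρ hball
  rw [D.grad_lamW_sub hw ht] at h1
  have h2 := (D.bounds t ht).norm_grad_lamPlus_sub_le D.pos
  have h3 := abs_norm_two_momentum_sub_le j t₀ t
  have h4 := (abs_norm_sub_norm_le _ _).trans h1
  have h5 := (abs_norm_sub_norm_le _ _).trans h2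
  rw [abs_le] at h3 h4 h5 ⊢
  constructor <;> linarith

end ModelData

/-! ### Assembly: choice of the constants and conclusion -/

theorem modelData_of_isResonantPoint {v : Idx → ℂ} {q j : Idx} {k ε : ℝ} {t₀ : R2} (hε : 0 < ε)
    (hε1 : ε ≤ 1 / 100000) (hv0 : v 0 = 0) (hreal : ∀ p, v (-p) = conj (v p))
    (hv : starNorm v ≤ ENNReal.ofReal (ε ^ 9)) (hvq : ε ^ 10 < ‖v q‖) (hk : 1 ≤ k)
    (hkq : 4 * len q ≤ k * ε ^ 40) (hres : IsResonantPoint q k ε t₀ j) :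
    ModelData v q j ε (Metric.ball (toC t₀) (2 * k⁻¹ * ε ^ 7)) where
  pos := hε
  small := hε1
  zero := hv0
  real := hreal
  ne := by
    rintro rfl
    rw [hv0, norm_zero] at hvq
    exact absurd hvq (pow_pos hε 10).not_gt
  norm_le := hv
  isOpen := Metric.isOpen_ball
  bounds t ht := modelBounds hε (by linarith) hres
    (norm_le_of_starNorm (pow_pos hε 9).le hv q) hvq hk hkq ht

end ResonantGP

end

theorem mainTheorem5 :
    ∃ ε₀ : ℝ, 0 < ε₀ ∧ ∃ c : ℝ, 0 < c ∧ ∃ C : ℝ, 0 < C ∧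
    ∀ ε : ℝ, 0 < ε → ε < ε₀ →
    -- a real trigonometric polynomial with zero mean and the smallness restrictions
    ∀ v : ResonantGP.Idx → ℂ, v.support.Finite → v 0 = 0 → (∀ p, v (-p) = conj (v p)) →
    ResonantGP.starNorm v < ENNReal.ofReal (ε ^ 9) →
    ∀ q : ResonantGP.Idx, ε ^ 10 < ‖v q‖ →
    ∃ k₁ : ℝ, ∀ k : ℝ, k₁ < k →
    ∀ (σ : ℝ) (A : ℂ), |σ| * ‖A‖ ^ 2 < ε ^ 11 →
    ∀ (t₀ : ResonantGP.R2) (j : ResonantGP.Idx), ResonantGP.IsResonantPoint q k ε t₀ j →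
    ∃ W : ResonantGP.C2 → ResonantGP.Idx → ℂ, ∀ t ∈ ResonantGP.nbhd k ε t₀,
      -- `W` is the limit of the successive approximations
      Filter.Tendsto
        (fun m => ResonantGP.starNorm (ResonantGP.Wseq v q j ε σ A m t - W t)) Filter.atTop (𝓝 0) ∧
      -- for real `t`, the series give an eigenvalue of `H₀ + W` and its spectral projection
      (∀ s : ResonantGP.R2, t = ResonantGP.toC s → ∃ L : ℝ,
        ResonantGP.lamW v q j ε (W t) t = L ∧
        ResonantGP.IsSimpleSpectralProjection
          (ResonantGP.fullOp (W t) t) (ResonantGP.EW v q j ε (W t) t) L) ∧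
      -- the traces and the two series converge
      (∀ r : ℕ, Summable fun m => ResonantGP.gMat v q j ε (W t) (r + 1) t m m) ∧
      (Summable fun r : ℕ => ResonantGP.gTerm v q j ε (W t) (r + 1) t) ∧
      Filter.Tendsto
        (fun N : ℕ => ResonantGP.norm0 fun m n =>
          ResonantGP.EW v q j ε (W t) t m n - ResonantGP.EPlus v q j t m n -
            ∑ r ∈ Finset.range N, ResonantGP.GTerm v q j ε (W t) (r + 1) t m n)
        Filter.atTop (𝓝 0) ∧
      -- the series for the eigenvalue can be differentiated termwise
      DifferentiableAt ℂ (ResonantGP.lamPlus v q j) t ∧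
      (∀ r : ℕ, DifferentiableAt ℂ
        (fun s => ResonantGP.gTerm v q j ε (W s) (r + 1) s) t) ∧
      DifferentiableAt ℂ (fun s => ResonantGP.lamW v q j ε (W s) s) t ∧
      HasSum
        (fun r : ℕ => ResonantGP.grad (fun s => ResonantGP.gTerm v q j ε (W s) (r + 1) s) t)
        (ResonantGP.grad (fun s => ResonantGP.lamW v q j ε (W s) s) t -
          ResonantGP.grad (ResonantGP.lamPlus v q j) t) ∧
      -- the series for the projection can be differentiated termwise
      ResonantGP.DifferentiableAt0 (ResonantGP.EPlus v q j) t ∧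
      (∀ r : ℕ, ResonantGP.DifferentiableAt0
        (fun s => ResonantGP.GTerm v q j ε (W s) (r + 1) s) t) ∧
      ResonantGP.DifferentiableAt0 (fun s => ResonantGP.EW v q j ε (W s) s) t ∧
      Filter.Tendsto
        (fun N : ℕ => ResonantGP.norm0 fun m n =>
          ResonantGP.matGrad (fun s => ResonantGP.EW v q j ε (W s) s) t m n -
            ResonantGP.matGrad (ResonantGP.EPlus v q j) t m n -
            ∑ r ∈ Finset.range N,
              ResonantGP.matGrad (fun s => ResonantGP.GTerm v q j ε (W s) (r + 1) s) t m n)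
        Filter.atTop (𝓝 0) ∧
      -- the estimates of the coefficients
      (∀ r : ℕ, 1 ≤ r →
        ‖ResonantGP.grad (fun s => ResonantGP.gTerm v q j ε (W s) r s) t‖ <
          (c * ε) ^ r * (k * ε)) ∧
      (∀ r : ℕ, 1 ≤ r →
        ResonantGP.norm0 (ResonantGP.matGrad (fun s => ResonantGP.GTerm v q j ε (W s) r s) t) <
          ENNReal.ofReal ((c * ε) ^ r * (k * (ε ^ 10)⁻¹))) ∧
      -- the estimates of the gradients of the eigenvalue and of the projection
      ‖ResonantGP.grad
          (fun s => ResonantGP.lamW v q j ε (W s) s - ResonantGP.lamPlus v q j s) t‖ <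
        C * k * ε ^ 2 ∧
      ResonantGP.norm0 (ResonantGP.matGrad (fun s m n =>
          ResonantGP.EW v q j ε (W s) s m n - ResonantGP.EPlus v q j s m n) t) <
        ENNReal.ofReal (C * k * (ε ^ 9)⁻¹) ∧
      |‖ResonantGP.grad (fun s => ResonantGP.lamW v q j ε (W s) s) t‖ / (2 * k) - 1| ≤
        C * ε ^ 2 := by
  -- The threshold is the one under which the model bounds are proved, 260 is the ratio of the
  -- Neumann series, and 1000000 is a generous common bound for the remaining constants.
  refine ⟨1 / 100000, by norm_num, 260, by norm_num, 1000000, by norm_num, ?_⟩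
  intro ε hε hε1 v _ hv0 hreal hv q hvq
  -- This gives 4 len q + 1 < k ε⁴⁰: it freezes the detuning on the ball, and the summand 1 yields k
  -- ≥ 1.
  refine ⟨(4 * ResonantGP.len q + 1) / ε ^ 40, fun k hk σ A hσ t₀ j hres => ?_⟩
  have hlen := ResonantGP.len_nonneg q
  have h40 : 0 < ε ^ 40 := pow_pos hε 40
  have h40' : ε ^ 40 ≤ 1 := pow_le_one₀ hε.le (by linarith)
  rw [div_lt_iff₀ h40] at hk
  have hk0 : 0 < k := pos_of_mul_pos_left (by linarith) h40.le
  have hk1 : 1 ≤ k := by nlinarith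
  have D := ResonantGP.modelData_of_isResonantPoint hε hε1.le hv0 hreal hv.le hvq hk1
    (by linarith) hres
  have hB : ∀ t ∈ Metric.ball (ResonantGP.toC t₀) (2 * k⁻¹ * ε ^ 7), ResonantGP.conjC t ∈
      Metric.ball (ResonantGP.toC t₀) (2 * k⁻¹ * ε ^ 7) :=
    fun t ht => ResonantGP.conjC_mem_ball ht
  have hw := D.potFamily_Wlim hB hσ.le
  refine ⟨ResonantGP.Wlim v q j ε σ A, fun t htn => ?_⟩
  have hρ : 0 < k⁻¹ * ε ^ 7 / 2 := by positivity
  have hball := ResonantGP.ball_subset_of_mem_nbhd hk0 hε (by linarith) htn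
  have ht := hball (Metric.mem_ball_self hρ)
  have hwt := hw.close t ht
  have hε2 : ε ^ 2 < 1 / 100000 := by nlinarith
  -- Cauchy's estimate on radius k⁻¹ε⁷/2 turns a bound M into 16 M k ε⁻⁷. With M = ε¹⁰ (260 ε)^r
  -- this beats the claimed k ε (260 ε)^r by 16 ε², and with M = 5 (260 ε)^r it beats k ε⁻¹⁰ (260
  -- ε)^r by 80 ε³.
  have e : ∀ M : ℝ, 8 * M / (k⁻¹ * ε ^ 7 / 2) = 16 * M * k / ε ^ 7 := fun M => by
    field_simp
    ring
  refine ⟨D.tendsto_starNorm_Wseq hB hσ.le ht, ?_, fun r => D.summable_gMat ht hwt (r + 1),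
    D.summable_gTerm ht hwt, D.tendsto_norm0_EW ht hwt, (D.bounds t ht).differentiableAt_lamPlus,
    fun r => (D.differentiableOn_gTerm hw (r + 1)).differentiableAt (D.isOpen.mem_nhds ht),
    (D.hasFDerivAt_lamW hw hρ hball).differentiableAt, D.hasSum_grad_gTerm hw hρ hball,
    D.differentiableAt0_EPlus ht, fun r => D.differentiableAt0_GTerm hw ht (r + 1),
    D.differentiableAt0_EW hw ht, D.tendsto_norm0_matGrad_EW hw ht,
    fun r _ => (D.norm_grad_gTerm_le hw hρ hball r).trans_lt ?_,
    fun r _ => (D.norm0_matGrad_GTerm_le hw hρ hball r).trans_lt ?_,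
    (D.norm_grad_lamW_sub_le hw hρ hball).trans_lt ?_,
    (D.norm0_matGrad_EW_sub_le hw hρ hball).trans_lt ?_, ?_⟩
  · rintro s rfl
    refine D.isSimpleSpectralProjection ht ?_ hwt fun b => D.Wlim_neg hB hσ.le ht b
    exact norm_pos_iff.mp ((pow_pos hε 10).trans hvq)
  · rw [e, div_lt_iff₀ (by positivity)]
    have h1 : 0 < (260 * ε) ^ r * (k * ε ^ 8) := by positivity
    calc _ = (260 * ε) ^ r * (k * ε ^ 8) * (16 * ε ^ 2) := by ring
      _ < (260 * ε) ^ r * (k * ε ^ 8) * 1 := mul_lt_mul_of_pos_left (by linarith) h1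
      _ = _ := by ring
  · rw [e, ENNReal.ofReal_lt_ofReal_iff (by positivity), div_lt_iff₀ (by positivity)]
    have h1 : 0 < (260 * ε) ^ r * (k * (ε ^ 10)⁻¹ * ε ^ 7) := by positivity
    calc _ = (260 * ε) ^ r * (k * (ε ^ 10)⁻¹ * ε ^ 7) * (80 * (ε ^ 2 * ε)) := by field_simp; ring
      _ < (260 * ε) ^ r * (k * (ε ^ 10)⁻¹ * ε ^ 7) * 1 :=
        mul_lt_mul_of_pos_left (by nlinarith) h1
      _ = _ := by ring
  · rw [e, div_lt_iff₀ (by positivity)]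
    have h1 : 0 < k * ε ^ 9 := by positivity
    calc _ = k * ε ^ 9 * (4800 * ε ^ 2) := by ring
      _ < k * ε ^ 9 * 1000000 := mul_lt_mul_of_pos_left (by linarith) h1
      _ = _ := by ring
  · rw [e, ENNReal.ofReal_lt_ofReal_iff (by positivity), div_lt_iff₀ (by positivity)]
    have h1 : 0 < k * (ε ^ 9)⁻¹ * ε ^ 7 := by positivity
    calc _ = k * (ε ^ 9)⁻¹ * ε ^ 7 * (24000 * (ε ^ 2 * ε)) := by field_simp; ring
      _ < k * (ε ^ 9)⁻¹ * ε ^ 7 * 1000000 := mul_lt_mul_of_pos_left (by nlinarith) h1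
      _ = _ := by ring
  · have h1 := D.abs_norm_grad_lamW_sub_le hw hρ hball t₀
    rw [hres.norm_eq, e] at h1
    have h2 : 16 * (ε ^ 10 * (300 * ε)) * k / ε ^ 7 ≤ 4800 * (k * ε ^ 2) := by
      rw [div_le_iff₀ (by positivity)]
      have h3 : 0 ≤ k * ε ^ 9 := by positivity
      nlinarith
    have h3 : ε ^ 40 ≤ ε ^ 2 := pow_le_pow_of_le_one hε.le (by linarith) (by norm_num)
    have h4 : k * ε ^ 40 ≤ k * ε ^ 2 := mul_le_mul_of_nonneg_left h3 hk0.le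
    have h5 : ‖t - ResonantGP.toC t₀‖ ≤ 2 * (k * ε ^ 2) := by
      have h6 := (mem_ball_iff_norm.mp ht).le
      have h7 : k⁻¹ * ε ^ 7 ≤ k * ε ^ 2 :=
        mul_le_mul ((inv_le_one_of_one_le₀ hk1).trans hk1)
          (pow_le_pow_of_le_one hε.le (by linarith) (by norm_num)) (by positivity) hk0.le
      linarith
    have h6 : 0 < k * ε ^ 2 := by positivity
    have hk2 : 0 < 2 * k := by linarith
    rw [div_sub_one hk2.ne', abs_div, abs_of_pos hk2, div_le_iff₀ hk2]
    linarith
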